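/- **Setting.** Let $q,a,b,h,l,p,\varkappa$ be integers with $1\le a,b\le q$, $h\ge2$, $0\le l\le p\le 2h-1$, $\varkappa\ge1$, let $s>0$, $S(t)=st^{1+b/q}$, $\vartheta=s(1+b/q)$, and let $H(x,y)=\frac{y^2}{2}+U(x)$, $U(x)=\frac{x^{2h}}{2h}+\sum_{i=1}^{2h-1}u_ix^i$. Consider $$\dot x=\partial_yH+t^{-a/q}f(x,y,S(t),t),\qquad \dot y=-\partial_xH+t^{-a/q}g(x,y,S(t),t),$$ where $f,g$ are $C^\infty$ for $(x,y,S)\in\mathbb R^3$, $t>0$, and $2\pi$-periodic in $S$, with expansions $f\sim\sum_{k\ge0}t^{-k/q}f_k$, $g\sim\sum_{k\ge0}t^{-k/q}g_k$ as $t\to\infty$, $f_k=\sum_{i\le p,\,j\le l-1}A_{k,i,j}(S)x^iy^j$, $g_k=\sum_{i\le p,\,j\le l}B_{k,i,j}(S)x^iy^j$, with $C^\infty$, $2\pi$-periodic coefficients that vanish for $i+j>p$. The expansions mean: for every $m$, the remainder of $f$ after the terms $k<m$ is bounded, for all large $t$ and all $(x,y,S)$, by $C_mt^{-m/q}\sum|x|^i|y|^j$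 (sum over $i\le p$, $j\le l-1$, $i+j\le p$), and likewise for $g$ with $j\le l$. Assume $$-1\le\sigma<\tfrac bq,\qquad \sigma=\tfrac bq\Big(l-1+\tfrac{p-1}{h-1}\Big)-\tfrac aq,$$ and set $\mu=\frac12(\frac bq-\sigma)$, $\nu=1+2\mu+\sigma$, $M=2\mu q(h-1)$, $N=2\nu q(h-1)$ (positive integers). *Energy, angle, amplitude, phase difference.* For large $E$ let $T(E)$ be the period of the periodic solution $(x_0,y_0)(t,E)$ of $\dot x=\partial_yH$, $\dot y=-\partial_xH$ on $\{H=E\}$ that starts at $(x_+(E),0)$, $U(x_+(E))=E$, $x_+(E)>0$; put $\omega=2\pi/T$ and $(X,Y)(\phi,E)=(x_0,y_0)(\phi/\omega(E),E)$. For large $t$ let $I_*(t)$ be the large solution of $\omega(I_*(t))=\varkappa^{-1}S'(t)$. The substitution $x=X(\phi,I)$, $y=Y(\phi,I)$, $I=I_*(t)(1+t^{-\mu}r)^{2h}$, $\phi=\theta+\varkappa^{-1}S(t)$, $\tau=t^\nu/\nu$ turns the system into $$\frac{dr}{d\tau}=\tau^{-M/N}\mathcal A,\qquad\frac{d\theta}{d\tau}=\tau^{-M/N}\mathcal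 B.\tag{1}$$ With $\zeta=S(t)$ treated as an independent variable, let $\mathcal A_K,\mathcal B_K$ be the coefficients of the expansions $\mathcal A\sim\sum_{K\ge0}\tau^{-K/N}\mathcal A_K(r,\theta,\zeta)$, $\mathcal B\sim\sum_{K\ge0}\tau^{-K/N}\mathcal B_K(r,\theta,\zeta)$, $\tau\to\infty$; they are $2\pi\varkappa$-periodic in $\zeta$. Write $\langle\cdot\rangle$ for the mean over this period. *Averaging.* For $K=0,1,2,\dots$ put successively $\Lambda_K(r,\theta)=\langle\mathcal A_K+\mathfrak A_K\rangle$, $\Omega_K(r,\theta)=\langle\mathcal B_K+\mathfrak B_K\rangle$, and let $\rho_K,\psi_K$ be the solutions, periodic in $\zeta$ and of zero mean, of $$\vartheta\partial_\zeta\rho_K=\Lambda_K-\mathcal A_K-\mathfrak A_K,\qquad \vartheta\partial_\zeta\psi_K=\Omega_K-\mathcal B_K-\mathfrak B_K,$$ where $$\mathfrak A_K=\sum_{i+j=K-M}(\mathcal A_i\partial_r+\mathcal B_i\partial_\theta)\rho_j-\frac{M+K-N}{N}\rho_{K-N}-[\varepsilon^K]\sum_{j<K}\varepsilon^j\Lambda_j\Big(r+\sum_{i<K}\varepsilon^{M+i}\rho_i,\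 \theta+\sum_{i<K}\varepsilon^{M+i}\psi_i\Big),$$ $\mathfrak B_K$ is obtained by writing $\psi_j,\psi_{K-N},\Omega_j$ for $\rho_j,\rho_{K-N},\Lambda_j$ outside the arguments of $\Lambda_j$, terms with negative indices are zero, and $[\varepsilon^K]$ denotes the Taylor coefficient. For $n\ge0$ let $R_n=r+\sum_{K=0}^n\tau^{-\frac{M+K}N}\rho_K$, $\Psi_n=\theta+\sum_{K=0}^n\tau^{-\frac{M+K}N}\psi_K$, taken at $\zeta=\zeta(\tau)=S((\nu\tau)^{1/\nu})$. Fix any $r_0>0$. The *averaged system* is the system $$\frac{dR}{d\tau}=\sum_{K=0}^n\tau^{-\frac{M+K}N}\Lambda_K(R,\Psi)+\widetilde\Lambda_n(R,\Psi,\tau),\qquad \frac{d\Psi}{d\tau}=\sum_{K=0}^n\tau^{-\frac{M+K}N}\Omega_K(R,\Psi)+\widetilde\Omega_n(R,\Psi,\tau)\tag{2}$$ that (1) becomes, for large $\tau$, in the variables $R=R_n(r,\theta,\tau)$, $\Psi=\Psi_n(r,\theta,\tau)$, $|r|\le r_0$; so the remainders $\widetilde\Lambda_n,\widetilde\Omega_n$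 are the differences between the total derivatives of $R_n,\Psi_n$ along (1), expressed through $(R,\Psi)$ by the inverse map, and the sums. **Assumptions.** Let $0\le L\le\min\{N-M,2M-1\}$ with $\Lambda_K\equiv0$ for all $K<L$ and $\Lambda_L\not\equiv0$; let $\varphi_0\in\mathbb R$ with $\Lambda_L(0,\varphi_0)=0$ and $\lambda_L:=\partial_\varphi\Lambda_L(0,\varphi_0)<0$; let $D\ge M$ with $\partial_\varrho\Lambda_K+\partial_\varphi\Omega_K\equiv0$ for all $K<D$ and $\gamma_D:=\partial_\varrho\Lambda_D(0,\varphi_0)+\partial_\varphi\Omega_D(0,\varphi_0)\ne0$; let $n\ge L+D$. Put $\hat\gamma_D=\gamma_D+\delta_{M+D,N}\frac LN$, where $\delta$ is the Kronecker symbol. Let $(\varrho_*,\varphi_*)$ be any solution, on some $(\tau_0,\infty)$ with $\tau_0>0$, of the truncated system $$\frac{d\varrho}{d\tau}=\sum_{K=L}^n\tau^{-\frac{M+K}N}\Lambda_K(\varrho,\varphi),\qquad \frac{d\varphi}{d\tau}=\sum_{K=0}^n\tau^{-\frac{M+K}N}\Omega_K(\varrho,\varphi)$$ with asymptotic expansions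 $\varrho_*\sim\sum_{K\ge0}\varrho_K\tau^{-\frac{M+K}N}$, $\varphi_*\sim\varphi_0+\sum_{K\ge1}\varphi_K\tau^{-\frac KN}$ as $\tau\to\infty$, with constant coefficients. **Corollary.** If $\hat\gamma_D<0$ and $M+D\le N$, then for every $\varsigma\in(0,1)$ there exist $\Delta_s>0$ and $\tau_s>\tau_0$ such that for all $(R_s,\Psi_s)$ with $|R_s-\varrho_*(\tau_s)|<\Delta_s$ and $|\Psi_s-\varphi_*(\tau_s)|<\Delta_s$ system (2) has a solution on $[\tau_s,\infty)$ with $R(\tau_s)=R_s$, $\Psi(\tau_s)=\Psi_s$, and every such solution satisfies, as $\tau\to\infty$, $$R(\tau)=\delta_{M+D,N}\,O\big(\tau^{-\frac\varsigma2|\hat\gamma_D|}\big)+O\big(\tau^{-\frac MN}\big),\qquad \Psi(\tau)=\varphi_0+\delta_{M+D,N}\,O\big(\tau^{-\frac\varsigma2|\hat\gamma_D|}\big)+O\big(\tau^{-\frac1N}\big).$$ -/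

import Mathlib

open Filter Topology Asymptotics
open scoped ContDiff

noncomputable section

/-- The perturbed Hamiltonian system
`x' = ∂_y H + t^(-a/q) f(x,y,S(t),t)`, `y' = -∂_x H + t^(-a/q) g(x,y,S(t),t)`, `S(t) = s t^(1+b/q)`,
with `H = y²/2 + U(x)`, `U(x) = x^(2h)/(2h) + ∑_{1 ≤ i < 2h} u_i x^i`, whose perturbations have the
expansions `f ~ ∑ t^(-k/q) f_k`, `g ~ ∑ t^(-k/q) g_k` with polynomial coefficients
`f_k = ∑_{i ≤ p, j < l} A_{k,i,j}(S) x^i y^j`, `g_k = ∑_{i ≤ p, j ≤ l} B_{k,i,j}(S) x^i y^j`;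
`kap` is the order of the resonance (`φ ≈ S / kap`). The remainders of the two expansions are
measured against the monomials that are allowed in them, because `x` and `y` grow along the
resonant solutions. -/
structure ChirpedSystem where
  q : ℕ
  a : ℕ
  b : ℕ
  h : ℕ
  l : ℕ
  p : ℕ
  kap : ℕ
  s : ℝ
  u : ℕ → ℝ
  f : ℝ → ℝ → ℝ → ℝ → ℝ
  g : ℝ → ℝ → ℝ → ℝ → ℝ
  A : ℕ → ℕ → ℕ → ℝ → ℝ
  B : ℕ → ℕ → ℕ → ℝ → ℝ
  one_le_a : 1 ≤ a
  a_le_q : a ≤ q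
  one_le_b : 1 ≤ b
  b_le_q : b ≤ q
  two_le_h : 2 ≤ h
  l_le_p : l ≤ p
  p_lt : p < 2 * h
  kap_pos : 0 < kap
  s_pos : 0 < s
  f_smooth : ContDiffOn ℝ ∞ (fun v : ℝ × ℝ × ℝ × ℝ => f v.1 v.2.1 v.2.2.1 v.2.2.2)
    {v | 0 < v.2.2.2}
  g_smooth : ContDiffOn ℝ ∞ (fun v : ℝ × ℝ × ℝ × ℝ => g v.1 v.2.1 v.2.2.1 v.2.2.2)
    {v | 0 < v.2.2.2}
  f_periodic : ∀ x y S t, 0 < t → f x y (S + 2 * Real.pi) t = f x y S t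
  g_periodic : ∀ x y S t, 0 < t → g x y (S + 2 * Real.pi) t = g x y S t
  A_smooth : ∀ k i j, ContDiff ℝ ∞ (A k i j)
  B_smooth : ∀ k i j, ContDiff ℝ ∞ (B k i j)
  A_periodic : ∀ k i j S, A k i j (S + 2 * Real.pi) = A k i j S
  B_periodic : ∀ k i j S, B k i j (S + 2 * Real.pi) = B k i j S
  A_zero : ∀ k i j S, p < i + j → A k i j S = 0
  B_zero : ∀ k i j S, p < i + j → B k i j S = 0
  f_expansion : ∀ m : ℕ, ∃ C T : ℝ, 0 < T ∧ ∀ t, T ≤ t → ∀ x y S,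
    |f x y S t - ∑ k ∈ Finset.range m, t ^ (-(k : ℝ) / q) *
        ∑ i ∈ Finset.range (p + 1), ∑ j ∈ Finset.range l, A k i j S * x ^ i * y ^ j|
      ≤ C * t ^ (-(m : ℝ) / q) * ∑ i ∈ Finset.range (p + 1), ∑ j ∈ Finset.range l,
          if i + j ≤ p then |x| ^ i * |y| ^ j else 0
  g_expansion : ∀ m : ℕ, ∃ C T : ℝ, 0 < T ∧ ∀ t, T ≤ t → ∀ x y S,
    |g x y S t - ∑ k ∈ Finset.range m, t ^ (-(k : ℝ) / q) *
        ∑ i ∈ Finset.range (p + 1), ∑ j ∈ Finset.range (l + 1), B k i j S * x ^ i * y ^ j|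
      ≤ C * t ^ (-(m : ℝ) / q) * ∑ i ∈ Finset.range (p + 1), ∑ j ∈ Finset.range (l + 1),
          if i + j ≤ p then |x| ^ i * |y| ^ j else 0

/-- The coefficients `c_K` of an asymptotic expansion `w(τ) ~ ∑ c_K τ^(-K/N)`, `τ → ∞`, found
one after another as limits. -/
def expansionCoeff (N : ℕ) (w : ℝ → ℝ) (K : ℕ) : ℝ :=
  limUnder atTop (fun τ : ℝ => τ ^ ((K : ℝ) / N) *
    (w τ - ∑ j : Fin K, τ ^ (-((j : ℕ) : ℝ) / N) * expansionCoeff N w j))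
termination_by K
decreasing_by exact j.2

/-- One step of the averaging procedure: right-hand sides `Λ_K`, `Ω_K` of the averaged equations
and coefficients `ρ_K`, `ψ_K` of the near-identity transformation. -/
structure AvgCoeff where
  Λ : ℝ → ℝ → ℝ
  Ω : ℝ → ℝ → ℝ
  ρ : ℝ → ℝ → ℝ → ℝ
  ψ : ℝ → ℝ → ℝ → ℝ

/-- All four functions vanish. -/
def AvgCoeff.zero : AvgCoeff :=
  ⟨fun _ _ => 0, fun _ _ => 0, fun _ _ _ => 0, fun _ _ _ => 0⟩

namespace ChirpedSystem

variable (P : ChirpedSystem)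

/-! ### Parameters -/

def σ : ℝ := (P.b : ℝ) / P.q * ((P.l : ℝ) - 1 + ((P.p : ℝ) - 1) / ((P.h : ℝ) - 1)) - (P.a : ℝ) / P.q

def μ : ℝ := ((P.b : ℝ) / P.q - P.σ) / 2

def ν : ℝ := 1 + 2 * P.μ + P.σ

/-- `M = 2μq(h-1)`; this real number is a positive integer as soon as `σ < b/q`, see `M_cast`. -/
def M : ℕ := ⌊2 * P.μ * P.q * ((P.h : ℝ) - 1)⌋₊

/-- `N = 2νq(h-1)`; this real number is a positive integer, see `N_cast`. -/
def N : ℕ := ⌊2 * P.ν * P.q * ((P.h : ℝ) - 1)⌋₊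

/-- `S(t) = s t^(1+b/q)`. -/
def chirp (t : ℝ) : ℝ := P.s * t ^ (1 + (P.b : ℝ) / P.q)

/-- `ϑ = s (1 + b/q)`. -/
def vartheta : ℝ := P.s * (1 + (P.b : ℝ) / P.q)

theorem M_cast (hσ : P.σ < (P.b : ℝ) / P.q) :
    (P.M : ℝ) = 2 * P.μ * P.q * ((P.h : ℝ) - 1) ∧ 1 ≤ P.M := by
  have hq : (0 : ℝ) < P.q := by
    have := P.one_le_b.trans P.b_le_q
    exact_mod_cast this
  have hh : (0 : ℝ) < (P.h : ℝ) - 1 := by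
    have : (2 : ℝ) ≤ P.h := by exact_mod_cast P.two_le_h
    linarith
  have hpos : 0 < 2 * P.μ * P.q * ((P.h : ℝ) - 1) := by
    have : 0 < P.μ := by unfold μ; linarith
    positivity
  obtain ⟨z, hz⟩ : ∃ z : ℤ, 2 * P.μ * P.q * ((P.h : ℝ) - 1) = (z : ℝ) := by
    refine ⟨((P.h : ℤ) - 1) * (P.a + P.b) - P.b * (((P.l : ℤ) - 1) * (P.h - 1) + (P.p - 1)), ?_⟩
    push_cast
    unfold μ σ
    field_simp
    ring
  have hz0 : 0 < z := by rw [hz] at hpos; exact_mod_cast hpos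
  obtain ⟨k, rfl⟩ := Int.eq_ofNat_of_zero_le hz0.le
  have hM : P.M = k := by unfold M; rw [hz]; simp
  rw [hM, hz]
  refine ⟨by simp, by omega⟩

theorem N_cast : (P.N : ℝ) = 2 * P.ν * P.q * ((P.h : ℝ) - 1) ∧ 1 ≤ P.N := by
  have hq1 := P.one_le_b.trans P.b_le_q
  have hq : (0 : ℝ) < P.q := by exact_mod_cast hq1
  obtain ⟨k, hk⟩ : ∃ k, P.h = k + 2 := ⟨P.h - 2, by have := P.two_le_h; omega⟩
  have hz : 2 * P.ν * P.q * ((P.h : ℝ) - 1) = ((2 * (P.q + P.b) * (k + 1) : ℕ) : ℝ) := by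
    unfold ν μ
    rw [hk]
    push_cast
    field_simp
    ring
  have hN : P.N = 2 * (P.q + P.b) * (k + 1) := by unfold N; rw [hz]; exact Nat.floor_natCast _
  rw [hN, hz]
  refine ⟨rfl, ?_⟩
  have : 0 < 2 * (P.q + P.b) * (k + 1) := by positivity
  omega

/-! ### Energy-angle variables -/

def U (x : ℝ) : ℝ :=
  x ^ (2 * P.h) / (2 * P.h) + ∑ i ∈ Finset.Ico 1 (2 * P.h), P.u i * x ^ i

/-- The right end `x_+(E)` of the level line `H = E` (for large `E`, the only positive root). -/
def xPlus (E : ℝ) : ℝ := sSup {x | P.U x = E}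

/-- The left end `x_-(E)` of the level line `H = E` (for large `E`, the only negative root). -/
def xMinus (E : ℝ) : ℝ := sInf {x | P.U x = E}

/-- The period `T(E)`. -/
def period (E : ℝ) : ℝ :=
  ∫ ς in P.xMinus E..P.xPlus E, Real.sqrt 2 / Real.sqrt (E - P.U ς)

/-- The frequency `ω(E) = 2π/T(E)`. -/
def freq (E : ℝ) : ℝ := 2 * Real.pi / P.period E

/-- The periodic solution `(x_0(t,E), y_0(t,E))` of the limiting system on the level line `H = E`
that starts at `(x_+(E), 0)`. For large `E` it exists on the whole line and is unique. -/
def orbit (E : ℝ) : ℝ → ℝ × ℝ :=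
  Classical.epsilon fun γ : ℝ → ℝ × ℝ =>
    γ 0 = (P.xPlus E, 0) ∧ ∀ t, HasDerivAt γ ((γ t).2, -deriv P.U (γ t).1) t

def X (φ E : ℝ) : ℝ := (P.orbit E (φ / P.freq E)).1

def Y (φ E : ℝ) : ℝ := (P.orbit E (φ / P.freq E)).2

/-- Energy equation `dI/dt = t^(-a/q) F(I,φ,S(t),t)`. -/
def F (I φ S t : ℝ) : ℝ :=
  P.f (P.X φ I) (P.Y φ I) S t * deriv P.U (P.X φ I) + P.g (P.X φ I) (P.Y φ I) S t * P.Y φ I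

/-- Angle equation `dφ/dt = ω(I) + t^(-a/q) G(I,φ,S(t),t)`. -/
def G (I φ S t : ℝ) : ℝ :=
  P.freq I * (P.f (P.X φ I) (P.Y φ I) S t * deriv (fun E => P.Y φ E) I -
    P.g (P.X φ I) (P.Y φ I) S t * deriv (fun E => P.X φ E) I)

/-! ### Amplitude and phase difference -/

/-- The resonant energy `I_*(t)`, `ω(I_*(t)) = S'(t)/kap`. For large `t` the equation has exactly
one solution in the range of large energies, where `ω` increases: the largest one. -/
def resonantEnergy (t : ℝ) : ℝ := sSup {E | P.freq E = deriv P.chirp t / P.kap}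

/-- The inverse `t = (ντ)^(1/ν)` of `τ = t^ν/ν`. -/
def time (τ : ℝ) : ℝ := (P.ν * τ) ^ (1 / P.ν)

/-- `ζ(τ) = S((ντ)^(1/ν))`. -/
def ζ (τ : ℝ) : ℝ := P.chirp (P.time τ)

/-- `I = I_*(t) (1 + t^(-μ) r)^(2h)`. -/
def energy (r t : ℝ) : ℝ := P.resonantEnergy t * (1 + t ^ (-P.μ) * r) ^ (2 * P.h)

/-- The change of variables `I = I_*(t) (1 + t^(-μ) r(τ))^(2h)`, `φ = θ(τ) + S(t)/kap`, `τ = t^ν/ν`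
gives `dr/dτ = τ^(-M/N) 𝒜`, `dθ/dτ = τ^(-M/N) ℬ`. This is `𝒜`, with the fast phase `ζ = S(t)` as a
separate argument:
`dr/dt = μ r/t + t^μ (1 + t^(-μ) r)/(2h) * (I'/I - I_*'/I_*)`, `dτ/dt = t^(ν-1)`. -/
def fieldR (r θ ζ τ : ℝ) : ℝ :=
  τ ^ ((P.M : ℝ) / P.N) * P.time τ ^ (1 - P.ν) *
    (P.μ * r / P.time τ + P.time τ ^ P.μ * (1 + P.time τ ^ (-P.μ) * r) / (2 * P.h) *
      (P.time τ ^ (-(P.a : ℝ) / P.q) *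
          P.F (P.energy r (P.time τ)) (θ + ζ / P.kap) ζ (P.time τ) / P.energy r (P.time τ) -
        deriv P.resonantEnergy (P.time τ) / P.resonantEnergy (P.time τ)))

/-- The field `ℬ` of the phase equation `dθ/dτ = τ^(-M/N) ℬ`; here `dθ/dt = φ' - S'(t)/kap`. -/
def fieldΘ (r θ ζ τ : ℝ) : ℝ :=
  τ ^ ((P.M : ℝ) / P.N) * P.time τ ^ (1 - P.ν) *
    (P.freq (P.energy r (P.time τ)) - deriv P.chirp (P.time τ) / P.kap +
      P.time τ ^ (-(P.a : ℝ) / P.q) *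
        P.G (P.energy r (P.time τ)) (θ + ζ / P.kap) ζ (P.time τ))

/-- `𝒜_K` in `𝒜 ~ ∑ τ^(-K/N) 𝒜_K(r,θ,ζ)`, `τ → ∞`. -/
def coeffR (K : ℕ) (r θ ζ : ℝ) : ℝ := expansionCoeff P.N (fun τ => P.fieldR r θ ζ τ) K

/-- `ℬ_K` in `ℬ ~ ∑ τ^(-K/N) ℬ_K(r,θ,ζ)`, `τ → ∞`. -/
def coeffΘ (K : ℕ) (r θ ζ : ℝ) : ℝ := expansionCoeff P.N (fun τ => P.fieldΘ r θ ζ τ) K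

/-! ### Averaging -/

/-- The mean over the period `2π kap` in `ζ`. -/
def mean (w : ℝ → ℝ) : ℝ :=
  1 / (2 * Real.pi * P.kap) * ∫ ζ in (0 : ℝ)..(2 * Real.pi * P.kap), w ζ

/-- The contribution `𝔄_K` (for `χ = ρ`, `Γ = Λ`) or `𝔅_K` (for `χ = ψ`, `Γ = Ω`) of the lower
order coefficients `c_0, …, c_{K-1}` to the coefficient of `τ^(-(M+K)/N)`:
`∑_{i+j=K-M} (𝒜_i ∂_r + ℬ_i ∂_θ) χ_j` comes from the derivative along the trajectories,
`-(M+K-N)/N χ_{K-N}` from the derivative of the powers of `τ`, and the subtracted term is the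
coefficient of `ε^K`, `ε = τ^(-1/N)`, in the Taylor expansion of
`∑_j ε^j Γ_j(r + ∑_i ε^(M+i) ρ_i, θ + ∑_i ε^(M+i) ψ_i)`, without `Γ_K` itself. -/
def lowerOrder (K : ℕ) (c : ℕ → AvgCoeff) (χ : AvgCoeff → ℝ → ℝ → ℝ → ℝ)
    (Γ : AvgCoeff → ℝ → ℝ → ℝ) (r θ ζ : ℝ) : ℝ :=
  (if P.M ≤ K then ∑ ij ∈ Finset.HasAntidiagonal.antidiagonal (K - P.M),
      (P.coeffR ij.1 r θ ζ * deriv (fun r' => χ (c ij.2) r' θ ζ) r +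
        P.coeffΘ ij.1 r θ ζ * deriv (fun θ' => χ (c ij.2) r θ' ζ) θ) else 0) -
  (if P.N ≤ K then ((P.M : ℝ) + K - P.N) / P.N * χ (c (K - P.N)) r θ ζ else 0) -
  iteratedDeriv K (fun ε : ℝ => ∑ j ∈ Finset.range K, ε ^ j *
      Γ (c j) (r + ∑ i ∈ Finset.range K, ε ^ (P.M + i) * (c i).ρ r θ ζ)
        (θ + ∑ i ∈ Finset.range K, ε ^ (P.M + i) * (c i).ψ r θ ζ)) 0 / (K.factorial : ℝ)

/-- The solution `χ` with zero mean of `vartheta ∂_ζ χ = ⟨w⟩ - w`. -/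
def correction (w : ℝ → ℝ) (ζ : ℝ) : ℝ :=
  let v : ℝ → ℝ := fun ζ' => -(1 / P.vartheta) * ∫ x in (0 : ℝ)..ζ', (w x - P.mean w)
  v ζ - P.mean v

/-- `Λ_K = ⟨𝒜_K + 𝔄_K⟩`, `Ω_K = ⟨ℬ_K + 𝔅_K⟩`, and `ρ_K`, `ψ_K` solve the homological equations. -/
def avgStep (K : ℕ) (c : ℕ → AvgCoeff) : AvgCoeff where
  Λ r θ := P.mean fun ζ =>
    P.coeffR K r θ ζ + P.lowerOrder K c AvgCoeff.ρ AvgCoeff.Λ r θ ζ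
  Ω r θ := P.mean fun ζ =>
    P.coeffΘ K r θ ζ + P.lowerOrder K c AvgCoeff.ψ AvgCoeff.Ω r θ ζ
  ρ r θ := P.correction fun ζ =>
    P.coeffR K r θ ζ + P.lowerOrder K c AvgCoeff.ρ AvgCoeff.Λ r θ ζ
  ψ r θ := P.correction fun ζ =>
    P.coeffΘ K r θ ζ + P.lowerOrder K c AvgCoeff.ψ AvgCoeff.Ω r θ ζ

/-- The chain of averaging coefficients. -/
def avg (K : ℕ) : AvgCoeff :=
  P.avgStep K fun j => if _hj : j < K then avg j else AvgCoeff.zero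
termination_by K

/-- `Λ_K(R,Ψ)`. -/
def Λ (K : ℕ) : ℝ → ℝ → ℝ := (P.avg K).Λ

/-- `Ω_K(R,Ψ)`. -/
def Ω (K : ℕ) : ℝ → ℝ → ℝ := (P.avg K).Ω

/-- `R_n(r,θ,τ) = r + ∑_{K ≤ n} τ^(-(M+K)/N) ρ_K(r,θ,ζ(τ))`. -/
def Rn (n : ℕ) (r θ τ : ℝ) : ℝ :=
  r + ∑ K ∈ Finset.range (n + 1), τ ^ (-((P.M : ℝ) + K) / P.N) * (P.avg K).ρ r θ (P.ζ τ)

/-- `Ψ_n(r,θ,τ) = θ + ∑_{K ≤ n} τ^(-(M+K)/N) ψ_K(r,θ,ζ(τ))`. -/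
def Ψn (n : ℕ) (r θ τ : ℝ) : ℝ :=
  θ + ∑ K ∈ Finset.range (n + 1), τ ^ (-((P.M : ℝ) + K) / P.N) * (P.avg K).ψ r θ (P.ζ τ)

/-- The total derivative of `Q(r,θ,τ)` along `dr/dτ = τ^(-M/N) 𝒜`, `dθ/dτ = τ^(-M/N) ℬ`. -/
def totalDeriv (Q : ℝ → ℝ → ℝ → ℝ) (r θ τ : ℝ) : ℝ :=
  τ ^ (-(P.M : ℝ) / P.N) *
    (P.fieldR r θ (P.ζ τ) τ * deriv (fun r' => Q r' θ τ) r +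
      P.fieldΘ r θ (P.ζ τ) τ * deriv (fun θ' => Q r θ' τ) θ) +
  deriv (fun τ' => Q r θ τ') τ

/-- The inverse `(R,Ψ) ↦ (r,θ)` of `(r,θ) ↦ (R_n,Ψ_n)(r,θ,τ)` on the strip `|r| ≤ r₀`. -/
def backward (r₀ : ℝ) (n : ℕ) (τ R Ψ : ℝ) : ℝ × ℝ :=
  Function.invFunOn (fun v : ℝ × ℝ => (P.Rn n v.1 v.2 τ, P.Ψn n v.1 v.2 τ))
    {v : ℝ × ℝ | |v.1| ≤ r₀} (R, Ψ)

/-- The remainder of the equation for `R`. -/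
def remΛ (r₀ : ℝ) (n : ℕ) (R Ψ τ : ℝ) : ℝ :=
  P.totalDeriv (P.Rn n) (P.backward r₀ n τ R Ψ).1 (P.backward r₀ n τ R Ψ).2 τ -
    ∑ K ∈ Finset.range (n + 1), τ ^ (-((P.M : ℝ) + K) / P.N) * P.Λ K R Ψ

/-- The remainder of the equation for `Ψ`. -/
def remΩ (r₀ : ℝ) (n : ℕ) (R Ψ τ : ℝ) : ℝ :=
  P.totalDeriv (P.Ψn n) (P.backward r₀ n τ R Ψ).1 (P.backward r₀ n τ R Ψ).2 τ -
    ∑ K ∈ Finset.range (n + 1), τ ^ (-((P.M : ℝ) + K) / P.N) * P.Ω K R Ψ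

/-- `(R,Ψ)` solves the averaged system
`dR/dτ = ∑_{K ≤ n} τ^(-(M+K)/N) Λ_K(R,Ψ) + Λ̃_n(R,Ψ,τ)`,
`dΨ/dτ = ∑_{K ≤ n} τ^(-(M+K)/N) Ω_K(R,Ψ) + Ω̃_n(R,Ψ,τ)` on `[τs, ∞)`. -/
def IsAveragedSolution (r₀ : ℝ) (n : ℕ) (τs : ℝ) (R Ψ : ℝ → ℝ) : Prop :=
  ∀ τ, τs ≤ τ →
    HasDerivWithinAt R
      (∑ K ∈ Finset.range (n + 1), τ ^ (-((P.M : ℝ) + K) / P.N) * P.Λ K (R τ) (Ψ τ) +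
        P.remΛ r₀ n (R τ) (Ψ τ) τ) (Set.Ici τs) τ ∧
    HasDerivWithinAt Ψ
      (∑ K ∈ Finset.range (n + 1), τ ^ (-((P.M : ℝ) + K) / P.N) * P.Ω K (R τ) (Ψ τ) +
        P.remΩ r₀ n (R τ) (Ψ τ) τ) (Set.Ici τs) τ

/-- `(ϱ,φ)` solves the truncated system (without remainders; `Λ_K` vanishes for `K < L`)
for `τ > τ₀`. -/
def IsTruncatedSolution (L n : ℕ) (τ₀ : ℝ) (ϱ φ : ℝ → ℝ) : Prop :=
  ∀ τ, τ₀ < τ →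
    HasDerivAt ϱ
      (∑ K ∈ Finset.Icc L n, τ ^ (-((P.M : ℝ) + K) / P.N) * P.Λ K (ϱ τ) (φ τ)) τ ∧
    HasDerivAt φ
      (∑ K ∈ Finset.range (n + 1), τ ^ (-((P.M : ℝ) + K) / P.N) * P.Ω K (ϱ τ) (φ τ)) τ

/-- `ϱ ~ ∑_{K ≥ 0} ϱ_K τ^(-(M+K)/N)` and `φ ~ φ₀ + ∑_{K ≥ 1} φ_K τ^(-K/N)` as `τ → ∞`. -/
def IsPhaseLocked (φ₀ : ℝ) (ϱ φ : ℝ → ℝ) : Prop :=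
  ∃ c d : ℕ → ℝ, ∀ m : ℕ,
    ((fun τ : ℝ => ϱ τ - ∑ K ∈ Finset.range m, c K * τ ^ (-((P.M : ℝ) + K) / P.N))
      =O[atTop] fun τ : ℝ => τ ^ (-((P.M : ℝ) + m) / P.N)) ∧
    ((fun τ : ℝ => φ τ - φ₀ - ∑ K ∈ Finset.Icc 1 m, d K * τ ^ (-(K : ℝ) / P.N))
      =O[atTop] fun τ : ℝ => τ ^ (-((m : ℝ) + 1) / P.N))

/-- `∂_R Λ_K + ∂_Ψ Ω_K`. -/
def divergence (K : ℕ) (R Ψ : ℝ) : ℝ :=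
  deriv (fun R' => P.Λ K R' Ψ) R + deriv (fun Ψ' => P.Ω K R Ψ') Ψ

/-- `γ̂_D = γ_D + δ_{M+D,N} L/N` with `γ_D = ∂_R Λ_D(0,φ₀) + ∂_Ψ Ω_D(0,φ₀)`. -/
def γHat (L D : ℕ) (φ₀ : ℝ) : ℝ :=
  P.divergence D 0 φ₀ + if P.M + D = P.N then (L : ℝ) / P.N else 0

end ChirpedSystem

end

noncomputable section

open Set (Icc Ioo Ici mem_Ici univ Iic projIcc)
open Finset (range sum_congr mul_sum mem_range)
open Real (norm_eq_abs rpow_natCast rpow_mul rpow_add rpow_pos_of_pos rpow_nonneg rpow_neg)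

/-! ### Smoothness of parametric integrals and of partial derivatives -/

theorem hasFDerivAt_intervalIntegral_of_contDiff {E F : Type} [NormedAddCommGroup E]
    [NormedSpace ℝ E] [ProperSpace E] [NormedAddCommGroup F] [NormedSpace ℝ F] [CompleteSpace F]
    {f : E × ℝ → F} (hf : ContDiff ℝ 1 f) (a b : ℝ) (p₀ : E) :
    HasFDerivAt (fun p => ∫ x in a..b, f (p, x))
      (∫ x in a..b, (fderiv ℝ f (p₀, x)).comp (ContinuousLinearMap.inl ℝ E ℝ)) p₀ := by
  have hf' : Continuous fun q => (fderiv ℝ f q).comp (ContinuousLinearMap.inl ℝ E ℝ) :=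
    (hf.continuous_fderiv (by simp)).clm_comp continuous_const
  obtain ⟨C, hC⟩ := ((isCompact_closedBall p₀ 1).prod
    (isCompact_uIcc (a := a) (b := b))).exists_bound_of_continuousOn hf'.continuousOn
  refine (intervalIntegral.hasFDerivAt_integral_of_dominated_of_fderiv_le
    (F := fun p x => f (p, x)) (bound := fun _ => C) (s := Metric.closedBall p₀ 1)
    (F' := fun p x => (fderiv ℝ f (p, x)).comp (ContinuousLinearMap.inl ℝ E ℝ))
    (Metric.closedBall_mem_nhds p₀ one_pos) ?_ ?_ ?_ ?_ ?_ ?_)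
  · refine Eventually.of_forall fun p => ?_
    exact (hf.continuous.comp (by fun_prop : Continuous fun x : ℝ => (p, x))).aestronglyMeasurable
  · exact (hf.continuous.comp
      (by fun_prop : Continuous fun x : ℝ => (p₀, x))).intervalIntegrable _ _
  · exact (hf'.comp (by fun_prop : Continuous fun x : ℝ => (p₀, x))).aestronglyMeasurable
  · refine Eventually.of_forall fun x hx p hp => ?_
    exact hC (p, x) ⟨hp, Set.uIoc_subset_uIcc hx⟩
  · exact intervalIntegrable_const
  · refine Eventually.of_forall fun x hx p hp => ?_
    have h1 : HasFDerivAt f (fderiv ℝ f (p, x)) (p, x) :=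
      (hf.differentiable (by simp) _).hasFDerivAt
    exact h1.comp p (hasFDerivAt_prodMk_left p x)

theorem contDiff_intervalIntegral_nat {E : Type} [NormedAddCommGroup E]
    [NormedSpace ℝ E] [ProperSpace E] (a b : ℝ) (n : ℕ) :
    ∀ {F : Type} [NormedAddCommGroup F] [NormedSpace ℝ F] [CompleteSpace F]
    {f : E × ℝ → F}, ContDiff ℝ ∞ f → ContDiff ℝ n (fun p => ∫ x in a..b, f (p, x)) := by
  induction n with
  | zero =>
    intro F _ _ _ f hf
    have : Differentiable ℝ (fun p => ∫ x in a..b, f (p, x)) := fun p =>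
      (hasFDerivAt_intervalIntegral_of_contDiff
        (hf.of_le (by exact_mod_cast le_top)) a b p).differentiableAt
    exact contDiff_zero.2 this.continuous
  | succ n ih =>
    intro F _ _ _ f hf
    have h1 : ContDiff ℝ 1 f := hf.of_le (by exact_mod_cast le_top)
    push_cast
    rw [contDiff_succ_iff_hasFDerivAt]
    refine ⟨_, ?_, fun p => hasFDerivAt_intervalIntegral_of_contDiff h1 a b p⟩
    refine ih (f := fun q => (fderiv ℝ f q).comp (ContinuousLinearMap.inl ℝ E ℝ)) ?_
    exact (hf.fderiv_right (m := ∞) (by simp)).clm_comp contDiff_const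

theorem contDiff_intervalIntegral {E F : Type} [NormedAddCommGroup E]
    [NormedSpace ℝ E] [ProperSpace E] [NormedAddCommGroup F] [NormedSpace ℝ F] [CompleteSpace F]
    {f : E × ℝ → F} (hf : ContDiff ℝ ∞ f) (a b : ℝ) :
    ContDiff ℝ ∞ (fun p => ∫ x in a..b, f (p, x)) :=
  contDiff_infty.2 fun n => contDiff_intervalIntegral_nat a b n hf

/-- Smooth dependence of a primitive on its upper limit and on parameters. -/
theorem contDiff_intervalIntegral_upper {E F : Type} [NormedAddCommGroup E]
    [NormedSpace ℝ E] [ProperSpace E] [NormedAddCommGroup F] [NormedSpace ℝ F] [CompleteSpace F]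
    {f : E × ℝ → F} (hf : ContDiff ℝ ∞ f) {u : E → ℝ} (hu : ContDiff ℝ ∞ u) :
    ContDiff ℝ ∞ (fun p => ∫ x in (0 : ℝ)..u p, f (p, x)) := by
  have h1 : (fun p => ∫ x in (0 : ℝ)..u p, f (p, x)) =
      fun p => u p • ∫ x in (0 : ℝ)..1, f (p, u p * x) := by
    ext p
    have := intervalIntegral.smul_integral_comp_mul_left (a := 0) (b := 1) (fun x => f (p, x)) (u p)
    simpa using this.symm
  rw [h1]
  refine hu.smul (contDiff_intervalIntegral (f := fun q : E × ℝ => f (q.1, u q.1 * q.2)) ?_ 0 1)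
  fun_prop

/-- The iterated derivative with respect to the first variable of a jointly smooth function. -/
theorem contDiffOn_iteratedDeriv_fst {E : Type} [NormedAddCommGroup E] [NormedSpace ℝ E]
    {O : Set (ℝ × E)} (hO : IsOpen O) {G : ℝ × E → ℝ} (hG : ContDiffOn ℝ ∞ G O) (k : ℕ) :
    ContDiffOn ℝ ∞ (fun q : ℝ × E => iteratedDeriv k (fun κ => G (κ, q.2)) q.1) O := by
  induction k with
  | zero => simpa using hG
  | succ k ih =>
    have h1 : ContDiffOn ℝ ∞ (fun q : ℝ × E => fderiv ℝ
        (fun q : ℝ × E => iteratedDeriv k (fun κ => G (κ, q.2)) q.1) q (1, 0)) O :=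
      (ih.fderiv_of_isOpen hO (m := ∞) (by simp)).clm_apply contDiffOn_const
    refine h1.congr fun q hq => ?_
    rw [iteratedDeriv_succ]
    have h2 : HasFDerivAt (fun q : ℝ × E => iteratedDeriv k (fun κ => G (κ, q.2)) q.1) _ (q.1, q.2) :=
      ((ih.differentiableOn (by simp) q hq).differentiableAt (hO.mem_nhds hq)).hasFDerivAt
    have h3 := h2.comp_hasDerivAt q.1 ((hasDerivAt_id q.1).prodMk (hasDerivAt_const q.1 q.2))
    exact h3.deriv

theorem contDiffOn_deriv_fst {E : Type} [NormedAddCommGroup E] [NormedSpace ℝ E]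
    {O : Set (ℝ × E)} (hO : IsOpen O) {G : ℝ × E → ℝ} (hG : ContDiffOn ℝ ∞ G O) :
    ContDiffOn ℝ ∞ (fun q : ℝ × E => deriv (fun κ => G (κ, q.2)) q.1) O := by
  simpa using contDiffOn_iteratedDeriv_fst hO hG 1

theorem contDiff_iteratedDeriv_zero {E : Type} [NormedAddCommGroup E] [NormedSpace ℝ E]
    {O : Set (ℝ × E)} (hO : IsOpen O) (h0 : ∀ p, ((0 : ℝ), p) ∈ O) {G : ℝ × E → ℝ}
    (hG : ContDiffOn ℝ ∞ G O) (k : ℕ) :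
    ContDiff ℝ ∞ (fun p : E => iteratedDeriv k (fun κ => G (κ, p)) 0) := by
  have h := (contDiffOn_iteratedDeriv_fst hO hG k).comp (g := fun q : ℝ × E =>
    iteratedDeriv k (fun κ => G (κ, q.2)) q.1) (f := fun p : E => ((0 : ℝ), p)) (s := univ)
    (by fun_prop) (fun p _ => h0 p)
  exact contDiffOn_univ.1 h

/-- Taylor expansion in the first variable, uniformly on compact sets of parameters. -/
theorem exists_taylor_bound {E : Type} [NormedAddCommGroup E] [NormedSpace ℝ E]
    {O : Set (ℝ × E)} (hO : IsOpen O) {S : Set E} (hS : IsCompact S)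
    (hSO : ∀ p ∈ S, ((0 : ℝ), p) ∈ O) (m : ℕ) : ∀ {G : ℝ × E → ℝ}, ContDiffOn ℝ ∞ G O →
    ∃ C : ℝ, ∃ κ₀ > 0, ∀ κ, 0 ≤ κ → κ < κ₀ → ∀ p ∈ S, (κ, p) ∈ O ∧
      |G (κ, p) - ∑ K ∈ range m,
        κ ^ K * (iteratedDeriv K (fun κ' => G (κ', p)) 0 / K.factorial)| ≤ C * κ ^ m := by
  have key : ∃ κ₀ > 0, Icc (0 : ℝ) κ₀ ×ˢ S ⊆ O := by
    obtain ⟨u, v, hu, hv, h0u, hSv, huv⟩ := generalized_tube_lemma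
      (isCompact_singleton (x := (0 : ℝ))) hS (n := O) hO
      (by rintro ⟨x, p⟩ ⟨hx, hp⟩; rw [Set.mem_singleton_iff] at hx; subst hx; exact hSO p hp)
    obtain ⟨ε, hε, hεu⟩ := Metric.isOpen_iff.1 hu 0 (h0u rfl)
    refine ⟨ε / 2, by positivity, fun q hq => huv ⟨hεu ?_, hSv hq.2⟩⟩
    rw [Metric.mem_ball, Real.dist_eq, sub_zero, abs_of_nonneg hq.1.1]
    linarith [hq.1.2]
  obtain ⟨κ₀, hκ₀, hsub⟩ := key
  have hcpt : IsCompact (Icc (0 : ℝ) κ₀ ×ˢ S) := isCompact_Icc.prod hS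
  induction m with
  | zero =>
    intro G hG
    obtain ⟨C, hC⟩ := hcpt.exists_bound_of_continuousOn (hG.continuousOn.mono hsub)
    refine ⟨C, κ₀, hκ₀, fun κ h0 h1 p hp => ⟨hsub ⟨⟨h0, h1.le⟩, hp⟩, ?_⟩⟩
    simpa using hC (κ, p) ⟨⟨h0, h1.le⟩, hp⟩
  | succ m ih =>
    intro G hG
    obtain ⟨C, κ₁, hκ₁, hC⟩ := ih (contDiffOn_deriv_fst hO hG)
    refine ⟨C, min κ₀ κ₁, lt_min hκ₀ hκ₁, fun κ h0 h1 p hp =>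
      ⟨hsub ⟨⟨h0, (h1.trans_le (min_le_left _ _)).le⟩, hp⟩, ?_⟩⟩
    set T : ℝ → ℝ := fun x => G (x, p) - ∑ K ∈ range (m + 1),
        x ^ K * (iteratedDeriv K (fun κ' => G (κ', p)) 0 / K.factorial) with hT
    set T' : ℝ → ℝ := fun x => deriv (fun κ' => G (κ', p)) x - ∑ K ∈ range m,
        x ^ K * (iteratedDeriv K (fun x => deriv (fun κ' => G (κ', p)) x) 0 / K.factorial) with hT'
    have hder : ∀ x ∈ Icc 0 κ, HasDerivWithinAt T (T' x) (Icc 0 κ) x := by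
      intro x hx
      have hxO : (x, p) ∈ O := hsub ⟨⟨hx.1, (hx.2.trans h1.le).trans (min_le_left _ _)⟩, hp⟩
      have hd : DifferentiableAt ℝ (fun κ' => G (κ', p)) x := by
        have := (hG.differentiableOn (by simp) _ hxO).differentiableAt (hO.mem_nhds hxO)
        exact this.comp x (by fun_prop)
      refine HasDerivAt.hasDerivWithinAt (HasDerivAt.sub hd.hasDerivAt ?_)
      have : ∀ K, HasDerivAt (fun x : ℝ => x ^ K *
          (iteratedDeriv K (fun κ' => G (κ', p)) 0 / K.factorial))
          (K * x ^ (K - 1) * (iteratedDeriv K (fun κ' => G (κ', p)) 0 / K.factorial)) x :=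
        fun K => (hasDerivAt_pow K x).mul_const _
      convert! HasDerivAt.fun_sum (u := range (m + 1)) fun K _ => this K using 1
      rw [Finset.sum_range_succ']
      simp only [Nat.cast_zero, zero_mul, add_zero, Nat.add_sub_cancel]
      refine sum_congr rfl fun K _ => ?_
      have : iteratedDeriv K (fun x => deriv (fun κ' => G (κ', p)) x) 0 =
          iteratedDeriv (K + 1) (fun κ' => G (κ', p)) 0 := by rw [iteratedDeriv_succ']
      rw [this, Nat.factorial_succ]
      push_cast
      have : (K.factorial : ℝ) ≠ 0 := by exact_mod_cast K.factorial_ne_zero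
      field_simp
    have hbd : ∀ x ∈ Set.Ico 0 κ, ‖T' x‖ ≤ C * κ ^ m := by
      intro x hx
      have := (hC x hx.1 (hx.2.trans (h1.trans_le (min_le_right _ _))) p hp).2
      refine this.trans ?_
      have hC0 : 0 ≤ C := by
        have := (hC (κ₁ / 2) (by positivity) (by linarith) p hp).2
        have h2 : 0 ≤ C * (κ₁ / 2) ^ m := (abs_nonneg _).trans this
        exact nonneg_of_mul_nonneg_left h2 (by positivity)
      have := hx.1
      have := hx.2.le
      gcongr
    have := norm_image_sub_le_of_norm_deriv_le_segment' hder hbd κ ⟨h0, le_rfl⟩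
    have hT0 : T 0 = 0 := by
      simp only [hT]
      rw [Finset.sum_range_succ']
      simp
    rw [hT0, sub_zero, sub_zero] at this
    calc _ ≤ _ := this
      _ = _ := by ring

/-! ### Expansions in a small parameter, locally uniform in the other variables -/

/-- `κ → 0+`, uniformly on `S`. -/
def smallOn {E : Type} (S : Set E) : Filter (ℝ × E) := 𝓝[>] (0 : ℝ) ×ˢ 𝓟 S

theorem eventually_smallOn {E : Type} {S : Set E} {Q : ℝ × E → Prop} :
    (∀ᶠ q in smallOn S, Q q) ↔ ∃ κ₀ > 0, ∀ κ, 0 < κ → κ < κ₀ → ∀ p ∈ S, Q (κ, p) := by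
  rw [smallOn, eventually_prod_principal_iff, eventually_nhdsWithin_iff, Metric.eventually_nhds_iff]
  constructor
  · rintro ⟨ε, hε, h⟩
    refine ⟨ε, hε, fun κ h0 h1 p hp => h ?_ h0 p hp⟩
    rw [Real.dist_eq, sub_zero, abs_of_pos h0]; exact h1
  · rintro ⟨ε, hε, h⟩
    refine ⟨ε, hε, fun κ h1 h0 p hp => h κ h0 ?_ p hp⟩
    rw [Real.dist_eq, sub_zero] at h1
    exact (le_abs_self κ).trans_lt h1

theorem isBigO_smallOn {E : Type} {S : Set E} {w : ℝ × E → ℝ} {m : ℕ} :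
    (w =O[smallOn S] fun q => q.1 ^ m) ↔
      ∃ C > 0, ∃ κ₀ > 0, ∀ κ, 0 < κ → κ < κ₀ → ∀ p ∈ S, |w (κ, p)| ≤ C * κ ^ m := by
  rw [isBigO_iff']
  simp only [eventually_smallOn]
  constructor
  · rintro ⟨C, hC, κ₀, hκ₀, h⟩
    refine ⟨C, hC, κ₀, hκ₀, fun κ h0 h1 p hp => ?_⟩
    have := h κ h0 h1 p hp
    rwa [norm_eq_abs, norm_eq_abs, abs_of_pos (pow_pos h0 m)] at this
  · rintro ⟨C, hC, κ₀, hκ₀, h⟩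
    refine ⟨C, hC, κ₀, hκ₀, fun κ h0 h1 p hp => ?_⟩
    have := h κ h0 h1 p hp
    rwa [norm_eq_abs, norm_eq_abs, abs_of_pos (pow_pos h0 m)]

theorem isBigO_pow_smallOn {E : Type} (S : Set E) {m k : ℕ} (h : m ≤ k) :
    (fun q : ℝ × E => q.1 ^ k) =O[smallOn S] fun q => q.1 ^ m := by
  rw [isBigO_smallOn]
  refine ⟨1, one_pos, 1, one_pos, fun κ h0 h1 p _ => ?_⟩
  rw [one_mul, abs_of_pos (pow_pos h0 k)]
  exact pow_le_pow_of_le_one h0.le h1.le h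

theorem isBigO_coeff_smallOn {E : Type} [NormedAddCommGroup E] {S : Set E} (hS : IsCompact S)
    {c : E → ℝ} (hc : Continuous c) :
    (fun q : ℝ × E => c q.2) =O[smallOn S] fun _ => (1 : ℝ) := by
  obtain ⟨C, hC⟩ := hS.exists_bound_of_continuousOn hc.continuousOn
  refine IsBigO.of_bound C ?_
  rw [eventually_smallOn]
  exact ⟨1, one_pos, fun κ _ _ p hp => by simpa using hC p hp⟩

theorem isBigO_pow_mul_coeff_smallOn {E : Type} [NormedAddCommGroup E] {S : Set E}
    (hS : IsCompact S) {c : E → ℝ} (hc : Continuous c) {m k : ℕ} (h : m ≤ k) :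
    (fun q : ℝ × E => q.1 ^ k * c q.2) =O[smallOn S] fun q => q.1 ^ m := by
  simpa using (isBigO_pow_smallOn S h).mul (isBigO_coeff_smallOn hS hc)

/-- `w ~ ∑ κ^K c_K` as `κ → 0+`, with smooth coefficients, locally uniformly in `p`. -/
def HasExp {E : Type} [NormedAddCommGroup E] [NormedSpace ℝ E] (w : ℝ → E → ℝ)
    (c : ℕ → E → ℝ) : Prop :=
  (∀ K, ContDiff ℝ ∞ (c K)) ∧ ∀ (m : ℕ) (S : Set E), IsCompact S →
    (fun q : ℝ × E => w q.1 q.2 - ∑ K ∈ range m, q.1 ^ K * c K q.2) =O[smallOn S]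
      fun q => q.1 ^ m

theorem isBigO_pow_nhdsGT {i j : ℕ} (h : i ≤ j) :
    (fun κ : ℝ => κ ^ j) =O[𝓝[>] 0] fun κ => κ ^ i := by
  refine IsBigO.of_bound 1 ?_
  filter_upwards [Ioo_mem_nhdsGT (zero_lt_one' ℝ)] with κ hκ
  rw [one_mul, Real.norm_of_nonneg (pow_nonneg hκ.1.le _), Real.norm_of_nonneg (pow_nonneg hκ.1.le _)]
  exact pow_le_pow_of_le_one hκ.1.le hκ.2.le h

theorem coeff_eq_zero_of_isBigO {a : ℕ → ℝ} {m : ℕ}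
    (h : (fun κ : ℝ => ∑ K ∈ range m, κ ^ K * a K) =O[𝓝[>] 0] fun κ => κ ^ m) :
    ∀ K < m, a K = 0 := by
  intro K
  induction K using Nat.strong_induction_on with
  | _ K ih =>
  intro hK
  have h1 : (fun κ : ℝ => κ ^ K * a K) =O[𝓝[>] 0] fun κ => κ ^ (K + 1) := by
    have h2 : (fun κ : ℝ => κ ^ K * a K) = fun κ => (∑ K ∈ range m, κ ^ K * a K) -
        ∑ j ∈ Finset.Ico (K + 1) m, κ ^ j * a j := by
      ext κ
      rw [← Finset.sum_range_add_sum_Ico _ (Nat.succ_le_of_lt hK), Finset.sum_range_succ,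
        Finset.sum_eq_zero (s := range K)]
      · ring
      · intro j hj
        rw [mem_range] at hj
        rw [ih j hj (hj.trans hK), mul_zero]
    rw [h2]
    refine (h.trans (isBigO_pow_nhdsGT hK)).sub (IsBigO.fun_sum fun j hj => ?_)
    rw [Finset.mem_Ico] at hj
    simpa using (isBigO_pow_nhdsGT hj.1).mul (isBigO_refl (fun _ : ℝ => a j) (𝓝[>] 0)) |>.trans
      (isBigO_const_mul_self (a j) (fun κ : ℝ => κ ^ (K + 1)) _ |>.congr_left
        fun κ => mul_comm _ _)
  have h3 : (fun _ : ℝ => a K) =O[𝓝[>] 0] fun κ : ℝ => κ := by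
    have h4 := (isBigO_refl (fun κ : ℝ => (κ ^ K)⁻¹) (𝓝[>] 0)).mul h1
    refine h4.congr' ?_ ?_
    · filter_upwards [self_mem_nhdsWithin] with κ hκ
      have : κ ≠ 0 := (ne_of_gt hκ)
      field_simp
    · filter_upwards [self_mem_nhdsWithin] with κ hκ
      have : κ ≠ 0 := (ne_of_gt hκ)
      field_simp
      ring
  have h5 : Tendsto (fun κ : ℝ => κ) (𝓝[>] 0) (𝓝 0) := tendsto_id.mono_left nhdsWithin_le_nhds
  exact tendsto_nhds_unique tendsto_const_nhds (h3.trans_tendsto h5)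

theorem isBigO_at_of_smallOn {E : Type} {u : ℝ × E → ℝ} {S : Set E} {m : ℕ}
    (h : u =O[smallOn S] fun q => q.1 ^ m) {p : E} (hp : p ∈ S) :
    (fun κ => u (κ, p)) =O[𝓝[>] 0] fun κ => κ ^ m := by
  refine h.comp_tendsto (k := fun κ : ℝ => (κ, p)) ?_
  exact tendsto_id.prodMk (tendsto_principal.2 (Eventually.of_forall fun _ => hp))

section
variable {E : Type} [NormedAddCommGroup E] [NormedSpace ℝ E]

theorem HasExp.congr {w w' : ℝ → E → ℝ} {c : ℕ → E → ℝ} (h : HasExp w c)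
    (hw : ∀ S : Set E, IsCompact S → ∀ᶠ q in smallOn S, w q.1 q.2 = w' q.1 q.2) : HasExp w' c :=
  ⟨h.1, fun m S hS => (h.2 m S hS).congr' ((hw S hS).mono fun q hq => by simp [hq])
    EventuallyEq.rfl⟩

theorem HasExp.of_contDiffOn {O : Set (ℝ × E)} (hO : IsOpen O) (h0 : ∀ p, ((0 : ℝ), p) ∈ O)
    {G : ℝ × E → ℝ} (hG : ContDiffOn ℝ ∞ G O) :
    HasExp (fun κ p => G (κ, p)) fun K p => iteratedDeriv K (fun κ => G (κ, p)) 0 / K.factorial := by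
  refine ⟨fun K => (contDiff_iteratedDeriv_zero hO h0 hG K).div_const _, fun m S hS => ?_⟩
  obtain ⟨C, κ₀, hκ₀, h⟩ := exists_taylor_bound hO hS (fun p _ => h0 p) m hG
  refine isBigO_smallOn.2 ⟨max C 1, by positivity, κ₀, hκ₀, fun κ k0 k1 p hp => ?_⟩
  refine ((h κ k0.le k1 p hp).2).trans ?_
  have := pow_pos k0 m
  gcongr
  exact le_max_left _ _

theorem HasExp.add {w w' : ℝ → E → ℝ} {c c' : ℕ → E → ℝ} (h : HasExp w c) (h' : HasExp w' c') :
    HasExp (fun κ p => w κ p + w' κ p) fun K p => c K p + c' K p := by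
  refine ⟨fun K => (h.1 K).add (h'.1 K), fun m S hS => ?_⟩
  refine ((h.2 m S hS).add (h'.2 m S hS)).congr_left fun q => ?_
  simp only [mul_add, Finset.sum_add_distrib]
  ring

theorem HasExp.eq_zero_of_isBigO {w : ℝ → E → ℝ} {c : ℕ → E → ℝ} (h : HasExp w c) {p : E} {m : ℕ}
    (hw : (fun κ => w κ p) =O[𝓝[>] 0] fun κ => κ ^ m) : ∀ K < m, c K p = 0 := by
  have h1 := isBigO_at_of_smallOn (h.2 m {p} isCompact_singleton) (Set.mem_singleton p)
  refine coeff_eq_zero_of_isBigO (a := fun K => c K p) ((hw.sub h1).congr_left fun κ => ?_)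
  ring

theorem HasExp.coeff_unique {w w' : ℝ → E → ℝ} {c c' : ℕ → E → ℝ} (h : HasExp w c)
    (h' : HasExp w' c') {p p' : E} {m : ℕ}
    (hw : (fun κ => w κ p - w' κ p') =O[𝓝[>] 0] fun κ => κ ^ m) : ∀ K < m, c K p = c' K p' := by
  have h1 := isBigO_at_of_smallOn (h.2 m {p} isCompact_singleton) (Set.mem_singleton p)
  have h2 := isBigO_at_of_smallOn (h'.2 m {p'} isCompact_singleton) (Set.mem_singleton p')
  intro K hK
  refine sub_eq_zero.1 (coeff_eq_zero_of_isBigO (a := fun K => c K p - c' K p') (m := m)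
    (((hw.sub h1).add h2).congr_left fun κ => ?_) K hK)
  simp only [mul_sub, Finset.sum_sub_distrib]
  ring

/-- A function that is approximated to every order by functions with expansions has one itself. -/
theorem exists_hasExp_of_approx {w : ℝ → E → ℝ}
    (h : ∀ m : ℕ, ∃ (g : ℝ → E → ℝ) (c : ℕ → E → ℝ), HasExp g c ∧ ∀ S : Set E, IsCompact S →
      (fun q : ℝ × E => w q.1 q.2 - g q.1 q.2) =O[smallOn S] fun q => q.1 ^ m) :
    ∃ c, HasExp w c := by
  choose g c hg hw using h
  refine ⟨fun K => c (K + 1) K, fun K => (hg (K + 1)).1 K, fun m S hS => ?_⟩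
  have h1 : ∀ K < m, ∀ p, c m K p = c (K + 1) K p := by
    intro K hK p
    refine (hg m).coeff_unique (hg (K + 1)) (m := K + 1) (p := p) (p' := p) ?_ K (by omega)
    have e1 := isBigO_at_of_smallOn (hw m {p} isCompact_singleton) (Set.mem_singleton p)
    have e2 := isBigO_at_of_smallOn (hw (K + 1) {p} isCompact_singleton) (Set.mem_singleton p)
    refine (e2.sub (e1.trans ?_)).congr_left fun κ => by ring
    exact isBigO_pow_nhdsGT hK
  refine ((hw m S hS).add ((hg m).2 m S hS)).congr_left fun q => ?_
  rw [sum_congr rfl fun K hK => by rw [h1 K (mem_range.1 hK) q.2]]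
  ring

theorem HasExp.shift {w : ℝ → E → ℝ} {c : ℕ → E → ℝ} (h : HasExp w c) {M : ℕ}
    (h0 : ∀ K < M, ∀ p, c K p = 0) :
    HasExp (fun κ p => w κ p / κ ^ M) fun K => c (K + M) := by
  refine ⟨fun K => h.1 _, fun m S hS => ?_⟩
  obtain ⟨C, hC, κ₀, hκ₀, hb⟩ := isBigO_smallOn.1 (h.2 (m + M) S hS)
  refine isBigO_smallOn.2 ⟨C, hC, κ₀, hκ₀, fun κ k0 k1 p hp => ?_⟩
  have h1 := hb κ k0 k1 p hp
  have hk : 0 < κ ^ M := pow_pos k0 M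
  have h2 : w κ p / κ ^ M - ∑ K ∈ range m, κ ^ K * c (K + M) p =
      (w κ p - ∑ K ∈ range (m + M), κ ^ K * c K p) / κ ^ M := by
    rw [add_comm m M, Finset.sum_range_add, Finset.sum_eq_zero (s := range M)]
    · rw [zero_add, sub_div, Finset.sum_div]
      congr 1
      refine sum_congr rfl fun K _ => ?_
      rw [pow_add, add_comm K M]
      field_simp
    · intro K hK
      rw [h0 K (mem_range.1 hK), mul_zero]
  simp only at h1 ⊢
  rw [h2, abs_div, abs_of_pos hk, div_le_iff₀ hk]
  calc _ ≤ _ := h1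
    _ = _ := by ring

theorem HasExp.pow_mul {w : ℝ → E → ℝ} {c : ℕ → E → ℝ} (h : HasExp w c) (M : ℕ) :
    ∃ c', HasExp (fun κ p => κ ^ M * w κ p) c' := by
  refine exists_hasExp_of_approx fun m => ⟨fun κ p => κ ^ M * ∑ K ∈ range m, κ ^ K * c K p,
    _, HasExp.of_contDiffOn (O := univ) isOpen_univ (fun _ => trivial)
      (G := fun q : ℝ × E => q.1 ^ M * ∑ K ∈ range m, q.1 ^ K * c K q.2) ?_, fun S hS => ?_⟩
  · refine ContDiff.contDiffOn ?_
    refine (contDiff_fst.pow M).mul (ContDiff.sum fun K _ => ?_)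
    exact (contDiff_fst.pow K).mul ((h.1 K).comp contDiff_snd)
  · have := (isBigO_pow_smallOn S (Nat.zero_le M)).mul (h.2 m S hS)
    refine (this.congr_left fun q => ?_).congr_right fun q => ?_
    · ring
    · ring

end

/-- The coefficients found as successive limits are those of the expansion. -/
theorem expansionCoeff_eq {N : ℕ} (hN : 1 ≤ N) {w : ℝ → ℝ} {c : ℕ → ℝ}
    (h : ∀ m : ℕ, (fun κ : ℝ => w (κ ^ (-(N : ℝ))) - ∑ K ∈ range m, κ ^ K * c K)
      =O[𝓝[>] 0] fun κ => κ ^ m) (K : ℕ) : expansionCoeff N w K = c K := by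
  induction K using Nat.strong_induction_on with
  | _ K ih =>
  rw [expansionCoeff]
  refine Tendsto.limUnder_eq ?_
  have hN0 : (0 : ℝ) < N := by exact_mod_cast hN
  have h1 : Tendsto (fun τ : ℝ => τ ^ (-(1 / (N : ℝ)))) atTop (𝓝[>] 0) := by
    refine tendsto_nhdsWithin_iff.2 ⟨tendsto_rpow_neg_atTop (by positivity), ?_⟩
    filter_upwards [eventually_gt_atTop 0] with τ hτ
    exact rpow_pos_of_pos hτ _
  have h2 : Tendsto (fun κ : ℝ => (κ ^ K)⁻¹ *
      (w (κ ^ (-(N : ℝ))) - ∑ j ∈ range K, κ ^ j * c j)) (𝓝[>] 0) (𝓝 (c K)) := by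
    have h3 : (fun κ : ℝ => (κ ^ K)⁻¹ *
        (w (κ ^ (-(N : ℝ))) - ∑ j ∈ range K, κ ^ j * c j) - c K) =O[𝓝[>] 0]
        fun κ : ℝ => κ := by
      have h4 := (isBigO_refl (fun κ : ℝ => (κ ^ K)⁻¹) (𝓝[>] 0)).mul (h (K + 1))
      refine h4.congr' ?_ ?_
      · filter_upwards [self_mem_nhdsWithin] with κ hκ
        have : κ ≠ 0 := (ne_of_gt hκ)
        rw [Finset.sum_range_succ]
        field_simp
        ring
      · filter_upwards [self_mem_nhdsWithin] with κ hκ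
        have : κ ≠ 0 := (ne_of_gt hκ)
        field_simp
        ring
    have h5 : Tendsto (fun κ : ℝ => κ) (𝓝[>] 0) (𝓝 0) := tendsto_id.mono_left nhdsWithin_le_nhds
    have := (h3.trans_tendsto h5).add_const (c K)
    simpa using this
  refine (h2.comp h1).congr' ?_
  filter_upwards [eventually_gt_atTop 0] with τ hτ
  have e1 : ∀ j : ℕ, (τ ^ (-(1 / (N : ℝ)))) ^ j = τ ^ (-(j : ℝ) / N) := by
    intro j
    rw [← rpow_natCast, ← rpow_mul hτ.le]
    congr 1
    ring
  have e2 : (τ ^ (-(1 / (N : ℝ)))) ^ (-(N : ℝ)) = τ := by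
    rw [← rpow_mul hτ.le]
    have : -(1 / (N : ℝ)) * -(N : ℝ) = 1 := by field_simp
    rw [this, Real.rpow_one]
  simp only [Function.comp, e1, e2]
  rw [neg_div, rpow_neg hτ.le, inv_inv]
  congr 2
  rw [← Fin.sum_univ_eq_sum_range (fun j => τ ^ (-(j : ℝ) / N) * c j) K]
  refine sum_congr rfl fun j _ => ?_
  rw [ih j j.2]

/-! ### Ordinary differential equations: uniqueness and global existence -/

open scoped NNReal in
theorem exists_lipschitzOnWith_of_contDiff {E F : Type} [NormedAddCommGroup E] [NormedSpace ℝ E]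
    [NormedAddCommGroup F] [NormedSpace ℝ F]
    {v : E → F} (hv : ContDiff ℝ 1 v) {s : Set E} (hs : IsCompact s) :
    ∃ K : ℝ≥0, LipschitzOnWith K v s :=
  LocallyLipschitzOn.exists_lipschitzOnWith_of_compact hs hv.locallyLipschitz.locallyLipschitzOn

theorem ode_unique_right {E : Type} [NormedAddCommGroup E] [NormedSpace ℝ E] [ProperSpace E]
    {v : E → E} (hv : ContDiff ℝ 1 v) {f g : ℝ → E} {a b : ℝ}
    (hf : ContinuousOn f (Icc a b))
    (hf' : ∀ t ∈ Set.Ico a b, HasDerivWithinAt f (v (f t)) (Ici t) t)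
    (hg : ContinuousOn g (Icc a b))
    (hg' : ∀ t ∈ Set.Ico a b, HasDerivWithinAt g (v (g t)) (Ici t) t)
    (ha : f a = g a) : Set.EqOn f g (Icc a b) := by
  have hc : IsCompact (f '' Icc a b ∪ g '' Icc a b) :=
    (isCompact_Icc.image_of_continuousOn hf).union (isCompact_Icc.image_of_continuousOn hg)
  obtain ⟨K, hK⟩ := exists_lipschitzOnWith_of_contDiff hv hc
  exact ODE_solution_unique_of_mem_Icc_right (v := fun _ => v) (s := fun _ => _)
    (fun _ _ => hK) hf hf' (fun t ht => Or.inl ⟨t, Set.Ico_subset_Icc_self ht, rfl⟩) hg hg'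
    (fun t ht => Or.inr ⟨t, Set.Ico_subset_Icc_self ht, rfl⟩) ha

theorem ode_unique {E : Type} [NormedAddCommGroup E] [NormedSpace ℝ E] [ProperSpace E]
    {v : E → E} (hv : ContDiff ℝ 1 v) {f g : ℝ → E} (t₀ : ℝ)
    (hf : ∀ t, HasDerivAt f (v (f t)) t) (hg : ∀ t, HasDerivAt g (v (g t)) t)
    (h : f t₀ = g t₀) : f = g := by
  have hfc : Continuous f := continuous_iff_continuousAt.2 fun t => (hf t).continuousAt
  have hgc : Continuous g := continuous_iff_continuousAt.2 fun t => (hg t).continuousAt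
  ext t
  obtain ⟨A, B, Ht, Ht₀⟩ : ∃ A B, t ∈ Ioo A B ∧ t₀ ∈ Ioo A B := by
    use (min (-|t|) (-|t₀|) - 1), (max |t| |t₀| + 1)
    grind
  have hc : IsCompact (f '' Icc A B ∪ g '' Icc A B) :=
    (isCompact_Icc.image hfc).union (isCompact_Icc.image hgc)
  obtain ⟨K, hK⟩ := exists_lipschitzOnWith_of_contDiff hv hc
  exact ODE_solution_unique_of_mem_Ioo (v := fun _ => v) (s := fun _ => _) (fun _ _ => hK) Ht₀
    (fun s hs => ⟨hf s, Or.inl ⟨s, Set.Ioo_subset_Icc_self hs, rfl⟩⟩)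
    (fun s hs => ⟨hg s, Or.inr ⟨s, Set.Ioo_subset_Icc_self hs, rfl⟩⟩) h Ht

/-- A curve that cannot leave `K` before it is found in the interior of `K` stays in `K`. -/
theorem forall_mem_of_bootstrap {E : Type} [TopologicalSpace E] {α : ℝ → E} {a : ℝ} {K : Set E}
    (hα : ∀ t, a ≤ t → ContinuousWithinAt α (Ici t) t)
    (h : ∀ T, a ≤ T → (∀ t, a ≤ t → t < T → α t ∈ K) → α T ∈ interior K) :
    ∀ t, a ≤ t → α t ∈ K := by
  by_contra! hcon
  set B := {t | a ≤ t ∧ α t ∉ K} with hB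
  have hne : B.Nonempty := hcon
  have hbd : BddBelow B := ⟨a, fun t ht => ht.1⟩
  have has : a ≤ sInf B := le_csInf hne fun t ht => ht.1
  have h1 : α (sInf B) ∈ interior K := h _ has fun t hat hts => by
    by_contra hK
    exact absurd (csInf_le hbd ⟨hat, hK⟩) (not_le.2 hts)
  have h2 : ∀ᶠ t in 𝓝[≥] (sInf B), α t ∈ K :=
    (hα _ has).eventually (mem_interior_iff_mem_nhds.1 h1)
  obtain ⟨u, hu, hsub⟩ := mem_nhdsGE_iff_exists_Ico_subset.1 h2
  obtain ⟨t, ht, htu⟩ := exists_lt_of_csInf_lt hne hu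
  exact ht.2 (hsub ⟨csInf_le hbd ht, htu⟩)

open scoped NNReal in
/-- Global existence for a bounded, globally Lipschitz field. -/
theorem exists_global_solution {E : Type} [NormedAddCommGroup E] [NormedSpace ℝ E]
    [CompleteSpace E] {v : ℝ → E → E} {a : ℝ} (p : E)
    (hlip : ∀ T, a ≤ T → ∃ K : ℝ≥0, ∀ t ∈ Icc a T, LipschitzWith K (v t))
    (hcont : ∀ x, ContinuousOn (fun t => v t x) (Ici a))
    (hbdd : ∀ T, a ≤ T → ∃ C : ℝ≥0, ∀ t ∈ Icc a T, ∀ x, ‖v t x‖ ≤ C) :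
    ∃ α : ℝ → E, α a = p ∧ ∀ t, a ≤ t → HasDerivWithinAt α (v t (α t)) (Ici a) t := by
  have hex : ∀ n : ℕ, ∃ α : ℝ → E, α a = p ∧
      ∀ t ∈ Icc a (a + n), HasDerivWithinAt α (v t (α t)) (Icc a (a + n)) t := by
    intro n
    have han : a ≤ a + n := by simp
    obtain ⟨K, hK⟩ := hlip (a + n) han
    obtain ⟨C, hC⟩ := hbdd (a + n) han
    have hP : IsPicardLindelof v (tmin := a) (tmax := a + n) ⟨a, le_rfl, han⟩ p (C * n) 0 C K :=
      { lipschitzOnWith := fun t ht => (hK t ht).lipschitzOnWith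
        continuousOn := fun x _ => (hcont x).mono Set.Icc_subset_Ici_self
        norm_le := fun t ht x _ => hC t ht x
        mul_max_le := by simp }
    obtain ⟨α, h1, h2⟩ := hP.exists_eq_forall_mem_Icc_hasDerivWithinAt₀
    exact ⟨α, h1, h2⟩
  choose α hα0 hα using hex
  have hright : ∀ n : ℕ, ∀ t ∈ Set.Ico a (a + n),
      HasDerivWithinAt (α n) (v t (α n t)) (Ici t) t := by
    intro n t ht
    refine ((hα n t ⟨ht.1, ht.2.le⟩).mono (Set.Icc_subset_Icc_left ht.1)).mono_of_mem_nhdsWithin ?_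
    exact Icc_mem_nhdsGE ht.2
  have hcomp : ∀ n m : ℕ, n ≤ m → Set.EqOn (α n) (α m) (Icc a (a + n)) := by
    intro n m hnm
    have hnm' : (n : ℝ) ≤ m := by exact_mod_cast hnm
    have han : a ≤ a + n := by simp
    obtain ⟨K, hK⟩ := hlip (a + n) han
    refine ODE_solution_unique_of_mem_Icc_right (v := v) (s := fun _ => univ) (K := K)
      (fun t ht => (hK t (Set.Ico_subset_Icc_self ht)).lipschitzOnWith)
      (fun t ht => (hα n t ht).continuousWithinAt) (hright n) (fun _ _ => trivial)
      (fun t ht => ?_) (fun t ht => hright m t ⟨ht.1, by linarith [ht.2]⟩)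
      (fun _ _ => trivial) (by rw [hα0, hα0])
    have hsub : Icc a (a + (n : ℝ)) ⊆ Icc a (a + m) :=
      Set.Icc_subset_Icc_right (by linarith)
    exact (hα m t (hsub ht)).continuousWithinAt.mono hsub
  refine ⟨fun t => α (⌈t - a⌉₊) t, by simp [hα0], fun t ht => ?_⟩
  set n := ⌈t - a⌉₊ + 1 with hn
  have htn : t < a + n := by
    have := Nat.le_ceil (t - a)
    rw [hn]; push_cast; linarith
  have heq : ∀ s ∈ Icc a (a + (n : ℝ)), α (⌈s - a⌉₊) s = α n s := by
    intro s hs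
    refine hcomp _ _ ?_ ⟨hs.1, by linarith [Nat.le_ceil (s - a)]⟩
    exact Nat.ceil_le.2 (by linarith [hs.2])
  have h1 : HasDerivWithinAt (fun s => α (⌈s - a⌉₊) s) (v t (α n t)) (Icc a (a + (n : ℝ))) t :=
    (hα n t ⟨ht, htn.le⟩).congr heq (heq t ⟨ht, htn.le⟩)
  simp only [heq t ⟨ht, htn.le⟩]
  refine h1.mono_of_mem_nhdsWithin ?_
  rw [← Set.Ici_inter_Iic]
  exact inter_mem self_mem_nhdsWithin (mem_nhdsWithin_of_mem_nhds (Iic_mem_nhds htn))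

open scoped NNReal in
/-- Global existence under an a priori bound: `π` retracts onto `K`, and a solution that has been
in `K` so far is in the interior of `K`. -/
theorem exists_global_solution_of_apriori {E : Type} [NormedAddCommGroup E] [NormedSpace ℝ E]
    [CompleteSpace E] {v : ℝ → E → E} {a : ℝ} {p : E} {K : Set E} {π : E → E}
    (hK : IsCompact K) (hπ : LipschitzWith 1 π) (hπK : ∀ x, π x ∈ K) (hπid : ∀ x ∈ K, π x = x)
    (hlip : ∀ T, a ≤ T → ∃ C : ℝ≥0, ∀ t ∈ Icc a T, LipschitzOnWith C (v t) K)
    (hcont : ContinuousOn (fun q : ℝ × E => v q.1 q.2) (Ici a ×ˢ K))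
    (hap : ∀ α : ℝ → E, α a = p → ∀ T, a ≤ T → ContinuousOn α (Icc a T) →
      (∀ t, a ≤ t → t < T → α t ∈ K ∧ HasDerivWithinAt α (v t (α t)) (Ici a) t) →
      α T ∈ interior K) :
    ∃ α : ℝ → E, α a = p ∧ ∀ t, a ≤ t → α t ∈ K ∧
      HasDerivWithinAt α (v t (α t)) (Ici a) t := by
  obtain ⟨α, hα0, hα⟩ := exists_global_solution (v := fun t x => v t (π x)) (a := a) p
    (fun T hT => by
      obtain ⟨C, hC⟩ := hlip T hT
      refine ⟨C * 1, fun t ht => ?_⟩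
      rw [← lipschitzOnWith_univ]
      exact (hC t ht).comp hπ.lipschitzOnWith fun x _ => hπK x)
    (fun x => hcont.comp (f := fun t => (t, π x)) (by fun_prop) fun t ht => ⟨ht, hπK x⟩)
    (fun T hT => by
      obtain ⟨C, hC⟩ := (isCompact_Icc.prod hK).exists_bound_of_continuousOn
        (hcont.mono (Set.prod_mono (show Icc a T ⊆ Ici a from fun t ht => ht.1) subset_rfl))
      refine ⟨C.toNNReal, fun t ht x => ?_⟩
      exact (hC (t, π x) ⟨ht, hπK x⟩).trans (Real.le_coe_toNNReal C))
  have hc : ContinuousOn α (Ici a) := fun t ht => (hα t ht).continuousWithinAt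
  have hmem : ∀ t, a ≤ t → α t ∈ K := by
    refine forall_mem_of_bootstrap
      (fun t ht => (hc t ht).mono (Set.Ici_subset_Ici.2 ht)) fun T hT hTK => ?_
    refine hap α hα0 T hT (hc.mono Set.Icc_subset_Ici_self) fun t ht htT => ?_
    have := hTK t ht htT
    refine ⟨this, ?_⟩
    have h2 := hα t ht
    rwa [hπid _ this] at h2
  refine ⟨α, hα0, fun t ht => ⟨hmem t ht, ?_⟩⟩
  have h2 := hα t ht
  rwa [hπid _ (hmem t ht)] at h2

/-! ### Smooth dependence on parameters for `x' = y`, `y' = -W(x, e)`, `W` polynomial in `x` -/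

theorem isUnit_one_sub_of_pow {B : Type} [NormedRing B] [HasSummableGeomSeries B] (T : B) (n : ℕ)
    (h : ‖T ^ n‖ < 1) : IsUnit (1 - T) := by
  have h1 : IsUnit (1 - T ^ n) := isUnit_one_sub_of_norm_lt_one h
  have h2 : (1 - T) * ∑ i ∈ range n, T ^ i = 1 - T ^ n := mul_neg_geom_sum T n
  have h3 : Commute (1 - T) (∑ i ∈ range n, T ^ i) :=
    Commute.sum_right _ _ _ fun i _ => ((Commute.one_left _).sub_left (Commute.refl T)).pow_right i
  rw [← h2] at h1
  exact (h3.isUnit_mul_iff.1 h1).1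

/-- Continuous functions on the unit interval. -/
abbrev UnitFun : Type := C(unitInterval, ℝ)

theorem continuous_extend (f : UnitFun) :
    Continuous fun x : ℝ => f (projIcc 0 1 zero_le_one x) :=
  f.continuous.comp continuous_projIcc

/-- The primitive that vanishes at `0`. -/
def volterra : UnitFun →L[ℝ] UnitFun :=
  LinearMap.mkContinuous
    { toFun := fun f => ⟨fun s => ∫ x in (0 : ℝ)..s, f (projIcc 0 1 zero_le_one x),
        (intervalIntegral.continuous_primitive
          (fun a b => (continuous_extend f).intervalIntegrable a b) 0).comp continuous_subtype_val⟩
      map_add' := fun f g => by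
        ext s
        exact intervalIntegral.integral_add ((continuous_extend f).intervalIntegrable _ _)
          ((continuous_extend g).intervalIntegrable _ _)
      map_smul' := fun c f => by
        ext s
        exact intervalIntegral.integral_const_mul c _ } 1
    (fun f => by
      rw [one_mul, ContinuousMap.norm_le _ (norm_nonneg f)]
      intro s
      have := intervalIntegral.norm_integral_le_of_norm_le_const (a := 0) (b := (s : ℝ))
        (f := fun x => f (projIcc 0 1 zero_le_one x)) (C := ‖f‖)
        (fun x _ => f.norm_coe_le_norm _)
      refine this.trans ?_
      rw [sub_zero, abs_of_nonneg s.2.1]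
      exact mul_le_of_le_one_right (norm_nonneg f) s.2.2)

theorem volterra_apply (f : UnitFun) (s : unitInterval) :
    volterra f s = ∫ x in (0 : ℝ)..s, f (projIcc 0 1 zero_le_one x) := rfl

theorem abs_volterra_le {f : UnitFun} {c : ℝ} {n : ℕ}
    (hf : ∀ s : unitInterval, |f s| ≤ c * (s : ℝ) ^ n) (s : unitInterval) :
    |volterra f s| ≤ c * (s : ℝ) ^ (n + 1) / (n + 1) := by
  rw [volterra_apply]
  have h := intervalIntegral.norm_integral_le_of_norm_le (a := 0) (b := (s : ℝ))
    (f := fun x => f (projIcc 0 1 zero_le_one x)) (g := fun x => c * x ^ n) (μ := MeasureTheory.volume) s.2.1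
    (Eventually.of_forall fun x hx => by
      have hx' : x ∈ Icc (0 : ℝ) 1 := ⟨hx.1.le, hx.2.trans s.2.2⟩
      have := hf ⟨x, hx'⟩
      simpa [Set.projIcc_of_mem _ hx'] using this)
    (by apply Continuous.intervalIntegrable; fun_prop)
  refine h.trans (le_of_eq ?_)
  rw [intervalIntegral.integral_const_mul, integral_pow]
  simp
  ring

theorem hasDerivAt_volterra (f : UnitFun) {t : ℝ} (ht : t ∈ Icc (0 : ℝ) 1) :
    HasDerivAt (fun s : ℝ => ∫ x in (0 : ℝ)..s, f (projIcc 0 1 zero_le_one x)) (f ⟨t, ht⟩) t := by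
  have := intervalIntegral.integral_hasDerivAt_right
    ((continuous_extend f).intervalIntegrable 0 t)
    (continuous_extend f).stronglyMeasurable.stronglyMeasurableAtFilter
    (continuous_extend f).continuousAt
  simpa [Set.projIcc_of_mem _ ht] using this

theorem eq_volterra {f : UnitFun} {g : ℝ → ℝ} (hg : ∀ t ∈ Icc (0 : ℝ) 1,
    ∀ ht : t ∈ Icc (0 : ℝ) 1, HasDerivAt g (f ⟨t, ht⟩) t) (s : unitInterval) :
    volterra f s = g s - g 0 := by
  rw [volterra_apply]
  refine intervalIntegral.integral_eq_sub_of_hasDerivAt (fun x hx => ?_)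
    ((continuous_extend f).intervalIntegrable _ _)
  rw [Set.uIcc_of_le s.2.1] at hx
  have hx' : x ∈ Icc (0 : ℝ) 1 := ⟨hx.1, hx.2.trans s.2.2⟩
  simpa [Set.projIcc_of_mem _ hx'] using hg x hx' hx'

/-- The linear operator `(ξ, η) ↦ (T ∫ η, -T ∫ w ξ)`. -/
def volterraPair (T : ℝ) (w : UnitFun) : UnitFun × UnitFun →L[ℝ] UnitFun × UnitFun :=
  ((T • volterra).comp (ContinuousLinearMap.snd ℝ UnitFun UnitFun)).prod
    (((-T) • volterra).comp ((ContinuousLinearMap.mul ℝ UnitFun w).comp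
      (ContinuousLinearMap.fst ℝ UnitFun UnitFun)))

theorem volterraPair_pow_apply (T : ℝ) (w : UnitFun) (n : ℕ) (v : UnitFun × UnitFun) :
    ∀ s : unitInterval,
      |((volterraPair T w ^ n) v).1 s| ≤ (|T| * (1 + ‖w‖)) ^ n / n.factorial * ‖v‖ * (s : ℝ) ^ n ∧
      |((volterraPair T w ^ n) v).2 s| ≤ (|T| * (1 + ‖w‖)) ^ n / n.factorial * ‖v‖ * (s : ℝ) ^ n := by
  induction n with
  | zero =>
    intro s
    simp only [pow_zero, one_apply_eq_self, Nat.factorial_zero, Nat.cast_one, div_one,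
      one_mul, mul_one]
    exact ⟨(v.1.norm_coe_le_norm s).trans (norm_fst_le v),
      (v.2.norm_coe_le_norm s).trans (norm_snd_le v)⟩
  | succ n ih =>
    intro s
    set z := (volterraPair T w ^ n) v with hz
    have hs : (volterraPair T w ^ (n + 1)) v = volterraPair T w z := by
      rw [pow_succ', mul_apply_eq_comp]
    set c := (|T| * (1 + ‖w‖)) ^ n / n.factorial * ‖v‖ with hc
    have hc0 : 0 ≤ c := by positivity
    have e : (|T| * (1 + ‖w‖)) ^ (n + 1) / (n + 1).factorial * ‖v‖ * (s : ℝ) ^ (n + 1) =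
        |T| * ((1 + ‖w‖) * c * (s : ℝ) ^ (n + 1) / (n + 1)) := by
      rw [hc, Nat.factorial_succ]
      push_cast
      have : (n.factorial : ℝ) ≠ 0 := by exact_mod_cast n.factorial_ne_zero
      field_simp
      ring
    have hw : 0 ≤ ‖w‖ := norm_nonneg w
    rw [e, hs]
    constructor
    · have h1 : (volterraPair T w z).1 s = T * volterra z.2 s := rfl
      rw [h1, abs_mul]
      refine mul_le_mul_of_nonneg_left (abs_volterra_le (fun s' => ?_) s) (abs_nonneg T)
      refine ((ih s').2).trans ?_
      have := pow_nonneg s'.2.1 n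
      refine mul_le_mul_of_nonneg_right ?_ this
      nlinarith
    · have h1 : (volterraPair T w z).2 s = -T * volterra (w * z.1) s := rfl
      rw [h1, abs_mul, abs_neg]
      refine mul_le_mul_of_nonneg_left (abs_volterra_le (fun s' => ?_) s) (abs_nonneg T)
      rw [ContinuousMap.mul_apply, abs_mul, mul_assoc]
      refine mul_le_mul ?_ (ih s').1 (abs_nonneg _) (by positivity)
      exact (w.norm_coe_le_norm s').trans (by linarith)

theorem isUnit_one_sub_volterraPair (T : ℝ) (w : UnitFun) : IsUnit (1 - volterraPair T w) := by
  obtain ⟨n, hn⟩ := ((FloorSemiring.tendsto_pow_div_factorial_atTop (|T| * (1 + ‖w‖))).eventually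
    (gt_mem_nhds (show (0 : ℝ) < 1 / 2 by norm_num))).exists
  refine isUnit_one_sub_of_pow (volterraPair T w) n (lt_of_le_of_lt ?_ (by linarith : (1 : ℝ) / 2 < 1))
  refine ContinuousLinearMap.opNorm_le_bound _ (by norm_num) fun v => ?_
  have hb := volterraPair_pow_apply T w n v
  have key : ∀ s : unitInterval, (|T| * (1 + ‖w‖)) ^ n / n.factorial * ‖v‖ * (s : ℝ) ^ n ≤
      1 / 2 * ‖v‖ := fun s => by
    have h1 : (s : ℝ) ^ n ≤ 1 := pow_le_one₀ s.2.1 s.2.2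
    have h2 : 0 ≤ (s : ℝ) ^ n := pow_nonneg s.2.1 n
    have h3 := norm_nonneg v
    calc _ ≤ 1 / 2 * ‖v‖ * 1 := by gcongr
      _ = _ := mul_one _
  rw [Prod.norm_def]
  refine max_le ?_ ?_ <;> rw [ContinuousMap.norm_le _ (by positivity)] <;> intro s
  · exact (hb s).1.trans (key s)
  · exact (hb s).2.trans (key s)

/-- `∑ c_i(e) x^i`, the coefficients of the polynomial depending on a parameter. -/
def polyParam (d : ℕ) (c : ℕ → ℝ → ℝ) {A : Type} [Ring A] [Algebra ℝ A] (x : A) (e : ℝ) : A :=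
  ∑ i ∈ range d, c i e • x ^ i

theorem polyParam_apply (d : ℕ) (c : ℕ → ℝ → ℝ) (x : UnitFun) (e : ℝ) (s : unitInterval) :
    polyParam d c x e s = polyParam d c (x s) e := by
  simp [polyParam]

theorem contDiff_polyParam {d : ℕ} {c : ℕ → ℝ → ℝ} (hc : ∀ i, ContDiff ℝ ∞ (c i))
    {A : Type} [NormedRing A] [NormedAlgebra ℝ A] :
    ContDiff ℝ ∞ fun q : A × ℝ => polyParam d c q.1 q.2 := by
  unfold polyParam
  refine ContDiff.sum fun i _ => ?_
  exact ((hc i).comp contDiff_snd).smul (contDiff_fst.pow i)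

theorem hasFDerivAt_polyParam (d : ℕ) (c : ℕ → ℝ → ℝ) (x : UnitFun) (e : ℝ) :
    HasFDerivAt (fun x : UnitFun => polyParam d c x e)
      (ContinuousLinearMap.mul ℝ UnitFun
        (∑ i ∈ range d, c i e • ((i : ℕ) • x ^ (i - 1)))) x := by
  unfold polyParam
  have h := HasFDerivAt.fun_sum (u := range d) fun i _ =>
    ((hasFDerivAt_id (𝕜 := ℝ) x).pow i).const_smul (c i e)
  refine h.congr_fderiv ?_
  ext z s
  simp

theorem contDiffOn_flow {d : ℕ} {c : ℕ → ℝ → ℝ} (hc : ∀ i, ContDiff ℝ ∞ (c i)) {O : Set ℝ}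
    (hO : IsOpen O) {X Y : ℝ → ℝ → ℝ} {ξ : ℝ → ℝ} (hξ : ContDiffOn ℝ ∞ ξ O)
    (hX : ∀ e ∈ O, ∀ t, HasDerivAt (fun t => X t e) (Y t e) t)
    (hY : ∀ e ∈ O, ∀ t, HasDerivAt (fun t => Y t e) (-polyParam d c (X t e) e) t)
    (hX0 : ∀ e ∈ O, X 0 e = ξ e) (hY0 : ∀ e ∈ O, Y 0 e = 0) :
    ContDiffOn ℝ ∞ (fun q : ℝ × ℝ => (X q.1 q.2, Y q.1 q.2)) (univ ×ˢ O) := by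
  rintro ⟨T, e₁⟩ ⟨-, he₁⟩
  have he₁ : e₁ ∈ O := he₁
  refine ContDiffAt.contDiffWithinAt ?_
  have hXc : ∀ e ∈ O, Continuous fun t => X t e := fun e he =>
    continuous_iff_continuousAt.2 fun t => (hX e he t).continuousAt
  have hYc : ∀ e ∈ O, Continuous fun t => Y t e := fun e he =>
    continuous_iff_continuousAt.2 fun t => (hY e he t).continuousAt
  set F : (ℝ × ℝ) × (UnitFun × UnitFun) → UnitFun × UnitFun := fun q =>
    (q.2.1 - ξ q.1.2 • (1 : UnitFun) - q.1.1 • volterra q.2.2,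
      q.2.2 + q.1.1 • volterra (polyParam d c q.2.1 q.1.2)) with hF
  set xA : UnitFun := ⟨fun s => X (T * s) e₁, (hXc e₁ he₁).comp (by fun_prop)⟩ with hxA
  set yA : UnitFun := ⟨fun s => Y (T * s) e₁, (hYc e₁ he₁).comp (by fun_prop)⟩ with hyA
  set u : (ℝ × ℝ) × (UnitFun × UnitFun) := ((T, e₁), (xA, yA)) with hu
  have hmul : ∀ s : ℝ, HasDerivAt (fun s => T * s) T s := fun s => by
    simpa using (hasDerivAt_id s).const_mul T
  have hFu : F u = 0 := by
    have e1 : ∀ s : unitInterval, volterra (T • yA) s = X (T * s) e₁ - X (T * 0) e₁ :=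
      eq_volterra (g := fun s => X (T * s) e₁) fun t _ ht => by
        have := (hX e₁ he₁ (T * t)).comp t (hmul t)
        simpa [hyA, mul_comm, Function.comp_def] using this
    have e2 : ∀ s : unitInterval, volterra (-T • polyParam d c xA e₁) s =
        Y (T * s) e₁ - Y (T * 0) e₁ :=
      eq_volterra (g := fun s => Y (T * s) e₁) fun t _ ht => by
        have := (hY e₁ he₁ (T * t)).comp t (hmul t)
        simpa [hxA, polyParam_apply, mul_comm, Function.comp_def] using this
    refine Prod.ext ?_ ?_ <;> ext s
    · have := e1 s
      rw [map_smul] at this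
      simp only [ContinuousMap.smul_apply, mul_zero, hX0 e₁ he₁, smul_eq_mul] at this
      simp [hF, hu, hxA]
      linarith
    · have := e2 s
      rw [map_smul] at this
      simp only [ContinuousMap.smul_apply, mul_zero, hY0 e₁ he₁, smul_eq_mul, neg_mul] at this
      simp only [hF, hu, Prod.snd_zero, ContinuousMap.add_apply, ContinuousMap.smul_apply,
        ContinuousMap.zero_apply, smul_eq_mul]
      have h2 : yA s = Y (T * s) e₁ := rfl
      rw [h2]; linarith
  have hξ1 : ContDiffAt ℝ ∞ (fun q : (ℝ × ℝ) × (UnitFun × UnitFun) => ξ q.1.2) u :=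
    ContDiffAt.comp u (g := ξ) (f := fun q : (ℝ × ℝ) × (UnitFun × UnitFun) => q.1.2)
      (hξ.contDiffAt (hO.mem_nhds he₁)) (by fun_prop)
  have hpoly : ContDiff ℝ ∞ (fun q : (ℝ × ℝ) × (UnitFun × UnitFun) =>
      volterra (polyParam d c q.2.1 q.1.2)) :=
    volterra.contDiff.comp ((contDiff_polyParam hc).comp
      (f := fun q : (ℝ × ℝ) × (UnitFun × UnitFun) => (q.2.1, q.1.2)) (by fun_prop))
  have cdf : ContDiffAt ℝ ∞ F u := by
    have hv : ContDiff ℝ ∞ (fun q : (ℝ × ℝ) × (UnitFun × UnitFun) => volterra q.2.2) :=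
      volterra.contDiff.comp (by fun_prop)
    have ht : ContDiff ℝ ∞ (fun q : (ℝ × ℝ) × (UnitFun × UnitFun) => q.1.1) := by fun_prop
    refine ContDiffAt.prodMk ?_ ?_
    · refine ContDiffAt.sub (ContDiffAt.sub (by fun_prop) (hξ1.smul contDiffAt_const)) ?_
      exact (ht.smul hv).contDiffAt
    · refine ContDiffAt.add (by fun_prop) ?_
      exact (ht.smul hpoly).contDiffAt
  set w : UnitFun := ∑ i ∈ range d, c i e₁ • ((i : ℕ) • xA ^ (i - 1)) with hw
  have hder : fderiv ℝ F u ∘L .inr ℝ (ℝ × ℝ) (UnitFun × UnitFun) = 1 - volterraPair T w := by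
    have h1 : HasFDerivAt (fun v : UnitFun × UnitFun => F ((T, e₁), v))
        (fderiv ℝ F u ∘L .inr ℝ (ℝ × ℝ) (UnitFun × UnitFun)) (xA, yA) :=
      (cdf.differentiableAt (by simp)).hasFDerivAt.comp (xA, yA) (hasFDerivAt_prodMk_right _ _)
    have h2 : HasFDerivAt (fun v : UnitFun × UnitFun => F ((T, e₁), v))
        ((ContinuousLinearMap.fst ℝ UnitFun UnitFun -
            T • volterra.comp (ContinuousLinearMap.snd ℝ UnitFun UnitFun)).prod
          (ContinuousLinearMap.snd ℝ UnitFun UnitFun +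
            T • volterra.comp ((ContinuousLinearMap.mul ℝ UnitFun w).comp
              (ContinuousLinearMap.fst ℝ UnitFun UnitFun)))) (xA, yA) := by
      refine HasFDerivAt.prodMk ?_ ?_
      · have a1 : HasFDerivAt (fun v : UnitFun × UnitFun => v.1 - ξ e₁ • (1 : UnitFun))
            (ContinuousLinearMap.fst ℝ UnitFun UnitFun) (xA, yA) := hasFDerivAt_fst.sub_const _
        have a2 : HasFDerivAt (fun v : UnitFun × UnitFun => volterra v.2) _ (xA, yA) :=
          volterra.hasFDerivAt.comp (xA, yA) hasFDerivAt_snd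
        exact a1.sub (a2.const_smul T)
      · have a1 : HasFDerivAt (fun v : UnitFun × UnitFun => v.2)
            (ContinuousLinearMap.snd ℝ UnitFun UnitFun) (xA, yA) := hasFDerivAt_snd
        have a2 : HasFDerivAt (fun v : UnitFun × UnitFun => polyParam d c v.1 e₁) _ (xA, yA) :=
          HasFDerivAt.comp (g := fun x : UnitFun => polyParam d c x e₁) (f := Prod.fst) (xA, yA)
            (hasFDerivAt_polyParam d c xA e₁) hasFDerivAt_fst
        have a3 : HasFDerivAt (fun v : UnitFun × UnitFun => volterra (polyParam d c v.1 e₁)) _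
          (xA, yA) := volterra.hasFDerivAt.comp (xA, yA) a2
        exact a1.add (a3.const_smul T)
    rw [h1.unique h2]
    refine ContinuousLinearMap.ext fun v => Prod.ext ?_ ?_
    · rfl
    · change v.2 + T • volterra (w * v.1) = v.2 - (-T) • volterra (w * v.1)
      rw [neg_smul, sub_neg_eq_add]
  have if₂ : (fderiv ℝ F u ∘L .inr ℝ (ℝ × ℝ) (UnitFun × UnitFun)).IsInvertible := by
    rw [hder]
    obtain ⟨U, hU⟩ := isUnit_one_sub_volterraPair T w
    exact ⟨ContinuousLinearEquiv.unitsEquiv ℝ _ U, by rw [← hU]; rfl⟩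
  set ψ := cdf.implicitFunction (by simp) if₂ with hψ
  have hψc : ContDiffAt ℝ ∞ ψ (T, e₁) := cdf.contDiffAt_implicitFunction (by simp) if₂
  have hψF : ∀ᶠ q in 𝓝 (T, e₁), F (q, ψ q) = F u :=
    cdf.eventually_apply_implicitFunction (by simp) if₂
  have hOn : ∀ᶠ q : ℝ × ℝ in 𝓝 (T, e₁), q.2 ∈ O :=
    continuous_snd.continuousAt.eventually (hO.mem_nhds he₁)
  have hone : (1 : ℝ) ∈ Icc (0 : ℝ) 1 := by simp
  have hev : ∀ᶠ q : ℝ × ℝ in 𝓝 (T, e₁), (X q.1 q.2, Y q.1 q.2) =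
      ((ψ q).1 ⟨1, hone⟩, (ψ q).2 ⟨1, hone⟩) := by
    filter_upwards [hψF, hOn] with q hq hqO
    obtain ⟨t, e⟩ := q
    rw [hFu] at hq
    set x := (ψ (t, e)).1
    set y := (ψ (t, e)).2
    have q1 : ∀ s : unitInterval, x s = ξ e + t * volterra y s := fun s => by
      have := congrArg (fun z : UnitFun × UnitFun => z.1 s) hq
      simp only [hF, Prod.fst_zero, ContinuousMap.sub_apply, ContinuousMap.smul_apply,
        ContinuousMap.one_apply, ContinuousMap.zero_apply, smul_eq_mul, mul_one] at this
      linarith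
    have q2 : ∀ s : unitInterval, y s = - (t * volterra (polyParam d c x e) s) := fun s => by
      have := congrArg (fun z : UnitFun × UnitFun => z.2 s) hq
      simp only [hF, Prod.snd_zero, ContinuousMap.add_apply, ContinuousMap.smul_apply,
        ContinuousMap.zero_apply, smul_eq_mul] at this
      linarith
    set v : ℝ × ℝ → ℝ × ℝ := fun z => (t * z.2, -(t * polyParam d c z.1 e)) with hv
    have hvc : ContDiff ℝ 1 v := by
      have : ContDiff ℝ 1 fun z : ℝ × ℝ => polyParam d c z.1 e :=
        ((contDiff_polyParam hc).of_le (by exact_mod_cast le_top)).comp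
          (f := fun z : ℝ × ℝ => (z.1, e)) (by fun_prop)
      fun_prop
    set f₁ : ℝ → ℝ × ℝ := fun s =>
      (ξ e + t * ∫ r in (0 : ℝ)..s, y (projIcc 0 1 zero_le_one r),
        -(t * ∫ r in (0 : ℝ)..s, polyParam d c x e (projIcc 0 1 zero_le_one r))) with hf₁
    set f₂ : ℝ → ℝ × ℝ := fun s => (X (t * s) e, Y (t * s) e) with hf₂
    have hf₁v : ∀ s (hs : s ∈ Icc (0 : ℝ) 1), f₁ s = (x ⟨s, hs⟩, y ⟨s, hs⟩) := fun s hs => by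
      rw [q1, q2]; rfl
    have hd₁ : ∀ s ∈ Icc (0 : ℝ) 1, HasDerivAt f₁ (v (f₁ s)) s := fun s hs => by
      rw [hf₁v s hs]
      have h1 := ((hasDerivAt_volterra y hs).const_mul t).const_add (ξ e)
      have h2 := ((hasDerivAt_volterra (polyParam d c x e) hs).const_mul t).neg
      rw [polyParam_apply] at h2
      exact h1.prodMk h2
    have hd₂ : ∀ s, HasDerivAt f₂ (v (f₂ s)) s := fun s => by
      have hts : HasDerivAt (fun s => t * s) t s := by simpa using (hasDerivAt_id s).const_mul t
      have h1 := (hX e hqO (t * s)).comp s hts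
      have h2 := (hY e hqO (t * s)).comp s hts
      have := h1.prodMk h2
      simpa [hv, hf₂, Function.comp_def, mul_comm] using this
    have h0 : f₁ 0 = f₂ 0 := by simp [hf₁, hf₂, hX0 e hqO, hY0 e hqO]
    have heq := ode_unique_right hvc (fun s hs => (hd₁ s hs).continuousAt.continuousWithinAt)
      (fun s hs => (hd₁ s (Set.Ico_subset_Icc_self hs)).hasDerivWithinAt)
      (fun s hs => (hd₂ s).continuousAt.continuousWithinAt)
      (fun s hs => (hd₂ s).hasDerivWithinAt) h0 hone
    rw [hf₁v 1 hone] at heq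
    simpa [hf₂] using heq.symm
  refine ContDiffAt.congr_of_eventuallyEq ?_ hev
  have hev1 : ∀ s : unitInterval, ContDiff ℝ ∞ fun f : UnitFun => f s := fun s =>
    (ContinuousMap.evalCLM ℝ s : UnitFun →L[ℝ] ℝ).contDiff
  exact ((hev1 _).contDiffAt.comp _ hψc.fst).prodMk ((hev1 _).contDiffAt.comp _ hψc.snd)

/-- A smooth equation `F(p, x) = 0` in one real unknown. -/
theorem exists_contDiffAt_implicit {E : Type} [NormedAddCommGroup E] [NormedSpace ℝ E]
    [CompleteSpace E] {F : E × ℝ → ℝ} {p₀ : E} {x₀ d : ℝ} (hF : ContDiffAt ℝ ∞ F (p₀, x₀))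
    (hd : HasDerivAt (fun x => F (p₀, x)) d x₀) (hd0 : d ≠ 0) (h0 : F (p₀, x₀) = 0) :
    ∃ ψ : E → ℝ, ContDiffAt ℝ ∞ ψ p₀ ∧ ψ p₀ = x₀ ∧ ∀ᶠ p in 𝓝 p₀, F (p, ψ p) = 0 := by
  have h1 : HasFDerivAt (fun x => F (p₀, x)) (fderiv ℝ F (p₀, x₀) ∘L .inr ℝ E ℝ) x₀ :=
    (hF.differentiableAt (by simp)).hasFDerivAt.comp x₀ (hasFDerivAt_prodMk_right _ _)
  have if₂ : (fderiv ℝ F (p₀, x₀) ∘L .inr ℝ E ℝ).IsInvertible := by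
    refine ⟨ContinuousLinearEquiv.unitsEquivAut ℝ (Units.mk0 d hd0), ?_⟩
    refine ContinuousLinearMap.ext_ring ?_
    have := h1.hasDerivAt.unique hd
    simpa using this.symm
  refine ⟨hF.implicitFunction (by simp) if₂, hF.contDiffAt_implicitFunction (by simp) if₂,
    hF.implicitFunction_apply_self (by simp) if₂, ?_⟩
  filter_upwards [hF.eventually_apply_implicitFunction (by simp) if₂] with p hp
  rw [hp, h0]

namespace ChirpedSystem

variable (P : ChirpedSystem)

/-! ### The scaled potential -/

/-- `e^(2h) U(x/e)`, a polynomial in `x` and `e`. -/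
def scaledU (x e : ℝ) : ℝ :=
  x ^ (2 * P.h) / (2 * P.h) + ∑ i ∈ Finset.Ico 1 (2 * P.h), P.u i * e ^ (2 * P.h - i) * x ^ i

/-- The coefficients of the scaled force. -/
def forceCoeff (i : ℕ) (e : ℝ) : ℝ :=
  if i + 1 = 2 * P.h then 1 else (i + 1) * P.u (i + 1) * e ^ (2 * P.h - (i + 1))

/-- `∂_x` of the scaled potential. -/
def scaledForce (x e : ℝ) : ℝ := polyParam (2 * P.h) P.forceCoeff x e

theorem contDiff_forceCoeff (i : ℕ) : ContDiff ℝ ∞ (P.forceCoeff i) := by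
  unfold forceCoeff
  split_ifs <;> fun_prop

theorem contDiff_scaledU : ContDiff ℝ ∞ fun q : ℝ × ℝ => P.scaledU q.1 q.2 := by
  unfold scaledU
  have : ∀ i, ContDiff ℝ ∞ fun q : ℝ × ℝ => P.u i * q.2 ^ (2 * P.h - i) * q.1 ^ i := fun i => by
    fun_prop
  exact ContDiff.add (by fun_prop) (ContDiff.sum fun i _ => this i)

theorem contDiff_scaledForce : ContDiff ℝ ∞ fun q : ℝ × ℝ => P.scaledForce q.1 q.2 :=
  contDiff_polyParam P.contDiff_forceCoeff

theorem scaledForce_eq (x e : ℝ) : P.scaledForce x e = x ^ (2 * P.h - 1) +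
    ∑ i ∈ Finset.Ico 1 (2 * P.h), P.u i * e ^ (2 * P.h - i) * (i * x ^ (i - 1)) := by
  have hh := P.two_le_h
  obtain ⟨d, hd⟩ : ∃ d, 2 * P.h = d + 1 := ⟨2 * P.h - 1, by omega⟩
  unfold scaledForce polyParam forceCoeff
  rw [hd, Finset.sum_range_succ, Finset.sum_Ico_eq_sum_range, add_comm]
  congr 1
  · simp
  · refine sum_congr rfl fun i hi => ?_
    rw [mem_range] at hi
    rw [if_neg (by omega)]
    have e1 : 1 + i - 1 = i := by omega
    rw [e1, add_comm 1 i, smul_eq_mul]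
    push_cast
    ring

theorem hasDerivAt_scaledU (x e : ℝ) :
    HasDerivAt (fun x => P.scaledU x e) (P.scaledForce x e) x := by
  rw [scaledForce_eq]
  unfold scaledU
  have hh := P.two_le_h
  refine HasDerivAt.add ?_ (HasDerivAt.fun_sum fun i _ => (hasDerivAt_pow i x).const_mul _)
  have := (hasDerivAt_pow (2 * P.h) x).div_const (2 * P.h : ℝ)
  convert! this using 1
  have : (P.h : ℝ) ≠ 0 := by positivity
  push_cast
  field_simp

theorem U_inv_mul {e : ℝ} (he : e ≠ 0) (x : ℝ) :
    P.U (e⁻¹ * x) = (e ^ (2 * P.h))⁻¹ * P.scaledU x e := by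
  unfold U scaledU
  rw [mul_add, mul_pow, inv_pow, mul_sum]
  congr 1
  · ring
  · refine sum_congr rfl fun i hi => ?_
    rw [Finset.mem_Ico] at hi
    have : e ^ (2 * P.h) = e ^ (2 * P.h - i) * e ^ i := by rw [← pow_add]; congr 1; omega
    rw [this, mul_pow, inv_pow]
    field_simp

theorem deriv_U_inv_mul {e : ℝ} (he : e ≠ 0) (x : ℝ) :
    deriv P.U (e⁻¹ * x) = (e ^ (2 * P.h - 1))⁻¹ * P.scaledForce x e := by
  have hh := P.two_le_h
  have h1 : P.U = fun z => (e ^ (2 * P.h))⁻¹ * P.scaledU (e * z) e := by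
    ext z
    rw [← P.U_inv_mul he, inv_mul_cancel_left₀ he]
  have h2 : HasDerivAt (fun z => e * z) e (e⁻¹ * x) := by
    simpa using (hasDerivAt_id (e⁻¹ * x)).const_mul e
  have h3 := ((P.hasDerivAt_scaledU (e * (e⁻¹ * x)) e).comp (e⁻¹ * x) h2).const_mul
    (e ^ (2 * P.h))⁻¹
  rw [h1]
  refine h3.deriv.trans ?_
  rw [mul_inv_cancel_left₀ he]
  have : e ^ (2 * P.h) = e ^ (2 * P.h - 1) * e := by rw [← pow_succ]; congr 1; omega
  rw [this]
  field_simp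

/-- The values of the small parameter for which the scaled potential has the shape of a well. -/
structure IsWell (e : ℝ) : Prop where
  pos : ∀ x, 1 / 2 ≤ x → 0 < P.scaledForce x e
  neg : ∀ x, x ≤ -(1 / 2) → P.scaledForce x e < 0
  mid : ∀ x, |x| ≤ 1 / 2 → |P.scaledU x e| ≤ 1 / 2
  right : 1 < P.scaledU 2 e
  left : 1 < P.scaledU (-2) e

theorem abs_scaledForce_sub_le {e x : ℝ} (he : |e| ≤ 1) (hx : 1 / 2 ≤ |x|) :
    |P.scaledForce x e - x ^ (2 * P.h - 1)| ≤
      |e| * (∑ i ∈ Finset.Ico 1 (2 * P.h), |P.u i| * i * 2 ^ (2 * P.h - i)) *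
        |x| ^ (2 * P.h - 1) := by
  rw [scaledForce_eq, add_sub_cancel_left, mul_sum, Finset.sum_mul]
  refine (Finset.abs_sum_le_sum_abs _ _).trans (Finset.sum_le_sum fun i hi => ?_)
  rw [Finset.mem_Ico] at hi
  rw [abs_mul, abs_mul, abs_mul, abs_pow, abs_pow, Nat.abs_cast]
  have h1 : |e| ^ (2 * P.h - i) ≤ |e| := by
    have : |e| ^ (2 * P.h - i) ≤ |e| ^ 1 :=
      pow_le_pow_of_le_one (abs_nonneg e) he (by omega)
    simpa using this
  have h2 : |x| ^ (i - 1) ≤ 2 ^ (2 * P.h - i) * |x| ^ (2 * P.h - 1) := by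
    have : 2 * P.h - 1 = (2 * P.h - i) + (i - 1) := by omega
    rw [this, pow_add, ← mul_assoc, ← mul_pow]
    refine le_mul_of_one_le_left (by positivity) (one_le_pow₀ (by linarith))
  calc |P.u i| * |e| ^ (2 * P.h - i) * (i * |x| ^ (i - 1))
      ≤ |P.u i| * |e| * (i * (2 ^ (2 * P.h - i) * |x| ^ (2 * P.h - 1))) := by gcongr
    _ = _ := by ring

theorem abs_scaledU_sub_le {e x : ℝ} (he : |e| ≤ 1) (hx : |x| ≤ 2) :
    |P.scaledU x e - x ^ (2 * P.h) / (2 * P.h)| ≤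
      |e| * ∑ i ∈ Finset.Ico 1 (2 * P.h), |P.u i| * 2 ^ i := by
  unfold scaledU
  rw [add_sub_cancel_left, mul_sum]
  refine (Finset.abs_sum_le_sum_abs _ _).trans (Finset.sum_le_sum fun i hi => ?_)
  rw [Finset.mem_Ico] at hi
  rw [abs_mul, abs_mul, abs_pow, abs_pow]
  have h1 : |e| ^ (2 * P.h - i) ≤ |e| := by
    have : |e| ^ (2 * P.h - i) ≤ |e| ^ 1 :=
      pow_le_pow_of_le_one (abs_nonneg e) he (by omega)
    simpa using this
  calc |P.u i| * |e| ^ (2 * P.h - i) * |x| ^ i ≤ |P.u i| * |e| * 2 ^ i := by gcongr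
    _ = _ := by ring

theorem exists_isWell : ∃ e₀ > 0, e₀ ≤ 1 ∧ ∀ e, |e| < e₀ → P.IsWell e := by
  have hh := P.two_le_h
  set C₁ := ∑ i ∈ Finset.Ico 1 (2 * P.h), |P.u i| * i * 2 ^ (2 * P.h - i) with hC₁
  set C₂ := ∑ i ∈ Finset.Ico 1 (2 * P.h), |P.u i| * 2 ^ i with hC₂
  have h1 : 0 ≤ C₁ := by positivity
  have h2 : 0 ≤ C₂ := by positivity
  refine ⟨1 / (4 * (1 + C₁ + C₂)), by positivity, ?_, fun e he => ?_⟩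
  · rw [div_le_one (by positivity)]; linarith
  rw [lt_div_iff₀ (by positivity)] at he
  have he1 : |e| ≤ 1 := by nlinarith [abs_nonneg e]
  have hb1 : |e| * C₁ ≤ 1 / 2 := by nlinarith [abs_nonneg e]
  have hb2 : |e| * C₂ ≤ 1 / 4 := by nlinarith [abs_nonneg e]
  have hodd : Odd (2 * P.h - 1) := ⟨P.h - 1, by omega⟩
  have heven : Even (2 * P.h) := ⟨P.h, by omega⟩
  have hpow : (2 : ℝ) ≤ (2 : ℝ) ^ (2 * P.h) / (2 * P.h) := by
    rw [le_div_iff₀ (by positivity), pow_mul]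
    have : ∀ k : ℕ, (2 * (2 * ((k + 1 : ℕ) : ℝ))) ≤ (2 ^ 2) ^ (k + 1) := by
      intro k
      induction k with
      | zero => norm_num
      | succ k ih => rw [pow_succ]; push_cast at ih ⊢; nlinarith
    obtain ⟨k, hk⟩ : ∃ k, P.h = k + 1 := ⟨P.h - 1, by omega⟩
    rw [hk]; exact this k
  have hforce : ∀ x : ℝ, 1 / 2 ≤ |x| →
      |P.scaledForce x e - x ^ (2 * P.h - 1)| < |x| ^ (2 * P.h - 1) := fun x hx => by
    refine (P.abs_scaledForce_sub_le he1 hx).trans_lt ?_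
    have : 0 < |x| ^ (2 * P.h - 1) := pow_pos (by linarith) _
    nlinarith
  refine ⟨fun x hx => ?_, fun x hx => ?_, fun x hx => ?_, ?_, ?_⟩
  · have := hforce x (by rw [abs_of_nonneg (by linarith)]; exact hx)
    rw [abs_of_nonneg (by linarith : 0 ≤ x)] at this
    linarith [(abs_lt.1 this).1]
  · have := hforce x (by rw [abs_of_nonpos (by linarith)]; linarith)
    rw [abs_of_nonpos (by linarith : x ≤ 0), hodd.neg_pow] at this
    linarith [(abs_lt.1 this).2]
  · have := P.abs_scaledU_sub_le he1 (hx.trans (by norm_num))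
    have h3 : |x ^ (2 * P.h) / (2 * P.h)| ≤ 1 / 4 := by
      rw [abs_div, abs_pow, abs_of_nonneg (by positivity : (0 : ℝ) ≤ 2 * P.h)]
      have h4 : |x| ^ (2 * P.h) ≤ 1 := pow_le_one₀ (abs_nonneg x) (by linarith)
      have h5 : (2 : ℝ) ≤ P.h := by exact_mod_cast hh
      rw [div_le_iff₀ (by positivity)]
      linarith
    have h6 := abs_sub_abs_le_abs_sub (P.scaledU x e) (x ^ (2 * P.h) / (2 * P.h))
    linarith
  · have := P.abs_scaledU_sub_le (x := 2) he1 (by simp)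
    linarith [(abs_le.1 this).1]
  · have := P.abs_scaledU_sub_le (x := -2) he1 (by simp)
    rw [heven.neg_pow] at this
    linarith [(abs_le.1 this).1]

section
variable {P} {e : ℝ} (hw : P.IsWell e)
include hw

theorem IsWell.strictMonoOn : StrictMonoOn (fun x => P.scaledU x e) (Ici (1 / 2)) := by
  refine strictMonoOn_of_deriv_pos (convex_Ici _)
    (fun x _ => (P.hasDerivAt_scaledU x e).continuousAt.continuousWithinAt) fun x hx => ?_
  rw [interior_Ici] at hx
  rw [(P.hasDerivAt_scaledU x e).deriv]
  exact hw.pos x (le_of_lt hx)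

theorem IsWell.strictAntiOn : StrictAntiOn (fun x => P.scaledU x e) (Iic (-(1 / 2))) := by
  refine strictAntiOn_of_deriv_neg (convex_Iic _)
    (fun x _ => (P.hasDerivAt_scaledU x e).continuousAt.continuousWithinAt) fun x hx => ?_
  rw [interior_Iic] at hx
  rw [(P.hasDerivAt_scaledU x e).deriv]
  exact hw.neg x (le_of_lt hx)

theorem IsWell.exists_root_right : ∃ x, 1 / 2 < x ∧ x < 2 ∧ P.scaledU x e = 1 := by
  have hc : ContinuousOn (fun x => P.scaledU x e) (Icc (1 / 2) 2) :=
    fun x _ => (P.hasDerivAt_scaledU x e).continuousAt.continuousWithinAt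
  have h1 : P.scaledU (1 / 2) e ≤ 1 / 2 := (le_abs_self _).trans (hw.mid _ (by norm_num))
  obtain ⟨x, hx, hx1⟩ := intermediate_value_Ioo (by norm_num) hc
    (show (1 : ℝ) ∈ Ioo _ _ from ⟨by linarith, hw.right⟩)
  exact ⟨x, hx.1, hx.2, hx1⟩

theorem IsWell.exists_root_left : ∃ x, -2 < x ∧ x < -(1 / 2) ∧ P.scaledU x e = 1 := by
  have hc : ContinuousOn (fun x => P.scaledU x e) (Icc (-2) (-(1 / 2))) :=
    fun x _ => (P.hasDerivAt_scaledU x e).continuousAt.continuousWithinAt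
  have h1 : P.scaledU (-(1 / 2)) e ≤ 1 / 2 := (le_abs_self _).trans (hw.mid _ (by norm_num))
  obtain ⟨x, hx, hx1⟩ := intermediate_value_Ioo' (by norm_num) hc
    (show (1 : ℝ) ∈ Ioo _ _ from ⟨by linarith, hw.left⟩)
  exact ⟨x, hx.1, hx.2, hx1⟩

theorem IsWell.neg_half_le (x : ℝ) : -(1 / 2) ≤ P.scaledU x e := by
  rcases le_total |x| (1 / 2) with h | h
  · exact (abs_le.1 (hw.mid x h)).1
  rcases le_abs'.1 h with h | h
  · have := hw.strictAntiOn.antitoneOn (a := x) (b := -(1 / 2)) h (Set.mem_Iic.2 le_rfl) h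
    exact (abs_le.1 (hw.mid (-(1 / 2)) (by norm_num))).1.trans this
  · have := hw.strictMonoOn.monotoneOn (a := 1 / 2) (b := x) (mem_Ici.2 le_rfl) h h
    exact (abs_le.1 (hw.mid (1 / 2) (by norm_num))).1.trans this

end

/-- The right turning point of the scaled level line. -/
def rightEnd (e : ℝ) : ℝ := sSup {x | P.scaledU x e = 1}

/-- The left turning point of the scaled level line. -/
def leftEnd (e : ℝ) : ℝ := sInf {x | P.scaledU x e = 1}

section
variable {P} {e : ℝ} (hw : P.IsWell e)
include hw

theorem IsWell.half_lt_abs {x : ℝ} (hx : P.scaledU x e = 1) : 1 / 2 < |x| := by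
  by_contra! h
  have := (le_abs_self _).trans (hw.mid x h)
  linarith

theorem IsWell.isGreatest_rightEnd : IsGreatest {x | P.scaledU x e = 1} (P.rightEnd e) := by
  obtain ⟨x, h1, h2, h3⟩ := hw.exists_root_right
  have : IsGreatest {x | P.scaledU x e = 1} x := by
    refine ⟨h3, fun z hz => ?_⟩
    by_contra! hxz
    have := hw.strictMonoOn (mem_Ici.2 h1.le) (mem_Ici.2 (h1.trans hxz).le) hxz
    simp only [h3] at this
    exact this.ne' hz
  rw [rightEnd, this.csSup_eq]; exact this

theorem IsWell.isLeast_leftEnd : IsLeast {x | P.scaledU x e = 1} (P.leftEnd e) := by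
  obtain ⟨x, h1, h2, h3⟩ := hw.exists_root_left
  have : IsLeast {x | P.scaledU x e = 1} x := by
    refine ⟨h3, fun z hz => ?_⟩
    by_contra! hxz
    have := hw.strictAntiOn (Set.mem_Iic.2 (hxz.trans h2).le) (Set.mem_Iic.2 h2.le) hxz
    simp only [h3] at this
    exact this.ne' hz
  rw [leftEnd, this.csInf_eq]; exact this

theorem IsWell.half_lt_rightEnd : 1 / 2 < P.rightEnd e := by
  obtain ⟨x, h1, h2, h3⟩ := hw.exists_root_right
  exact h1.trans_le (hw.isGreatest_rightEnd.2 h3)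

theorem IsWell.leftEnd_lt : P.leftEnd e < -(1 / 2) := by
  obtain ⟨x, h1, h2, h3⟩ := hw.exists_root_left
  exact (hw.isLeast_leftEnd.2 h3).trans_lt h2

theorem IsWell.eq_rightEnd {x : ℝ} (hx : 0 < x) (h : P.scaledU x e = 1) : x = P.rightEnd e := by
  have h1 := hw.half_lt_abs h
  rw [abs_of_pos hx] at h1
  exact hw.strictMonoOn.injOn (mem_Ici.2 h1.le) (mem_Ici.2 hw.half_lt_rightEnd.le)
    (h.trans hw.isGreatest_rightEnd.1.symm)

theorem IsWell.eq_leftEnd {x : ℝ} (hx : x < 0) (h : P.scaledU x e = 1) : x = P.leftEnd e := by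
  have h1 := hw.half_lt_abs h
  rw [abs_of_neg hx] at h1
  exact hw.strictAntiOn.injOn (Set.mem_Iic.2 (by linarith)) (Set.mem_Iic.2 hw.leftEnd_lt.le)
    (h.trans hw.isLeast_leftEnd.1.symm)

theorem IsWell.rightEnd_lt : P.rightEnd e < 2 := by
  obtain ⟨x, h1, h2, h3⟩ := hw.exists_root_right
  rwa [← hw.eq_rightEnd (by linarith) h3]

theorem IsWell.lt_leftEnd : -2 < P.leftEnd e := by
  obtain ⟨x, h1, h2, h3⟩ := hw.exists_root_left
  rwa [← hw.eq_leftEnd (by linarith) h3]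

theorem IsWell.mem_Icc {x : ℝ} (hx : P.scaledU x e ≤ 1) :
    x ∈ Icc (P.leftEnd e) (P.rightEnd e) := by
  have h1 := hw.half_lt_rightEnd
  have h2 := hw.leftEnd_lt
  constructor <;> by_contra! h
  · have := hw.strictAntiOn (Set.mem_Iic.2 (by linarith)) (Set.mem_Iic.2 h2.le) h
    have h3 : P.scaledU (P.leftEnd e) e = 1 := hw.isLeast_leftEnd.1
    simp only [h3] at this
    linarith
  · have := hw.strictMonoOn (mem_Ici.2 h1.le) (mem_Ici.2 (by linarith)) h
    have h3 : P.scaledU (P.rightEnd e) e = 1 := hw.isGreatest_rightEnd.1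
    simp only [h3] at this
    linarith

end

theorem contDiffAt_rightEnd {e₀ : ℝ} (hw : ∀ᶠ e in 𝓝 e₀, P.IsWell e) :
    ContDiffAt ℝ ∞ P.rightEnd e₀ := by
  have hw0 := hw.self_of_nhds
  obtain ⟨ψ, h1, h2, h3⟩ := exists_contDiffAt_implicit (p₀ := e₀) (x₀ := P.rightEnd e₀)
    (F := fun q : ℝ × ℝ => P.scaledU q.2 q.1 - 1) (d := P.scaledForce (P.rightEnd e₀) e₀)
    ((P.contDiff_scaledU.comp (f := fun q : ℝ × ℝ => (q.2, q.1)) (by fun_prop)).contDiffAt.sub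
      contDiffAt_const)
    ((P.hasDerivAt_scaledU _ e₀).sub_const 1) (hw0.pos _ hw0.half_lt_rightEnd.le).ne'
    (by have : P.scaledU (P.rightEnd e₀) e₀ = 1 := hw0.isGreatest_rightEnd.1
        simp [this])
  refine h1.congr_of_eventuallyEq ?_
  have hpos : ∀ᶠ e in 𝓝 e₀, 0 < ψ e := by
    refine h1.continuousAt.eventually (lt_mem_nhds ?_)
    rw [h2]; linarith [hw0.half_lt_rightEnd]
  filter_upwards [hw, h3, hpos] with e he h3 hpos
  exact (he.eq_rightEnd hpos (by linarith)).symm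

end ChirpedSystem

theorem not_bddBelow_of_deriv_le {f f' : ℝ → ℝ} {a c B : ℝ} (hc : 0 < c)
    (hf : ∀ t, a ≤ t → HasDerivAt f (f' t) t) (hf' : ∀ t, a ≤ t → f' t ≤ -c)
    (hB : ∀ t, a ≤ t → B ≤ f t) : False := by
  have h1 : ∀ t, a ≤ t → f t - f a ≤ -c * (t - a) := fun t ht =>
    (convex_Ici a).image_sub_le_mul_sub_of_deriv_le
      (fun s hs => (hf s hs).continuousAt.continuousWithinAt)
      (fun s hs => (hf s (interior_subset hs)).differentiableAt.differentiableWithinAt)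
      (fun s hs => by
        rw [(hf s (interior_subset hs)).deriv]
        exact hf' s (interior_subset hs)) a (mem_Ici.2 le_rfl) t ht ht
  have h2 := hB a le_rfl
  have h3 : a ≤ a + (f a - B + 1) / c := by
    have : 0 ≤ (f a - B + 1) / c := by apply div_nonneg <;> linarith
    linarith
  have h4 := h1 _ h3
  have h5 := hB _ h3
  have h6 : -c * (a + (f a - B + 1) / c - a) = -(f a - B + 1) := by field_simp; ring
  linarith

namespace ChirpedSystem

variable (P : ChirpedSystem)

/-! ### The scaled orbits -/

/-- The scaled Hamiltonian field. -/
def scaledField (e : ℝ) (z : ℝ × ℝ) : ℝ × ℝ := (z.2, -P.scaledForce z.1 e)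

theorem contDiff_scaledField (e : ℝ) : ContDiff ℝ 1 (P.scaledField e) := by
  have : ContDiff ℝ 1 fun z : ℝ × ℝ => P.scaledForce z.1 e :=
    (P.contDiff_scaledForce.of_le (by exact_mod_cast le_top)).comp
      (f := fun z : ℝ × ℝ => (z.1, e)) (by fun_prop)
  unfold scaledField
  fun_prop

theorem energy_hasDerivWithinAt {e : ℝ} {γ : ℝ → ℝ × ℝ} {s : Set ℝ} {t : ℝ}
    (h : HasDerivWithinAt γ (P.scaledField e (γ t)) s t) :
    HasDerivWithinAt (fun t => (γ t).2 ^ 2 / 2 + P.scaledU (γ t).1 e) 0 s t := by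
  have h1 : HasDerivWithinAt (fun t => (γ t).1) (γ t).2 s t :=
    HasFDerivAt.comp_hasDerivWithinAt t (f := γ) (hasFDerivAt_fst (𝕜 := ℝ) (E := ℝ) (F := ℝ) (p := γ t)) h
  have h2 : HasDerivWithinAt (fun t => (γ t).2) (-P.scaledForce (γ t).1 e) s t :=
    HasFDerivAt.comp_hasDerivWithinAt t (f := γ) (hasFDerivAt_snd (𝕜 := ℝ) (E := ℝ) (F := ℝ) (p := γ t)) h
  have h3 := ((h2.pow 2).div_const 2).add
    ((P.hasDerivAt_scaledU (γ t).1 e).comp_hasDerivWithinAt t h1)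
  refine h3.congr_deriv ?_
  simp
  ring

/-- `γ` is the solution of the scaled system that starts at the right turning point. -/
def IsScaledOrbit (e : ℝ) (γ : ℝ → ℝ × ℝ) : Prop :=
  γ 0 = (P.rightEnd e, 0) ∧ ∀ t, HasDerivAt γ (P.scaledField e (γ t)) t

theorem reflect_hasDerivAt {e : ℝ} {γ : ℝ → ℝ × ℝ} {T t : ℝ}
    (h : HasDerivAt γ (P.scaledField e (γ (T - t))) (T - t)) :
    HasDerivAt (fun t => ((γ (T - t)).1, -(γ (T - t)).2))
      (P.scaledField e ((γ (T - t)).1, -(γ (T - t)).2)) t := by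
  have hs : HasDerivAt (fun t : ℝ => T - t) (-1) t := by
    simpa using (hasDerivAt_id t).const_sub T
  have h0 : HasDerivAt (fun t => γ (T - t)) ((-1 : ℝ) • P.scaledField e (γ (T - t))) t :=
    HasDerivAt.scomp t h hs
  have h1 : HasDerivAt (fun t => (γ (T - t)).1) _ t := hasFDerivAt_fst.comp_hasDerivAt t h0
  have h2 : HasDerivAt (fun t => (γ (T - t)).2) _ t := hasFDerivAt_snd.comp_hasDerivAt t h0
  have h3 := h1.prodMk h2.neg
  convert! h3 using 1
  simp [scaledField]

theorem IsWell.exists_orbit {P : ChirpedSystem} {e : ℝ} (hw : P.IsWell e) :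
    ∃ γ, P.IsScaledOrbit e γ := by
  set K : Set (ℝ × ℝ) := Icc (-3) 3 ×ˢ Icc (-3) 3 with hK
  have h33 : (-3 : ℝ) ≤ 3 := by norm_num
  set π : ℝ × ℝ → ℝ × ℝ := fun z => (projIcc (-3) 3 h33 z.1, projIcc (-3) 3 h33 z.2) with hπ
  have hKc : IsCompact K := isCompact_Icc.prod isCompact_Icc
  have hv := P.contDiff_scaledField e
  have hprojlip : LipschitzWith 1 fun x : ℝ => (projIcc (-3) 3 h33 x : ℝ) := by
    have := (LipschitzWith.subtype_val (Icc (-3 : ℝ) 3)).comp (LipschitzWith.projIcc h33)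
    rwa [one_mul] at this
  have hstart : P.scaledU (P.rightEnd e) e = 1 := hw.isGreatest_rightEnd.1
  obtain ⟨α, hα0, hα⟩ := exists_global_solution_of_apriori (v := fun _ => P.scaledField e) (a := 0)
    (p := (P.rightEnd e, 0)) (K := K) (π := π) hKc
    (by
      have h1 := (hprojlip.comp LipschitzWith.prod_fst).prodMk
        (hprojlip.comp (LipschitzWith.prod_snd (α := ℝ) (β := ℝ)))
      simpa using h1)
    (fun z => ⟨Subtype.coe_prop _, Subtype.coe_prop _⟩)
    (fun z hz => Prod.ext (by simp [hπ, Set.projIcc_of_mem h33 hz.1])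
      (by simp [hπ, Set.projIcc_of_mem h33 hz.2]))
    (fun T _ => by
      obtain ⟨C, hC⟩ := exists_lipschitzOnWith_of_contDiff hv hKc
      exact ⟨C, fun _ _ => hC⟩)
    ((hv.continuous.comp continuous_snd).continuousOn)
    (fun α hα0 T hT hαc hα => by
      have hconst := constant_of_has_deriv_right_zero (a := 0) (b := T)
        (f := fun t => (α t).2 ^ 2 / 2 + P.scaledU (α t).1 e)
        (by
          have : Continuous fun x => P.scaledU x e :=
            continuous_iff_continuousAt.2 fun x => (P.hasDerivAt_scaledU x e).continuousAt
          exact ((hαc.snd.pow 2).div_const 2).add (this.comp_continuousOn hαc.fst))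
        (fun t ht => ((P.energy_hasDerivWithinAt (hα t ht.1 ht.2).2).mono
          (Set.Ici_subset_Ici.2 ht.1)))
        T ⟨hT, le_rfl⟩
      simp only [hα0, hstart] at hconst
      have h1 : P.scaledU (α T).1 e ≤ 1 := by nlinarith [sq_nonneg (α T).2]
      have h2 := hw.mem_Icc h1
      have h3 := hw.neg_half_le (α T).1
      have h4 : (α T).2 ^ 2 < 3 ^ 2 := by nlinarith
      have h5 := abs_lt.1 (abs_lt_of_sq_lt_sq h4 (by norm_num))
      rw [hK, interior_prod_eq, interior_Icc]
      exact ⟨⟨by linarith [hw.lt_leftEnd, h2.1], by linarith [hw.rightEnd_lt, h2.2]⟩, h5⟩)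
  have hpos : ∀ t, 0 < t → HasDerivAt α (P.scaledField e (α t)) t := fun t ht =>
    (hα t ht.le).2.hasDerivAt (Ici_mem_nhds ht)
  refine ⟨fun t => if 0 ≤ t then α t else ((α (0 - t)).1, -(α (0 - t)).2), by simp [hα0],
    fun t => ?_⟩
  rcases lt_trichotomy t 0 with ht | rfl | ht
  · have h1 := P.reflect_hasDerivAt (T := 0) (hpos (0 - t) (by linarith))
    simp only [not_le.2 ht, if_false]
    refine h1.congr_of_eventuallyEq ?_
    filter_upwards [gt_mem_nhds ht] with s hs
    simp [not_le.2 hs]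
  · simp only [le_refl, if_true]
    have h1 : HasDerivWithinAt α (P.scaledField e (α 0)) (Ici 0) 0 := (hα 0 le_rfl).2
    have h2 : HasDerivWithinAt (fun t => ((α (0 - t)).1, -(α (0 - t)).2))
        (P.scaledField e (α 0)) (Iic 0) 0 := by
      have hs : HasDerivWithinAt (fun t : ℝ => 0 - t) (-1) (Iic 0) 0 := by
        simpa using ((hasDerivAt_id (0 : ℝ)).const_sub 0).hasDerivWithinAt
      have hm : Set.MapsTo (fun t : ℝ => 0 - t) (Iic 0) (Ici 0) := fun t ht => by
        simpa using ht
      have h10 : HasDerivWithinAt α (P.scaledField e (α 0)) (Ici 0) (0 - 0) := by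
        simpa using h1
      have h0 : HasDerivWithinAt (fun t => α (0 - t)) ((-1 : ℝ) • P.scaledField e (α 0))
        (Iic 0) 0 := HasDerivWithinAt.scomp (0 : ℝ) h10 hs hm
      have h3 : HasDerivWithinAt (fun t => (α (0 - t)).1) _ (Iic 0) 0 :=
        hasFDerivAt_fst.comp_hasDerivWithinAt 0 h0
      have h4 : HasDerivWithinAt (fun t => (α (0 - t)).2) _ (Iic 0) 0 :=
        hasFDerivAt_snd.comp_hasDerivWithinAt 0 h0
      have h5 := h3.prodMk h4.neg
      convert! h5 using 1
      simp [scaledField, hα0]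
    rw [← hasDerivWithinAt_univ, ← Set.Ici_union_Iic (a := (0 : ℝ))]
    refine HasDerivWithinAt.union (h1.congr (fun t ht => ?_) ?_) (h2.congr (fun t ht => ?_) ?_)
    · simp [mem_Ici.1 ht]
    · simp
    · rcases eq_or_lt_of_le (Set.mem_Iic.1 ht) with rfl | ht
      · simp [hα0]
      · simp [not_le.2 ht]
    · simp [hα0]
  · simp only [ht.le, if_true]
    refine (hpos t ht).congr_of_eventuallyEq ?_
    filter_upwards [lt_mem_nhds ht] with s hs
    simp [le_of_lt hs]

/-- The scaled orbit. -/
def scaledOrbit (e : ℝ) : ℝ → ℝ × ℝ := Classical.epsilon (P.IsScaledOrbit e)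

/-- The first return to the axis `y = 0`. -/
def halfPeriod (e : ℝ) : ℝ := sInf {t | 0 < t ∧ (P.scaledOrbit e t).2 = 0}

section
variable {P} {e : ℝ} (hw : P.IsWell e)
include hw

theorem IsWell.isScaledOrbit : P.IsScaledOrbit e (P.scaledOrbit e) :=
  Classical.epsilon_spec hw.exists_orbit

theorem IsWell.hasDerivAt_fst (t : ℝ) :
    HasDerivAt (fun t => (P.scaledOrbit e t).1) (P.scaledOrbit e t).2 t :=
  HasFDerivAt.comp_hasDerivAt t (f := P.scaledOrbit e)
    (hasFDerivAt_fst (𝕜 := ℝ) (E := ℝ) (F := ℝ) (p := P.scaledOrbit e t)) (hw.isScaledOrbit.2 t)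

theorem IsWell.hasDerivAt_snd (t : ℝ) :
    HasDerivAt (fun t => (P.scaledOrbit e t).2) (-P.scaledForce (P.scaledOrbit e t).1 e) t :=
  HasFDerivAt.comp_hasDerivAt t (f := P.scaledOrbit e)
    (hasFDerivAt_snd (𝕜 := ℝ) (E := ℝ) (F := ℝ) (p := P.scaledOrbit e t)) (hw.isScaledOrbit.2 t)

theorem IsWell.continuous_fst : Continuous fun t => (P.scaledOrbit e t).1 :=
  continuous_iff_continuousAt.2 fun t => (hw.hasDerivAt_fst t).continuousAt

theorem IsWell.continuous_snd : Continuous fun t => (P.scaledOrbit e t).2 :=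
  continuous_iff_continuousAt.2 fun t => (hw.hasDerivAt_snd t).continuousAt

theorem IsWell.energy_eq (t : ℝ) :
    (P.scaledOrbit e t).2 ^ 2 / 2 + P.scaledU (P.scaledOrbit e t).1 e = 1 := by
  have h1 : ∀ t, HasDerivAt
      (fun t => (P.scaledOrbit e t).2 ^ 2 / 2 + P.scaledU (P.scaledOrbit e t).1 e) 0 t := fun t =>
    hasDerivWithinAt_univ.1 (P.energy_hasDerivWithinAt (hw.isScaledOrbit.2 t).hasDerivWithinAt)
  have h2 := is_const_of_deriv_eq_zero (fun t => (h1 t).differentiableAt) (fun t => (h1 t).deriv) t 0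
  have h3 : P.scaledU (P.rightEnd e) e = 1 := hw.isGreatest_rightEnd.1
  simpa [hw.isScaledOrbit.1, h3] using h2

theorem IsWell.fst_mem (t : ℝ) : (P.scaledOrbit e t).1 ∈ Icc (P.leftEnd e) (P.rightEnd e) :=
  hw.mem_Icc (by nlinarith [hw.energy_eq t, sq_nonneg (P.scaledOrbit e t).2])

theorem IsWell.abs_snd_lt (t : ℝ) : |(P.scaledOrbit e t).2| < 2 := by
  refine abs_lt_of_sq_lt_sq ?_ (by norm_num)
  nlinarith [hw.energy_eq t, hw.neg_half_le (P.scaledOrbit e t).1]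

theorem IsWell.orbit_reflect {T : ℝ} (hT : (P.scaledOrbit e T).2 = 0) (s : ℝ) :
    P.scaledOrbit e (T + s) = ((P.scaledOrbit e (T - s)).1, -(P.scaledOrbit e (T - s)).2) := by
  have h1 : ∀ s, HasDerivAt (fun s => P.scaledOrbit e (T + s))
      (P.scaledField e (P.scaledOrbit e (T + s))) s := fun s => by
    have := (hw.isScaledOrbit.2 (T + s)).scomp s ((hasDerivAt_id s).const_add T)
    simpa [Function.comp_def] using this
  have h2 := fun s => P.reflect_hasDerivAt (hw.isScaledOrbit.2 (T - s))
  refine congrFun (ode_unique (P.contDiff_scaledField e) 0 h1 h2 ?_) s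
  ext <;> simp [hT]

theorem IsWell.orbit_neg (s : ℝ) :
    P.scaledOrbit e (-s) = ((P.scaledOrbit e s).1, -(P.scaledOrbit e s).2) := by
  have := hw.orbit_reflect (T := 0) (by rw [hw.isScaledOrbit.1]) (-s)
  simpa using this

theorem IsWell.snd_neg_near_zero : ∃ δ > 0, ∀ t, 0 < t → t < δ → (P.scaledOrbit e t).2 < 0 := by
  have h1 := hw.hasDerivAt_snd 0
  rw [hw.isScaledOrbit.1] at h1
  have h2 : -P.scaledForce (P.rightEnd e) e < 0 := by
    linarith [hw.pos _ hw.half_lt_rightEnd.le]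
  have h3 := (hasDerivWithinAt_iff_tendsto_slope' (s := Set.Ioi (0 : ℝ)) (by simp)).1
    h1.hasDerivWithinAt
  have h4 := h3.eventually (gt_mem_nhds h2)
  rw [eventually_nhdsWithin_iff, Metric.eventually_nhds_iff] at h4
  obtain ⟨δ, hδ, h5⟩ := h4
  refine ⟨δ, hδ, fun t ht htδ => ?_⟩
  have h6 := h5 (y := t) (by rwa [Real.dist_eq, sub_zero, abs_of_pos ht]) ht
  rw [slope_def_field, hw.isScaledOrbit.1, sub_zero, sub_zero] at h6
  by_contra! h7
  exact absurd h6 (not_lt.2 (div_nonneg h7 ht.le))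

theorem IsWell.exists_zero : ∃ t, 0 < t ∧ (P.scaledOrbit e t).2 = 0 := by
  by_contra! hno
  obtain ⟨δ, hδ, hneg0⟩ := hw.snd_neg_near_zero
  have hneg : ∀ t, 0 < t → (P.scaledOrbit e t).2 < 0 := by
    intro t ht
    by_contra! h
    have hm : 0 < min (δ / 2) t := lt_min (by linarith) ht
    have h1 := hneg0 (min (δ / 2) t) hm (by linarith [min_le_left (δ / 2) t])
    obtain ⟨s, hs, hs0⟩ := intermediate_value_Icc (min_le_right (δ / 2) t)
      hw.continuous_snd.continuousOn (show (0 : ℝ) ∈ Icc _ _ from ⟨h1.le, h⟩)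
    exact hno s (hm.trans_le hs.1) hs0
  have hanti : StrictAntiOn (fun t => (P.scaledOrbit e t).1) (Ici 0) :=
    strictAntiOn_of_deriv_neg (convex_Ici 0) hw.continuous_fst.continuousOn fun t ht => by
      rw [interior_Ici] at ht
      rw [(hw.hasDerivAt_fst t).deriv]
      exact hneg t ht
  have hcW : Continuous fun x => P.scaledForce x e :=
    P.contDiff_scaledForce.continuous.comp (by fun_prop : Continuous fun x : ℝ => (x, e))
  obtain ⟨z, hz, hzmin⟩ := isCompact_Icc.exists_isMinOn
    (show (Icc (1 / 2 : ℝ) 2).Nonempty from ⟨1, by norm_num, by norm_num⟩) hcW.continuousOn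
  obtain ⟨z', hz', hzmax⟩ := isCompact_Icc.exists_isMaxOn
    (show (Icc (-2 : ℝ) (-(1 / 2))).Nonempty from ⟨-1, by norm_num, by norm_num⟩)
    hcW.continuousOn
  have hmem := hw.fst_mem
  have hl := hw.lt_leftEnd
  have hr := hw.rightEnd_lt
  have hy := fun t => abs_lt.1 (hw.abs_snd_lt t)
  have s1 : ∃ t, 0 ≤ t ∧ (P.scaledOrbit e t).1 < 1 / 2 := by
    by_contra! h
    refine not_bddBelow_of_deriv_le (a := 0) (B := -2) (hw.pos z hz.1)
      (fun t _ => hw.hasDerivAt_snd t) (fun t ht => ?_) fun t ht => (hy t).1.le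
    have := hzmin ⟨h t ht, by linarith [(hmem t).2]⟩
    simp only [Set.mem_ofPred_eq] at this
    linarith
  obtain ⟨t₁, ht₁, hx₁⟩ := s1
  have s2 : ∃ t, t₁ ≤ t ∧ (P.scaledOrbit e t).1 < -(1 / 2) := by
    by_contra! h
    refine not_bddBelow_of_deriv_le (a := t₁ + 1) (B := -2) one_pos
      (fun t _ => hw.hasDerivAt_fst t) (fun t ht => ?_) fun t ht => by linarith [(hmem t).1]
    have h1 := h t (by linarith)
    have h2 := hanti.antitoneOn (mem_Ici.2 ht₁) (mem_Ici.2 (by linarith : 0 ≤ t))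
      (by linarith : t₁ ≤ t)
    have h3 := hw.mid (P.scaledOrbit e t).1 (abs_le.2 ⟨h1, h2.trans hx₁.le⟩)
    have h4 := hw.energy_eq t
    have h5 := hneg t (by linarith)
    nlinarith [(abs_le.1 h3).2]
  obtain ⟨t₂, ht₂, hx₂⟩ := s2
  have hz'neg := hw.neg z' hz'.2
  refine not_bddBelow_of_deriv_le (a := t₂) (B := -2) (f := fun t => -(P.scaledOrbit e t).2)
    (c := -P.scaledForce z' e) (by linarith)
    (fun t _ => (hw.hasDerivAt_snd t).neg) (fun t ht => ?_) fun t ht => by linarith [(hy t).2]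
  have h2 := hanti.antitoneOn (mem_Ici.2 (ht₁.trans ht₂))
    (mem_Ici.2 (by linarith : 0 ≤ t)) ht
  have h3 := hzmax (a := (P.scaledOrbit e t).1) ⟨by linarith [(hmem t).1], h2.trans hx₂.le⟩
  simp only [Set.mem_ofPred_eq] at h3
  linarith

theorem IsWell.halfPeriod_spec : 0 < P.halfPeriod e ∧ (P.scaledOrbit e (P.halfPeriod e)).2 = 0 ∧
    ∀ t, 0 < t → t < P.halfPeriod e → (P.scaledOrbit e t).2 < 0 := by
  obtain ⟨δ, hδ, hneg0⟩ := hw.snd_neg_near_zero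
  set Z := {t | 0 < t ∧ (P.scaledOrbit e t).2 = 0} with hZ
  have hZδ : Z = {t | δ ≤ t ∧ (P.scaledOrbit e t).2 = 0} := by
    ext t
    constructor
    · rintro ⟨h1, h2⟩
      refine ⟨?_, h2⟩
      by_contra! h
      exact absurd h2 (hneg0 t h1 h).ne
    · rintro ⟨h1, h2⟩
      exact ⟨hδ.trans_le h1, h2⟩
  have hcl : IsClosed Z := by
    rw [hZδ]
    exact isClosed_Ici.inter (isClosed_eq hw.continuous_snd continuous_const)
  have hbd : BddBelow Z := ⟨0, fun t ht => ht.1.le⟩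
  have hmem : P.halfPeriod e ∈ Z := hcl.csInf_mem hw.exists_zero hbd
  refine ⟨hmem.1, hmem.2, fun t ht htT => ?_⟩
  by_contra! h
  have hm : 0 < min (δ / 2) t := lt_min (by linarith) ht
  have h1 := hneg0 (min (δ / 2) t) hm (by linarith [min_le_left (δ / 2) t])
  obtain ⟨s, hs, hs0⟩ := intermediate_value_Icc (min_le_right (δ / 2) t)
    hw.continuous_snd.continuousOn (show (0 : ℝ) ∈ Icc _ _ from ⟨h1.le, h⟩)
  have : P.halfPeriod e ≤ s := csInf_le hbd ⟨hm.trans_le hs.1, hs0⟩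
  linarith [hs.2]

theorem IsWell.orbit_periodic (s : ℝ) :
    P.scaledOrbit e (s + 2 * P.halfPeriod e) = P.scaledOrbit e s := by
  have h1 := hw.orbit_reflect hw.halfPeriod_spec.2.1 (P.halfPeriod e + s)
  have h2 : P.halfPeriod e + (P.halfPeriod e + s) = s + 2 * P.halfPeriod e := by ring
  have h3 : P.halfPeriod e - (P.halfPeriod e + s) = -s := by ring
  rw [h2, h3, hw.orbit_neg] at h1
  simpa using h1

theorem IsWell.strictAntiOn_fst :
    StrictAntiOn (fun t => (P.scaledOrbit e t).1) (Icc 0 (P.halfPeriod e)) :=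
  strictAntiOn_of_deriv_neg (convex_Icc _ _) hw.continuous_fst.continuousOn fun t ht => by
    rw [interior_Icc] at ht
    rw [(hw.hasDerivAt_fst t).deriv]
    exact hw.halfPeriod_spec.2.2 t ht.1 ht.2

theorem IsWell.fst_halfPeriod : (P.scaledOrbit e (P.halfPeriod e)).1 = P.leftEnd e := by
  have h1 := hw.energy_eq (P.halfPeriod e)
  have hsp := hw.halfPeriod_spec
  rw [hsp.2.1] at h1
  have h2 : P.scaledU (P.scaledOrbit e (P.halfPeriod e)).1 e = 1 := by linarith
  have h3 := hw.strictAntiOn_fst (Set.left_mem_Icc.2 hsp.1.le) (Set.right_mem_Icc.2 hsp.1.le) hsp.1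
  simp only [hw.isScaledOrbit.1] at h3
  rcases lt_trichotomy (P.scaledOrbit e (P.halfPeriod e)).1 0 with h | h | h
  · exact hw.eq_leftEnd h h2
  · have := hw.half_lt_abs h2
    rw [h] at this
    norm_num at this
  · exact absurd (hw.eq_rightEnd h h2) h3.ne

/-- The period integral. -/
theorem IsWell.integral_eq : ∫ x in P.leftEnd e..P.rightEnd e,
    Real.sqrt 2 / Real.sqrt (1 - P.scaledU x e) = 2 * P.halfPeriod e := by
  have hsp := hw.halfPeriod_spec
  have hanti := hw.strictAntiOn_fst
  have h0 : (P.scaledOrbit e 0).1 = P.rightEnd e := by rw [hw.isScaledOrbit.1]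
  have himg : (fun t => (P.scaledOrbit e t).1) '' Ioo 0 (P.halfPeriod e) =
      Ioo (P.leftEnd e) (P.rightEnd e) := by
    apply Set.Subset.antisymm
    · rintro _ ⟨t, ht, rfl⟩
      have h1 := hanti (Set.left_mem_Icc.2 hsp.1.le) (Set.Ioo_subset_Icc_self ht) ht.1
      have h2 := hanti (Set.Ioo_subset_Icc_self ht) (Set.right_mem_Icc.2 hsp.1.le) ht.2
      simp only [h0, hw.fst_halfPeriod] at h1 h2
      exact ⟨h2, h1⟩
    · have := intermediate_value_Ioo' hsp.1.le hw.continuous_fst.continuousOn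
      rwa [h0, hw.fst_halfPeriod] at this
  have hle : P.leftEnd e ≤ P.rightEnd e := by linarith [hw.leftEnd_lt, hw.half_lt_rightEnd]
  rw [intervalIntegral.integral_of_le hle, MeasureTheory.integral_Ioc_eq_integral_Ioo, ← himg,
    MeasureTheory.integral_image_eq_integral_abs_deriv_smul measurableSet_Ioo
      (fun t _ => (hw.hasDerivAt_fst t).hasDerivWithinAt)
      (hanti.injOn.mono Set.Ioo_subset_Icc_self)]
  have h2 : Set.EqOn (fun t => |(P.scaledOrbit e t).2| • (Real.sqrt 2 /
      Real.sqrt (1 - P.scaledU (P.scaledOrbit e t).1 e))) (fun _ => (2 : ℝ))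
      (Ioo 0 (P.halfPeriod e)) := fun t ht => by
    have h3 : 1 - P.scaledU (P.scaledOrbit e t).1 e = (P.scaledOrbit e t).2 ^ 2 / 2 := by
      linarith [hw.energy_eq t]
    have h4 : 0 < |(P.scaledOrbit e t).2| := abs_pos.2 (hsp.2.2 t ht.1 ht.2).ne
    simp only [h3, smul_eq_mul]
    rw [Real.sqrt_div (sq_nonneg _), Real.sqrt_sq_eq_abs]
    have h5 : Real.sqrt 2 * Real.sqrt 2 = 2 := Real.mul_self_sqrt (by norm_num)
    have h6 : 0 < Real.sqrt 2 := by positivity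
    field_simp
    linarith
  rw [MeasureTheory.setIntegral_congr_fun measurableSet_Ioo h2]
  simp [hsp.1.le]
  ring

end

end ChirpedSystem

namespace ChirpedSystem

variable (P : ChirpedSystem)

/-! ### Smooth dependence of the scaled orbits and of their frequency on the energy -/

theorem contDiffOn_scaledOrbit {O : Set ℝ} (hO : IsOpen O) (hw : ∀ e ∈ O, P.IsWell e) :
    ContDiffOn ℝ ∞ (fun q : ℝ × ℝ => P.scaledOrbit q.2 q.1) (univ ×ˢ O) :=
  contDiffOn_flow (X := fun t e => (P.scaledOrbit e t).1) (Y := fun t e => (P.scaledOrbit e t).2)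
    (ξ := P.rightEnd) P.contDiff_forceCoeff hO
    (fun e he => (P.contDiffAt_rightEnd
      (Filter.eventually_of_mem (hO.mem_nhds he) hw)).contDiffWithinAt)
    (fun e he t => (hw e he).hasDerivAt_fst t) (fun e he t => (hw e he).hasDerivAt_snd t)
    (fun e he => by rw [(hw e he).isScaledOrbit.1]) (fun e he => by rw [(hw e he).isScaledOrbit.1])

theorem contDiffOn_halfPeriod {O : Set ℝ} (hO : IsOpen O) (hw : ∀ e ∈ O, P.IsWell e) :
    ContDiffOn ℝ ∞ P.halfPeriod O := by
  intro e₁ he₁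
  refine ContDiffAt.contDiffWithinAt ?_
  have hw₁ := hw e₁ he₁
  have hsp := hw₁.halfPeriod_spec
  set T := P.halfPeriod e₁ with hT
  have hOU : IsOpen ((univ : Set ℝ) ×ˢ O) := isOpen_univ.prod hO
  have hflow := P.contDiffOn_scaledOrbit hO hw
  have hcX : ContinuousOn (fun q : ℝ × ℝ => P.scaledOrbit q.2 q.1) (univ ×ˢ O) :=
    hflow.continuousOn
  have hYc : ∀ t, ContinuousAt (fun q : ℝ × ℝ => (P.scaledOrbit q.2 q.1).2) (t, e₁) := fun t =>
    (hcX.continuousAt (hOU.mem_nhds ⟨trivial, he₁⟩)).snd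
  have hDc : ∀ t, ContinuousAt
      (fun q : ℝ × ℝ => -P.scaledForce (P.scaledOrbit q.2 q.1).1 q.2) (t, e₁) := fun t => by
    have h1 := (hcX.continuousAt (hOU.mem_nhds (x := (t, e₁)) ⟨trivial, he₁⟩)).fst
    exact (P.contDiff_scaledForce.continuous.continuousAt.comp
      (f := fun q : ℝ × ℝ => ((P.scaledOrbit q.2 q.1).1, q.2)) (h1.prodMk (by fun_prop))).neg
  obtain ⟨ψ, hψ, hψ0, hψz⟩ := exists_contDiffAt_implicit (p₀ := e₁) (x₀ := T)
    (F := fun q : ℝ × ℝ => (P.scaledOrbit q.1 q.2).2) (d := -P.scaledForce (P.scaledOrbit e₁ T).1 e₁)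
    (by
      have h1 : ContDiffAt ℝ ∞ (fun q : ℝ × ℝ => P.scaledOrbit q.2 q.1) (T, e₁) :=
        hflow.contDiffAt (hOU.mem_nhds ⟨trivial, he₁⟩)
      exact (ContDiffAt.comp (e₁, T) (g := fun q : ℝ × ℝ => P.scaledOrbit q.2 q.1)
        (f := fun q : ℝ × ℝ => (q.2, q.1)) h1 (by fun_prop)).snd)
    (hw₁.hasDerivAt_snd T)
    (by
      rw [hw₁.fst_halfPeriod]
      have := hw₁.neg _ hw₁.leftEnd_lt.le
      linarith) hsp.2.1
  have hDT : 0 < -P.scaledForce (P.scaledOrbit e₁ T).1 e₁ := by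
    rw [hw₁.fst_halfPeriod]
    have := hw₁.neg _ hw₁.leftEnd_lt.le
    linarith
  have hD0 : -P.scaledForce (P.scaledOrbit e₁ 0).1 e₁ < 0 := by
    rw [hw₁.isScaledOrbit.1]
    have := hw₁.pos _ hw₁.half_lt_rightEnd.le
    linarith
  obtain ⟨η, hη, hηT⟩ := Metric.eventually_nhds_iff.1 ((hDc T).eventually (lt_mem_nhds hDT))
  obtain ⟨η', hη', hη0⟩ := Metric.eventually_nhds_iff.1 ((hDc 0).eventually (gt_mem_nhds hD0))
  have hmid : ∀ᶠ e in 𝓝 e₁, ∀ t ∈ Icc (η' / 2) (T - η / 2), (P.scaledOrbit e t).2 < 0 := by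
    refine isCompact_Icc.eventually_forall_of_forall_eventually
      (P := fun e t => (P.scaledOrbit e t).2 < 0) fun t ht => ?_
    have h1 : ContinuousAt (fun q : ℝ × ℝ => (P.scaledOrbit q.1 q.2).2) (e₁, t) :=
      ContinuousAt.comp (x := (e₁, t)) (g := fun q : ℝ × ℝ => (P.scaledOrbit q.2 q.1).2)
        (f := fun q : ℝ × ℝ => (q.2, q.1)) (hYc t) (by fun_prop)
    refine h1.eventually (gt_mem_nhds ?_)
    exact hsp.2.2 t (by linarith [ht.1]) (by linarith [ht.2])
  have hψT : ∀ᶠ e in 𝓝 e₁, ψ e ∈ Ioo (max 0 (T - η)) (T + η) := by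
    refine hψ.continuousAt.eventually (Ioo_mem_nhds ?_ ?_) <;> rw [hψ0]
    · exact max_lt hsp.1 (by linarith)
    · linarith
  refine hψ.congr_of_eventuallyEq ?_
  filter_upwards [hψz, hmid, hψT, hO.mem_nhds he₁, Metric.ball_mem_nhds e₁ hη,
    Metric.ball_mem_nhds e₁ hη'] with e hz hmid hψT heO hdη hdη'
  have hwe := hw e heO
  have hspe := hwe.halfPeriod_spec
  have hψpos : 0 < ψ e := (le_max_left _ _).trans_lt hψT.1
  have hmono : StrictMonoOn (fun t => (P.scaledOrbit e t).2) (Ioo (T - η) (T + η)) := by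
    refine strictMonoOn_of_deriv_pos (convex_Ioo _ _) hwe.continuous_snd.continuousOn
      fun t ht => ?_
    rw [interior_Ioo] at ht
    rw [(hwe.hasDerivAt_snd t).deriv]
    refine hηT (y := (t, e)) ?_
    rw [Prod.dist_eq, max_lt_iff]
    exact ⟨by rw [Real.dist_eq, abs_lt]; constructor <;> linarith [ht.1, ht.2], hdη⟩
  have hanti : StrictAntiOn (fun t => (P.scaledOrbit e t).2) (Ioo (-η') η') := by
    refine strictAntiOn_of_deriv_neg (convex_Ioo _ _) hwe.continuous_snd.continuousOn
      fun t ht => ?_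
    rw [interior_Ioo] at ht
    rw [(hwe.hasDerivAt_snd t).deriv]
    refine hη0 (y := (t, e)) ?_
    rw [Prod.dist_eq, max_lt_iff]
    exact ⟨by rw [Real.dist_eq, abs_lt]; constructor <;> linarith [ht.1, ht.2], hdη'⟩
  have hle : P.halfPeriod e ≤ ψ e :=
    csInf_le ⟨0, fun t ht => ht.1.le⟩ ⟨hψpos, hz⟩
  refine le_antisymm hle ?_
  by_contra! hlt
  refine absurd hspe.2.1 (ne_of_lt ?_)
  rcases lt_or_ge (P.halfPeriod e) η' with h1 | h1
  · have := hanti (show (0 : ℝ) ∈ Ioo (-η') η' from ⟨by linarith, hη'⟩)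
      ⟨by linarith, h1⟩ hspe.1
    simp only [hwe.isScaledOrbit.1] at this
    exact this
  rcases lt_or_ge (T - η) (P.halfPeriod e) with h2 | h2
  · have := hmono ⟨h2, hlt.trans hψT.2⟩ ⟨(le_max_right _ _).trans_lt hψT.1, hψT.2⟩ hlt
    simp only [hz] at this
    exact this
  · exact hmid _ ⟨by linarith, by linarith⟩

/-- The frequency of the scaled orbit. -/
def scaledFreq (e : ℝ) : ℝ := Real.pi / P.halfPeriod e

/-- The scaled orbit in terms of the angle. -/
def scaledXY (φ e : ℝ) : ℝ × ℝ := P.scaledOrbit e (φ / P.scaledFreq e)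

theorem IsWell.scaledFreq_pos {P : ChirpedSystem} {e : ℝ} (hw : P.IsWell e) : 0 < P.scaledFreq e :=
  div_pos Real.pi_pos hw.halfPeriod_spec.1

theorem contDiffOn_scaledFreq {O : Set ℝ} (hO : IsOpen O) (hw : ∀ e ∈ O, P.IsWell e) :
    ContDiffOn ℝ ∞ P.scaledFreq O :=
  contDiffOn_const.div (P.contDiffOn_halfPeriod hO hw) fun e he => (hw e he).halfPeriod_spec.1.ne'

theorem contDiffOn_scaledXY {O : Set ℝ} (hO : IsOpen O) (hw : ∀ e ∈ O, P.IsWell e) :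
    ContDiffOn ℝ ∞ (fun q : ℝ × ℝ => P.scaledXY q.1 q.2) (univ ×ˢ O) := by
  have h1 : ContDiffOn ℝ ∞ (fun q : ℝ × ℝ => P.scaledFreq q.2) (univ ×ˢ O) :=
    (P.contDiffOn_scaledFreq hO hw).comp contDiff_snd.contDiffOn fun q hq => hq.2
  have h2 : ContDiffOn ℝ ∞ (fun q : ℝ × ℝ => (q.1 / P.scaledFreq q.2, q.2)) (univ ×ˢ O) :=
    (contDiff_fst.contDiffOn.div h1 fun q hq => (hw _ hq.2).scaledFreq_pos.ne').prodMk
      contDiff_snd.contDiffOn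
  exact (P.contDiffOn_scaledOrbit hO hw).comp h2 fun q hq => ⟨trivial, hq.2⟩

theorem IsWell.scaledXY_periodic {P : ChirpedSystem} {e : ℝ} (hw : P.IsWell e) (φ : ℝ) :
    P.scaledXY (φ + 2 * Real.pi) e = P.scaledXY φ e := by
  unfold scaledXY
  have h1 : (φ + 2 * Real.pi) / P.scaledFreq e = φ / P.scaledFreq e + 2 * P.halfPeriod e := by
    have := hw.halfPeriod_spec.1
    unfold scaledFreq
    field_simp
  rw [h1, hw.orbit_periodic]

/-! ### The orbits of large energy -/

theorem contDiff_U : ContDiff ℝ ∞ P.U := by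
  unfold U
  exact ContDiff.add (by fun_prop) (ContDiff.sum fun i _ => by fun_prop)

theorem setOf_U_eq {e : ℝ} (he : 0 < e) :
    {x | P.U x = (e ^ (2 * P.h))⁻¹} = (fun x => e⁻¹ * x) '' {x | P.scaledU x e = 1} := by
  have h2 : (e ^ (2 * P.h))⁻¹ ≠ 0 := by positivity
  ext x
  simp only [Set.mem_image, Set.mem_ofPred_eq]
  constructor
  · intro h
    refine ⟨e * x, ?_, inv_mul_cancel_left₀ he.ne' x⟩
    rw [← inv_mul_cancel_left₀ he.ne' x, P.U_inv_mul he.ne'] at h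
    exact mul_left_cancel₀ h2 (h.trans (mul_one _).symm)
  · rintro ⟨z, hz, rfl⟩
    rw [P.U_inv_mul he.ne', hz, mul_one]

section
variable {P} {e : ℝ} (hw : P.IsWell e) (he : 0 < e)
include hw he

theorem IsWell.xPlus_eq : P.xPlus (e ^ (2 * P.h))⁻¹ = e⁻¹ * P.rightEnd e := by
  have hmono : Monotone fun x : ℝ => e⁻¹ * x := fun a b hab =>
    mul_le_mul_of_nonneg_left hab (by positivity)
  have : IsGreatest {x | P.U x = (e ^ (2 * P.h))⁻¹} (e⁻¹ * P.rightEnd e) := by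
    rw [P.setOf_U_eq he]
    exact hmono.map_isGreatest hw.isGreatest_rightEnd
  exact this.csSup_eq

theorem IsWell.xMinus_eq : P.xMinus (e ^ (2 * P.h))⁻¹ = e⁻¹ * P.leftEnd e := by
  have hmono : Monotone fun x : ℝ => e⁻¹ * x := fun a b hab =>
    mul_le_mul_of_nonneg_left hab (by positivity)
  have : IsLeast {x | P.U x = (e ^ (2 * P.h))⁻¹} (e⁻¹ * P.leftEnd e) := by
    rw [P.setOf_U_eq he]
    exact hmono.map_isLeast hw.isLeast_leftEnd
  exact this.csInf_eq

theorem IsWell.freq_eq : P.freq (e ^ (2 * P.h))⁻¹ = (e ^ (P.h - 1))⁻¹ * P.scaledFreq e := by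
  have hh := P.two_le_h
  have h1 : P.period (e ^ (2 * P.h))⁻¹ = e ^ (P.h - 1) * (2 * P.halfPeriod e) := by
    unfold period
    rw [hw.xPlus_eq he, hw.xMinus_eq he, ← intervalIntegral.smul_integral_comp_mul_left,
      ← hw.integral_eq, smul_eq_mul, ← intervalIntegral.integral_const_mul,
      ← intervalIntegral.integral_const_mul]
    congr 1
    ext x
    have h2 : (e ^ (2 * P.h))⁻¹ - P.U (e⁻¹ * x) = ((e ^ P.h)⁻¹) ^ 2 * (1 - P.scaledU x e) := by
      rw [P.U_inv_mul he.ne', inv_pow, ← pow_mul, mul_comm P.h 2]; ring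
    have h3 : e ^ P.h = e ^ (P.h - 1) * e := by rw [← pow_succ]; congr 1; omega
    rw [h2, Real.sqrt_mul (sq_nonneg _), Real.sqrt_sq (by positivity), h3]
    rcases eq_or_ne (Real.sqrt (1 - P.scaledU x e)) 0 with h0 | h0
    · simp [h0]
    · field_simp
  unfold freq scaledFreq
  rw [h1]
  have := hw.halfPeriod_spec.1
  field_simp

theorem IsWell.orbit_eq (t : ℝ) : P.orbit (e ^ (2 * P.h))⁻¹ t =
    (e⁻¹ * (P.scaledOrbit e (t / e ^ (P.h - 1))).1,
      (e ^ P.h)⁻¹ * (P.scaledOrbit e (t / e ^ (P.h - 1))).2) := by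
  have hh := P.two_le_h
  set γ : ℝ → ℝ × ℝ := fun t => (e⁻¹ * (P.scaledOrbit e (t / e ^ (P.h - 1))).1,
      (e ^ P.h)⁻¹ * (P.scaledOrbit e (t / e ^ (P.h - 1))).2) with hγ
  have hγd : ∀ t, HasDerivAt γ ((γ t).2, -deriv P.U (γ t).1) t := fun t => by
    have hs : HasDerivAt (fun t : ℝ => t / e ^ (P.h - 1)) (1 / e ^ (P.h - 1)) t :=
      (hasDerivAt_id t).div_const _
    have h1 := (HasDerivAt.comp t (hw.hasDerivAt_fst (t / e ^ (P.h - 1))) hs).const_mul e⁻¹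
    have h2 := (HasDerivAt.comp t (hw.hasDerivAt_snd (t / e ^ (P.h - 1))) hs).const_mul (e ^ P.h)⁻¹
    have h3 : e ^ P.h = e ^ (P.h - 1) * e := by rw [← pow_succ]; congr 1; omega
    have h4 : e ^ (2 * P.h - 1) = e ^ (P.h - 1) * e ^ P.h := by rw [← pow_add]; congr 1; omega
    refine (h1.prodMk h2).congr_deriv (Prod.ext ?_ ?_)
    · simp only [hγ]
      rw [h3]
      field_simp
    · simp only [hγ]
      rw [P.deriv_U_inv_mul he.ne', h4]
      field_simp
  have hγ0 : γ 0 = (P.xPlus (e ^ (2 * P.h))⁻¹, 0) := by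
    rw [hw.xPlus_eq he]
    simp [hγ, hw.isScaledOrbit.1]
  have hspec := Classical.epsilon_spec (p := fun γ : ℝ → ℝ × ℝ =>
    γ 0 = (P.xPlus (e ^ (2 * P.h))⁻¹, 0) ∧ ∀ t, HasDerivAt γ ((γ t).2, -deriv P.U (γ t).1) t)
    ⟨γ, hγ0, hγd⟩
  have hv : ContDiff ℝ 1 fun z : ℝ × ℝ => (z.2, -deriv P.U z.1) := by
    have h1 : ContDiff ℝ 1 (deriv P.U) :=
      (contDiff_infty_iff_deriv.1 P.contDiff_U).2.of_le (by exact_mod_cast le_top)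
    have h2 : ContDiff ℝ 1 fun z : ℝ × ℝ => deriv P.U z.1 := h1.comp contDiff_fst
    exact contDiff_snd.prodMk h2.neg
  exact congrFun (ode_unique hv 0 hspec.2 hγd (hspec.1.trans hγ0.symm)) t

theorem IsWell.XY_eq (φ : ℝ) : P.X φ (e ^ (2 * P.h))⁻¹ = e⁻¹ * (P.scaledXY φ e).1 ∧
    P.Y φ (e ^ (2 * P.h))⁻¹ = (e ^ P.h)⁻¹ * (P.scaledXY φ e).2 := by
  have h1 : φ / P.freq (e ^ (2 * P.h))⁻¹ / e ^ (P.h - 1) = φ / P.scaledFreq e := by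
    rw [hw.freq_eq he]
    have := hw.scaledFreq_pos
    field_simp
  unfold X Y scaledXY
  rw [hw.orbit_eq he, h1]
  exact ⟨rfl, rfl⟩

end

end ChirpedSystem

namespace ChirpedSystem

variable (P : ChirpedSystem)

/-! ### The resonant energy -/

theorem vartheta_pos : 0 < P.vartheta := by
  have := P.s_pos
  unfold vartheta
  positivity

/-- `ϑ / kap`. -/
def resRatio : ℝ := P.vartheta / P.kap

theorem resRatio_pos : 0 < P.resRatio :=
  div_pos P.vartheta_pos (by exact_mod_cast P.kap_pos)

theorem exists_strictMonoOn_ratio {e₀ : ℝ} (he₀ : 0 < e₀) (hw : ∀ e, |e| < e₀ → P.IsWell e) :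
    ∃ e₁ > 0, e₁ ≤ e₀ ∧
      StrictMonoOn (fun e => e ^ (P.h - 1) / P.scaledFreq e) (Ioo 0 e₁) := by
  have hh := P.two_le_h
  have hO : IsOpen (Ioo (-e₀) e₀) := isOpen_Ioo
  have hw' : ∀ e ∈ Ioo (-e₀) e₀, P.IsWell e := fun e he => hw e (abs_lt.2 he)
  have hsm := P.contDiffOn_scaledFreq hO hw'
  have hd : ContinuousOn (deriv P.scaledFreq) (Ioo (-e₀) e₀) :=
    (hsm.continuousOn_deriv_of_isOpen hO (by simp))
  have h0 : (0 : ℝ) ∈ Ioo (-e₀) e₀ := ⟨by linarith, he₀⟩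
  have hc : ContinuousAt (fun e => ((P.h - 1 : ℕ) : ℝ) * P.scaledFreq e - e * deriv P.scaledFreq e)
      0 := by
    have h1 := hsm.continuousOn.continuousAt (hO.mem_nhds h0)
    have h2 := hd.continuousAt (hO.mem_nhds h0)
    exact (continuousAt_const.mul h1).sub (continuousAt_id.mul h2)
  have hpos : 0 < ((P.h - 1 : ℕ) : ℝ) * P.scaledFreq 0 - 0 * deriv P.scaledFreq 0 := by
    have := (hw' 0 h0).scaledFreq_pos
    have h3 : (0 : ℝ) < ((P.h - 1 : ℕ) : ℝ) := by
      have : 0 < P.h - 1 := by omega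
      exact_mod_cast this
    rw [zero_mul, sub_zero]
    positivity
  obtain ⟨ε, hε, hev⟩ := Metric.eventually_nhds_iff.1 (hc.eventually (lt_mem_nhds hpos))
  refine ⟨min ε e₀, lt_min hε he₀, min_le_right _ _, ?_⟩
  have hmem : ∀ e ∈ Ioo 0 (min ε e₀), e ∈ Ioo (-e₀) e₀ := fun e he =>
    ⟨by linarith [he.1], he.2.trans_le (min_le_right _ _)⟩
  have hder : ∀ e ∈ Ioo 0 (min ε e₀), HasDerivAt (fun e => e ^ (P.h - 1) / P.scaledFreq e)
      ((((P.h - 1 : ℕ) : ℝ) * e ^ (P.h - 1 - 1) * P.scaledFreq e -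
        e ^ (P.h - 1) * deriv P.scaledFreq e) / P.scaledFreq e ^ 2) e := fun e he => by
    have h1 := ((hsm.differentiableOn (by simp) e (hmem e he)).differentiableAt
      (hO.mem_nhds (hmem e he))).hasDerivAt
    exact (hasDerivAt_pow (P.h - 1) e).div h1 (hw' e (hmem e he)).scaledFreq_pos.ne'
  refine strictMonoOn_of_deriv_pos (convex_Ioo _ _)
    (fun e he => (hder e he).continuousAt.continuousWithinAt) fun e he => ?_
  rw [interior_Ioo] at he
  rw [(hder e he).deriv]
  have h4 := (hw' e (hmem e he)).scaledFreq_pos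
  have h5 := hev (y := e) (by
    rw [Real.dist_eq, sub_zero, abs_of_pos he.1]; exact he.2.trans_le (min_le_left _ _))
  have h6 : e ^ (P.h - 1) = e ^ (P.h - 1 - 1) * e := by rw [← pow_succ]; congr 1; omega
  have h7 : 0 < e ^ (P.h - 1 - 1) := pow_pos he.1 _
  refine div_pos ?_ (by positivity)
  rw [h6]
  nlinarith [mul_pos h7 h5]

theorem sSup_freq_eq {e₀ e₁ δ x : ℝ} (he₁₀ : e₁ ≤ e₀) (hw : ∀ e, |e| < e₀ → P.IsWell e)
    (hmono : StrictMonoOn (fun e => e ^ (P.h - 1) / P.scaledFreq e) (Ioo 0 e₁))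
    (hδ : 0 < δ) (hx : 0 < x) (hlt : δ * x < e₁)
    (hfe : P.scaledFreq (δ * x) = P.resRatio * x ^ (P.h - 1)) :
    sSup {E | P.freq E = P.resRatio * (δ ^ (P.h - 1))⁻¹} = ((δ * x) ^ (2 * P.h))⁻¹ := by
  have hh := P.two_le_h
  have hc := P.resRatio_pos
  have hep : 0 < δ * x := mul_pos hδ hx
  have hwe : ∀ e, 0 < e → e < e₁ → P.IsWell e := fun e h1 h2 =>
    hw e (by rw [abs_of_pos h1]; linarith)
  have hgr : IsGreatest {E | P.freq E = P.resRatio * (δ ^ (P.h - 1))⁻¹}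
      (((δ * x) ^ (2 * P.h))⁻¹) := by
    constructor
    · rw [Set.mem_ofPred_eq, (hwe _ hep hlt).freq_eq hep, hfe, mul_pow]
      field_simp
    · intro E hE
      by_contra! hEgt
      have hE0 : 0 < E := lt_trans (by positivity) hEgt
      set e := E ^ (-(((2 * P.h : ℕ) : ℝ)⁻¹)) with he
      have he0 : 0 < e := rpow_pos_of_pos hE0 _
      have hEe : (e ^ (2 * P.h))⁻¹ = E := by
        rw [he, rpow_neg hE0.le, inv_pow, inv_inv,
          Real.rpow_inv_natCast_pow hE0.le (by omega)]
      have hlt' : e < δ * x := by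
        rw [← hEe, inv_lt_inv₀ (by positivity) (by positivity)] at hEgt
        exact lt_of_pow_lt_pow_left₀ _ hep.le hEgt
      rw [Set.mem_ofPred_eq, ← hEe, (hwe e he0 (hlt'.trans hlt)).freq_eq he0] at hE
      have h1 := hmono ⟨he0, hlt'.trans hlt⟩ ⟨hep, hlt⟩ hlt'
      have h2 := (hwe e he0 (hlt'.trans hlt)).scaledFreq_pos
      simp only [hfe, mul_pow] at h1
      have h3 : e ^ (P.h - 1) / P.scaledFreq e =
          δ ^ (P.h - 1) * x ^ (P.h - 1) / (P.resRatio * x ^ (P.h - 1)) := by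
        have h5 : P.scaledFreq e = e ^ (P.h - 1) * (P.resRatio * (δ ^ (P.h - 1))⁻¹) := by
          rw [← hE]; field_simp
        rw [h5]; field_simp
      exact absurd h3 h1.ne
  exact hgr.csSup_eq

/-- The energy `I_* = (δ η(δ))^(-2h)` at which the frequency equals `(ϑ/kap) δ^(-(h-1))`. -/
theorem exists_resonantScale {e₀ : ℝ} (he₀ : 0 < e₀) (hw : ∀ e, |e| < e₀ → P.IsWell e) :
    ∃ (δ₀ : ℝ) (η : ℝ → ℝ), 0 < δ₀ ∧ ContDiffOn ℝ ∞ η (Ioo (-δ₀) δ₀) ∧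
      ∀ δ ∈ Ioo (-δ₀) δ₀, 0 < η δ ∧ |δ * η δ| < e₀ / 2 ∧
        P.scaledFreq (δ * η δ) = P.resRatio * η δ ^ (P.h - 1) ∧
        (0 < δ → sSup {E | P.freq E = P.resRatio * (δ ^ (P.h - 1))⁻¹} =
          ((δ * η δ) ^ (2 * P.h))⁻¹) := by
  have hh := P.two_le_h
  have hc := P.resRatio_pos
  have hO : IsOpen (Ioo (-e₀) e₀) := isOpen_Ioo
  have hw' : ∀ e ∈ Ioo (-e₀) e₀, P.IsWell e := fun e he => hw e (abs_lt.2 he)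
  have hpos : ∀ e ∈ Ioo (-e₀) e₀, 0 < P.scaledFreq e := fun e he => (hw' e he).scaledFreq_pos
  have hsm := P.contDiffOn_scaledFreq hO hw'
  have h0 : (0 : ℝ) ∈ Ioo (-e₀) e₀ := ⟨by linarith, he₀⟩
  have hh1 : P.h - 1 ≠ 0 := by omega
  obtain ⟨e₁, he₁, he₁₀, hmono⟩ := P.exists_strictMonoOn_ratio he₀ hw
  obtain ⟨g, hg⟩ : ∃ g : ℝ → ℝ, g = fun e => (P.scaledFreq e / P.resRatio) ^
    (((P.h - 1 : ℕ) : ℝ)⁻¹) := ⟨_, rfl⟩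
  have hgpos : ∀ e ∈ Ioo (-e₀) e₀, 0 < g e := fun e he => by
    rw [hg]; exact rpow_pos_of_pos (div_pos (hpos e he) hc) _
  have hgpow : ∀ e ∈ Ioo (-e₀) e₀, P.scaledFreq e = P.resRatio * g e ^ (P.h - 1) :=
    fun e he => by
      simp only [hg]
      rw [Real.rpow_inv_natCast_pow (div_pos (hpos e he) hc).le hh1]
      field_simp
  have hgs : ContDiffOn ℝ ∞ g (Ioo (-e₀) e₀) := by
    rw [hg]
    exact (hsm.div_const _).rpow_const_of_ne fun e he => (div_pos (hpos e he) hc).ne'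
  have hDs : ContDiffOn ℝ ∞ (fun e => e / g e) (Ioo (-e₀) e₀) :=
    contDiffOn_id.div hgs fun e he => (hgpos e he).ne'
  have hDd : ∀ e ∈ Ioo (-e₀) e₀, HasDerivAt (fun e => e / g e) (deriv (fun e => e / g e) e) e :=
    fun e he => ((hDs.differentiableOn (by simp) e he).differentiableAt (hO.mem_nhds he)).hasDerivAt
  have hD0 : deriv (fun e => e / g e) 0 = (g 0)⁻¹ := by
    have h1 := ((hgs.differentiableOn (by simp) 0 h0).differentiableAt (hO.mem_nhds h0)).hasDerivAt
    have h2 := ((hasDerivAt_id (0 : ℝ)).div h1 (hgpos 0 h0).ne').deriv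
    have h3 := (hgpos 0 h0).ne'
    calc _ = _ := h2
      _ = _ := by simp only [id]; field_simp; ring
  have hD0' : deriv (fun e => e / g e) 0 ≠ 0 := by rw [hD0]; exact inv_ne_zero (hgpos 0 h0).ne'
  have hDc : ContinuousOn (deriv fun e => e / g e) (Ioo (-e₀) e₀) :=
    hDs.continuousOn_deriv_of_isOpen hO (by simp)
  obtain ⟨Φ, hΦ, hΦ0⟩ : ∃ Φ : OpenPartialHomeomorph ℝ ℝ, (Φ : ℝ → ℝ) = (fun e => e / g e) ∧
      (0 : ℝ) ∈ Φ.source := by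
    have h1 : HasFDerivAt (fun e => e / g e) ((ContinuousLinearEquiv.unitsEquivAut ℝ
        (Units.mk0 _ hD0') : ℝ ≃L[ℝ] ℝ) : ℝ →L[ℝ] ℝ) 0 := by
      rw [hasFDerivAt_iff_hasDerivAt]
      simpa using hDd 0 h0
    have h2 := hDs.contDiffAt (hO.mem_nhds h0)
    exact ⟨h2.toOpenPartialHomeomorph _ h1 (by simp), h2.toOpenPartialHomeomorph_coe h1 (by simp),
      h2.mem_toOpenPartialHomeomorph_source h1 (by simp)⟩
  have hΦ00 : Φ 0 = 0 := by rw [hΦ]; simp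
  have hs0 : Φ.symm 0 = 0 := by
    have := Φ.left_inv hΦ0
    rwa [hΦ00] at this
  have h0t : (0 : ℝ) ∈ Φ.target := by
    have := Φ.map_source hΦ0
    rwa [hΦ00] at this
  have hsc : ContinuousAt Φ.symm 0 := Φ.continuousAt_symm h0t
  have e1 : ∀ᶠ e in 𝓝 (0 : ℝ), |e| < min (e₀ / 2) e₁ ∧ deriv (fun e => e / g e) e ≠ 0 := by
    refine Filter.Eventually.and ?_ ((hDc.continuousAt (hO.mem_nhds h0)).eventually_ne hD0')
    have h1 : ContinuousAt (fun e : ℝ => |e|) 0 := by fun_prop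
    exact h1.eventually (gt_mem_nhds (by simpa using ⟨he₀, he₁⟩))
  have e2 : ∀ᶠ δ in 𝓝 (0 : ℝ), |Φ.symm δ| < min (e₀ / 2) e₁ ∧
      deriv (fun e => e / g e) (Φ.symm δ) ≠ 0 := by
    rw [ContinuousAt, hs0] at hsc
    exact hsc.eventually e1
  obtain ⟨δ₀, hδ₀, hall⟩ := Metric.eventually_nhds_iff.1
    (e2.and (Φ.open_target.eventually_mem h0t))
  have hball : ∀ δ ∈ Ioo (-δ₀) δ₀, dist δ 0 < δ₀ := fun δ hδ => by
    rw [Real.dist_eq, sub_zero]; exact abs_lt.2 hδ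
  have hmem : ∀ δ ∈ Ioo (-δ₀) δ₀, Φ.symm δ ∈ Ioo (-e₀) e₀ := fun δ hδ => by
    have h1 := (hall (hball δ hδ)).1.1.trans_le (min_le_left _ _)
    exact abs_lt.1 (h1.trans (by linarith))
  have hmul : ∀ δ ∈ Ioo (-δ₀) δ₀, δ * g (Φ.symm δ) = Φ.symm δ := fun δ hδ => by
    have h1 := Φ.right_inv (hall (hball δ hδ)).2
    rw [hΦ] at h1
    have h2 := (hgpos _ (hmem δ hδ)).ne'
    nth_rewrite 1 [← h1]
    field_simp
  refine ⟨δ₀, fun δ => g (Φ.symm δ), hδ₀, ?_, fun δ hδ => ?_⟩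
  · refine hgs.comp (t := Ioo (-e₀) e₀) (fun δ hδ => ContDiffAt.contDiffWithinAt ?_) hmem
    have h1 : HasDerivAt Φ (deriv (fun e => e / g e) (Φ.symm δ)) (Φ.symm δ) := by
      rw [hΦ]; exact hDd _ (hmem δ hδ)
    refine Φ.contDiffAt_symm_deriv (hall (hball δ hδ)).1.2 (hall (hball δ hδ)).2 h1 ?_
    rw [hΦ]
    exact hDs.contDiffAt (hO.mem_nhds (hmem δ hδ))
  · have h1 := (hall (hball δ hδ)).1.1
    have h2 := hgpow _ (hmem δ hδ)
    have h3 := hgpos _ (hmem δ hδ)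
    rw [← hmul δ hδ] at h1
    nth_rewrite 1 [← hmul δ hδ] at h2
    refine ⟨h3, h1.trans_le (min_le_left _ _), h2, fun hδp => ?_⟩
    have hlt := h1.trans_le (min_le_right _ _)
    rw [abs_of_pos (mul_pos hδp h3)] at hlt
    exact P.sSup_freq_eq he₁₀ hw hmono hδp h3 hlt h2

end ChirpedSystem

/-! ### Powers of the original time in terms of `κ = τ^(-1/N)` -/

namespace ChirpedSystem

variable (P : ChirpedSystem)

theorem q_pos : (0 : ℝ) < P.q := by exact_mod_cast P.one_le_b.trans P.b_le_q

theorem h_sub_one_pos : (0 : ℝ) < (P.h : ℝ) - 1 := by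
  have : (2 : ℝ) ≤ P.h := by exact_mod_cast P.two_le_h
  linarith

theorem h_sub_one_cast : ((P.h - 1 : ℕ) : ℝ) = (P.h : ℝ) - 1 := by
  rw [Nat.cast_sub (by have := P.two_le_h; omega)]; simp

theorem ν_eq : P.ν = 1 + (P.b : ℝ) / P.q := by unfold ν μ; ring

theorem ν_pos : 0 < P.ν := by
  have := P.q_pos
  rw [ν_eq]; positivity

theorem time_rpow {κ : ℝ} (hκ : 0 < κ) (x : ℝ) :
    P.time (κ ^ (-(P.N : ℝ))) ^ x =
      P.ν ^ (x / P.ν) * κ ^ (-(2 * (P.q : ℝ) * ((P.h : ℝ) - 1) * x)) := by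
  have hν := P.ν_pos
  unfold time
  rw [← rpow_mul (by positivity), Real.mul_rpow hν.le (by positivity), ← rpow_mul hκ.le,
    P.N_cast.1]
  congr 2 <;> field_simp

theorem time_pos {κ : ℝ} (hκ : 0 < κ) : 0 < P.time (κ ^ (-(P.N : ℝ))) := by
  have hν := P.ν_pos
  unfold time
  positivity

/-- `β = b/(q(h-1))`. -/
def scaleExp : ℝ := (P.b : ℝ) / (P.q * ((P.h : ℝ) - 1))

/-- `t^(-μ) = ampConst κ^M`. -/
def ampConst : ℝ := P.ν ^ (-P.μ / P.ν)

/-- `t^(-b/(q(h-1)))` in terms of `κ`. -/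
def scaleVar (κ : ℝ) : ℝ := P.ν ^ (-P.scaleExp / P.ν) * κ ^ (2 * P.b)

theorem ampConst_pos : 0 < P.ampConst := rpow_pos_of_pos P.ν_pos _

theorem scaleVar_pos {κ : ℝ} (hκ : 0 < κ) : 0 < P.scaleVar κ :=
  mul_pos (rpow_pos_of_pos P.ν_pos _) (pow_pos hκ _)

theorem scaleVar_zero : P.scaleVar 0 = 0 := by
  unfold scaleVar
  rw [zero_pow (by have := P.one_le_b; omega), mul_zero]

theorem time_rpow_neg_μ (hσ : P.σ < (P.b : ℝ) / P.q) {κ : ℝ} (hκ : 0 < κ) :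
    P.time (κ ^ (-(P.N : ℝ))) ^ (-P.μ) = P.ampConst * κ ^ P.M := by
  rw [P.time_rpow hκ, ampConst, ← rpow_natCast κ P.M, (P.M_cast hσ).1]
  congr 2; ring

theorem time_rpow_neg_scaleExp {κ : ℝ} (hκ : 0 < κ) :
    P.time (κ ^ (-(P.N : ℝ))) ^ (-P.scaleExp) = P.scaleVar κ := by
  have := P.q_pos
  have := P.h_sub_one_pos
  rw [P.time_rpow hκ, scaleVar, ← rpow_natCast κ (2 * P.b)]
  congr 2
  push_cast
  unfold scaleExp
  field_simp

theorem time_rpow_neg_div_q {κ : ℝ} (hκ : 0 < κ) (k : ℕ) :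
    P.time (κ ^ (-(P.N : ℝ))) ^ (-(k : ℝ) / P.q) =
      P.ν ^ (-(k : ℝ) / P.q / P.ν) * κ ^ (2 * (P.h - 1) * k) := by
  have := P.q_pos
  rw [P.time_rpow hκ, ← rpow_natCast κ (2 * (P.h - 1) * k)]
  congr 2
  push_cast
  rw [h_sub_one_cast]
  field_simp

theorem time_rpow_one_sub_ν {κ : ℝ} (hκ : 0 < κ) :
    P.time (κ ^ (-(P.N : ℝ))) ^ (1 - P.ν) = P.scaleVar κ ^ (P.h - 1) := by
  have := P.q_pos
  have := P.h_sub_one_pos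
  rw [← P.time_rpow_neg_scaleExp hκ, ← rpow_natCast, ← rpow_mul (P.time_pos hκ).le,
    h_sub_one_cast, ν_eq]
  congr 1
  unfold scaleExp
  field_simp
  ring

theorem time_rpow_ν {κ : ℝ} (hκ : 0 < κ) :
    P.time (κ ^ (-(P.N : ℝ))) ^ P.ν = P.ν * κ ^ (-(P.N : ℝ)) := by
  have hν := P.ν_pos
  unfold time
  rw [← rpow_mul (by positivity), one_div, inv_mul_cancel₀ hν.ne', Real.rpow_one]

theorem rpow_neg_N_rpow {κ : ℝ} (hκ : 0 < κ) (x : ℝ) :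
    (κ ^ (-(P.N : ℝ))) ^ (x / P.N) = κ ^ (-x) := by
  have : (P.N : ℝ) ≠ 0 := by have := P.N_cast.2; positivity
  rw [← rpow_mul hκ.le]
  congr 1; field_simp

theorem deriv_chirp {t : ℝ} (ht : 0 < t) :
    deriv P.chirp t = P.vartheta * t ^ ((P.b : ℝ) / P.q) := by
  have h1 := (Real.hasDerivAt_rpow_const (x := t) (p := 1 + (P.b : ℝ) / P.q)
    (Or.inl ht.ne')).const_mul P.s
  rw [show P.chirp = fun t => P.s * t ^ (1 + (P.b : ℝ) / P.q) from rfl, h1.deriv, add_sub_cancel_left]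
  unfold vartheta; ring

theorem deriv_chirp_div_kap {t : ℝ} (ht : 0 < t) :
    deriv P.chirp t / P.kap = P.resRatio * ((t ^ (-P.scaleExp)) ^ (P.h - 1))⁻¹ := by
  have := P.q_pos
  have := P.h_sub_one_pos
  rw [P.deriv_chirp ht, ← rpow_natCast, ← rpow_mul ht.le, ← rpow_neg ht.le,
    h_sub_one_cast, resRatio]
  have : -(-P.scaleExp * ((P.h : ℝ) - 1)) = (P.b : ℝ) / P.q := by
    unfold scaleExp; field_simp
  rw [this]
  ring

/-- The degree `p + (h-1)l` of the perturbation of the second equation with respect to `1/e`. -/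
def pertDeg : ℕ := P.p + (P.h - 1) * P.l

/-- The defining relation of `σ`: the perturbation enters with the power `t^(-2μ)`. -/
theorem time_rpow_resonance (hσ : P.σ < (P.b : ℝ) / P.q) {κ : ℝ} (hκ : 0 < κ) :
    P.time (κ ^ (-(P.N : ℝ))) ^ (1 - P.ν) * P.time (κ ^ (-(P.N : ℝ))) ^ (-(P.a : ℝ) / P.q) *
      P.scaleVar κ ^ ((P.h : ℝ) - P.pertDeg) = (P.ampConst * κ ^ P.M) ^ 2 := by
  have ht := P.time_pos hκ
  have := P.q_pos
  have := P.h_sub_one_pos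
  rw [← P.time_rpow_neg_scaleExp hκ, ← P.time_rpow_neg_μ hσ hκ, ← rpow_mul ht.le,
    ← rpow_natCast, ← rpow_mul ht.le, ← rpow_add ht, ← rpow_add ht]
  congr 1
  unfold pertDeg
  push_cast
  rw [h_sub_one_cast]
  unfold ν μ scaleExp σ
  field_simp
  ring

theorem two_mul_M_le_N (hrc : -1 ≤ P.σ ∧ P.σ < (P.b : ℝ) / P.q) : 2 * P.M ≤ P.N := by
  have h1 := (P.M_cast hrc.2).1
  have h2 := P.N_cast.1
  have h3 : (2 * P.M : ℝ) ≤ P.N := by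
    rw [h1, h2]
    have : 0 ≤ (P.q : ℝ) * ((P.h : ℝ) - 1) := mul_nonneg P.q_pos.le P.h_sub_one_pos.le
    have hν : P.ν = 1 + 2 * P.μ + P.σ := rfl
    nlinarith [hrc.1]
  exact_mod_cast h3

/-! ### The geometry near the resonance -/

/-- A range of scales for which the limiting system is well behaved. -/
structure ResonantScale where
  e₀ : ℝ
  δ₀ : ℝ
  η : ℝ → ℝ
  e₀_pos : 0 < e₀
  e₀_le : e₀ ≤ 1
  well : ∀ e, |e| < e₀ → P.IsWell e
  δ₀_pos : 0 < δ₀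
  η_smooth : ContDiffOn ℝ ∞ η (Ioo (-δ₀) δ₀)
  η_spec : ∀ δ ∈ Ioo (-δ₀) δ₀, 0 < η δ ∧ |δ * η δ| < e₀ / 2 ∧
    P.scaledFreq (δ * η δ) = P.resRatio * η δ ^ (P.h - 1) ∧
    (0 < δ → sSup {E | P.freq E = P.resRatio * (δ ^ (P.h - 1))⁻¹} = ((δ * η δ) ^ (2 * P.h))⁻¹)

theorem nonempty_resonantScale : Nonempty P.ResonantScale := by
  obtain ⟨e₀, h1, h2, h3⟩ := P.exists_isWell
  obtain ⟨δ₀, η, h4, h5, h6⟩ := P.exists_resonantScale h1 h3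
  exact ⟨⟨e₀, δ₀, η, h1, h2, h3, h4, h5, h6⟩⟩

/-- The arguments `(κ, (r, θ, ζ))`. -/
abbrev Pt : Type := ℝ × ℝ × ℝ × ℝ

/-- `1 + t^(-μ) r`. -/
def ampFactor (q : Pt) : ℝ := 1 + P.ampConst * q.1 ^ P.M * q.2.1

theorem contDiff_ampFactor : ContDiff ℝ ∞ P.ampFactor := by
  unfold ampFactor; fun_prop

theorem contDiff_scaleVar : ContDiff ℝ ∞ P.scaleVar := by
  unfold scaleVar; fun_prop

/-- The angle `θ + ζ/kap`. -/
def angle (q : Pt) : ℝ := q.2.2.1 + q.2.2.2 / P.kap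

theorem contDiff_angle : ContDiff ℝ ∞ P.angle := by
  unfold angle; fun_prop

namespace ResonantScale

variable {P} (Z : P.ResonantScale)

/-- The scale of the resonant energy. -/
def resScale (κ : ℝ) : ℝ := P.scaleVar κ * Z.η (P.scaleVar κ)

/-- The scale `e`, `I = e^(-2h)`. -/
def scale (q : Pt) : ℝ := Z.resScale q.1 / P.ampFactor q

/-- Where everything is defined and smooth. -/
def dom : Set Pt := {q | P.scaleVar q.1 ∈ Ioo (-Z.δ₀) Z.δ₀ ∧ 1 / 2 < P.ampFactor q}

theorem isOpen_dom : IsOpen Z.dom :=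
  ((isOpen_Ioo (a := -Z.δ₀) (b := Z.δ₀)).preimage
    (P.contDiff_scaleVar.continuous.comp continuous_fst)).inter
    (isOpen_lt continuous_const P.contDiff_ampFactor.continuous)

theorem zero_mem_dom (hσ : P.σ < (P.b : ℝ) / P.q) (p : ℝ × ℝ × ℝ) : ((0 : ℝ), p) ∈ Z.dom := by
  have h1 := (P.M_cast hσ).2
  have h2 := Z.δ₀_pos
  refine ⟨?_, ?_⟩
  · simp only [scaleVar_zero]; exact ⟨by linarith, h2⟩
  · simp only [ampFactor]
    rw [zero_pow (by omega)]; norm_num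

variable {Z} {q : Pt}

theorem ampFactor_pos (hq : q ∈ Z.dom) : 0 < P.ampFactor q := by linarith [hq.2]

theorem η_pos (hq : q ∈ Z.dom) : 0 < Z.η (P.scaleVar q.1) := (Z.η_spec _ hq.1).1

theorem abs_resScale_lt (hq : q ∈ Z.dom) : |Z.resScale q.1| < Z.e₀ / 2 := (Z.η_spec _ hq.1).2.1

theorem abs_scale_lt (hq : q ∈ Z.dom) : |Z.scale q| < Z.e₀ := by
  have h1 := abs_resScale_lt hq
  have h2 := hq.2
  have h3 := Z.e₀_pos
  rw [scale, abs_div, abs_of_pos (ampFactor_pos hq), div_lt_iff₀ (ampFactor_pos hq)]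
  nlinarith

theorem scale_mem (hq : q ∈ Z.dom) : Z.scale q ∈ Ioo (-Z.e₀) Z.e₀ := abs_lt.1 (abs_scale_lt hq)

theorem resScale_mem (hq : q ∈ Z.dom) : Z.resScale q.1 ∈ Ioo (-Z.e₀) Z.e₀ :=
  abs_lt.1 ((abs_resScale_lt hq).trans (by linarith [Z.e₀_pos]))

theorem isWell_scale (hq : q ∈ Z.dom) : P.IsWell (Z.scale q) := Z.well _ (abs_scale_lt hq)

theorem resScale_pos (hq : q ∈ Z.dom) (hκ : 0 < q.1) : 0 < Z.resScale q.1 :=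
  mul_pos (P.scaleVar_pos hκ) (η_pos hq)

theorem scale_pos (hq : q ∈ Z.dom) (hκ : 0 < q.1) : 0 < Z.scale q :=
  div_pos (resScale_pos hq hκ) (ampFactor_pos hq)

theorem well' : ∀ e ∈ Ioo (-Z.e₀) Z.e₀, P.IsWell e := fun e he => Z.well e (abs_lt.2 he)

theorem contDiffOn_η : ContDiffOn ℝ ∞ (fun q : Pt => Z.η (P.scaleVar q.1)) Z.dom :=
  Z.η_smooth.comp (P.contDiff_scaleVar.comp contDiff_fst).contDiffOn fun _ hq => hq.1

theorem contDiffOn_deriv_η : ContDiffOn ℝ ∞ (fun q : Pt => deriv Z.η (P.scaleVar q.1)) Z.dom :=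
  (Z.η_smooth.deriv_of_isOpen isOpen_Ioo (m := ∞) (by simp)).comp
    (P.contDiff_scaleVar.comp contDiff_fst).contDiffOn fun _ hq => hq.1

theorem contDiffOn_resScale : ContDiffOn ℝ ∞ (fun q : Pt => Z.resScale q.1) Z.dom :=
  (P.contDiff_scaleVar.comp contDiff_fst).contDiffOn.mul contDiffOn_η

theorem contDiffOn_scale : ContDiffOn ℝ ∞ Z.scale Z.dom :=
  contDiffOn_resScale.div P.contDiff_ampFactor.contDiffOn fun _ hq => (ampFactor_pos hq).ne'

theorem contDiffOn_freq_scale : ContDiffOn ℝ ∞ (fun q : Pt => P.scaledFreq (Z.scale q)) Z.dom :=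
  (P.contDiffOn_scaledFreq isOpen_Ioo well').comp contDiffOn_scale fun _ hq => scale_mem hq

theorem contDiffOn_XY : ContDiffOn ℝ ∞ (fun q : Pt => P.scaledXY (P.angle q) (Z.scale q)) Z.dom :=
  (P.contDiffOn_scaledXY isOpen_Ioo well').comp (f := fun q : Pt => (P.angle q, Z.scale q))
    (P.contDiff_angle.contDiffOn.prodMk contDiffOn_scale) fun _ hq => ⟨trivial, scale_mem hq⟩

theorem contDiffOn_deriv_X : ContDiffOn ℝ ∞ (fun q : Pt =>
    deriv (fun e => (P.scaledXY (P.angle q) e).1) (Z.scale q)) Z.dom := by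
  have h1 := (P.contDiffOn_scaledXY isOpen_Ioo (well' (Z := Z))).comp
    (f := fun q : ℝ × ℝ => (q.2, q.1)) (s := Ioo (-Z.e₀) Z.e₀ ×ˢ univ) (by fun_prop)
    fun q hq => ⟨trivial, hq.1⟩
  have h2 := contDiffOn_deriv_fst (G := fun q : ℝ × ℝ => (P.scaledXY q.2 q.1).1)
    (isOpen_Ioo.prod isOpen_univ) h1.fst
  exact h2.comp (f := fun q : Pt => (Z.scale q, P.angle q))
    (contDiffOn_scale.prodMk P.contDiff_angle.contDiffOn) fun _ hq => ⟨scale_mem hq, trivial⟩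

theorem contDiffOn_deriv_Y : ContDiffOn ℝ ∞ (fun q : Pt =>
    deriv (fun e => (P.scaledXY (P.angle q) e).2) (Z.scale q)) Z.dom := by
  have h1 := (P.contDiffOn_scaledXY isOpen_Ioo (well' (Z := Z))).comp
    (f := fun q : ℝ × ℝ => (q.2, q.1)) (s := Ioo (-Z.e₀) Z.e₀ ×ˢ univ) (by fun_prop)
    fun q hq => ⟨trivial, hq.1⟩
  have h2 := contDiffOn_deriv_fst (G := fun q : ℝ × ℝ => (P.scaledXY q.2 q.1).2)
    (isOpen_Ioo.prod isOpen_univ) h1.snd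
  exact h2.comp (f := fun q : Pt => (Z.scale q, P.angle q))
    (contDiffOn_scale.prodMk P.contDiff_angle.contDiffOn) fun _ hq => ⟨scale_mem hq, trivial⟩

theorem hasDerivAt_XY {e : ℝ} (he : e ∈ Ioo (-Z.e₀) Z.e₀) (φ : ℝ) :
    HasDerivAt (fun e => (P.scaledXY φ e).1) (deriv (fun e => (P.scaledXY φ e).1) e) e ∧
    HasDerivAt (fun e => (P.scaledXY φ e).2) (deriv (fun e => (P.scaledXY φ e).2) e) e := by
  have h1 := (P.contDiffOn_scaledXY isOpen_Ioo (well' (Z := Z))).contDiffAt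
    (x := (φ, e)) ((isOpen_univ.prod isOpen_Ioo).mem_nhds ⟨trivial, he⟩)
  have h2 : ContDiffAt ℝ ∞ (fun e => P.scaledXY φ e) e :=
    h1.comp (f := fun e : ℝ => (φ, e)) e (by fun_prop)
  exact ⟨(h2.fst.differentiableAt (by simp)).hasDerivAt,
    (h2.snd.differentiableAt (by simp)).hasDerivAt⟩

theorem abs_scaledXY_lt (hq : q ∈ Z.dom) (φ : ℝ) :
    |(P.scaledXY φ (Z.scale q)).1| < 2 ∧ |(P.scaledXY φ (Z.scale q)).2| < 2 := by
  have hw := isWell_scale hq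
  refine ⟨?_, hw.abs_snd_lt _⟩
  have h1 := hw.fst_mem (φ / P.scaledFreq (Z.scale q))
  exact abs_lt.2 ⟨hw.lt_leftEnd.trans_le h1.1, h1.2.trans_lt hw.rightEnd_lt⟩

/-! ### The energy and its derivatives -/

theorem resonantEnergy_eq {t : ℝ} (ht : 0 < t) (hδ : t ^ (-P.scaleExp) < Z.δ₀) :
    P.resonantEnergy t =
      ((t ^ (-P.scaleExp) * Z.η (t ^ (-P.scaleExp))) ^ (2 * P.h))⁻¹ := by
  have h1 : 0 < t ^ (-P.scaleExp) := rpow_pos_of_pos ht _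
  rw [resonantEnergy, P.deriv_chirp_div_kap ht]
  exact (Z.η_spec _ ⟨by linarith, hδ⟩).2.2.2 h1

theorem deriv_resonantEnergy_div {t : ℝ} (ht : 0 < t) (hδ : t ^ (-P.scaleExp) < Z.δ₀) :
    deriv P.resonantEnergy t / P.resonantEnergy t = 2 * P.h * (P.scaleExp / t) *
      (1 + t ^ (-P.scaleExp) * deriv Z.η (t ^ (-P.scaleExp)) / Z.η (t ^ (-P.scaleExp))) := by
  have h1 : 0 < t ^ (-P.scaleExp) := rpow_pos_of_pos ht _
  have hmem : t ^ (-P.scaleExp) ∈ Ioo (-Z.δ₀) Z.δ₀ := ⟨by linarith, hδ⟩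
  have hη := (Z.η_spec _ hmem).1
  have hδd := Real.hasDerivAt_rpow_const (x := t) (p := -P.scaleExp) (Or.inl ht.ne')
  have hηd : HasDerivAt Z.η (deriv Z.η (t ^ (-P.scaleExp))) (t ^ (-P.scaleExp)) :=
    ((Z.η_smooth.differentiableOn (by simp) _ hmem).differentiableAt
      (isOpen_Ioo.mem_nhds hmem)).hasDerivAt
  have hev : P.resonantEnergy =ᶠ[𝓝 t] fun t =>
      ((t ^ (-P.scaleExp) * Z.η (t ^ (-P.scaleExp))) ^ (2 * P.h))⁻¹ := by
    filter_upwards [hδd.continuousAt.eventually (gt_mem_nhds hδ), lt_mem_nhds ht] with t h2 h3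
    exact resonantEnergy_eq h3 h2
  have hne : (t ^ (-P.scaleExp) * Z.η (t ^ (-P.scaleExp))) ^ (2 * P.h) ≠ 0 := by positivity
  have hd := ((hδd.mul (HasDerivAt.comp t hηd hδd)).pow (2 * P.h)).inv hne
  have hder := hev.deriv_eq.trans hd.deriv
  rw [hder, resonantEnergy_eq ht hδ]
  have h2 : (t ^ (-P.scaleExp - 1) : ℝ) = t ^ (-P.scaleExp) / t := by
    rw [Real.rpow_sub_one ht.ne']
  simp only [Function.comp, Pi.mul_apply, Pi.pow_apply, h2]
  have h3 : ∀ x : ℝ, x ^ (2 * P.h) = x ^ (2 * P.h - 1) * x := fun x => by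
    rw [← pow_succ]; congr 1; have := P.two_le_h; omega
  rw [h3]
  push_cast
  field_simp
  ring

theorem energy_eq (hσ : P.σ < (P.b : ℝ) / P.q) (hq : q ∈ Z.dom) (hκ : 0 < q.1) :
    P.energy q.2.1 (P.time (q.1 ^ (-(P.N : ℝ)))) = ((Z.scale q) ^ (2 * P.h))⁻¹ := by
  have h1 : P.time (q.1 ^ (-(P.N : ℝ))) ^ (-P.scaleExp) < Z.δ₀ := by
    rw [P.time_rpow_neg_scaleExp hκ]; exact hq.1.2
  rw [energy, resonantEnergy_eq (P.time_pos hκ) h1, P.time_rpow_neg_μ hσ hκ,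
    P.time_rpow_neg_scaleExp hκ, scale, div_pow, inv_div, resScale, ampFactor]
  rw [div_eq_mul_inv, mul_comm]

end ResonantScale

/-- Differentiation with respect to the energy `E = e^(-2h)`. -/
theorem hasDerivAt_energy {w : ℝ → ℝ} {e d : ℝ} (he : 0 < e) {W : ℝ → ℝ} (hw : HasDerivAt w d e)
    (hW : ∀ᶠ x in 𝓝 e, W (x ^ (2 * P.h))⁻¹ = w x) :
    HasDerivAt W (-(e ^ (2 * P.h + 1) / (2 * P.h)) * d) (e ^ (2 * P.h))⁻¹ := by
  have hh := P.two_le_h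
  have hn : (2 * P.h : ℕ) ≠ 0 := by omega
  have hE : 0 < (e ^ (2 * P.h))⁻¹ := by positivity
  obtain ⟨g, hg⟩ : ∃ g : ℝ → ℝ, g = fun E => (E ^ (((2 * P.h : ℕ) : ℝ)⁻¹))⁻¹ := ⟨_, rfl⟩
  have hgE : ∀ E, 0 < E → 0 < g E ∧ ((g E) ^ (2 * P.h))⁻¹ = E := fun E hE => by
    rw [hg]
    refine ⟨by positivity, ?_⟩
    simp only []
    rw [inv_pow, inv_inv, Real.rpow_inv_natCast_pow hE.le hn]
  have hge : g (e ^ (2 * P.h))⁻¹ = e := by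
    have h1 := (hgE _ hE).2
    rw [inv_inj] at h1
    exact (pow_left_inj₀ (hgE _ hE).1.le he.le hn).1 h1
  have hgd : HasDerivAt g (-(e ^ (2 * P.h + 1) / (2 * P.h))) (e ^ (2 * P.h))⁻¹ := by
    have h1 : HasDerivAt (fun x : ℝ => (x ^ (2 * P.h))⁻¹)
        (-(((2 * P.h : ℕ) : ℝ) * e ^ (2 * P.h - 1)) / (e ^ (2 * P.h)) ^ 2) e :=
      (hasDerivAt_pow (2 * P.h) e).fun_inv (by positivity)
    have h2 := HasDerivAt.of_local_left_inverse (f := fun x : ℝ => (x ^ (2 * P.h))⁻¹) (g := g)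
      (a := (e ^ (2 * P.h))⁻¹) (f' := -(((2 * P.h : ℕ) : ℝ) * e ^ (2 * P.h - 1)) /
        (e ^ (2 * P.h)) ^ 2) ?_ (by rwa [hge]) ?_ ?_
    · refine h2.congr_deriv ?_
      have h3 : e ^ (2 * P.h) = e ^ (2 * P.h - 1) * e := by rw [← pow_succ]; congr 1; omega
      rw [pow_succ e (2 * P.h), h3]
      push_cast
      field_simp
    · rw [hg]
      exact ((Real.continuousAt_rpow_const _ _ (Or.inl hE.ne'))).inv₀ (by positivity)
    · have : ((2 * P.h : ℕ) : ℝ) ≠ 0 := by exact_mod_cast hn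
      have h4 : 0 < e ^ (2 * P.h - 1) := by positivity
      have h5 : 0 < (e ^ (2 * P.h)) ^ 2 := by positivity
      exact div_ne_zero (neg_ne_zero.2 (mul_ne_zero this h4.ne')) h5.ne'
    · filter_upwards [lt_mem_nhds hE] with E hE
      exact (hgE E hE).2
  have h1 := HasDerivAt.comp (h₂ := w) (h := g) (e ^ (2 * P.h))⁻¹ (by rwa [hge]) hgd
  have h2 : W =ᶠ[𝓝 (e ^ (2 * P.h))⁻¹] w ∘ g := by
    have hgc : Tendsto g (𝓝 (e ^ (2 * P.h))⁻¹) (𝓝 e) := by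
      have := hgd.continuousAt
      rwa [ContinuousAt, hge] at this
    filter_upwards [hgc.eventually hW, lt_mem_nhds hE] with E h3 h4
    rw [(hgE E h4).2] at h3
    exact h3
  exact (h1.congr_of_eventuallyEq h2).congr_deriv (mul_comm _ _)

end ChirpedSystem

theorem eventually_smallOn_mem {E : Type} [NormedAddCommGroup E] [NormedSpace ℝ E]
    {O : Set (ℝ × E)} (hO : IsOpen O) (h0 : ∀ p, ((0 : ℝ), p) ∈ O) {S : Set E} (hS : IsCompact S) :
    ∀ᶠ q in smallOn S, q ∈ O := by
  obtain ⟨C, κ₀, hκ₀, h⟩ := exists_taylor_bound hO hS (fun p _ => h0 p) 0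
    (G := fun _ => 0) contDiffOn_const
  exact eventually_smallOn.2 ⟨κ₀, hκ₀, fun κ k0 k1 p hp => (h κ k0.le k1 p hp).1⟩

theorem eventually_smallOn_fst {E : Type} {S : Set E} {Q : ℝ → Prop} (h : ∀ᶠ κ in 𝓝[>] (0 : ℝ), Q κ) :
    ∀ᶠ q in smallOn S, Q q.1 := by
  exact tendsto_fst.eventually h

theorem isBigO_one_smallOn {E : Type} [NormedAddCommGroup E] [NormedSpace ℝ E]
    {O : Set (ℝ × E)} (hO : IsOpen O) (h0 : ∀ p, ((0 : ℝ), p) ∈ O) {S : Set E} (hS : IsCompact S)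
    {G : ℝ × E → ℝ} (hG : ContDiffOn ℝ ∞ G O) : G =O[smallOn S] fun _ => (1 : ℝ) := by
  simpa using (HasExp.of_contDiffOn hO h0 hG).2 0 S hS

namespace ChirpedSystem

variable {P : ChirpedSystem}

theorem tendsto_time : Tendsto (fun κ : ℝ => P.time (κ ^ (-(P.N : ℝ)))) (𝓝[>] 0) atTop := by
  have hν := P.ν_pos
  have h1 : Tendsto (fun κ : ℝ => κ ^ (-(P.N : ℝ))) (𝓝[>] 0) atTop :=
    tendsto_rpow_neg_nhdsGT_zero (by have := P.N_cast.2; simp; omega)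
  have h2 : Tendsto (fun τ : ℝ => (P.ν * τ) ^ (1 / P.ν)) atTop atTop :=
    (tendsto_rpow_atTop (by positivity)).comp (tendsto_id.const_mul_atTop hν)
  exact h2.comp h1

namespace ResonantScale

variable (Z : P.ResonantScale)

/-- The scaled solution of the limiting system. -/
def XY (q : Pt) : ℝ × ℝ := P.scaledXY (P.angle q) (Z.scale q)

/-- A scaled perturbation. -/
def pert (w : ℝ → ℝ → ℝ → ℝ → ℝ) (Θ : ℝ) (q : Pt) : ℝ :=
  Z.scale q ^ Θ * w ((Z.scale q)⁻¹ * (Z.XY q).1) ((Z.scale q ^ P.h)⁻¹ * (Z.XY q).2) q.2.2.2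
    (P.time (q.1 ^ (-(P.N : ℝ))))

/-- The first `m` terms of the expansion of a scaled perturbation. -/
def pertApprox (C : ℕ → ℕ → ℕ → ℝ → ℝ) (J : ℕ) (d : ℕ → ℕ → ℕ) (m : ℕ) (q : Pt) : ℝ :=
  ∑ k ∈ range m, P.ν ^ (-(k : ℝ) / P.q / P.ν) * q.1 ^ (2 * (P.h - 1) * k) *
    ∑ i ∈ range (P.p + 1), ∑ j ∈ range J,
      C k i j q.2.2.2 * Z.scale q ^ d i j * (Z.XY q).1 ^ i * (Z.XY q).2 ^ j

variable {Z}

theorem contDiffOn_pertApprox {C : ℕ → ℕ → ℕ → ℝ → ℝ} (hC : ∀ k i j, ContDiff ℝ ∞ (C k i j))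
    (J : ℕ) (d : ℕ → ℕ → ℕ) (m : ℕ) : ContDiffOn ℝ ∞ (Z.pertApprox C J d m) Z.dom := by
  unfold pertApprox
  refine ContDiffOn.sum fun k _ => ContDiffOn.mul (by fun_prop) ?_
  refine ContDiffOn.sum fun i _ => ContDiffOn.sum fun j _ => ?_
  have h1 : ContDiffOn ℝ ∞ (fun q : Pt => C k i j q.2.2.2) Z.dom :=
    ((hC k i j).comp (by fun_prop)).contDiffOn
  exact ((h1.mul (contDiffOn_scale.pow _)).mul (contDiffOn_XY.fst.pow _)).mul
    (contDiffOn_XY.snd.pow _)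

theorem contDiffOn_pert {w : ℝ → ℝ → ℝ → ℝ → ℝ}
    (hw : ContDiffOn ℝ ∞ (fun v : ℝ × ℝ × ℝ × ℝ => w v.1 v.2.1 v.2.2.1 v.2.2.2) {v | 0 < v.2.2.2})
    (Θ : ℝ) : ContDiffOn ℝ ∞ (Z.pert w Θ) (Z.dom ∩ {q | 0 < q.1}) := by
  have h1 : ContDiffOn ℝ ∞ Z.scale (Z.dom ∩ {q | 0 < q.1}) :=
    contDiffOn_scale.mono Set.inter_subset_left
  have h2 : ContDiffOn ℝ ∞ Z.XY (Z.dom ∩ {q | 0 < q.1}) := contDiffOn_XY.mono Set.inter_subset_left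
  have hne : ∀ q ∈ Z.dom ∩ {q | 0 < q.1}, Z.scale q ≠ 0 := fun q hq => (scale_pos hq.1 hq.2).ne'
  have h3 : ContDiffOn ℝ ∞ (fun q : Pt => P.time (q.1 ^ (-(P.N : ℝ)))) (Z.dom ∩ {q | 0 < q.1}) := by
    have hν := P.ν_pos
    unfold time
    refine ContDiffOn.rpow_const_of_ne (contDiffOn_const.mul
      (contDiffOn_fst.rpow_const_of_ne fun q hq => ne_of_gt hq.2)) fun q hq => ?_
    have : (0 : ℝ) < q.1 := hq.2
    positivity
  unfold pert
  refine (h1.rpow_const_of_ne hne).mul (hw.comp (f := fun q : Pt =>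
    ((Z.scale q)⁻¹ * (Z.XY q).1, (Z.scale q ^ P.h)⁻¹ * (Z.XY q).2, q.2.2.2,
      P.time (q.1 ^ (-(P.N : ℝ))))) ?_ fun q hq => P.time_pos hq.2)
  exact ((h1.inv hne).mul h2.fst).prodMk ((((h1.pow _).inv fun q hq => pow_ne_zero _ (hne q hq)).mul
    h2.snd).prodMk ((by fun_prop : ContDiffOn ℝ ∞ (fun q : Pt => q.2.2.2) _).prodMk h3))

theorem isBigO_pert_sub_pertApprox (hσ : P.σ < (P.b : ℝ) / P.q) {w : ℝ → ℝ → ℝ → ℝ → ℝ}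
    {C : ℕ → ℕ → ℕ → ℝ → ℝ} {J : ℕ} {d : ℕ → ℕ → ℕ} {Θ : ℝ}
    (hexp : ∀ m : ℕ, ∃ C' T : ℝ, 0 < T ∧ ∀ t, T ≤ t → ∀ x y S,
      |w x y S t - ∑ k ∈ range m, t ^ (-(k : ℝ) / P.q) *
          ∑ i ∈ range (P.p + 1), ∑ j ∈ range J, C k i j S * x ^ i * y ^ j|
        ≤ C' * t ^ (-(m : ℝ) / P.q) * ∑ i ∈ range (P.p + 1), ∑ j ∈ range J,
            if i + j ≤ P.p then |x| ^ i * |y| ^ j else 0)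
    (hzero : ∀ k i j S, P.p < i + j → C k i j S = 0)
    (hd : ∀ i j, j < J → i + j ≤ P.p → Θ = i + P.h * j + d i j) (m : ℕ) {S : Set (ℝ × ℝ × ℝ)}
    (hS : IsCompact S) :
    (fun q => Z.pert w Θ q - Z.pertApprox C J d m q) =O[smallOn S] fun q => q.1 ^ m := by
  obtain ⟨C', T, -, hC'⟩ := hexp m
  obtain ⟨B, hB⟩ : ∃ B : ℝ, B = ∑ i ∈ range (P.p + 1), ∑ j ∈ range J,
    (2 : ℝ) ^ i * 2 ^ j := ⟨_, rfl⟩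
  refine IsBigO.of_bound (|C'| * P.ν ^ (-(m : ℝ) / P.q / P.ν) * B) ?_
  filter_upwards [eventually_smallOn_mem Z.isOpen_dom (Z.zero_mem_dom hσ) hS,
    eventually_smallOn_fst (tendsto_time.eventually (eventually_ge_atTop T)),
    eventually_smallOn_fst (Ioo_mem_nhdsGT (zero_lt_one' ℝ))] with q hq hT hκ
  have he := scale_pos hq hκ.1
  have he1 : Z.scale q ≤ 1 := (le_abs_self _).trans ((abs_scale_lt hq).le.trans Z.e₀_le)
  have hν := P.ν_pos
  obtain ⟨hx, hy⟩ := abs_scaledXY_lt hq (P.angle q)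
  have hmono : ∀ i j, j < J → i + j ≤ P.p → Z.scale q ^ Θ =
      Z.scale q ^ i * (Z.scale q ^ P.h) ^ j * Z.scale q ^ d i j := fun i j h1 h2 => by
    rw [hd i j h1 h2, rpow_add he, rpow_add he, rpow_natCast, rpow_natCast,
      ← pow_mul, ← rpow_natCast _ (P.h * j)]
    push_cast; rfl
  have h1 := hC' _ hT ((Z.scale q)⁻¹ * (Z.XY q).1) ((Z.scale q ^ P.h)⁻¹ * (Z.XY q).2) q.2.2.2
  have h2 : Z.pert w Θ q - Z.pertApprox C J d m q = Z.scale q ^ Θ *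
      (w ((Z.scale q)⁻¹ * (Z.XY q).1) ((Z.scale q ^ P.h)⁻¹ * (Z.XY q).2) q.2.2.2
        (P.time (q.1 ^ (-(P.N : ℝ)))) - ∑ k ∈ range m,
          P.time (q.1 ^ (-(P.N : ℝ))) ^ (-(k : ℝ) / P.q) *
          ∑ i ∈ range (P.p + 1), ∑ j ∈ range J, C k i j q.2.2.2 *
            ((Z.scale q)⁻¹ * (Z.XY q).1) ^ i * ((Z.scale q ^ P.h)⁻¹ * (Z.XY q).2) ^ j) := by
    rw [mul_sub, pert, pertApprox, mul_sum (range m)]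
    congr 1
    refine sum_congr rfl fun k _ => ?_
    rw [P.time_rpow_neg_div_q hκ.1]
    refine Eq.trans (congrArg (HMul.hMul _) ?_) (mul_left_comm _ _ _)
    rw [mul_sum]
    refine sum_congr rfl fun i _ => ?_
    rw [mul_sum]
    refine sum_congr rfl fun j hj => ?_
    by_cases hij : i + j ≤ P.p
    · rw [hmono i j (mem_range.1 hj) hij]
      simp only [mul_pow, inv_pow]
      field_simp
    · rw [hzero k i j _ (by omega)]; ring
  rw [h2, norm_mul, Real.norm_of_nonneg (rpow_nonneg he.le _), norm_eq_abs,
    Real.norm_of_nonneg (pow_nonneg hκ.1.le _)]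
  have h3 : Z.scale q ^ Θ * ∑ i ∈ range (P.p + 1), ∑ j ∈ range J,
      (if i + j ≤ P.p then |(Z.scale q)⁻¹ * (Z.XY q).1| ^ i *
        |(Z.scale q ^ P.h)⁻¹ * (Z.XY q).2| ^ j else 0) ≤ B := by
    rw [hB, mul_sum]
    refine Finset.sum_le_sum fun i _ => ?_
    rw [mul_sum]
    refine Finset.sum_le_sum fun j hj => ?_
    split_ifs with hij
    · rw [hmono i j (mem_range.1 hj) hij, abs_mul, abs_mul, abs_of_pos (inv_pos.2 he),
        abs_of_pos (inv_pos.2 (pow_pos he _))]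
      have h4 : Z.scale q ^ i * (Z.scale q ^ P.h) ^ j * Z.scale q ^ d i j *
          (((Z.scale q)⁻¹ * |(Z.XY q).1|) ^ i * ((Z.scale q ^ P.h)⁻¹ * |(Z.XY q).2|) ^ j) =
          |(Z.XY q).1| ^ i * |(Z.XY q).2| ^ j * Z.scale q ^ d i j := by
        simp only [mul_pow, inv_pow]
        field_simp
      rw [h4]
      have h5 : |(Z.XY q).1| ^ i ≤ 2 ^ i := pow_le_pow_left₀ (abs_nonneg _) hx.le _
      have h6 : |(Z.XY q).2| ^ j ≤ 2 ^ j := pow_le_pow_left₀ (abs_nonneg _) hy.le _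
      have h7 : Z.scale q ^ d i j ≤ 1 := pow_le_one₀ he.le he1
      calc _ ≤ 2 ^ i * 2 ^ j * (1 : ℝ) := by gcongr
        _ = _ := mul_one _
    · rw [mul_zero]; positivity
  have hB0 : 0 ≤ B := by rw [hB]; positivity
  have h8 : q.1 ^ (2 * (P.h - 1) * m) ≤ q.1 ^ m :=
    pow_le_pow_of_le_one hκ.1.le hκ.2.le (by
      have := P.two_le_h
      exact Nat.le_mul_of_pos_left _ (by omega))
  calc _ ≤ Z.scale q ^ Θ * (|C'| * P.time (q.1 ^ (-(P.N : ℝ))) ^ (-(m : ℝ) / P.q) *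
        ∑ i ∈ range (P.p + 1), ∑ j ∈ range J,
        (if i + j ≤ P.p then |(Z.scale q)⁻¹ * (Z.XY q).1| ^ i *
          |(Z.scale q ^ P.h)⁻¹ * (Z.XY q).2| ^ j else 0)) := by
        refine mul_le_mul_of_nonneg_left (h1.trans ?_) (rpow_nonneg he.le _)
        refine mul_le_mul_of_nonneg_right (mul_le_mul_of_nonneg_right (le_abs_self _)
          (rpow_nonneg (P.time_pos hκ.1).le _)) ?_
        positivity
    _ = |C'| * P.time (q.1 ^ (-(P.N : ℝ))) ^ (-(m : ℝ) / P.q) * (Z.scale q ^ Θ *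
        ∑ i ∈ range (P.p + 1), ∑ j ∈ range J,
        (if i + j ≤ P.p then |(Z.scale q)⁻¹ * (Z.XY q).1| ^ i *
          |(Z.scale q ^ P.h)⁻¹ * (Z.XY q).2| ^ j else 0)) := mul_left_comm _ _ _
    _ ≤ |C'| * P.time (q.1 ^ (-(P.N : ℝ))) ^ (-(m : ℝ) / P.q) * B := by
        refine mul_le_mul_of_nonneg_left h3 ?_
        have := (P.time_pos hκ.1)
        positivity
    _ = |C'| * P.ν ^ (-(m : ℝ) / P.q / P.ν) * B * q.1 ^ (2 * (P.h - 1) * m) := by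
        rw [P.time_rpow_neg_div_q hκ.1]; ring
    _ ≤ _ := by gcongr

variable (Z)

/-- The scaled perturbations of the two equations. -/
def fs (q : Pt) : ℝ := Z.pert P.f ((P.pertDeg : ℝ) - ((P.h : ℝ) - 1)) q

def gs (q : Pt) : ℝ := Z.pert P.g P.pertDeg q

variable {Z}

theorem exists_approx_fs (hσ : P.σ < (P.b : ℝ) / P.q) (m : ℕ) : ∃ w : Pt → ℝ,
    ContDiffOn ℝ ∞ w Z.dom ∧ ∀ S : Set (ℝ × ℝ × ℝ), IsCompact S →
      (fun q => Z.fs q - w q) =O[smallOn S] fun q => q.1 ^ m := by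
  refine ⟨Z.pertApprox P.A P.l (fun i j => P.p + (P.h - 1) * (P.l - 1) - (i + P.h * j)) m,
    contDiffOn_pertApprox P.A_smooth _ _ _, fun S hS =>
    isBigO_pert_sub_pertApprox hσ P.f_expansion P.A_zero (fun i j h1 h2 => ?_) m hS⟩
  obtain ⟨h, hh⟩ : ∃ h, P.h = h + 1 := ⟨P.h - 1, by have := P.two_le_h; omega⟩
  obtain ⟨l, hl⟩ : ∃ l, P.l = l + 1 := ⟨P.l - 1, by omega⟩
  have h3 : i + P.h * j ≤ P.p + (P.h - 1) * (P.l - 1) := by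
    rw [hh, hl]
    have : h * j ≤ h * l := Nat.mul_le_mul_left _ (by omega)
    simp only [Nat.add_sub_cancel]
    nlinarith
  rw [Nat.cast_sub h3, pertDeg, hh, hl]
  push_cast
  ring

theorem exists_approx_gs (hσ : P.σ < (P.b : ℝ) / P.q) (m : ℕ) : ∃ w : Pt → ℝ,
    ContDiffOn ℝ ∞ w Z.dom ∧ ∀ S : Set (ℝ × ℝ × ℝ), IsCompact S →
      (fun q => Z.gs q - w q) =O[smallOn S] fun q => q.1 ^ m := by
  refine ⟨Z.pertApprox P.B (P.l + 1) (fun i j => P.pertDeg - (i + P.h * j)) m,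
    contDiffOn_pertApprox P.B_smooth _ _ _, fun S hS =>
    isBigO_pert_sub_pertApprox hσ P.g_expansion P.B_zero (fun i j h1 h2 => ?_) m hS⟩
  obtain ⟨h, hh⟩ : ∃ h, P.h = h + 1 := ⟨P.h - 1, by have := P.two_le_h; omega⟩
  have h3 : i + P.h * j ≤ P.pertDeg := by
    rw [pertDeg, hh]
    have : h * j ≤ h * P.l := Nat.mul_le_mul_left _ (by omega)
    simp only [Nat.add_sub_cancel]
    nlinarith
  rw [Nat.cast_sub h3]
  push_cast
  ring

/-- Expansions of expressions that are linear in the perturbations. -/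
theorem exists_hasExp_linear (hσ : P.σ < (P.b : ℝ) / P.q) {c₀ c₁ c₂ : Pt → ℝ}
    (h₀ : ContDiffOn ℝ ∞ c₀ Z.dom) (h₁ : ContDiffOn ℝ ∞ c₁ Z.dom) (h₂ : ContDiffOn ℝ ∞ c₂ Z.dom) :
    ∃ c, HasExp (fun κ p => c₀ (κ, p) + (c₁ (κ, p) * Z.fs (κ, p) + c₂ (κ, p) * Z.gs (κ, p))) c := by
  refine exists_hasExp_of_approx fun m => ?_
  obtain ⟨F, hF, hF'⟩ := exists_approx_fs (Z := Z) hσ m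
  obtain ⟨G, hG, hG'⟩ := exists_approx_gs (Z := Z) hσ m
  refine ⟨fun κ p => c₀ (κ, p) + (c₁ (κ, p) * F (κ, p) + c₂ (κ, p) * G (κ, p)), _,
    HasExp.of_contDiffOn (G := fun q => c₀ q + (c₁ q * F q + c₂ q * G q)) Z.isOpen_dom
      (Z.zero_mem_dom hσ) (h₀.add ((h₁.mul hF).add (h₂.mul hG))), fun S hS => ?_⟩
  have e1 := (isBigO_one_smallOn Z.isOpen_dom (Z.zero_mem_dom hσ) hS h₁).mul (hF' S hS)
  have e2 := (isBigO_one_smallOn Z.isOpen_dom (Z.zero_mem_dom hσ) hS h₂).mul (hG' S hS)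
  simp only [one_mul] at e1 e2
  refine (e1.add e2).congr_left fun q => ?_
  ring

end ResonantScale

end ChirpedSystem

namespace ChirpedSystem

variable {P : ChirpedSystem}

/-! ### The energy and angle equations in scaled variables -/

theorem F_scaled {e : ℝ} (he : 0 < e) (hw : P.IsWell e) (φ ζ t : ℝ) :
    P.F (e ^ (2 * P.h))⁻¹ φ ζ t / (e ^ (2 * P.h))⁻¹ =
      e * P.f (e⁻¹ * (P.scaledXY φ e).1) ((e ^ P.h)⁻¹ * (P.scaledXY φ e).2) ζ t *
        P.scaledForce (P.scaledXY φ e).1 e +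
      e ^ P.h * P.g (e⁻¹ * (P.scaledXY φ e).1) ((e ^ P.h)⁻¹ * (P.scaledXY φ e).2) ζ t *
        (P.scaledXY φ e).2 := by
  have h1 := hw.XY_eq he φ
  have h2 : e ^ (2 * P.h) = e ^ (2 * P.h - 1) * e := by
    rw [← pow_succ]; congr 1; have := P.two_le_h; omega
  have h3 : e ^ (2 * P.h) = e ^ P.h * e ^ P.h := by rw [← pow_add]; congr 1; omega
  rw [F, h1.1, h1.2, P.deriv_U_inv_mul he.ne', div_inv_eq_mul, add_mul]
  congr 1
  · rw [h2]; field_simp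
  · rw [h3]; field_simp

theorem G_scaled {e : ℝ} (he : 0 < e) {e₀ : ℝ} (hlt : e < e₀) (hw : ∀ e, |e| < e₀ → P.IsWell e)
    {φ dX dY : ℝ} (hX : HasDerivAt (fun e => (P.scaledXY φ e).1) dX e)
    (hY : HasDerivAt (fun e => (P.scaledXY φ e).2) dY e) (ζ t : ℝ) :
    P.G (e ^ (2 * P.h))⁻¹ φ ζ t =
      e * P.f (e⁻¹ * (P.scaledXY φ e).1) ((e ^ P.h)⁻¹ * (P.scaledXY φ e).2) ζ t *
        (P.scaledFreq e * (P.h * (P.scaledXY φ e).2 - e * dY) / (2 * P.h)) -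
      e ^ P.h * P.g (e⁻¹ * (P.scaledXY φ e).1) ((e ^ P.h)⁻¹ * (P.scaledXY φ e).2) ζ t *
        (P.scaledFreq e * ((P.scaledXY φ e).1 - e * dX) / (2 * P.h)) := by
  have hwe : P.IsWell e := hw e (by rwa [abs_of_pos he])
  have hev : ∀ᶠ x in 𝓝 e, 0 < x ∧ x < e₀ := (lt_mem_nhds he).and (gt_mem_nhds hlt)
  have hh := P.two_le_h
  have hh0 : (P.h : ℝ) ≠ 0 := by positivity
  have h1 := P.hasDerivAt_energy he (((hasDerivAt_inv he.ne')).mul hX) (W := fun E => P.X φ E)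
    (hev.mono fun x hx => ((hw x (by rw [abs_of_pos hx.1]; exact hx.2)).XY_eq hx.1 φ).1)
  have h2 := P.hasDerivAt_energy he (((hasDerivAt_pow P.h e).fun_inv (by positivity)).mul hY)
    (W := fun E => P.Y φ E)
    (hev.mono fun x hx => ((hw x (by rw [abs_of_pos hx.1]; exact hx.2)).XY_eq hx.1 φ).2)
  have h3 := hwe.XY_eq he φ
  obtain ⟨k, hk⟩ : ∃ k, P.h = k + 1 := ⟨P.h - 1, by omega⟩
  rw [G, h1.deriv, h2.deriv, h3.1, h3.2, hwe.freq_eq he, hk]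
  have hk0 : ((k + 1 : ℕ) : ℝ) ≠ 0 := by positivity
  simp only [Nat.add_sub_cancel]
  have e1 : e ^ (2 * (k + 1) + 1) = e ^ k * e ^ k * e * e * e := by ring
  have e2 : e ^ (k + 1) = e ^ k * e := by ring
  rw [e1, e2]
  field_simp
  ring

namespace ResonantScale

variable (Z : P.ResonantScale)

/-- The power of the scale that is left over in front of the perturbations. -/
def ratio (q : Pt) : ℝ := (Z.η (P.scaleVar q.1) / P.ampFactor q) ^ ((P.h : ℝ) - P.pertDeg)

/-- `ω ∂_E X` and `ω ∂_E Y` in scaled variables. -/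
def dXs (q : Pt) : ℝ := P.scaledFreq (Z.scale q) * ((Z.XY q).1 - Z.scale q *
  deriv (fun e => (P.scaledXY (P.angle q) e).1) (Z.scale q)) / (2 * P.h)

def dYs (q : Pt) : ℝ := P.scaledFreq (Z.scale q) * (P.h * (Z.XY q).2 - Z.scale q *
  deriv (fun e => (P.scaledXY (P.angle q) e).2) (Z.scale q)) / (2 * P.h)

/-- The part of `𝒜` that does not come from the perturbation. -/
def driftR (q : Pt) : ℝ := P.μ / P.ν * q.1 ^ (P.N - P.M) * q.2.1 -
  P.ampFactor q * P.scaleExp * q.1 ^ (P.N - 2 * P.M) / (P.ν * P.ampConst) *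
    (1 + P.scaleVar q.1 * deriv Z.η (P.scaleVar q.1) / Z.η (P.scaleVar q.1))

/-- The difference of the frequencies at the scales `e` and `e_*`. -/
def detuning (q : Pt) : ℝ :=
  (P.ampFactor q ^ (P.h - 1) * P.scaledFreq (Z.scale q) - P.scaledFreq (Z.resScale q.1)) /
    Z.η (P.scaleVar q.1) ^ (P.h - 1)

def fieldA (q : Pt) : ℝ := Z.driftR q +
  (P.ampFactor q * P.ampConst / (2 * P.h) * Z.ratio q * P.scaledForce (Z.XY q).1 (Z.scale q) *
      Z.fs q +
    P.ampFactor q * P.ampConst / (2 * P.h) * Z.ratio q * (Z.XY q).2 * Z.gs q)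

def fieldB (q : Pt) : ℝ := Z.detuning q / q.1 ^ P.M + q.1 ^ P.M *
  (0 + (P.ampConst ^ 2 * Z.ratio q * Z.dYs q * Z.fs q + -(P.ampConst ^ 2 * Z.ratio q * Z.dXs q) *
    Z.gs q))

variable {Z} {q : Pt}

theorem ratio_mul (hq : q ∈ Z.dom) (hκ : 0 < q.1) :
    Z.scale q ^ ((P.h : ℝ) - P.pertDeg) =
      P.scaleVar q.1 ^ ((P.h : ℝ) - P.pertDeg) * Z.ratio q := by
  have h1 := P.scaleVar_pos hκ
  have h2 := η_pos hq
  have h3 := ampFactor_pos hq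
  rw [ratio, ← Real.mul_rpow h1.le (by positivity), scale, resScale, mul_div_assoc]

theorem mul_f_eq (hq : q ∈ Z.dom) (hκ : 0 < q.1) :
    Z.scale q * P.f ((Z.scale q)⁻¹ * (Z.XY q).1) ((Z.scale q ^ P.h)⁻¹ * (Z.XY q).2) q.2.2.2
      (P.time (q.1 ^ (-(P.N : ℝ)))) =
      P.scaleVar q.1 ^ ((P.h : ℝ) - P.pertDeg) * Z.ratio q * Z.fs q := by
  have he := scale_pos hq hκ
  rw [← ratio_mul hq hκ, fs, pert, ← mul_assoc, ← rpow_add he]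
  congr 1
  rw [show (P.h : ℝ) - P.pertDeg + (P.pertDeg - ((P.h : ℝ) - 1)) = 1 by ring, Real.rpow_one]

theorem pow_mul_g_eq (hq : q ∈ Z.dom) (hκ : 0 < q.1) :
    Z.scale q ^ P.h * P.g ((Z.scale q)⁻¹ * (Z.XY q).1) ((Z.scale q ^ P.h)⁻¹ * (Z.XY q).2) q.2.2.2
      (P.time (q.1 ^ (-(P.N : ℝ)))) =
      P.scaleVar q.1 ^ ((P.h : ℝ) - P.pertDeg) * Z.ratio q * Z.gs q := by
  have he := scale_pos hq hκ
  rw [← ratio_mul hq hκ, gs, pert, ← mul_assoc, ← rpow_add he]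
  congr 1
  rw [show (P.h : ℝ) - P.pertDeg + P.pertDeg = P.h by ring, rpow_natCast]

theorem fieldR_eq (hrc : -1 ≤ P.σ ∧ P.σ < (P.b : ℝ) / P.q) (hq : q ∈ Z.dom) (hκ : 0 < q.1) :
    P.fieldR q.2.1 q.2.2.1 q.2.2.2 (q.1 ^ (-(P.N : ℝ))) = Z.fieldA q := by
  have hδ : P.time (q.1 ^ (-(P.N : ℝ))) ^ (-P.scaleExp) < Z.δ₀ := by
    rw [P.time_rpow_neg_scaleExp hκ]; exact hq.1.2
  have he := scale_pos hq hκ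
  have ht := P.time_pos hκ
  have h1 := P.time_rpow_resonance hrc.2 hκ
  have h2 := P.two_mul_M_le_N hrc
  have hA := P.ampConst_pos
  have hν := P.ν_pos
  have hK : 0 < q.1 ^ P.M := pow_pos hκ _
  have hη := η_pos hq
  have hμ : P.time (q.1 ^ (-(P.N : ℝ))) ^ P.μ = (P.ampConst * q.1 ^ P.M)⁻¹ := by
    rw [← P.time_rpow_neg_μ hrc.2 hκ, rpow_neg ht.le, inv_inv]
  have h4 : P.time (q.1 ^ (-(P.N : ℝ))) ^ (1 - P.ν) =
      P.time (q.1 ^ (-(P.N : ℝ))) * (q.1 ^ P.N / P.ν) := by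
    rw [Real.rpow_sub ht, Real.rpow_one, P.time_rpow_ν hκ, rpow_neg hκ.le, rpow_natCast]
    field_simp
  have hh0 : (P.h : ℝ) ≠ 0 := by have := P.two_le_h; positivity
  have hNM : q.1 ^ (P.N - P.M) = q.1 ^ (P.N - 2 * P.M) * q.1 ^ P.M := by
    rw [← pow_add]; congr 1; omega
  have hN : q.1 ^ P.N = q.1 ^ (P.N - 2 * P.M) * q.1 ^ P.M * q.1 ^ P.M := by
    rw [← pow_add, ← pow_add]; congr 1; omega
  unfold fieldR
  rw [deriv_resonantEnergy_div ht hδ, energy_eq hrc.2 hq hκ,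
    mul_div_assoc (P.time (q.1 ^ (-(P.N : ℝ))) ^ (-(P.a : ℝ) / P.q)), F_scaled he (isWell_scale hq), P.rpow_neg_N_rpow hκ, P.time_rpow_neg_scaleExp hκ, hμ,
    P.time_rpow_neg_μ hrc.2 hκ, rpow_neg hκ.le, rpow_natCast]
  change _ * (_ + _ * (_ * (Z.scale q * P.f ((Z.scale q)⁻¹ * (Z.XY q).1)
    ((Z.scale q ^ P.h)⁻¹ * (Z.XY q).2) q.2.2.2 _ * P.scaledForce (Z.XY q).1 (Z.scale q) +
    Z.scale q ^ P.h * P.g ((Z.scale q)⁻¹ * (Z.XY q).1) ((Z.scale q ^ P.h)⁻¹ * (Z.XY q).2)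
      q.2.2.2 _ * (Z.XY q).2) - _)) = _
  rw [mul_f_eq hq hκ, pow_mul_g_eq hq hκ]
  obtain ⟨t, hte⟩ : ∃ t, t = P.time (q.1 ^ (-(P.N : ℝ))) := ⟨_, rfl⟩
  obtain ⟨D, hD⟩ : ∃ D, D = P.scaleVar q.1 ^ ((P.h : ℝ) - P.pertDeg) := ⟨_, rfl⟩
  obtain ⟨ta, hta⟩ : ∃ ta, ta = t ^ (-(P.a : ℝ) / P.q) := ⟨_, rfl⟩
  obtain ⟨tν, htν⟩ : ∃ tν, tν = t ^ (1 - P.ν) := ⟨_, rfl⟩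
  rw [← hte] at h1 h4 ⊢
  rw [← hD, ← hta, ← htν] at h1 ⊢
  rw [← htν] at h4
  have e1 : ∀ x, (q.1 ^ P.M)⁻¹ * tν * ((P.ampConst * q.1 ^ P.M)⁻¹ *
      (1 + P.ampConst * q.1 ^ P.M * q.2.1) / (2 * P.h) * (ta * (D * x))) =
      P.ampFactor q * P.ampConst / (2 * P.h) * x := fun x => by
    have : (q.1 ^ P.M)⁻¹ * tν * ((P.ampConst * q.1 ^ P.M)⁻¹ *
      (1 + P.ampConst * q.1 ^ P.M * q.2.1) / (2 * P.h) * (ta * (D * x))) =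
      (q.1 ^ P.M)⁻¹ * ((P.ampConst * q.1 ^ P.M)⁻¹ *
      (1 + P.ampConst * q.1 ^ P.M * q.2.1) / (2 * P.h)) * (tν * ta * D) * x := by ring
    rw [this, h1, ampFactor]
    field_simp
  have e2 : (q.1 ^ P.M)⁻¹ * tν * (P.μ * q.2.1 / t - (P.ampConst * q.1 ^ P.M)⁻¹ *
      (1 + P.ampConst * q.1 ^ P.M * q.2.1) / (2 * P.h) * (2 * P.h * (P.scaleExp / t) *
      (1 + P.scaleVar q.1 * deriv Z.η (P.scaleVar q.1) / Z.η (P.scaleVar q.1)))) = Z.driftR q := by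
    have ht' : t ≠ 0 := by rw [hte]; exact ht.ne'
    rw [h4, driftR, hNM, hN, ampFactor]
    field_simp
  rw [fieldA, ← e2]
  have e3 := e1 (Z.ratio q * Z.fs q * P.scaledForce (Z.XY q).1 (Z.scale q) +
    Z.ratio q * Z.gs q * (Z.XY q).2)
  linear_combination e3

theorem fieldΘ_eq (hrc : -1 ≤ P.σ ∧ P.σ < (P.b : ℝ) / P.q) (hq : q ∈ Z.dom) (hκ : 0 < q.1) :
    P.fieldΘ q.2.1 q.2.2.1 q.2.2.2 (q.1 ^ (-(P.N : ℝ))) = Z.fieldB q := by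
  have he := scale_pos hq hκ
  have ht := P.time_pos hκ
  have h1 := P.time_rpow_resonance hrc.2 hκ
  have hK : 0 < q.1 ^ P.M := pow_pos hκ _
  have hη := η_pos hq
  have hρ := ampFactor_pos hq
  have hδp := P.scaleVar_pos hκ
  have h5 := (Z.η_spec _ hq.1).2.2.1
  unfold fieldΘ
  obtain ⟨hX, hY⟩ := hasDerivAt_XY (scale_mem hq) (P.angle q)
  rw [energy_eq hrc.2 hq hκ, P.deriv_chirp_div_kap ht, P.time_rpow_neg_scaleExp hκ]
  change _ * (_ + _ * P.G ((Z.scale q ^ (2 * P.h))⁻¹) (P.angle q) _ _) = _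
  rw [G_scaled he (scale_mem hq).2 Z.well hX hY, (isWell_scale hq).freq_eq he,
    P.rpow_neg_N_rpow hκ, rpow_neg hκ.le, rpow_natCast]
  change _ * (_ + _ * (Z.scale q * P.f ((Z.scale q)⁻¹ * (Z.XY q).1)
    ((Z.scale q ^ P.h)⁻¹ * (Z.XY q).2) q.2.2.2 _ * Z.dYs q -
    Z.scale q ^ P.h * P.g ((Z.scale q)⁻¹ * (Z.XY q).1) ((Z.scale q ^ P.h)⁻¹ * (Z.XY q).2)
      q.2.2.2 _ * Z.dXs q)) = _
  rw [mul_f_eq hq hκ, pow_mul_g_eq hq hκ]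
  have h6 := P.time_rpow_one_sub_ν hκ
  have e2 : (q.1 ^ P.M)⁻¹ * P.scaleVar q.1 ^ (P.h - 1) * ((Z.scale q ^ (P.h - 1))⁻¹ *
      P.scaledFreq (Z.scale q) - P.resRatio * (P.scaleVar q.1 ^ (P.h - 1))⁻¹) =
      Z.detuning q / q.1 ^ P.M := by
    have h7 : Z.scale q ^ (P.h - 1) = P.scaleVar q.1 ^ (P.h - 1) *
        Z.η (P.scaleVar q.1) ^ (P.h - 1) / P.ampFactor q ^ (P.h - 1) := by
      rw [scale, resScale, div_pow, mul_pow]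
    have h8 : P.scaledFreq (Z.resScale q.1) =
      P.resRatio * Z.η (P.scaleVar q.1) ^ (P.h - 1) := h5
    rw [detuning, h7, h8]
    field_simp
  rw [fieldB, ← e2, ← h6]
  obtain ⟨D, hD⟩ : ∃ D, D = P.scaleVar q.1 ^ ((P.h : ℝ) - P.pertDeg) := ⟨_, rfl⟩
  obtain ⟨ta, hta⟩ : ∃ ta, ta = P.time (q.1 ^ (-(P.N : ℝ))) ^ (-(P.a : ℝ) / P.q) := ⟨_, rfl⟩
  obtain ⟨tν, htν⟩ : ∃ tν, tν = P.time (q.1 ^ (-(P.N : ℝ))) ^ (1 - P.ν) := ⟨_, rfl⟩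
  rw [← hD, ← hta, ← htν] at h1 ⊢
  have e1 : ∀ x, (q.1 ^ P.M)⁻¹ * tν * (ta * (D * x)) = q.1 ^ P.M * (P.ampConst ^ 2 * x) := by
    intro x
    have : (q.1 ^ P.M)⁻¹ * tν * (ta * (D * x)) = (q.1 ^ P.M)⁻¹ * (tν * ta * D) * x := by ring
    rw [this, h1]
    field_simp
  have e3 := e1 (Z.ratio q * Z.fs q * Z.dYs q - Z.ratio q * Z.gs q * Z.dXs q)
  linear_combination e3

/-! ### Smoothness -/

theorem contDiffOn_ratio : ContDiffOn ℝ ∞ Z.ratio Z.dom :=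
  (contDiffOn_η.div P.contDiff_ampFactor.contDiffOn fun _ hq => (ampFactor_pos hq).ne').rpow_const_of_ne
    fun _ hq => (div_pos (η_pos hq) (ampFactor_pos hq)).ne'

theorem contDiffOn_dXs : ContDiffOn ℝ ∞ Z.dXs Z.dom :=
  (contDiffOn_freq_scale.mul (contDiffOn_XY.fst.sub
    (contDiffOn_scale.mul contDiffOn_deriv_X))).div_const _

theorem contDiffOn_dYs : ContDiffOn ℝ ∞ Z.dYs Z.dom :=
  (contDiffOn_freq_scale.mul ((contDiffOn_const.mul contDiffOn_XY.snd).sub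
    (contDiffOn_scale.mul contDiffOn_deriv_Y))).div_const _

theorem contDiffOn_driftR : ContDiffOn ℝ ∞ Z.driftR Z.dom := by
  unfold driftR
  refine ContDiffOn.sub (by fun_prop) (ContDiffOn.mul ?_ (contDiffOn_const.add ?_))
  · exact (((P.contDiff_ampFactor.contDiffOn.mul contDiffOn_const).mul
      (contDiffOn_fst.pow _))).div_const _
  · exact ((P.contDiff_scaleVar.comp contDiff_fst).contDiffOn.mul contDiffOn_deriv_η).div
      contDiffOn_η fun q hq => (η_pos hq).ne'

theorem contDiffOn_detuning : ContDiffOn ℝ ∞ Z.detuning Z.dom := by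
  refine ContDiffOn.div (((P.contDiff_ampFactor.contDiffOn.pow _).mul contDiffOn_freq_scale).sub ?_)
    (contDiffOn_η.pow _) fun q hq => pow_ne_zero _ (η_pos hq).ne'
  exact (P.contDiffOn_scaledFreq isOpen_Ioo (well' (Z := Z))).comp contDiffOn_resScale
    fun q hq => resScale_mem hq

theorem contDiffOn_coeffA : ContDiffOn ℝ ∞ (fun q => P.ampFactor q * P.ampConst / (2 * P.h) *
      Z.ratio q * P.scaledForce (Z.XY q).1 (Z.scale q)) Z.dom ∧
    ContDiffOn ℝ ∞ (fun q => P.ampFactor q * P.ampConst / (2 * P.h) *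
      Z.ratio q * (Z.XY q).2) Z.dom := by
  have h1 : ContDiffOn ℝ ∞ (fun q => P.ampFactor q * P.ampConst / (2 * P.h) * Z.ratio q) Z.dom :=
    ((P.contDiff_ampFactor.contDiffOn.mul contDiffOn_const).div_const _).mul contDiffOn_ratio
  refine ⟨h1.mul ?_, h1.mul contDiffOn_XY.snd⟩
  exact P.contDiff_scaledForce.comp_contDiffOn (contDiffOn_XY.fst.prodMk contDiffOn_scale)

theorem contDiffOn_coeffB : ContDiffOn ℝ ∞ (fun q => P.ampConst ^ 2 * Z.ratio q * Z.dYs q) Z.dom ∧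
    ContDiffOn ℝ ∞ (fun q => -(P.ampConst ^ 2 * Z.ratio q * Z.dXs q)) Z.dom :=
  ⟨(contDiffOn_const.mul contDiffOn_ratio).mul contDiffOn_dYs,
    ((contDiffOn_const.mul contDiffOn_ratio).mul contDiffOn_dXs).neg⟩

theorem contDiffOn_fieldA : ContDiffOn ℝ ∞ Z.fieldA (Z.dom ∩ {q | 0 < q.1}) :=
  (contDiffOn_driftR.mono Set.inter_subset_left).add
    (((contDiffOn_coeffA.1.mono Set.inter_subset_left).mul (contDiffOn_pert P.f_smooth _)).add
      ((contDiffOn_coeffA.2.mono Set.inter_subset_left).mul (contDiffOn_pert P.g_smooth _)))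

theorem contDiffOn_fieldB : ContDiffOn ℝ ∞ Z.fieldB (Z.dom ∩ {q | 0 < q.1}) :=
  ((contDiffOn_detuning.mono Set.inter_subset_left).div (contDiffOn_fst.pow _)
      fun _ hq => pow_ne_zero _ (ne_of_gt hq.2)).add
    ((contDiffOn_fst.pow _).mul (contDiffOn_const.add
      (((contDiffOn_coeffB.1.mono Set.inter_subset_left).mul (contDiffOn_pert P.f_smooth _)).add
      ((contDiffOn_coeffB.2.mono Set.inter_subset_left).mul (contDiffOn_pert P.g_smooth _)))))

/-! ### Periodicity -/

theorem field_eq_of_angle {q' : Pt} (hq : q ∈ Z.dom) (hκ : 0 < q.1) (h1 : q'.1 = q.1)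
    (h2 : q'.2.1 = q.2.1) (ha : P.angle q' = P.angle q + 2 * Real.pi)
    (hf : ∀ x y t, 0 < t → P.f x y q'.2.2.2 t = P.f x y q.2.2.2 t)
    (hg : ∀ x y t, 0 < t → P.g x y q'.2.2.2 t = P.g x y q.2.2.2 t) :
    Z.fieldA q' = Z.fieldA q ∧ Z.fieldB q' = Z.fieldB q := by
  have e1 : P.ampFactor q' = P.ampFactor q := by unfold ampFactor; rw [h1, h2]
  have e2 : Z.scale q' = Z.scale q := by unfold scale; rw [h1, e1]
  have e3 : Z.XY q' = Z.XY q := by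
    unfold XY; rw [ha, e2]; exact (isWell_scale hq).scaledXY_periodic _
  have e4 : Z.ratio q' = Z.ratio q := by unfold ratio; rw [h1, e1]
  have ht := P.time_pos hκ
  have e5 : Z.fs q' = Z.fs q := by unfold fs pert; rw [e2, e3, h1, hf _ _ _ ht]
  have e6 : Z.gs q' = Z.gs q := by unfold gs pert; rw [e2, e3, h1, hg _ _ _ ht]
  have hev : ∀ᶠ e in 𝓝 (Z.scale q), P.scaledXY (P.angle q') e = P.scaledXY (P.angle q) e := by
    filter_upwards [isOpen_Ioo.mem_nhds (scale_mem hq)] with e he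
    rw [ha]; exact (well' e he).scaledXY_periodic _
  have e7 : Z.dXs q' = Z.dXs q := by
    unfold dXs
    rw [e2, e3, EventuallyEq.deriv_eq (hev.mono fun e he => by simp only [he] :
      (fun e => (P.scaledXY (P.angle q') e).1) =ᶠ[𝓝 (Z.scale q)] fun e =>
        (P.scaledXY (P.angle q) e).1)]
  have e8 : Z.dYs q' = Z.dYs q := by
    unfold dYs
    rw [e2, e3, EventuallyEq.deriv_eq (hev.mono fun e he => by simp only [he] :
      (fun e => (P.scaledXY (P.angle q') e).2) =ᶠ[𝓝 (Z.scale q)] fun e =>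
        (P.scaledXY (P.angle q) e).2)]
  unfold fieldA fieldB driftR detuning
  rw [e1, e2, e3, e4, e5, e6, e7, e8, h1, h2]
  exact ⟨rfl, rfl⟩

theorem field_periodic_angle (hq : q ∈ Z.dom) (hκ : 0 < q.1) :
    Z.fieldA (q.1, q.2.1, q.2.2.1 + 2 * Real.pi, q.2.2.2) = Z.fieldA q ∧
      Z.fieldB (q.1, q.2.1, q.2.2.1 + 2 * Real.pi, q.2.2.2) = Z.fieldB q :=
  field_eq_of_angle hq hκ rfl rfl (by simp only [angle]; ring) (fun _ _ _ _ => rfl)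
    fun _ _ _ _ => rfl

theorem field_periodic_phase (hq : q ∈ Z.dom) (hκ : 0 < q.1) :
    Z.fieldA (q.1, q.2.1, q.2.2.1, q.2.2.2 + 2 * Real.pi * P.kap) = Z.fieldA q ∧
      Z.fieldB (q.1, q.2.1, q.2.2.1, q.2.2.2 + 2 * Real.pi * P.kap) = Z.fieldB q := by
  have hk : (P.kap : ℝ) ≠ 0 := by have := P.kap_pos; positivity
  refine field_eq_of_angle hq hκ rfl rfl (by simp only [angle]; field_simp; ring)
    (fun x y t ht => ?_) fun x y t ht => ?_
  · have h1 : Function.Periodic (fun S => P.f x y S t) (2 * Real.pi) :=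
      fun S => P.f_periodic x y S t ht
    simpa [mul_comm] using h1.nat_mul P.kap q.2.2.2
  · have h1 : Function.Periodic (fun S => P.g x y S t) (2 * Real.pi) :=
      fun S => P.g_periodic x y S t ht
    simpa [mul_comm] using h1.nat_mul P.kap q.2.2.2

end ResonantScale

end ChirpedSystem

namespace ChirpedSystem

variable {P : ChirpedSystem}

namespace ResonantScale

variable {Z : P.ResonantScale}

theorem tendsto_detuning (hσ : P.σ < (P.b : ℝ) / P.q) (p : ℝ × ℝ × ℝ) :
    Tendsto (fun κ : ℝ => Z.detuning (κ, p) / κ ^ P.M) (𝓝[>] 0)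
      (𝓝 (P.resRatio * ((P.h : ℝ) - 1) * P.ampConst * p.1)) := by
  have hM := (P.M_cast hσ).2
  have hδ0 : (0 : ℝ) ∈ Ioo (-Z.δ₀) Z.δ₀ := ⟨by linarith [Z.δ₀_pos], Z.δ₀_pos⟩
  have he0 : (0 : ℝ) ∈ Ioo (-Z.e₀) Z.e₀ := ⟨by linarith [Z.e₀_pos], Z.e₀_pos⟩
  have hη0 := (Z.η_spec 0 hδ0).1
  have hfe := (Z.η_spec 0 hδ0).2.2.1
  rw [zero_mul] at hfe
  obtain ⟨Q, hQ⟩ : ∃ Q : ℝ × ℝ → ℝ, Q = fun v => v.1 ^ (P.h - 1) * P.scaledFreq (v.2 / v.1) :=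
    ⟨_, rfl⟩
  have hfs : ContDiffAt ℝ ∞ P.scaledFreq ((0 : ℝ) / 1) := by
    rw [zero_div]
    exact (P.contDiffOn_scaledFreq isOpen_Ioo (well' (Z := Z))).contDiffAt (isOpen_Ioo.mem_nhds he0)
  have hQs : ContDiffAt ℝ ∞ Q (1, 0) := by
    rw [hQ]
    refine (contDiffAt_fst.pow _).mul (ContDiffAt.comp (1, 0) (g := P.scaledFreq)
      (f := fun v : ℝ × ℝ => v.2 / v.1) hfs (contDiffAt_snd.div contDiffAt_fst one_ne_zero))
  have hst := hQs.hasStrictFDerivAt (by simp)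
  have hd : fderiv ℝ Q (1, 0) (1, 0) = ((P.h : ℝ) - 1) * P.scaledFreq 0 := by
    have h1 : HasDerivAt (fun x : ℝ => Q (x, 0)) (fderiv ℝ Q (1, 0) (1, 0)) 1 := by
      have := hst.hasFDerivAt.comp_hasDerivAt (1 : ℝ) (f := fun x : ℝ => (x, (0 : ℝ)))
        ((hasDerivAt_id (1 : ℝ)).prodMk (hasDerivAt_const _ _))
      exact this
    have h2 : HasDerivAt (fun x : ℝ => Q (x, 0)) (((P.h : ℝ) - 1) * P.scaledFreq 0) 1 := by
      simp only [hQ, zero_div]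
      have := (hasDerivAt_pow (P.h - 1) (1 : ℝ)).mul_const (P.scaledFreq 0)
      simpa [P.h_sub_one_cast] using this
    exact h1.unique h2
  have hcont : ContinuousAt (fun κ : ℝ => Z.resScale κ) 0 := by
    have h1 := P.contDiff_scaleVar.continuous.continuousAt (x := 0)
    have h2 : ContinuousAt Z.η (P.scaleVar 0) := by
      rw [P.scaleVar_zero]
      exact Z.η_smooth.continuousOn.continuousAt (isOpen_Ioo.mem_nhds hδ0)
    exact h1.mul (ContinuousAt.comp (f := P.scaleVar) h2 h1)
  have hr0 : Z.resScale 0 = 0 := by unfold resScale; rw [P.scaleVar_zero, zero_mul]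
  have t1 : Tendsto (fun κ : ℝ => ((P.ampFactor (κ, p), Z.resScale κ), ((1 : ℝ), Z.resScale κ)))
      (𝓝[>] 0) (𝓝 ((1, 0), (1, 0))) := by
    refine Tendsto.mono_left ?_ nhdsWithin_le_nhds
    rw [ContinuousAt, hr0] at hcont
    have h1 : Tendsto (fun κ : ℝ => P.ampFactor (κ, p)) (𝓝 0) (𝓝 1) := by
      have h2 : Continuous fun κ : ℝ => P.ampFactor (κ, p) :=
        P.contDiff_ampFactor.continuous.comp (by fun_prop)
      have h3 : P.ampFactor (0, p) = 1 := by
        simp only [ampFactor]; rw [zero_pow (by omega)]; ring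
      have h4 := h2.tendsto 0
      rwa [h3] at h4
    exact (h1.prodMk_nhds hcont).prodMk_nhds (tendsto_const_nhds.prodMk_nhds hcont)
  have o1 := hst.isLittleO.comp_tendsto t1
  have o2 : (fun κ : ℝ => Q (P.ampFactor (κ, p), Z.resScale κ) - Q (1, Z.resScale κ) -
      P.ampConst * κ ^ P.M * p.1 * (((P.h : ℝ) - 1) * P.scaledFreq 0)) =o[𝓝[>] 0]
      fun κ : ℝ => κ ^ P.M := by
    refine (o1.congr_left fun κ => ?_).trans_isBigO ?_
    · simp only [Function.comp]
      rw [← hd]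
      have : ((P.ampFactor (κ, p), Z.resScale κ) - ((1 : ℝ), Z.resScale κ) : ℝ × ℝ) =
          (P.ampConst * κ ^ P.M * p.1) • ((1 : ℝ), (0 : ℝ)) := by
        ext <;> simp [ampFactor]
      rw [this, map_smul, smul_eq_mul]
    · refine IsBigO.of_bound (P.ampConst * |p.1|) ?_
      filter_upwards [self_mem_nhdsWithin] with κ hκ
      have hκ' : (0 : ℝ) < κ := hκ
      have hA := P.ampConst_pos
      have : ((P.ampFactor (κ, p), Z.resScale κ) - ((1 : ℝ), Z.resScale κ) : ℝ × ℝ) =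
          (P.ampConst * κ ^ P.M * p.1, 0) := by
        ext <;> simp [ampFactor]
      simp only [Function.comp]
      rw [this, Prod.norm_mk, norm_zero, max_eq_left (norm_nonneg _), norm_eq_abs, abs_mul,
        abs_mul, abs_of_pos hA, abs_of_pos (pow_pos hκ' _), Real.norm_of_nonneg (pow_pos hκ' _).le]
      exact le_of_eq (by ring)
  have t2 := o2.tendsto_div_nhds_zero
  have t3 : Tendsto (fun κ : ℝ => Z.η (P.scaleVar κ) ^ (P.h - 1)) (𝓝[>] 0)
      (𝓝 (Z.η 0 ^ (P.h - 1))) := by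
    refine Tendsto.mono_left ?_ nhdsWithin_le_nhds
    have h1 := P.contDiff_scaleVar.continuous.tendsto 0
    rw [P.scaleVar_zero] at h1
    exact ((Z.η_smooth.continuousOn.continuousAt (isOpen_Ioo.mem_nhds hδ0)).tendsto.comp h1).pow _
  have t4 := (t2.add_const (P.ampConst * p.1 * (((P.h : ℝ) - 1) * P.scaledFreq 0))).div t3
    (pow_pos hη0 _).ne'
  have e1 : (0 + P.ampConst * p.1 * (((P.h : ℝ) - 1) * P.scaledFreq 0)) / Z.η 0 ^ (P.h - 1) =
      P.resRatio * ((P.h : ℝ) - 1) * P.ampConst * p.1 := by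
    rw [hfe]; field_simp; ring
  rw [e1] at t4
  refine t4.congr' ?_
  filter_upwards [self_mem_nhdsWithin] with κ hκ
  have hκ' : (0 : ℝ) < κ := hκ
  have hk : κ ^ P.M ≠ 0 := (pow_pos hκ' _).ne'
  simp only [hQ, one_pow, one_mul, div_one, Pi.div_apply, detuning, scale]
  field_simp
  ring

theorem exists_hasExp_fieldA (hσ : P.σ < (P.b : ℝ) / P.q) :
    ∃ c, HasExp (fun κ p => Z.fieldA (κ, p)) c :=
  exists_hasExp_linear hσ contDiffOn_driftR contDiffOn_coeffA.1 contDiffOn_coeffA.2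

theorem exists_hasExp_fieldB (hσ : P.σ < (P.b : ℝ) / P.q) :
    ∃ c, HasExp (fun κ p => Z.fieldB (κ, p)) c := by
  have h1 := HasExp.of_contDiffOn Z.isOpen_dom (Z.zero_mem_dom hσ) contDiffOn_detuning
  have h2 := h1.shift (M := P.M) fun K hK p => by
    refine h1.eq_zero_of_isBigO (m := P.M) ?_ K hK
    have h3 := (tendsto_detuning (Z := Z) hσ p).isBigO_one ℝ
    refine (h3.mul (isBigO_refl (fun κ : ℝ => κ ^ P.M) _)).congr' ?_ (by simp)
    filter_upwards [self_mem_nhdsWithin] with κ hκ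
    have hκ' : (0 : ℝ) < κ := hκ
    field_simp
  obtain ⟨c, hc⟩ := exists_hasExp_linear (Z := Z) hσ (c₀ := fun _ => 0) contDiffOn_const
    contDiffOn_coeffB.1 contDiffOn_coeffB.2
  obtain ⟨c', hc'⟩ := hc.pow_mul P.M
  exact ⟨_, h2.add hc'⟩

end ResonantScale

/-! ### The expansions of the fields -/

theorem eventually_field_eq (Z : P.ResonantScale) (hrc : -1 ≤ P.σ ∧ P.σ < (P.b : ℝ) / P.q)
    {S : Set (ℝ × ℝ × ℝ)} (hS : IsCompact S) :
    ∀ᶠ q : Pt in smallOn S, (q ∈ Z.dom ∧ 0 < q.1) ∧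
      P.fieldR q.2.1 q.2.2.1 q.2.2.2 (q.1 ^ (-(P.N : ℝ))) = Z.fieldA q ∧
      P.fieldΘ q.2.1 q.2.2.1 q.2.2.2 (q.1 ^ (-(P.N : ℝ))) = Z.fieldB q := by
  filter_upwards [eventually_smallOn_mem Z.isOpen_dom (Z.zero_mem_dom hrc.2) hS,
    eventually_smallOn_fst (Q := fun κ => 0 < κ) self_mem_nhdsWithin] with q h1 h2
  exact ⟨⟨h1, h2⟩, ResonantScale.fieldR_eq hrc h1 h2, ResonantScale.fieldΘ_eq hrc h1 h2⟩

theorem HasExp.expansionCoeff_eq {E : Type} [NormedAddCommGroup E] [NormedSpace ℝ E]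
    {w : E → ℝ → ℝ} {c : ℕ → E → ℝ}
    (h : HasExp (fun κ p => w p (κ ^ (-(P.N : ℝ)))) c) :
    HasExp (fun κ p => w p (κ ^ (-(P.N : ℝ)))) fun K p => expansionCoeff P.N (w p) K := by
  have h1 : (fun K p => expansionCoeff P.N (w p) K) = c := by
    ext K p
    exact _root_.expansionCoeff_eq P.N_cast.2 (c := fun K => c K p) (fun m =>
      isBigO_at_of_smallOn (h.2 m {p} isCompact_singleton) (Set.mem_singleton p)) K
  rwa [h1]

theorem hasExp_fieldR (hrc : -1 ≤ P.σ ∧ P.σ < (P.b : ℝ) / P.q) :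
    HasExp (fun κ (p : ℝ × ℝ × ℝ) => P.fieldR p.1 p.2.1 p.2.2 (κ ^ (-(P.N : ℝ))))
      fun K p => P.coeffR K p.1 p.2.1 p.2.2 := by
  obtain ⟨Z⟩ := P.nonempty_resonantScale
  obtain ⟨c, hc⟩ := ResonantScale.exists_hasExp_fieldA (Z := Z) hrc.2
  exact HasExp.expansionCoeff_eq (w := fun (p : ℝ × ℝ × ℝ) τ => P.fieldR p.1 p.2.1 p.2.2 τ)
    (hc.congr fun S hS => (eventually_field_eq Z hrc hS).mono fun q hq => hq.2.1.symm)

theorem hasExp_fieldΘ (hrc : -1 ≤ P.σ ∧ P.σ < (P.b : ℝ) / P.q) :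
    HasExp (fun κ (p : ℝ × ℝ × ℝ) => P.fieldΘ p.1 p.2.1 p.2.2 (κ ^ (-(P.N : ℝ))))
      fun K p => P.coeffΘ K p.1 p.2.1 p.2.2 := by
  obtain ⟨Z⟩ := P.nonempty_resonantScale
  obtain ⟨c, hc⟩ := ResonantScale.exists_hasExp_fieldB (Z := Z) hrc.2
  exact HasExp.expansionCoeff_eq (w := fun (p : ℝ × ℝ × ℝ) τ => P.fieldΘ p.1 p.2.1 p.2.2 τ)
    (hc.congr fun S hS => (eventually_field_eq Z hrc hS).mono fun q hq => hq.2.2.symm)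

/-- Periodicity and smoothness of the fields for large times. -/
theorem exists_field_regular (hrc : -1 ≤ P.σ ∧ P.σ < (P.b : ℝ) / P.q) (r₁ : ℝ) :
    ∃ κ₀ > 0, (∀ κ, 0 < κ → κ < κ₀ → ∀ r, |r| ≤ r₁ → ∀ θ ζ,
        P.fieldR r (θ + 2 * Real.pi) ζ (κ ^ (-(P.N : ℝ))) = P.fieldR r θ ζ (κ ^ (-(P.N : ℝ))) ∧
        P.fieldΘ r (θ + 2 * Real.pi) ζ (κ ^ (-(P.N : ℝ))) = P.fieldΘ r θ ζ (κ ^ (-(P.N : ℝ))) ∧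
        P.fieldR r θ (ζ + 2 * Real.pi * P.kap) (κ ^ (-(P.N : ℝ))) =
          P.fieldR r θ ζ (κ ^ (-(P.N : ℝ))) ∧
        P.fieldΘ r θ (ζ + 2 * Real.pi * P.kap) (κ ^ (-(P.N : ℝ))) =
          P.fieldΘ r θ ζ (κ ^ (-(P.N : ℝ)))) ∧
      ∃ O : Set Pt, IsOpen O ∧ (∀ κ, 0 < κ → κ < κ₀ → ∀ r, |r| ≤ r₁ → ∀ θ ζ, (κ, r, θ, ζ) ∈ O) ∧
        ContDiffOn ℝ ∞ (fun q : Pt => P.fieldR q.2.1 q.2.2.1 q.2.2.2 (q.1 ^ (-(P.N : ℝ)))) O ∧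
        ContDiffOn ℝ ∞ (fun q : Pt => P.fieldΘ q.2.1 q.2.2.1 q.2.2.2 (q.1 ^ (-(P.N : ℝ)))) O := by
  obtain ⟨Z⟩ := P.nonempty_resonantScale
  have hS : IsCompact (Icc (-r₁) r₁ ×ˢ ({0} : Set ℝ) ×ˢ ({0} : Set ℝ)) :=
    isCompact_Icc.prod (isCompact_singleton.prod isCompact_singleton)
  obtain ⟨κ₀, hκ₀, h⟩ := eventually_smallOn.1
    (eventually_smallOn_mem Z.isOpen_dom (Z.zero_mem_dom hrc.2) hS)
  have hmem : ∀ κ, 0 < κ → κ < κ₀ → ∀ r, |r| ≤ r₁ → ∀ θ ζ, (κ, r, θ, ζ) ∈ Z.dom :=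
    fun κ k0 k1 r hr θ ζ => h κ k0 k1 (r, 0, 0) ⟨abs_le.1 hr, rfl, rfl⟩
  refine ⟨κ₀, hκ₀, fun κ k0 k1 r hr θ ζ => ?_, Z.dom ∩ {q | 0 < q.1},
    Z.isOpen_dom.inter (isOpen_lt continuous_const continuous_fst),
    fun κ k0 k1 r hr θ ζ => ⟨hmem κ k0 k1 r hr θ ζ, k0⟩, ?_, ?_⟩
  · have hq := hmem κ k0 k1 r hr
    have eA : ∀ θ ζ, P.fieldR r θ ζ (κ ^ (-(P.N : ℝ))) = Z.fieldA (κ, r, θ, ζ) := fun θ ζ =>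
      ResonantScale.fieldR_eq hrc (hq θ ζ) k0
    have eB : ∀ θ ζ, P.fieldΘ r θ ζ (κ ^ (-(P.N : ℝ))) = Z.fieldB (κ, r, θ, ζ) := fun θ ζ =>
      ResonantScale.fieldΘ_eq hrc (hq θ ζ) k0
    have h1 := ResonantScale.field_periodic_angle (hq θ ζ) k0
    have h2 := ResonantScale.field_periodic_phase (hq θ ζ) k0
    rw [eA, eA, eA, eB, eB, eB]
    exact ⟨h1.1, h1.2, h2.1, h2.2⟩
  · exact ResonantScale.contDiffOn_fieldA.congr fun q hq =>
      ResonantScale.fieldR_eq hrc hq.1 hq.2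
  · exact ResonantScale.contDiffOn_fieldB.congr fun q hq =>
      ResonantScale.fieldΘ_eq hrc hq.1 hq.2

theorem coeff_eq_of_eventually {E : Type} [NormedAddCommGroup E] [NormedSpace ℝ E]
    {w : ℝ → E → ℝ} {c : ℕ → E → ℝ} (h : HasExp w c) {p p' : E}
    (he : ∀ᶠ κ in 𝓝[>] (0 : ℝ), w κ p = w κ p') (K : ℕ) : c K p = c K p' := by
  refine h.coeff_unique h (m := K + 1) ?_ K (by omega)
  refine IsBigO.congr' (isBigO_zero _ _) (he.mono fun κ hκ => ?_) EventuallyEq.rfl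
  simp only [hκ, sub_self]

theorem coeff_periodic (hrc : -1 ≤ P.σ ∧ P.σ < (P.b : ℝ) / P.q) (K : ℕ) (r θ ζ : ℝ) :
    P.coeffR K r (θ + 2 * Real.pi) ζ = P.coeffR K r θ ζ ∧
      P.coeffΘ K r (θ + 2 * Real.pi) ζ = P.coeffΘ K r θ ζ ∧
      P.coeffR K r θ (ζ + 2 * Real.pi * P.kap) = P.coeffR K r θ ζ ∧
      P.coeffΘ K r θ (ζ + 2 * Real.pi * P.kap) = P.coeffΘ K r θ ζ := by
  obtain ⟨κ₀, hκ₀, h, -⟩ := exists_field_regular hrc |r|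
  have hev : ∀ᶠ κ in 𝓝[>] (0 : ℝ), κ ∈ Ioo 0 κ₀ := Ioo_mem_nhdsGT hκ₀
  exact ⟨coeff_eq_of_eventually (hasExp_fieldR hrc) (p := (r, θ + 2 * Real.pi, ζ)) (p' := (r, θ, ζ))
      (hev.mono fun κ hκ => (h κ hκ.1 hκ.2 r le_rfl θ ζ).1) K,
    coeff_eq_of_eventually (hasExp_fieldΘ hrc) (p := (r, θ + 2 * Real.pi, ζ)) (p' := (r, θ, ζ))
      (hev.mono fun κ hκ => (h κ hκ.1 hκ.2 r le_rfl θ ζ).2.1) K,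
    coeff_eq_of_eventually (hasExp_fieldR hrc) (p := (r, θ, ζ + 2 * Real.pi * P.kap))
      (p' := (r, θ, ζ)) (hev.mono fun κ hκ => (h κ hκ.1 hκ.2 r le_rfl θ ζ).2.2.1) K,
    coeff_eq_of_eventually (hasExp_fieldΘ hrc) (p := (r, θ, ζ + 2 * Real.pi * P.kap))
      (p' := (r, θ, ζ)) (hev.mono fun κ hκ => (h κ hκ.1 hκ.2 r le_rfl θ ζ).2.2.2) K⟩

/-- Up to `O(κ^M)` the phase equation is autonomous and does not contain the phase. -/
theorem isBigO_fieldΘ_sub (hrc : -1 ≤ P.σ ∧ P.σ < (P.b : ℝ) / P.q) (Z : P.ResonantScale)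
    (p : ℝ × ℝ × ℝ) :
    (fun κ : ℝ => P.fieldΘ p.1 p.2.1 p.2.2 (κ ^ (-(P.N : ℝ))) - Z.detuning (κ, p) / κ ^ P.M)
      =O[𝓝[>] 0] fun κ => κ ^ P.M := by
  obtain ⟨c, hc⟩ := ResonantScale.exists_hasExp_linear (Z := Z) hrc.2 (c₀ := fun _ => 0)
    contDiffOn_const ResonantScale.contDiffOn_coeffB.1 ResonantScale.contDiffOn_coeffB.2
  have h1 := isBigO_at_of_smallOn (hc.2 0 {p} isCompact_singleton) (Set.mem_singleton p)
  simp only [Finset.range_zero, Finset.sum_empty, sub_zero, pow_zero] at h1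
  refine ((isBigO_refl (fun κ : ℝ => κ ^ P.M) _).mul h1).congr' ?_ (by simp)
  have h2 := eventually_smallOn.1 (eventually_field_eq Z hrc (isCompact_singleton (x := p)))
  obtain ⟨κ₀, hκ₀, h⟩ := h2
  filter_upwards [Ioo_mem_nhdsGT hκ₀] with κ hκ
  have h3 := (h κ hκ.1 hκ.2 p rfl).2.2
  simp only at h3
  rw [h3, ResonantScale.fieldB]
  ring

theorem coeffΘ_eq_of_lt (hrc : -1 ≤ P.σ ∧ P.σ < (P.b : ℝ) / P.q) {K : ℕ} (hK : K < P.M)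
    (r θ ζ θ' ζ' : ℝ) : P.coeffΘ K r θ ζ = P.coeffΘ K r θ' ζ' := by
  obtain ⟨Z⟩ := P.nonempty_resonantScale
  have h1 := isBigO_fieldΘ_sub hrc Z (r, θ, ζ)
  have h2 := isBigO_fieldΘ_sub hrc Z (r, θ', ζ')
  refine (hasExp_fieldΘ hrc).coeff_unique (hasExp_fieldΘ hrc) (p := (r, θ, ζ)) (p' := (r, θ', ζ'))
    ((h1.sub h2).congr_left fun κ => ?_) K hK
  have : Z.detuning (κ, r, θ, ζ) = Z.detuning (κ, r, θ', ζ') := rfl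
  rw [this]; ring

theorem coeffΘ_zero_of_lt (hrc : -1 ≤ P.σ ∧ P.σ < (P.b : ℝ) / P.q) {K : ℕ} (hK : K < P.M)
    (θ ζ : ℝ) : P.coeffΘ K 0 θ ζ = 0 := by
  obtain ⟨Z⟩ := P.nonempty_resonantScale
  refine (hasExp_fieldΘ hrc).eq_zero_of_isBigO (p := (0, θ, ζ))
    ((isBigO_fieldΘ_sub hrc Z (0, θ, ζ)).congr_left fun κ => ?_) K hK
  have h1 : P.ampFactor (κ, 0, θ, ζ) = 1 := by simp [ampFactor]
  rw [ResonantScale.detuning, ResonantScale.scale, h1]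
  simp

theorem coeffΘ_zero (hrc : -1 ≤ P.σ ∧ P.σ < (P.b : ℝ) / P.q) (r θ ζ : ℝ) :
    P.coeffΘ 0 r θ ζ = P.resRatio * ((P.h : ℝ) - 1) * P.ampConst * r := by
  obtain ⟨Z⟩ := P.nonempty_resonantScale
  have hM := (P.M_cast hrc.2).2
  have h1 := isBigO_at_of_smallOn ((hasExp_fieldΘ hrc).2 1 {(r, θ, ζ)} isCompact_singleton)
    (Set.mem_singleton (r, θ, ζ))
  have h2 := isBigO_fieldΘ_sub hrc Z (r, θ, ζ)
  have z1 : Tendsto (fun κ : ℝ => κ ^ 1) (𝓝[>] 0) (𝓝 0) := by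
    simp only [pow_one]
    exact tendsto_id.mono_left nhdsWithin_le_nhds
  have z2 : Tendsto (fun κ : ℝ => κ ^ P.M) (𝓝[>] 0) (𝓝 0) := by
    have := ((continuous_pow P.M).tendsto (0 : ℝ)).mono_left (nhdsWithin_le_nhds (s := Set.Ioi 0))
    rwa [zero_pow (by omega)] at this
  have h3 := h1.trans_tendsto z1
  have h4 := h2.trans_tendsto z2
  have h5 := (h4.sub h3).add (ResonantScale.tendsto_detuning (Z := Z) hrc.2 (r, θ, ζ))
  have h6 : Tendsto (fun _ : ℝ => P.coeffΘ 0 r θ ζ) (𝓝[>] 0)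
      (𝓝 (0 - 0 + P.resRatio * ((P.h : ℝ) - 1) * P.ampConst * r)) := by
    refine h5.congr fun κ => ?_
    simp
  have h7 := tendsto_nhds_unique h6 tendsto_const_nhds
  rw [← h7]; ring

end ChirpedSystem

/-! ### Products and shifts of expansions -/

section

variable {E : Type} [NormedAddCommGroup E] [NormedSpace ℝ E]

theorem HasExp.poly {a : ℕ → E → ℝ} (ha : ∀ K, ContDiff ℝ ∞ (a K)) (n : ℕ) :
    HasExp (fun κ p => ∑ K ∈ range n, κ ^ K * a K p) fun K p => if K < n then a K p else 0 := by
  refine ⟨fun K => ?_, fun m S hS => ?_⟩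
  · by_cases h : K < n <;> simp only [h, if_true, if_false]
    · exact ha K
    · exact contDiff_const
  · have h1 : (fun q : ℝ × E => ∑ K ∈ range n, q.1 ^ K * a K q.2 - ∑ K ∈ range m,
        q.1 ^ K * (if K < n then a K q.2 else 0)) = fun q : ℝ × E =>
        ∑ K ∈ (range n).filter (fun K => ¬K < m), q.1 ^ K * a K q.2 := by
      ext q
      rw [← Finset.sum_filter_add_sum_filter_not (range n) (fun K => K < m)]
      have h2 : ∑ K ∈ range m, q.1 ^ K * (if K < n then a K q.2 else 0) =
          ∑ K ∈ (range n).filter (fun K => K < m), q.1 ^ K * a K q.2 := by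
        simp only [mul_ite, mul_zero]
        rw [← Finset.sum_filter]
        refine sum_congr ?_ fun _ _ => rfl
        ext K; simp [and_comm]
      rw [h2]; ring
    rw [h1]
    refine IsBigO.fun_sum fun K hK => isBigO_pow_mul_coeff_smallOn hS (ha K).continuous ?_
    simpa using (Finset.mem_filter.1 hK).2

theorem HasExp.const {a : E → ℝ} (ha : ContDiff ℝ ∞ a) :
    HasExp (fun _ p => a p) fun K p => if K = 0 then a p else 0 := by
  have := HasExp.poly (a := fun _ => a) (fun _ => ha) 1
  simpa [Nat.lt_one_iff] using this

theorem HasExp.isBigO_one {w : ℝ → E → ℝ} {c : ℕ → E → ℝ} (h : HasExp w c) {S : Set E}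
    (hS : IsCompact S) : (fun q : ℝ × E => w q.1 q.2) =O[smallOn S] fun _ => (1 : ℝ) := by
  simpa using h.2 0 S hS

theorem HasExp.neg {w : ℝ → E → ℝ} {c : ℕ → E → ℝ} (h : HasExp w c) :
    HasExp (fun κ p => -w κ p) fun K p => -c K p := by
  refine ⟨fun K => (h.1 K).neg, fun m S hS => ((h.2 m S hS).neg_left).congr_left fun q => ?_⟩
  simp only [mul_neg, Finset.sum_neg_distrib]
  ring

theorem HasExp.sub {w w' : ℝ → E → ℝ} {c c' : ℕ → E → ℝ} (h : HasExp w c) (h' : HasExp w' c') :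
    HasExp (fun κ p => w κ p - w' κ p) fun K p => c K p - c' K p := by
  simpa only [sub_eq_add_neg] using h.add h'.neg

theorem HasExp.pow_mul_shift {w : ℝ → E → ℝ} {c : ℕ → E → ℝ} (h : HasExp w c) (M : ℕ) :
    HasExp (fun κ p => κ ^ M * w κ p) fun K p => if M ≤ K then c (K - M) p else 0 := by
  refine ⟨fun K => ?_, fun m S hS => ?_⟩
  · by_cases hK : M ≤ K <;> simp only [hK, if_true, if_false]
    · exact h.1 _
    · exact contDiff_const
  · have h1 := (isBigO_refl (fun q : ℝ × E => q.1 ^ M) (smallOn S)).mul (h.2 m S hS)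
    have h2 : (fun q : ℝ × E => ∑ K ∈ range M, q.1 ^ (K + m) * (if M ≤ K + m then
        c (K + m - M) q.2 else 0)) =O[smallOn S] fun q => q.1 ^ m := by
      refine IsBigO.fun_sum fun K _ => isBigO_pow_mul_coeff_smallOn hS
        (c := fun p => if M ≤ K + m then c (K + m - M) p else 0) ?_ (by omega)
      split_ifs
      · exact (h.1 _).continuous
      · exact continuous_const
    have h3 : (fun q : ℝ × E => q.1 ^ M * q.1 ^ m) =O[smallOn S] fun q => q.1 ^ m := by
      simpa only [← pow_add] using isBigO_pow_smallOn S (Nat.le_add_left m M)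
    refine ((h1.trans h3).add h2).congr_left fun q => ?_
    have h4 : ∑ K ∈ range (M + m), q.1 ^ K * (if M ≤ K then c (K - M) q.2 else 0) =
        q.1 ^ M * ∑ K ∈ range m, q.1 ^ K * c K q.2 := by
      rw [Finset.sum_range_add, Finset.sum_eq_zero, zero_add, mul_sum]
      · refine sum_congr rfl fun K _ => ?_
        rw [if_pos (by omega), Nat.add_sub_cancel_left, pow_add, mul_assoc]
      · intro K hK
        rw [if_neg (by have := mem_range.1 hK; omega), mul_zero]
    have h5 : ∑ K ∈ range (M + m), q.1 ^ K * (if M ≤ K then c (K - M) q.2 else 0) =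
        ∑ K ∈ range m, q.1 ^ K * (if M ≤ K then c (K - M) q.2 else 0) +
        ∑ K ∈ range M, q.1 ^ (K + m) * (if M ≤ K + m then c (K + m - M) q.2 else 0) := by
      rw [add_comm M m, Finset.sum_range_add]
      simp only [add_comm m]
    rw [mul_sub, ← h4, h5]
    ring

theorem sum_range_mul_sum_range {a b : ℕ → ℝ} (m : ℕ) (κ : ℝ) :
    (∑ i ∈ range m, κ ^ i * a i) * (∑ j ∈ range m, κ ^ j * b j) =
      ∑ K ∈ range m, κ ^ K * ∑ ij ∈ Finset.HasAntidiagonal.antidiagonal K, a ij.1 * b ij.2 +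
      ∑ ij ∈ (range m ×ˢ range m).filter (fun ij => ¬ij.1 + ij.2 < m),
        κ ^ (ij.1 + ij.2) * (a ij.1 * b ij.2) := by
  rw [Finset.sum_mul_sum, ← Finset.sum_product',
    ← Finset.sum_filter_add_sum_filter_not _ (fun ij : ℕ × ℕ => ij.1 + ij.2 < m)]
  congr 1
  · rw [← Finset.sum_fiberwise_of_maps_to (t := range m) (g := fun ij : ℕ × ℕ => ij.1 + ij.2)
      (fun ij h => mem_range.2 (Finset.mem_filter.1 h).2)]
    refine sum_congr rfl fun K hK => ?_
    rw [mul_sum]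
    refine sum_congr ?_ fun ij hij => ?_
    · ext ij
      simp only [Finset.mem_filter, Finset.mem_product, mem_range,
        Finset.HasAntidiagonal.mem_antidiagonal] at hK ⊢
      omega
    · rw [← Finset.HasAntidiagonal.mem_antidiagonal.1 hij, pow_add]; ring
  · refine sum_congr rfl fun ij _ => ?_
    rw [pow_add]; ring

theorem HasExp.mul {w w' : ℝ → E → ℝ} {c c' : ℕ → E → ℝ} (h : HasExp w c) (h' : HasExp w' c') :
    HasExp (fun κ p => w κ p * w' κ p) fun K p =>
      ∑ ij ∈ Finset.HasAntidiagonal.antidiagonal K, c ij.1 p * c' ij.2 p := by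
  refine ⟨fun K => ContDiff.sum fun ij _ => (h.1 _).mul (h'.1 _), fun m S hS => ?_⟩
  have h1 := (h.2 m S hS).mul (h'.isBigO_one hS)
  have h2 : (fun q : ℝ × E => ∑ K ∈ range m, q.1 ^ K * c K q.2) =O[smallOn S]
      fun _ => (1 : ℝ) := by
    have := IsBigO.fun_sum (s := range m) fun K _ =>
      isBigO_pow_mul_coeff_smallOn hS (h.1 K).continuous (Nat.zero_le K)
    simpa using this
  have h3 := h2.mul (h'.2 m S hS)
  have h4 : (fun q : ℝ × E => ∑ ij ∈ (range m ×ˢ range m).filter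
      (fun ij => ¬ij.1 + ij.2 < m), q.1 ^ (ij.1 + ij.2) * (c ij.1 q.2 * c' ij.2 q.2)) =O[smallOn S]
      fun q => q.1 ^ m := by
    refine IsBigO.fun_sum fun ij hij => isBigO_pow_mul_coeff_smallOn hS
      (c := fun p => c ij.1 p * c' ij.2 p) ((h.1 _).mul (h'.1 _)).continuous ?_
    have := (Finset.mem_filter.1 hij).2
    omega
  simp only [mul_one, one_mul] at h1 h3
  refine ((h1.add h3).add h4).congr_left fun q => ?_
  have h5 := sum_range_mul_sum_range (a := fun i => c i q.2) (b := fun i => c' i q.2) m q.1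
  simp only at h5 ⊢
  linear_combination -h5

end

/-! ### Partial derivatives of smooth functions -/

theorem contDiff_deriv_one {G : ℝ × ℝ × ℝ → ℝ} (hG : ContDiff ℝ ∞ G) :
    ContDiff ℝ ∞ fun p : ℝ × ℝ × ℝ => deriv (fun r => G (r, p.2)) p.1 :=
  contDiffOn_univ.1 (contDiffOn_deriv_fst isOpen_univ hG.contDiffOn)

theorem contDiff_deriv_two {G : ℝ × ℝ × ℝ → ℝ} (hG : ContDiff ℝ ∞ G) :
    ContDiff ℝ ∞ fun p : ℝ × ℝ × ℝ => deriv (fun θ => G (p.1, θ, p.2.2)) p.2.1 := by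
  have h1 : ContDiff ℝ ∞ fun v : ℝ × ℝ × ℝ => G (v.2.1, v.1, v.2.2) :=
    hG.comp (by fun_prop : ContDiff ℝ ∞ fun v : ℝ × ℝ × ℝ => (v.2.1, v.1, v.2.2))
  have h2 := contDiffOn_univ.1 (contDiffOn_deriv_fst isOpen_univ h1.contDiffOn)
  exact h2.comp (by fun_prop : ContDiff ℝ ∞ fun p : ℝ × ℝ × ℝ => (p.2.1, p.1, p.2.2))

namespace ChirpedSystem

variable {P : ChirpedSystem}

/-! ### Means and corrections -/

theorem kap_cast_pos : (0 : ℝ) < P.kap := by exact_mod_cast P.kap_pos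

theorem phase_period_pos : 0 < 2 * Real.pi * P.kap := by
  have := P.kap_cast_pos
  positivity

theorem contDiff_mean {E : Type} [NormedAddCommGroup E] [NormedSpace ℝ E] [ProperSpace E]
    {f : E × ℝ → ℝ} (hf : ContDiff ℝ ∞ f) : ContDiff ℝ ∞ fun p => P.mean fun ζ => f (p, ζ) := by
  unfold mean
  exact contDiff_const.mul (contDiff_intervalIntegral hf _ _)

theorem contDiff_correction {E : Type} [NormedAddCommGroup E] [NormedSpace ℝ E] [ProperSpace E]
    {f : E × ℝ → ℝ} (hf : ContDiff ℝ ∞ f) :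
    ContDiff ℝ ∞ fun v : E × ℝ => P.correction (fun ζ => f (v.1, ζ)) v.2 := by
  have h1 : ContDiff ℝ ∞ fun v : E × ℝ => f v - P.mean fun ζ => f (v.1, ζ) :=
    hf.sub ((contDiff_mean hf).comp contDiff_fst)
  have h2 : ContDiff ℝ ∞ fun v : E × ℝ => -(1 / P.vartheta) *
      ∫ x in (0 : ℝ)..v.2, (f (v.1, x) - P.mean fun ζ => f (v.1, ζ)) := by
    refine contDiff_const.mul (contDiff_intervalIntegral_upper
      (f := fun z : (E × ℝ) × ℝ => f (z.1.1, z.2) - P.mean fun ζ => f (z.1.1, ζ)) ?_ contDiff_snd)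
    exact h1.comp (by fun_prop : ContDiff ℝ ∞ fun z : (E × ℝ) × ℝ => (z.1.1, z.2))
  unfold correction
  exact h2.sub ((contDiff_mean h2).comp contDiff_fst)

theorem mean_const (c : ℝ) : P.mean (fun _ => c) = c := by
  have := kap_cast_pos (P := P)
  unfold mean
  rw [intervalIntegral.integral_const, smul_eq_mul, sub_zero]
  field_simp

theorem hasDerivAt_correction {w : ℝ → ℝ} (hw : Continuous w) (ζ : ℝ) :
    HasDerivAt (P.correction w) ((P.mean w - w ζ) / P.vartheta) ζ := by
  have h1 : Continuous fun x => w x - P.mean w := hw.sub continuous_const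
  have h2 := (intervalIntegral.integral_hasDerivAt_right (h1.intervalIntegrable 0 ζ)
    (h1.stronglyMeasurableAtFilter _ _) h1.continuousAt).const_mul (-(1 / P.vartheta))
  unfold correction
  refine (h2.sub_const _).congr_deriv ?_
  have := P.vartheta_pos
  field_simp
  ring

theorem correction_periodic {w : ℝ → ℝ} (hw : Continuous w)
    (hp : ∀ ζ, w (ζ + 2 * Real.pi * P.kap) = w ζ) (ζ : ℝ) :
    P.correction w (ζ + 2 * Real.pi * P.kap) = P.correction w ζ := by
  have h1 : Continuous fun x => w x - P.mean w := hw.sub continuous_const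
  have hper : Function.Periodic (fun x => w x - P.mean w) (2 * Real.pi * P.kap) := fun x => by
    simp only [hp]
  have h2 := hper.intervalIntegral_add_eq ζ 0
  have h3 : ∫ x in (0 : ℝ)..0 + 2 * Real.pi * P.kap, (w x - P.mean w) = 0 := by
    rw [zero_add, intervalIntegral.integral_sub (hw.intervalIntegrable _ _)
      (continuous_const.intervalIntegrable _ _), intervalIntegral.integral_const, smul_eq_mul, sub_zero]
    have := kap_cast_pos (P := P)
    unfold mean
    field_simp
    ring
  have h4 := intervalIntegral.integral_add_adjacent_intervals (h1.intervalIntegrable 0 ζ)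
    (h1.intervalIntegrable (μ := MeasureTheory.volume) ζ (ζ + 2 * Real.pi * P.kap))
  unfold correction
  simp only
  rw [← h4, h2, h3, add_zero]

end ChirpedSystem

/-- Smoothness and periodicity of the averaging coefficients. -/
structure AvgCoeff.Regular (c : AvgCoeff) (T : ℝ) : Prop where
  Λ_smooth : ContDiff ℝ ∞ fun v : ℝ × ℝ => c.Λ v.1 v.2
  Ω_smooth : ContDiff ℝ ∞ fun v : ℝ × ℝ => c.Ω v.1 v.2
  ρ_smooth : ContDiff ℝ ∞ fun p : ℝ × ℝ × ℝ => c.ρ p.1 p.2.1 p.2.2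
  ψ_smooth : ContDiff ℝ ∞ fun p : ℝ × ℝ × ℝ => c.ψ p.1 p.2.1 p.2.2
  Λ_periodic : ∀ r θ, c.Λ r (θ + 2 * Real.pi) = c.Λ r θ
  Ω_periodic : ∀ r θ, c.Ω r (θ + 2 * Real.pi) = c.Ω r θ
  ρ_periodic : ∀ r θ ζ, c.ρ r (θ + 2 * Real.pi) ζ = c.ρ r θ ζ
  ψ_periodic : ∀ r θ ζ, c.ψ r (θ + 2 * Real.pi) ζ = c.ψ r θ ζ
  ρ_phase : ∀ r θ ζ, c.ρ r θ (ζ + T) = c.ρ r θ ζ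
  ψ_phase : ∀ r θ ζ, c.ψ r θ (ζ + T) = c.ψ r θ ζ

theorem AvgCoeff.regular_zero (T : ℝ) : AvgCoeff.zero.Regular T := by
  constructor <;> first | exact contDiff_const | (intros; rfl)

namespace ChirpedSystem

variable {P : ChirpedSystem}

theorem lowerOrder_congr (hM : 1 ≤ P.M) {K : ℕ} {c c' : ℕ → AvgCoeff} (h : ∀ j < K, c j = c' j)
    (χ : AvgCoeff → ℝ → ℝ → ℝ → ℝ) (Γ : AvgCoeff → ℝ → ℝ → ℝ) (r θ ζ : ℝ) :
    P.lowerOrder K c χ Γ r θ ζ = P.lowerOrder K c' χ Γ r θ ζ := by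
  have hN := P.N_cast.2
  unfold lowerOrder
  congr 1
  · congr 1
    · by_cases hK : P.M ≤ K
      · rw [if_pos hK, if_pos hK]
        refine sum_congr rfl fun ij hij => ?_
        have := Finset.HasAntidiagonal.mem_antidiagonal.1 hij
        rw [h ij.2 (by omega)]
      · rw [if_neg hK, if_neg hK]
    · by_cases hK : P.N ≤ K
      · rw [if_pos hK, if_pos hK, h (K - P.N) (by omega)]
      · rw [if_neg hK, if_neg hK]
  · congr 2
    ext ε
    refine sum_congr rfl fun j hj => ?_
    rw [h j (mem_range.1 hj)]
    congr 2 <;> refine congrArg _ (sum_congr rfl fun i hi => ?_) <;>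
      rw [h i (mem_range.1 hi)]

/-- The composed sum in the definition of `lowerOrder`. -/
def composed (K n : ℕ) (c : ℕ → AvgCoeff) (Γ : AvgCoeff → ℝ → ℝ → ℝ) (ε : ℝ)
    (p : ℝ × ℝ × ℝ) : ℝ :=
  ∑ j ∈ range K, ε ^ j *
    Γ (c j) (p.1 + ∑ i ∈ range n, ε ^ (P.M + i) * (c i).ρ p.1 p.2.1 p.2.2)
      (p.2.1 + ∑ i ∈ range n, ε ^ (P.M + i) * (c i).ψ p.1 p.2.1 p.2.2)

theorem contDiff_composed (K n : ℕ) {c : ℕ → AvgCoeff} {T : ℝ} (hc : ∀ j, (c j).Regular T)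
    {Γ : AvgCoeff → ℝ → ℝ → ℝ} (hΓ : ∀ j, ContDiff ℝ ∞ fun v : ℝ × ℝ => Γ (c j) v.1 v.2) :
    ContDiff ℝ ∞ fun q : Pt => composed (P := P) K n c Γ q.1 q.2 := by
  unfold composed
  refine ContDiff.sum fun j _ => (contDiff_fst.pow j).mul ((hΓ j).comp (f := fun q : Pt =>
    (q.2.1 + ∑ i ∈ range n, q.1 ^ (P.M + i) * (c i).ρ q.2.1 q.2.2.1 q.2.2.2,
      q.2.2.1 + ∑ i ∈ range n, q.1 ^ (P.M + i) * (c i).ψ q.2.1 q.2.2.1 q.2.2.2)) ?_)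
  refine ContDiff.prodMk (ContDiff.add (by fun_prop) (ContDiff.sum fun i _ => ?_))
    (ContDiff.add (by fun_prop) (ContDiff.sum fun i _ => ?_))
  · exact (contDiff_fst.pow _).mul ((hc i).ρ_smooth.comp contDiff_snd)
  · exact (contDiff_fst.pow _).mul ((hc i).ψ_smooth.comp contDiff_snd)

theorem contDiff_lowerOrder (hrc : -1 ≤ P.σ ∧ P.σ < (P.b : ℝ) / P.q) (K : ℕ) {c : ℕ → AvgCoeff}
    {T : ℝ} (hc : ∀ j, (c j).Regular T)
    {χ : AvgCoeff → ℝ → ℝ → ℝ → ℝ} {Γ : AvgCoeff → ℝ → ℝ → ℝ}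
    (hχ : ∀ j, ContDiff ℝ ∞ fun p : ℝ × ℝ × ℝ => χ (c j) p.1 p.2.1 p.2.2)
    (hΓ : ∀ j, ContDiff ℝ ∞ fun v : ℝ × ℝ => Γ (c j) v.1 v.2) :
    ContDiff ℝ ∞ fun p : ℝ × ℝ × ℝ => P.lowerOrder K c χ Γ p.1 p.2.1 p.2.2 := by
  unfold lowerOrder
  refine ContDiff.sub (ContDiff.sub ?_ ?_) (ContDiff.div_const ?_ _)
  · split_ifs
    · refine ContDiff.sum fun ij _ => ContDiff.add ?_ ?_
      · exact ((hasExp_fieldR hrc).1 _).mul (contDiff_deriv_one (hχ ij.2))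
      · exact ((hasExp_fieldΘ hrc).1 _).mul (contDiff_deriv_two (hχ ij.2))
    · exact contDiff_const
  · split_ifs
    · exact contDiff_const.mul (hχ _)
    · exact contDiff_const
  · exact contDiff_iteratedDeriv_zero isOpen_univ (fun _ => trivial)
      (contDiff_composed (P := P) K K hc hΓ).contDiffOn K

theorem lowerOrder_periodic (hrc : -1 ≤ P.σ ∧ P.σ < (P.b : ℝ) / P.q) (K : ℕ) {c : ℕ → AvgCoeff}
    (hc : ∀ j, (c j).Regular (2 * Real.pi * P.kap))
    {χ : AvgCoeff → ℝ → ℝ → ℝ → ℝ} {Γ : AvgCoeff → ℝ → ℝ → ℝ}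
    (hχ : ∀ j r θ ζ, χ (c j) r (θ + 2 * Real.pi) ζ = χ (c j) r θ ζ)
    (hχ' : ∀ j r θ ζ, χ (c j) r θ (ζ + 2 * Real.pi * P.kap) = χ (c j) r θ ζ)
    (hΓ : ∀ j r θ, Γ (c j) r (θ + 2 * Real.pi) = Γ (c j) r θ) (r θ ζ : ℝ) :
    P.lowerOrder K c χ Γ r (θ + 2 * Real.pi) ζ = P.lowerOrder K c χ Γ r θ ζ ∧
      P.lowerOrder K c χ Γ r θ (ζ + 2 * Real.pi * P.kap) = P.lowerOrder K c χ Γ r θ ζ := by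
  unfold lowerOrder
  constructor
  · have h1 : ∀ j, deriv (fun θ' => χ (c j) r θ' ζ) (θ + 2 * Real.pi) =
        deriv (fun θ' => χ (c j) r θ' ζ) θ := fun j => by
      rw [← deriv_comp_add_const]; simp only [hχ]
    simp only [(coeff_periodic hrc _ r θ ζ).1, (coeff_periodic hrc _ r θ ζ).2.1, h1, hχ,
      (hc _).ρ_periodic, (hc _).ψ_periodic]
    congr 3
    ext ε
    refine sum_congr rfl fun j _ => ?_
    rw [add_right_comm, hΓ]
  · simp only [(coeff_periodic hrc _ r θ ζ).2.2.1, (coeff_periodic hrc _ r θ ζ).2.2.2, hχ',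
      (hc _).ρ_phase, (hc _).ψ_phase]

theorem regular_of_source {w w' : ℝ → ℝ → ℝ → ℝ}
    (hw : ContDiff ℝ ∞ fun p : ℝ × ℝ × ℝ => w p.1 p.2.1 p.2.2)
    (hw' : ContDiff ℝ ∞ fun p : ℝ × ℝ × ℝ => w' p.1 p.2.1 p.2.2)
    (h1 : ∀ r θ ζ, w r (θ + 2 * Real.pi) ζ = w r θ ζ)
    (h1' : ∀ r θ ζ, w' r (θ + 2 * Real.pi) ζ = w' r θ ζ)
    (h2 : ∀ r θ ζ, w r θ (ζ + 2 * Real.pi * P.kap) = w r θ ζ)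
    (h2' : ∀ r θ ζ, w' r θ (ζ + 2 * Real.pi * P.kap) = w' r θ ζ) :
    (AvgCoeff.mk (fun r θ => P.mean (w r θ)) (fun r θ => P.mean (w' r θ))
      (fun r θ => P.correction (w r θ)) (fun r θ => P.correction (w' r θ))).Regular
      (2 * Real.pi * P.kap) := by
  have hre : ContDiff ℝ ∞ fun v : (ℝ × ℝ) × ℝ => (v.1.1, v.1.2, v.2) := by fun_prop
  have hre' : ContDiff ℝ ∞ fun p : ℝ × ℝ × ℝ => ((p.1, p.2.1), p.2.2) := by fun_prop
  have s1 : ContDiff ℝ ∞ fun v : (ℝ × ℝ) × ℝ => w v.1.1 v.1.2 v.2 := hw.comp hre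
  have s2 : ContDiff ℝ ∞ fun v : (ℝ × ℝ) × ℝ => w' v.1.1 v.1.2 v.2 := hw'.comp hre
  have h3 : ∀ r θ, w r (θ + 2 * Real.pi) = w r θ := fun r θ => funext (h1 r θ)
  have h3' : ∀ r θ, w' r (θ + 2 * Real.pi) = w' r θ := fun r θ => funext (h1' r θ)
  refine ⟨contDiff_mean s1, contDiff_mean s2, (contDiff_correction s1).comp hre',
    (contDiff_correction s2).comp hre', fun r θ => ?_, fun r θ => ?_, fun r θ ζ => ?_,
    fun r θ ζ => ?_, fun r θ => correction_periodic ?_ (h2 r θ),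
    fun r θ => correction_periodic ?_ (h2' r θ)⟩
  · simp only [h3]
  · simp only [h3']
  · simp only [h3]
  · simp only [h3']
  · exact hw.continuous.comp (by fun_prop : Continuous fun ζ : ℝ => (r, θ, ζ))
  · exact hw'.continuous.comp (by fun_prop : Continuous fun ζ : ℝ => (r, θ, ζ))

theorem contDiff_source (hrc : -1 ≤ P.σ ∧ P.σ < (P.b : ℝ) / P.q) (K : ℕ) {c : ℕ → AvgCoeff}
    {T : ℝ} (hc : ∀ j, (c j).Regular T) :
    (ContDiff ℝ ∞ fun p : ℝ × ℝ × ℝ => P.coeffR K p.1 p.2.1 p.2.2 +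
      P.lowerOrder K c AvgCoeff.ρ AvgCoeff.Λ p.1 p.2.1 p.2.2) ∧
    ContDiff ℝ ∞ fun p : ℝ × ℝ × ℝ => P.coeffΘ K p.1 p.2.1 p.2.2 +
      P.lowerOrder K c AvgCoeff.ψ AvgCoeff.Ω p.1 p.2.1 p.2.2 :=
  ⟨((hasExp_fieldR hrc).1 K).add (contDiff_lowerOrder hrc K hc (χ := AvgCoeff.ρ)
    (Γ := AvgCoeff.Λ) (fun j => (hc j).ρ_smooth) fun j => (hc j).Λ_smooth),
    ((hasExp_fieldΘ hrc).1 K).add (contDiff_lowerOrder hrc K hc (χ := AvgCoeff.ψ)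
    (Γ := AvgCoeff.Ω) (fun j => (hc j).ψ_smooth) fun j => (hc j).Ω_smooth)⟩

theorem regular_avgStep (hrc : -1 ≤ P.σ ∧ P.σ < (P.b : ℝ) / P.q) (K : ℕ) {c : ℕ → AvgCoeff}
    (hc : ∀ j, (c j).Regular (2 * Real.pi * P.kap)) :
    (P.avgStep K c).Regular (2 * Real.pi * P.kap) := by
  have p1 := lowerOrder_periodic hrc K hc (χ := AvgCoeff.ρ) (Γ := AvgCoeff.Λ)
    (fun j => (hc j).ρ_periodic) (fun j => (hc j).ρ_phase) fun j => (hc j).Λ_periodic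
  have p2 := lowerOrder_periodic hrc K hc (χ := AvgCoeff.ψ) (Γ := AvgCoeff.Ω)
    (fun j => (hc j).ψ_periodic) (fun j => (hc j).ψ_phase) fun j => (hc j).Ω_periodic
  exact regular_of_source
    (w := fun r θ ζ => P.coeffR K r θ ζ + P.lowerOrder K c AvgCoeff.ρ AvgCoeff.Λ r θ ζ)
    (w' := fun r θ ζ => P.coeffΘ K r θ ζ + P.lowerOrder K c AvgCoeff.ψ AvgCoeff.Ω r θ ζ)
    (contDiff_source hrc K hc).1 (contDiff_source hrc K hc).2
    (fun r θ ζ => by rw [(coeff_periodic hrc K r θ ζ).1, (p1 r θ ζ).1])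
    (fun r θ ζ => by rw [(coeff_periodic hrc K r θ ζ).2.1, (p2 r θ ζ).1])
    (fun r θ ζ => by rw [(coeff_periodic hrc K r θ ζ).2.2.1, (p1 r θ ζ).2])
    (fun r θ ζ => by rw [(coeff_periodic hrc K r θ ζ).2.2.2, (p2 r θ ζ).2])

theorem regular_avg (hrc : -1 ≤ P.σ ∧ P.σ < (P.b : ℝ) / P.q) (K : ℕ) :
    (P.avg K).Regular (2 * Real.pi * P.kap) := by
  induction K using Nat.strong_induction_on with
  | _ K ih =>
  rw [avg]
  refine regular_avgStep hrc K fun j => ?_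
  split_ifs with hj
  · exact ih j hj
  · exact AvgCoeff.regular_zero _

/-- The functions that are averaged. -/
def sourceR (P : ChirpedSystem) (K : ℕ) (r θ ζ : ℝ) : ℝ :=
  P.coeffR K r θ ζ + P.lowerOrder K P.avg AvgCoeff.ρ AvgCoeff.Λ r θ ζ

def sourceΘ (P : ChirpedSystem) (K : ℕ) (r θ ζ : ℝ) : ℝ :=
  P.coeffΘ K r θ ζ + P.lowerOrder K P.avg AvgCoeff.ψ AvgCoeff.Ω r θ ζ

theorem avg_eq (hσ : P.σ < (P.b : ℝ) / P.q) (K : ℕ) : P.avg K = ⟨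
    fun r θ => P.mean (P.sourceR K r θ), fun r θ => P.mean (P.sourceΘ K r θ),
    fun r θ => P.correction (P.sourceR K r θ), fun r θ => P.correction (P.sourceΘ K r θ)⟩ := by
  have h1 := lowerOrder_congr (P.M_cast hσ).2 (K := K)
    (c := fun j => if _hj : j < K then P.avg j else AvgCoeff.zero) (c' := P.avg)
    fun j hj => dif_pos hj
  rw [avg, avgStep]
  simp only [h1]
  rfl

theorem continuous_source (hrc : -1 ≤ P.σ ∧ P.σ < (P.b : ℝ) / P.q) (K : ℕ) (r θ : ℝ) :
    Continuous (P.sourceR K r θ) ∧ Continuous (P.sourceΘ K r θ) := by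
  have h0 : Continuous fun ζ : ℝ => (r, θ, ζ) := by fun_prop
  have h1 := contDiff_source hrc K (regular_avg hrc)
  have h2 : ContDiff ℝ ∞ fun p : ℝ × ℝ × ℝ => P.sourceR K p.1 p.2.1 p.2.2 := h1.1
  have h3 : ContDiff ℝ ∞ fun p : ℝ × ℝ × ℝ => P.sourceΘ K p.1 p.2.1 p.2.2 := h1.2
  exact ⟨h2.continuous.comp (f := fun ζ : ℝ => (r, θ, ζ)) h0,
    h3.continuous.comp (f := fun ζ : ℝ => (r, θ, ζ)) h0⟩

theorem hasDerivAt_ρ (hrc : -1 ≤ P.σ ∧ P.σ < (P.b : ℝ) / P.q) (K : ℕ) (r θ ζ : ℝ) :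
    HasDerivAt ((P.avg K).ρ r θ) ((P.Λ K r θ - P.sourceR K r θ ζ) / P.vartheta) ζ := by
  have h1 := hasDerivAt_correction (P := P) (continuous_source hrc K r θ).1 ζ
  rw [Λ, avg_eq hrc.2]
  exact h1

theorem hasDerivAt_ψ (hrc : -1 ≤ P.σ ∧ P.σ < (P.b : ℝ) / P.q) (K : ℕ) (r θ ζ : ℝ) :
    HasDerivAt ((P.avg K).ψ r θ) ((P.Ω K r θ - P.sourceΘ K r θ ζ) / P.vartheta) ζ := by
  have h1 := hasDerivAt_correction (P := P) (continuous_source hrc K r θ).2 ζ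
  rw [Ω, avg_eq hrc.2]
  exact h1

theorem lowerOrder_eq_zero (hrc : -1 ≤ P.σ ∧ P.σ < (P.b : ℝ) / P.q) {K : ℕ} (hK : K < P.M)
    (r θ ζ : ℝ) : P.lowerOrder K P.avg AvgCoeff.ψ AvgCoeff.Ω r θ ζ = 0 := by
  have hN := P.two_mul_M_le_N hrc
  have hc := regular_avg hrc
  unfold lowerOrder
  rw [if_neg (by omega), if_neg (by omega), sub_zero, zero_sub, neg_eq_zero]
  have h1 := HasExp.of_contDiffOn isOpen_univ (fun _ => trivial) (contDiff_composed (P := P) K K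
    (Γ := AvgCoeff.Ω) hc fun j => (hc j).Ω_smooth).contDiffOn
  have h2 := HasExp.poly (a := fun j (p : ℝ × ℝ × ℝ) => P.Ω j p.1 p.2.1)
    (fun j => (hc j).Ω_smooth.comp (by fun_prop : ContDiff ℝ ∞ fun p : ℝ × ℝ × ℝ => (p.1, p.2.1))) K
  have h3 := h1.coeff_unique h2 (p := (r, θ, ζ)) (p' := (r, θ, ζ)) (m := P.M) ?_ K hK
  · simp only [lt_irrefl, if_false] at h3
    exact h3
  · have h4 : ContDiff ℝ ∞ fun x : ℝ => ∑ j ∈ range K, 1 * x ^ j := by fun_prop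
    have key : ∀ j, (fun κ : ℝ => (P.avg j).Ω
        (r + ∑ i ∈ range K, κ ^ (P.M + i) * (P.avg i).ρ r θ ζ)
        (θ + ∑ i ∈ range K, κ ^ (P.M + i) * (P.avg i).ψ r θ ζ) - P.Ω j r θ) =O[𝓝[>] 0]
        fun κ => κ ^ P.M := fun j => by
      have h5 : HasFDerivAt (fun v : ℝ × ℝ => (P.avg j).Ω v.1 v.2) _ (r, θ) :=
        ((hc j).Ω_smooth.differentiable (by simp) (r, θ)).hasFDerivAt
      have hsum : ∀ f : ℕ → ℝ, (fun κ : ℝ => ∑ i ∈ range K, κ ^ (P.M + i) * f i) =O[𝓝[>] 0]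
          fun κ => κ ^ P.M := fun f => by
        refine IsBigO.fun_sum fun i _ => ?_
        have := (isBigO_pow_nhdsGT (Nat.le_add_right P.M i)).const_mul_left (f i)
        simpa only [mul_comm] using this
      have hlim : ∀ f : ℕ → ℝ, Tendsto (fun κ : ℝ => ∑ i ∈ range K, κ ^ (P.M + i) * f i)
          (𝓝[>] 0) (𝓝 0) := fun f => by
        refine (hsum f).trans_tendsto ?_
        have := ((continuous_pow P.M).tendsto (0 : ℝ)).mono_left
          (nhdsWithin_le_nhds (s := Set.Ioi 0))
        rwa [zero_pow (by omega)] at this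
      have h6 : Tendsto (fun κ : ℝ =>
          (r + ∑ i ∈ range K, κ ^ (P.M + i) * (P.avg i).ρ r θ ζ,
          θ + ∑ i ∈ range K, κ ^ (P.M + i) * (P.avg i).ψ r θ ζ)) (𝓝[>] 0) (𝓝 (r, θ)) := by
        have a1 := (hlim fun i => (P.avg i).ρ r θ ζ).const_add r
        have a2 := (hlim fun i => (P.avg i).ψ r θ ζ).const_add θ
        rw [add_zero] at a1 a2
        exact a1.prodMk_nhds a2
      have h7 := h5.isBigO_sub.comp_tendsto h6
      refine h7.trans ?_
      have h8 := (hsum fun i => (P.avg i).ρ r θ ζ).prod_left (hsum fun i => (P.avg i).ψ r θ ζ)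
      refine h8.congr_left fun κ => ?_
      simp
    refine (IsBigO.fun_sum (s := range K) (A := fun j κ => κ ^ j * ((P.avg j).Ω
        (r + ∑ i ∈ range K, κ ^ (P.M + i) * (P.avg i).ρ r θ ζ)
        (θ + ∑ i ∈ range K, κ ^ (P.M + i) * (P.avg i).ψ r θ ζ) - P.Ω j r θ))
        fun j _ => ?_).congr_left fun κ => ?_
    · have h9 := (isBigO_pow_nhdsGT (Nat.zero_le j)).mul (key j)
      simpa only [pow_zero, one_mul] using h9
    · simp only [composed, mul_sub, Finset.sum_sub_distrib]

/-- The leading terms of the averaged phase equation. -/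
theorem Ω_eq_of_lt (hrc : -1 ≤ P.σ ∧ P.σ < (P.b : ℝ) / P.q) {K : ℕ} (hK : K < P.M) (R Ψ : ℝ) :
    P.Ω K R Ψ = P.coeffΘ K R 0 0 := by
  rw [Ω, avg_eq hrc.2]
  have h1 : P.sourceΘ K R Ψ = fun _ => P.coeffΘ K R 0 0 := by
    ext ζ
    rw [sourceΘ, lowerOrder_eq_zero hrc hK, add_zero, coeffΘ_eq_of_lt hrc hK R Ψ ζ 0 0]
  simp only [h1, mean_const]

end ChirpedSystem

theorem isBigO_comp_sub_comp {Γ : ℝ × ℝ → ℝ} (hΓ : ContDiff ℝ ∞ Γ) {x₀ : ℝ × ℝ} {l : Filter ℝ}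
    {u v : ℝ → ℝ × ℝ} {g : ℝ → ℝ} (hu : Tendsto u l (𝓝 x₀)) (hv : Tendsto v l (𝓝 x₀))
    (h : (fun κ => v κ - u κ) =O[l] g) : (fun κ => Γ (v κ) - Γ (u κ)) =O[l] g := by
  have h1 := (hΓ.contDiffAt (x := x₀)).hasStrictFDerivAt (by simp)
  have h2 := h1.isBigO_sub.comp_tendsto (hv.prodMk_nhds hu)
  exact h2.trans h

theorem isBigO_sum_pow {M m : ℕ} (f : ℕ → ℝ) {s : Finset ℕ} (hs : ∀ i ∈ s, m ≤ M + i) : (fun κ : ℝ => ∑ i ∈ s, κ ^ (M + i) * f i) =O[𝓝[>] 0] fun κ => κ ^ m := by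
  refine IsBigO.fun_sum fun i hi => ?_
  have := (isBigO_pow_nhdsGT (hs i hi)).const_mul_left (f i)
  simpa only [mul_comm] using this

namespace ChirpedSystem

variable {P : ChirpedSystem}

/-- What the averaging of the amplitude (`b₁ = 1`, `b₂ = 0`) and of the phase (`b₁ = 0`, `b₂ = 1`)
have in common. -/
structure Channel (P : ChirpedSystem) (b₁ b₂ : ℝ) (χ : AvgCoeff → ℝ → ℝ → ℝ → ℝ)
    (Γ : AvgCoeff → ℝ → ℝ → ℝ) : Prop where
  χ_smooth : ∀ j, ContDiff ℝ ∞ fun p : ℝ × ℝ × ℝ => χ (P.avg j) p.1 p.2.1 p.2.2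
  Γ_smooth : ∀ j, ContDiff ℝ ∞ fun v : ℝ × ℝ => Γ (P.avg j) v.1 v.2
  χ_periodic : ∀ j r θ ζ, χ (P.avg j) r (θ + 2 * Real.pi) ζ = χ (P.avg j) r θ ζ
  χ_phase : ∀ j r θ ζ, χ (P.avg j) r θ (ζ + 2 * Real.pi * P.kap) = χ (P.avg j) r θ ζ
  Γ_periodic : ∀ j r θ, Γ (P.avg j) r (θ + 2 * Real.pi) = Γ (P.avg j) r θ
  hasDerivAt : ∀ K r θ ζ, HasDerivAt (χ (P.avg K) r θ) ((Γ (P.avg K) r θ -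
    (b₁ * P.coeffR K r θ ζ + b₂ * P.coeffΘ K r θ ζ + P.lowerOrder K P.avg χ Γ r θ ζ)) /
      P.vartheta) ζ

theorem channelR (hrc : -1 ≤ P.σ ∧ P.σ < (P.b : ℝ) / P.q) :
    P.Channel 1 0 AvgCoeff.ρ AvgCoeff.Λ := by
  have hc := regular_avg hrc
  refine ⟨fun j => (hc j).ρ_smooth, fun j => (hc j).Λ_smooth, fun j => (hc j).ρ_periodic,
    fun j => (hc j).ρ_phase, fun j => (hc j).Λ_periodic, fun K r θ ζ => ?_⟩
  have h := hasDerivAt_ρ hrc K r θ ζ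
  rw [one_mul, zero_mul, add_zero]
  exact h

theorem channelΘ (hrc : -1 ≤ P.σ ∧ P.σ < (P.b : ℝ) / P.q) :
    P.Channel 0 1 AvgCoeff.ψ AvgCoeff.Ω := by
  have hc := regular_avg hrc
  refine ⟨fun j => (hc j).ψ_smooth, fun j => (hc j).Ω_smooth, fun j => (hc j).ψ_periodic,
    fun j => (hc j).ψ_phase, fun j => (hc j).Ω_periodic, fun K r θ ζ => ?_⟩
  have h := hasDerivAt_ψ hrc K r θ ζ
  rw [one_mul, zero_mul, zero_add]
  exact h

namespace Channel

variable {b₁ b₂ : ℝ} {χ : AvgCoeff → ℝ → ℝ → ℝ → ℝ} {Γ : AvgCoeff → ℝ → ℝ → ℝ}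

/-- The Taylor coefficients of the full composition in terms of the partial ones. -/
theorem composed_coeff (hrc : -1 ≤ P.σ ∧ P.σ < (P.b : ℝ) / P.q) (hch : P.Channel b₁ b₂ χ Γ)
    {n K : ℕ} (hK : K < n) (p : ℝ × ℝ × ℝ) :
    iteratedDeriv K (fun ε => composed (P := P) n n P.avg Γ ε p) 0 / K.factorial =
      iteratedDeriv K (fun ε => composed (P := P) K K P.avg Γ ε p) 0 / K.factorial +
        Γ (P.avg K) p.1 p.2.1 := by
  have hc := regular_avg hrc
  have hM := (P.M_cast hrc.2).2
  have e1 := HasExp.of_contDiffOn isOpen_univ (fun _ => trivial)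
    (contDiff_composed (P := P) n n hc hch.Γ_smooth).contDiffOn
  have e2 := HasExp.of_contDiffOn isOpen_univ (fun _ => trivial)
    (contDiff_composed (P := P) K K hc hch.Γ_smooth).contDiffOn
  have e3 := (HasExp.const (a := fun p : ℝ × ℝ × ℝ => Γ (P.avg K) p.1 p.2.1)
    ((hch.Γ_smooth K).comp (by fun_prop : ContDiff ℝ ∞ fun p : ℝ × ℝ × ℝ => (p.1, p.2.1)))).pow_mul_shift K
  have h := e1.coeff_unique (e2.add e3) (p := p) (p' := p) (m := K + 1) ?_ K (by omega)
  · simpa using h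
  obtain ⟨v, hv⟩ : ∃ v : ℕ → ℝ → ℝ × ℝ, v = fun m κ =>
    (p.1 + ∑ i ∈ range m, κ ^ (P.M + i) * (P.avg i).ρ p.1 p.2.1 p.2.2,
      p.2.1 + ∑ i ∈ range m, κ ^ (P.M + i) * (P.avg i).ψ p.1 p.2.1 p.2.2) := ⟨_, rfl⟩
  have hsub : ∀ m, (fun κ => v m κ - (p.1, p.2.1)) =O[𝓝[>] 0] fun κ => κ ^ P.M := fun m => by
    refine ((isBigO_sum_pow (M := P.M) (m := P.M) (fun i => (P.avg i).ρ p.1 p.2.1 p.2.2)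
      (s := range m) (fun i _ => by omega)).prod_left
      (isBigO_sum_pow (M := P.M) (m := P.M) (fun i => (P.avg i).ψ p.1 p.2.1 p.2.2)
      (s := range m) (fun i _ => by omega))).congr_left fun κ => ?_
    simp [hv]
  have hlim : ∀ m, Tendsto (v m) (𝓝[>] 0) (𝓝 (p.1, p.2.1)) := fun m => by
    have h1 := ((continuous_pow P.M).tendsto (0 : ℝ)).mono_left (nhdsWithin_le_nhds (s := Set.Ioi 0))
    rw [zero_pow (by omega)] at h1
    simpa using ((hsub m).trans_tendsto h1).add_const (p.1, p.2.1)
  have hdiff : (fun κ => v n κ - v K κ) =O[𝓝[>] 0] fun κ => κ ^ (K + 1) := by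
    refine ((isBigO_sum_pow (M := P.M) (m := K + 1) (fun i => (P.avg i).ρ p.1 p.2.1 p.2.2)
      (s := Finset.Ico K n) (fun i hi => by have := Finset.mem_Ico.1 hi; omega)
     ).prod_left
      (isBigO_sum_pow (M := P.M) (m := K + 1) (fun i => (P.avg i).ψ p.1 p.2.1 p.2.2)
      (s := Finset.Ico K n) (fun i hi => by have := Finset.mem_Ico.1 hi; omega)
     )).congr_left fun κ => ?_
    simp only [hv, Prod.mk_sub_mk, Finset.sum_Ico_eq_sub _ hK.le]
    ext <;> simp
  have hΓ := fun j => hch.Γ_smooth j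
  have t1 : (fun κ : ℝ => ∑ j ∈ range K, κ ^ j * (Γ (P.avg j) (v n κ).1 (v n κ).2 -
      Γ (P.avg j) (v K κ).1 (v K κ).2)) =O[𝓝[>] 0] fun κ => κ ^ (K + 1) := by
    refine IsBigO.fun_sum fun j _ => ?_
    have := (isBigO_pow_nhdsGT (Nat.zero_le j)).mul
      (isBigO_comp_sub_comp (hΓ j) (hlim K) (hlim n) hdiff)
    simpa only [pow_zero, one_mul] using this
  have t2 : (fun κ : ℝ => κ ^ K * (Γ (P.avg K) (v n κ).1 (v n κ).2 -
      Γ (P.avg K) p.1 p.2.1)) =O[𝓝[>] 0] fun κ => κ ^ (K + 1) := by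
    have h1 := (isBigO_refl (fun κ : ℝ => κ ^ K) (𝓝[>] 0)).mul
      (isBigO_comp_sub_comp (hΓ K) tendsto_const_nhds (hlim n) (hsub n))
    simp only [← pow_add] at h1
    exact h1.trans (isBigO_pow_nhdsGT (by omega))
  have t3 : (fun κ : ℝ => ∑ j ∈ Finset.Ico (K + 1) n, κ ^ j * Γ (P.avg j) (v n κ).1 (v n κ).2)
      =O[𝓝[>] 0] fun κ => κ ^ (K + 1) := by
    refine IsBigO.fun_sum fun j hj => ?_
    have h1 : (fun κ : ℝ => Γ (P.avg j) (v n κ).1 (v n κ).2) =O[𝓝[>] 0] fun _ => (1 : ℝ) :=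
      (((hΓ j).continuous.tendsto (p.1, p.2.1)).comp (hlim n)).isBigO_one ℝ
    have h2 := (isBigO_pow_nhdsGT (Finset.mem_Ico.1 hj).1).mul h1
    simpa only [mul_one] using h2
  refine ((t1.add t2).add t3).congr_left fun κ => ?_
  have h1 : composed (P := P) n n P.avg Γ κ p =
      ∑ j ∈ range n, κ ^ j * Γ (P.avg j) (v n κ).1 (v n κ).2 := by rw [hv]; rfl
  have h2 : composed (P := P) K K P.avg Γ κ p =
      ∑ j ∈ range K, κ ^ j * Γ (P.avg j) (v K κ).1 (v K κ).2 := by rw [hv]; rfl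
  rw [h1, h2, ← Finset.sum_range_add_sum_Ico _ (by omega : K + 1 ≤ n), Finset.sum_range_succ]
  simp only [mul_sub, Finset.sum_sub_distrib]
  ring

/-- The total derivative of the new variable, divided by `κ^M`. -/
def velocity (P : ChirpedSystem) (b₁ b₂ : ℝ) (χ : AvgCoeff → ℝ → ℝ → ℝ → ℝ)
    (Γ : AvgCoeff → ℝ → ℝ → ℝ) (n : ℕ) (κ : ℝ) (p : ℝ × ℝ × ℝ) : ℝ :=
  b₁ * P.fieldR p.1 p.2.1 p.2.2 (κ ^ (-(P.N : ℝ))) +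
    b₂ * P.fieldΘ p.1 p.2.1 p.2.2 (κ ^ (-(P.N : ℝ))) +
  κ ^ P.M * (P.fieldR p.1 p.2.1 p.2.2 (κ ^ (-(P.N : ℝ))) * ∑ K ∈ range n, κ ^ K *
      deriv (fun r => χ (P.avg K) r p.2.1 p.2.2) p.1 +
    P.fieldΘ p.1 p.2.1 p.2.2 (κ ^ (-(P.N : ℝ))) * ∑ K ∈ range n, κ ^ K *
      deriv (fun θ => χ (P.avg K) p.1 θ p.2.2) p.2.1) +
  (∑ K ∈ range n, κ ^ K * (Γ (P.avg K) p.1 p.2.1 - (b₁ * P.coeffR K p.1 p.2.1 p.2.2 +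
      b₂ * P.coeffΘ K p.1 p.2.1 p.2.2 + P.lowerOrder K P.avg χ Γ p.1 p.2.1 p.2.2)) -
    κ ^ P.N * ∑ K ∈ range n, κ ^ K * (((P.M : ℝ) + K) / P.N * χ (P.avg K) p.1 p.2.1 p.2.2))

theorem isBigO_velocity_sub (hrc : -1 ≤ P.σ ∧ P.σ < (P.b : ℝ) / P.q) (hch : P.Channel b₁ b₂ χ Γ)
    (n : ℕ) {S : Set (ℝ × ℝ × ℝ)} (hS : IsCompact S) :
    (fun q : Pt => velocity P b₁ b₂ χ Γ n q.1 q.2 - composed (P := P) n n P.avg Γ q.1 q.2)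
      =O[smallOn S] fun q => q.1 ^ n := by
  have hc := regular_avg hrc
  have hM := (P.M_cast hrc.2).2
  have hN := P.N_cast.2
  have eR := hasExp_fieldR hrc
  have eΘ := hasExp_fieldΘ hrc
  have lin : HasExp (fun κ (p : ℝ × ℝ × ℝ) => b₁ * P.fieldR p.1 p.2.1 p.2.2 (κ ^ (-(P.N : ℝ))) +
      b₂ * P.fieldΘ p.1 p.2.1 p.2.2 (κ ^ (-(P.N : ℝ)))) fun K p =>
      b₁ * P.coeffR K p.1 p.2.1 p.2.2 + b₂ * P.coeffΘ K p.1 p.2.1 p.2.2 := by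
    refine ⟨fun K => (contDiff_const.mul (eR.1 K)).add (contDiff_const.mul (eΘ.1 K)),
      fun m S hS => (((eR.2 m S hS).const_mul_left b₁).add
        ((eΘ.2 m S hS).const_mul_left b₂)).congr_left fun q => ?_⟩
    simp only [mul_add, Finset.sum_add_distrib, mul_sub, mul_sum]
    rw [sum_congr rfl fun K _ => mul_left_comm (q.1 ^ K) b₁ _,
      sum_congr rfl fun K _ => mul_left_comm (q.1 ^ K) b₂ _]
    ring
  have e1 := HasExp.poly (fun K => contDiff_deriv_one (hch.χ_smooth K)) n
  have e2 := HasExp.poly (fun K => contDiff_deriv_two (hch.χ_smooth K)) n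
  have e3 := ((eR.mul e1).add (eΘ.mul e2)).pow_mul_shift P.M
  have sΓ : ∀ K, ContDiff ℝ ∞ fun p : ℝ × ℝ × ℝ => Γ (P.avg K) p.1 p.2.1 := fun K =>
    (hch.Γ_smooth K).comp (by fun_prop : ContDiff ℝ ∞ fun p : ℝ × ℝ × ℝ => (p.1, p.2.1))
  have e4 := HasExp.poly (a := fun K (p : ℝ × ℝ × ℝ) => Γ (P.avg K) p.1 p.2.1 -
      (b₁ * P.coeffR K p.1 p.2.1 p.2.2 + b₂ * P.coeffΘ K p.1 p.2.1 p.2.2 +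
      P.lowerOrder K P.avg χ Γ p.1 p.2.1 p.2.2)) (fun K => (sΓ K).sub ((lin.1 K).add
        (contDiff_lowerOrder hrc K hc hch.χ_smooth hch.Γ_smooth))) n
  have e5 := (HasExp.poly (a := fun K (p : ℝ × ℝ × ℝ) => ((P.M : ℝ) + K) / P.N *
    χ (P.avg K) p.1 p.2.1 p.2.2) (fun K => contDiff_const.mul (hch.χ_smooth K)) n).pow_mul_shift P.N
  have e6 := HasExp.of_contDiffOn isOpen_univ (fun _ => trivial)
    (contDiff_composed (P := P) n n hc hch.Γ_smooth).contDiffOn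
  have e7 := ((lin.add e3).add (e4.sub e5)).sub e6
  refine (e7.2 n S hS).congr_left fun q => ?_
  rw [Finset.sum_eq_zero, sub_zero]
  · rfl
  intro K hK
  have hKn := mem_range.1 hK
  refine mul_eq_zero_of_right _ ?_
  dsimp only
  rw [hch.composed_coeff hrc hKn q.2, if_pos hKn]
  have h1 : (if P.M ≤ K then ∑ ij ∈ Finset.HasAntidiagonal.antidiagonal (K - P.M),
      (P.coeffR ij.1 q.2.1 q.2.2.1 q.2.2.2 * if ij.2 < n then
        deriv (fun r => χ (P.avg ij.2) r q.2.2.1 q.2.2.2) q.2.1 else 0) +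
      ∑ ij ∈ Finset.HasAntidiagonal.antidiagonal (K - P.M),
      (P.coeffΘ ij.1 q.2.1 q.2.2.1 q.2.2.2 * if ij.2 < n then
        deriv (fun θ => χ (P.avg ij.2) q.2.1 θ q.2.2.2) q.2.2.1 else 0) else 0) =
      if P.M ≤ K then ∑ ij ∈ Finset.HasAntidiagonal.antidiagonal (K - P.M),
      (P.coeffR ij.1 q.2.1 q.2.2.1 q.2.2.2 * deriv (fun r' => χ (P.avg ij.2) r' q.2.2.1 q.2.2.2) q.2.1 +
        P.coeffΘ ij.1 q.2.1 q.2.2.1 q.2.2.2 *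
          deriv (fun θ' => χ (P.avg ij.2) q.2.1 θ' q.2.2.2) q.2.2.1) else 0 := by
    split_ifs
    · rw [← Finset.sum_add_distrib]
      refine sum_congr rfl fun ij hij => ?_
      have := Finset.HasAntidiagonal.mem_antidiagonal.1 hij
      rw [if_pos (by omega), if_pos (by omega)]
    · rfl
  have h2 : (if P.N ≤ K then if K - P.N < n then ((P.M : ℝ) + ↑(K - P.N)) / P.N *
      χ (P.avg (K - P.N)) q.2.1 q.2.2.1 q.2.2.2 else 0 else 0) =
      if P.N ≤ K then ((P.M : ℝ) + K - P.N) / P.N * χ (P.avg (K - P.N)) q.2.1 q.2.2.1 q.2.2.2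
        else 0 := by
    split_ifs with a1 a2
    · rw [Nat.cast_sub a1, add_sub_assoc]
    · omega
    · rfl
  rw [h1, h2, lowerOrder]
  simp only [composed]
  ring

end Channel

end ChirpedSystem

theorem exists_mem_Icc_of_periodic {f : ℝ → ℝ} {T : ℝ} (hT : 0 < T) (hf : ∀ x, f (x + T) = f x)
    (x : ℝ) : ∃ y ∈ Icc 0 T, f x = f y := by
  obtain ⟨y, hy, h⟩ := Function.Periodic.exists_mem_Ico₀ (f := f) hf hT x
  exact ⟨y, Set.Ico_subset_Icc_self hy, h⟩

namespace ChirpedSystem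

variable {P : ChirpedSystem}

theorem ζ_eq {τ : ℝ} (hτ : 0 < τ) : P.ζ τ = P.vartheta * τ := by
  have hν := P.ν_pos
  unfold ζ chirp time vartheta
  rw [← P.ν_eq, ← rpow_mul (by positivity), one_div, inv_mul_cancel₀ hν.ne', Real.rpow_one]
  ring

theorem κ_rpow_neg_div {κ : ℝ} (hκ : 0 < κ) (x : ℕ) :
    (κ ^ (-(P.N : ℝ))) ^ (-(x : ℝ) / P.N) = κ ^ x := by
  rw [P.rpow_neg_N_rpow hκ, neg_neg, rpow_natCast]

namespace Channel

variable {b₁ b₂ : ℝ} {χ : AvgCoeff → ℝ → ℝ → ℝ → ℝ} {Γ : AvgCoeff → ℝ → ℝ → ℝ}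

theorem velocity_sub_periodic (hrc : -1 ≤ P.σ ∧ P.σ < (P.b : ℝ) / P.q) (hch : P.Channel b₁ b₂ χ Γ)
    (n : ℕ) (r₁ : ℝ) : ∃ κ₀ > 0, ∀ κ, 0 < κ → κ < κ₀ → ∀ r, |r| ≤ r₁ → ∀ θ ζ,
      velocity P b₁ b₂ χ Γ n κ (r, θ + 2 * Real.pi, ζ) -
          composed (P := P) n n P.avg Γ κ (r, θ + 2 * Real.pi, ζ) =
        velocity P b₁ b₂ χ Γ n κ (r, θ, ζ) - composed (P := P) n n P.avg Γ κ (r, θ, ζ) ∧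
      velocity P b₁ b₂ χ Γ n κ (r, θ, ζ + 2 * Real.pi * P.kap) -
          composed (P := P) n n P.avg Γ κ (r, θ, ζ + 2 * Real.pi * P.kap) =
        velocity P b₁ b₂ χ Γ n κ (r, θ, ζ) - composed (P := P) n n P.avg Γ κ (r, θ, ζ) := by
  have hc := regular_avg hrc
  obtain ⟨κ₀, hκ₀, hper, -⟩ := exists_field_regular hrc r₁
  refine ⟨κ₀, hκ₀, fun κ k0 k1 r hr θ ζ => ?_⟩
  obtain ⟨h1, h2, h3, h4⟩ := hper κ k0 k1 r hr θ ζ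
  have hlow := fun K => lowerOrder_periodic hrc K hc hch.χ_periodic hch.χ_phase hch.Γ_periodic r θ ζ
  unfold velocity composed
  simp only
  constructor
  · have h5 : ∀ j, deriv (fun θ' => χ (P.avg j) r θ' ζ) (θ + 2 * Real.pi) =
        deriv (fun θ' => χ (P.avg j) r θ' ζ) θ := fun j => by
      rw [← deriv_comp_add_const]; simp only [hch.χ_periodic]
    have h6 : ∀ j x y, Γ (P.avg j) x (θ + 2 * Real.pi + y) = Γ (P.avg j) x (θ + y) :=
      fun j x y => by rw [add_right_comm, hch.Γ_periodic]
    simp only [h1, h2, h5, h6, hch.χ_periodic, hch.Γ_periodic, (coeff_periodic hrc _ r θ ζ).1,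
      (coeff_periodic hrc _ r θ ζ).2.1, (hlow _).1, (hc _).ρ_periodic, (hc _).ψ_periodic]
  · simp only [h3, h4, hch.χ_phase, (coeff_periodic hrc _ r θ ζ).2.2.1,
      (coeff_periodic hrc _ r θ ζ).2.2.2, (hlow _).2, (hc _).ρ_phase, (hc _).ψ_phase]

theorem exists_velocity_bound (hrc : -1 ≤ P.σ ∧ P.σ < (P.b : ℝ) / P.q) (hch : P.Channel b₁ b₂ χ Γ)
    (n : ℕ) (r₁ : ℝ) : ∃ C > 0, ∃ κ₀ > 0, ∀ κ, 0 < κ → κ < κ₀ → ∀ r, |r| ≤ r₁ → ∀ θ ζ,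
      |velocity P b₁ b₂ χ Γ n κ (r, θ, ζ) - composed (P := P) n n P.avg Γ κ (r, θ, ζ)| ≤
        C * κ ^ n := by
  obtain ⟨κ₁, hκ₁, hper⟩ := hch.velocity_sub_periodic hrc n r₁
  have hS : IsCompact (Icc (-r₁) r₁ ×ˢ Icc 0 (2 * Real.pi) ×ˢ
      Icc 0 (2 * Real.pi * P.kap)) := isCompact_Icc.prod (isCompact_Icc.prod isCompact_Icc)
  obtain ⟨C, hC, κ₂, hκ₂, hb⟩ := isBigO_smallOn.1 (hch.isBigO_velocity_sub hrc n hS)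
  refine ⟨C, hC, min κ₁ κ₂, lt_min hκ₁ hκ₂, fun κ k0 k1 r hr θ ζ => ?_⟩
  have k2 := k1.trans_le (min_le_left _ _)
  obtain ⟨θ', hθ', e1⟩ := exists_mem_Icc_of_periodic (by positivity : 0 < 2 * Real.pi)
    (f := fun θ => velocity P b₁ b₂ χ Γ n κ (r, θ, ζ) - composed (P := P) n n P.avg Γ κ (r, θ, ζ))
    (fun x => (hper κ k0 k2 r hr x ζ).1) θ
  obtain ⟨ζ', hζ', e2⟩ := exists_mem_Icc_of_periodic (P.phase_period_pos)
    (f := fun ζ => velocity P b₁ b₂ χ Γ n κ (r, θ', ζ) - composed (P := P) n n P.avg Γ κ (r, θ', ζ))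
    (fun x => (hper κ k0 k2 r hr θ' x).2) ζ
  rw [e1, e2]
  exact hb κ k0 (k1.trans_le (min_le_right _ _)) (r, θ', ζ') ⟨abs_le.1 hr, hθ', hζ'⟩

/-- The new variable. -/
def newVar (P : ChirpedSystem) (b₁ b₂ : ℝ) (χ : AvgCoeff → ℝ → ℝ → ℝ → ℝ) (n : ℕ)
    (r θ τ : ℝ) : ℝ :=
  (b₁ * r + b₂ * θ) + ∑ K ∈ range n, τ ^ (-((P.M : ℝ) + K) / P.N) * χ (P.avg K) r θ (P.ζ τ)

theorem hasDerivAt_newVar (hch : P.Channel b₁ b₂ χ Γ) (n : ℕ) (r θ : ℝ) {κ : ℝ} (hκ : 0 < κ) :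
    HasDerivAt (fun r => newVar P b₁ b₂ χ n r θ (κ ^ (-(P.N : ℝ)))) (b₁ + κ ^ P.M *
      ∑ K ∈ range n, κ ^ K * deriv (fun r => χ (P.avg K) r θ (P.ζ (κ ^ (-(P.N : ℝ))))) r) r ∧
    HasDerivAt (fun θ => newVar P b₁ b₂ χ n r θ (κ ^ (-(P.N : ℝ)))) (b₂ + κ ^ P.M *
      ∑ K ∈ range n, κ ^ K * deriv (fun θ => χ (P.avg K) r θ (P.ζ (κ ^ (-(P.N : ℝ))))) θ) θ ∧
    HasDerivAt (fun τ => newVar P b₁ b₂ χ n r θ τ) (κ ^ P.M * (∑ K ∈ range n, κ ^ K *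
        (Γ (P.avg K) r θ - (b₁ * P.coeffR K r θ (P.ζ (κ ^ (-(P.N : ℝ)))) +
          b₂ * P.coeffΘ K r θ (P.ζ (κ ^ (-(P.N : ℝ)))) +
          P.lowerOrder K P.avg χ Γ r θ (P.ζ (κ ^ (-(P.N : ℝ)))))) -
      κ ^ P.N * ∑ K ∈ range n, κ ^ K * (((P.M : ℝ) + K) / P.N *
        χ (P.avg K) r θ (P.ζ (κ ^ (-(P.N : ℝ))))))) (κ ^ (-(P.N : ℝ))) := by
  have hN : (P.N : ℝ) ≠ 0 := by have := P.N_cast.2; positivity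
  have hpow : ∀ K : ℕ, (κ ^ (-(P.N : ℝ))) ^ (-((P.M : ℝ) + K) / P.N) = κ ^ (P.M + K) := fun K => by
    rw [← κ_rpow_neg_div (P := P) hκ (P.M + K)]; push_cast; rfl
  have hτ : 0 < κ ^ (-(P.N : ℝ)) := rpow_pos_of_pos hκ _
  unfold newVar
  refine ⟨?_, ?_, ?_⟩
  · have h1 : ∀ K ∈ range n, HasDerivAt (fun r => (κ ^ (-(P.N : ℝ))) ^
        (-((P.M : ℝ) + K) / P.N) * χ (P.avg K) r θ (P.ζ (κ ^ (-(P.N : ℝ))))) (κ ^ (P.M + K) *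
        deriv (fun r => χ (P.avg K) r θ (P.ζ (κ ^ (-(P.N : ℝ))))) r) r := fun K _ => by
      rw [hpow]
      have h2 : ContDiff ℝ ∞ fun r => χ (P.avg K) r θ (P.ζ (κ ^ (-(P.N : ℝ)))) :=
        (hch.χ_smooth K).comp (by fun_prop :
          ContDiff ℝ ∞ fun r : ℝ => (r, θ, P.ζ (κ ^ (-(P.N : ℝ)))))
      exact (h2.differentiable (by simp) r).hasDerivAt.const_mul _
    refine ((((hasDerivAt_id r).const_mul b₁).add_const _).add (HasDerivAt.fun_sum h1)).congr_deriv ?_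
    simp only [pow_add, mul_assoc, mul_sum, mul_one]
  · have h1 : ∀ K ∈ range n, HasDerivAt (fun θ => (κ ^ (-(P.N : ℝ))) ^
        (-((P.M : ℝ) + K) / P.N) * χ (P.avg K) r θ (P.ζ (κ ^ (-(P.N : ℝ))))) (κ ^ (P.M + K) *
        deriv (fun θ => χ (P.avg K) r θ (P.ζ (κ ^ (-(P.N : ℝ))))) θ) θ := fun K _ => by
      rw [hpow]
      have h2 : ContDiff ℝ ∞ fun θ => χ (P.avg K) r θ (P.ζ (κ ^ (-(P.N : ℝ)))) :=
        (hch.χ_smooth K).comp (by fun_prop :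
          ContDiff ℝ ∞ fun θ : ℝ => (r, θ, P.ζ (κ ^ (-(P.N : ℝ)))))
      exact (h2.differentiable (by simp) θ).hasDerivAt.const_mul _
    refine ((((hasDerivAt_id θ).const_mul b₂).const_add _).add (HasDerivAt.fun_sum h1)).congr_deriv ?_
    simp only [pow_add, mul_assoc, mul_sum, mul_one]
  · have hζ : HasDerivAt P.ζ P.vartheta (κ ^ (-(P.N : ℝ))) := by
      have h1 : HasDerivAt (fun τ => P.vartheta * τ) P.vartheta (κ ^ (-(P.N : ℝ))) := by
        simpa using (hasDerivAt_id (κ ^ (-(P.N : ℝ)))).const_mul P.vartheta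
      refine h1.congr_of_eventuallyEq ?_
      filter_upwards [lt_mem_nhds hτ] with τ hτ
      exact ζ_eq hτ
    have h1 : ∀ K ∈ range n, HasDerivAt (fun τ : ℝ => τ ^ (-((P.M : ℝ) + K) / P.N) *
        χ (P.avg K) r θ (P.ζ τ)) (-(((P.M : ℝ) + K) / P.N) * (κ ^ P.N * κ ^ (P.M + K)) *
          χ (P.avg K) r θ (P.ζ (κ ^ (-(P.N : ℝ)))) + κ ^ (P.M + K) *
        (Γ (P.avg K) r θ - (b₁ * P.coeffR K r θ (P.ζ (κ ^ (-(P.N : ℝ)))) +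
          b₂ * P.coeffΘ K r θ (P.ζ (κ ^ (-(P.N : ℝ)))) +
          P.lowerOrder K P.avg χ Γ r θ (P.ζ (κ ^ (-(P.N : ℝ)))))))
        (κ ^ (-(P.N : ℝ))) := fun K _ => by
      have h2 := Real.hasDerivAt_rpow_const (x := κ ^ (-(P.N : ℝ)))
        (p := -((P.M : ℝ) + K) / P.N) (Or.inl hτ.ne')
      have h3 := HasDerivAt.comp _ (hch.hasDerivAt K r θ (P.ζ (κ ^ (-(P.N : ℝ))))) hζ
      refine (h2.mul h3).congr_deriv ?_
      rw [Real.rpow_sub_one hτ.ne', hpow, div_mul_cancel₀ _ P.vartheta_pos.ne', rpow_neg hκ.le,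
        rpow_natCast]
      simp only [Function.comp]
      field_simp
    refine ((HasDerivAt.fun_sum h1).const_add _).congr_deriv ?_
    simp only [mul_sub (κ ^ P.M), mul_sum, ← Finset.sum_sub_distrib]
    refine sum_congr rfl fun K _ => ?_
    rw [pow_add]; ring

theorem totalDeriv_newVar (hch : P.Channel b₁ b₂ χ Γ) (n : ℕ) (r θ : ℝ) {κ : ℝ} (hκ : 0 < κ) :
    P.totalDeriv (newVar P b₁ b₂ χ n) r θ (κ ^ (-(P.N : ℝ))) =
      κ ^ P.M * velocity P b₁ b₂ χ Γ n κ (r, θ, P.ζ (κ ^ (-(P.N : ℝ)))) := by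
  obtain ⟨h1, h2, h3⟩ := hch.hasDerivAt_newVar n r θ hκ
  rw [totalDeriv, h1.deriv, h2.deriv, h3.deriv, κ_rpow_neg_div hκ, velocity]
  ring

end Channel

theorem Rn_eq (n : ℕ) : P.Rn n = Channel.newVar P 1 0 AvgCoeff.ρ (n + 1) := by
  ext r θ τ
  rw [Rn, Channel.newVar, one_mul, zero_mul, add_zero]

theorem Ψn_eq (n : ℕ) : P.Ψn n = Channel.newVar P 0 1 AvgCoeff.ψ (n + 1) := by
  ext r θ τ
  rw [Ψn, Channel.newVar, one_mul, zero_mul, zero_add]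

theorem composed_eq (n : ℕ) (Γ : AvgCoeff → ℝ → ℝ → ℝ) {κ : ℝ} (hκ : 0 < κ) (r θ : ℝ) :
    composed (P := P) (n + 1) (n + 1) P.avg Γ κ (r, θ, P.ζ (κ ^ (-(P.N : ℝ)))) =
      ∑ K ∈ range (n + 1), κ ^ K * Γ (P.avg K) (P.Rn n r θ (κ ^ (-(P.N : ℝ))))
        (P.Ψn n r θ (κ ^ (-(P.N : ℝ)))) := by
  have hpow : ∀ K : ℕ, (κ ^ (-(P.N : ℝ))) ^ (-((P.M : ℝ) + K) / P.N) = κ ^ (P.M + K) := fun K => by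
    rw [← κ_rpow_neg_div (P := P) hκ (P.M + K)]; push_cast; rfl
  unfold composed Rn Ψn
  simp only [hpow]

/-- The averaged equations hold with a remainder of the order of the first neglected term. -/
theorem exists_totalDeriv_bound (hrc : -1 ≤ P.σ ∧ P.σ < (P.b : ℝ) / P.q) (n : ℕ) (r₁ : ℝ) :
    ∃ C > 0, ∃ κ₀ > 0, ∀ κ, 0 < κ → κ < κ₀ → ∀ r, |r| ≤ r₁ → ∀ θ,
      |P.totalDeriv (P.Rn n) r θ (κ ^ (-(P.N : ℝ))) - κ ^ P.M * ∑ K ∈ range (n + 1), κ ^ K *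
        P.Λ K (P.Rn n r θ (κ ^ (-(P.N : ℝ)))) (P.Ψn n r θ (κ ^ (-(P.N : ℝ))))| ≤
          C * κ ^ (P.M + n + 1) ∧
      |P.totalDeriv (P.Ψn n) r θ (κ ^ (-(P.N : ℝ))) - κ ^ P.M * ∑ K ∈ range (n + 1), κ ^ K *
        P.Ω K (P.Rn n r θ (κ ^ (-(P.N : ℝ)))) (P.Ψn n r θ (κ ^ (-(P.N : ℝ))))| ≤
          C * κ ^ (P.M + n + 1) := by
  obtain ⟨C₁, hC₁, κ₁, hκ₁, h1⟩ := (channelR hrc).exists_velocity_bound hrc (n + 1) r₁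
  obtain ⟨C₂, hC₂, κ₂, hκ₂, h2⟩ := (channelΘ hrc).exists_velocity_bound hrc (n + 1) r₁
  refine ⟨max C₁ C₂, by positivity, min κ₁ κ₂, lt_min hκ₁ hκ₂, fun κ k0 k1 r hr θ => ?_⟩
  have a1 := h1 κ k0 (k1.trans_le (min_le_left _ _)) r hr θ (P.ζ (κ ^ (-(P.N : ℝ))))
  have a2 := h2 κ k0 (k1.trans_le (min_le_right _ _)) r hr θ (P.ζ (κ ^ (-(P.N : ℝ))))
  rw [composed_eq n _ k0] at a1 a2
  have hk := pow_pos k0 P.M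
  have hk' := pow_pos k0 (n + 1)
  have e1 := (channelR hrc).totalDeriv_newVar (n + 1) r θ k0
  have e2 := (channelΘ hrc).totalDeriv_newVar (n + 1) r θ k0
  rw [← Rn_eq] at e1
  rw [← Ψn_eq] at e2
  rw [e1, e2, ← mul_sub, ← mul_sub, abs_mul, abs_mul, abs_of_pos hk, add_assoc, pow_add]
  constructor
  · calc _ ≤ κ ^ P.M * (C₁ * κ ^ (n + 1)) := mul_le_mul_of_nonneg_left a1 hk.le
      _ ≤ κ ^ P.M * (max C₁ C₂ * κ ^ (n + 1)) := by gcongr; exact le_max_left _ _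
      _ = _ := by ring
  · calc _ ≤ κ ^ P.M * (C₂ * κ ^ (n + 1)) := mul_le_mul_of_nonneg_left a2 hk.le
      _ ≤ κ ^ P.M * (max C₁ C₂ * κ ^ (n + 1)) := by gcongr; exact le_max_right _ _
      _ = _ := by ring

end ChirpedSystem

section Hadamard

variable {E : Type} [NormedAddCommGroup E] [NormedSpace ℝ E]

theorem hasDerivAt_fst_of_contDiff {f : ℝ × E → ℝ} (hf : ContDiff ℝ ∞ f) (x : ℝ) (e : E) :
    HasDerivAt (fun s => f (s, e)) (deriv (fun s => f (s, e)) x) x := by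
  have h : ContDiff ℝ ∞ fun s => f (s, e) := hf.comp (f := fun s : ℝ => (s, e)) (by fun_prop)
  exact (h.differentiable (by simp) x).hasDerivAt

theorem contDiff_deriv_fst {f : ℝ × E → ℝ} (hf : ContDiff ℝ ∞ f) :
    ContDiff ℝ ∞ fun q : ℝ × E => deriv (fun s => f (s, q.2)) q.1 :=
  contDiffOn_univ.1 (contDiffOn_deriv_fst isOpen_univ hf.contDiffOn)

/-- The mean `∫₀¹ f(tx, e) dt`. -/
def rayMean {E : Type} (f : ℝ × E → ℝ) (q : ℝ × E) : ℝ := ∫ t in (0 : ℝ)..1, f (t * q.1, q.2)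

theorem contDiff_rayMean [ProperSpace E] {f : ℝ × E → ℝ} (hf : ContDiff ℝ ∞ f) :
    ContDiff ℝ ∞ (rayMean f) :=
  contDiff_intervalIntegral (f := fun v : (ℝ × E) × ℝ => f (v.2 * v.1.1, v.1.2))
    (hf.comp (f := fun v : (ℝ × E) × ℝ => (v.2 * v.1.1, v.1.2)) (by fun_prop)) 0 1

theorem rayMean_zero {E : Type} (f : ℝ × E → ℝ) (e : E) : rayMean f (0, e) = f (0, e) := by
  simp [rayMean]

/-- Hadamard's lemma. -/
theorem sub_eq_mul_rayMean_deriv {f : ℝ × E → ℝ} (hf : ContDiff ℝ ∞ f) (x : ℝ) (e : E) :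
    f (x, e) - f (0, e) =
      x * rayMean (fun q : ℝ × E => deriv (fun s => f (s, q.2)) q.1) (x, e) := by
  have h1 : ∀ t ∈ Set.uIcc (0 : ℝ) 1, HasDerivAt (fun t : ℝ => f (t * x, e))
      (x * deriv (fun s => f (s, e)) (t * x)) t := fun t _ => by
    have := (hasDerivAt_fst_of_contDiff hf (t * x) e).comp t ((hasDerivAt_id t).mul_const x)
    simpa [mul_comm, Function.comp_def] using this
  have hc : Continuous fun t : ℝ => x * deriv (fun s => f (s, e)) (t * x) :=
    continuous_const.mul ((contDiff_deriv_fst hf).continuous.comp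
      (f := fun t : ℝ => (t * x, e)) (by fun_prop))
  have h2 := intervalIntegral.integral_eq_sub_of_hasDerivAt h1 (hc.intervalIntegrable 0 1)
  simp only [one_mul, zero_mul] at h2
  rw [← h2, rayMean, intervalIntegral.integral_const_mul]

theorem hasDerivAt_mul_rayMean {f : ℝ × E → ℝ} (hf : ContDiff ℝ ∞ f) (x : ℝ) (e : E) :
    HasDerivAt (fun s => s * rayMean f (s, e)) (f (x, e)) x := by
  have hc : Continuous fun s => f (s, e) := hf.continuous.comp (f := fun s : ℝ => (s, e))
    (by fun_prop)
  have h1 : (fun s => s * rayMean f (s, e)) = fun s => ∫ y in (0 : ℝ)..s, f (y, e) := by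
    ext s
    rw [rayMean]
    simp only [mul_comm _ s]
    rw [intervalIntegral.mul_integral_comp_mul_left (f := fun y => f (y, e))]
    simp
  rw [h1]
  exact (intervalIntegral.integral_hasDerivAt_right (hc.intervalIntegrable 0 x)
    (hc.stronglyMeasurableAtFilter _ _) hc.continuousAt)

/-- Differentiation of a ray mean with respect to a parameter. -/
theorem hasDerivAt_rayMean_param {f : ℝ × ℝ × ℝ → ℝ} (hf : ContDiff ℝ ∞ f) (x w κ : ℝ) :
    HasDerivAt (fun w => rayMean f (x, w, κ))
      (rayMean (fun q : ℝ × ℝ × ℝ => deriv (fun w => f (q.1, w, q.2.2)) q.2.1) (x, w, κ)) w := by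
  have hg : ContDiff ℝ ∞ fun v : ℝ × ℝ => f (v.2 * x, v.1, κ) :=
    hf.comp (f := fun v : ℝ × ℝ => (v.2 * x, v.1, κ)) (by fun_prop)
  have h := (hasFDerivAt_intervalIntegral_of_contDiff (hg.of_le (by simp)) 0 1 w).hasDerivAt
  refine HasDerivAt.congr_deriv h ?_
  have hcf : Continuous fun t : ℝ => (fderiv ℝ (fun v : ℝ × ℝ => f (v.2 * x, v.1, κ)) (w, t)).comp
      (ContinuousLinearMap.inl ℝ ℝ ℝ) :=
    (((hg.continuous_fderiv (by simp)).comp (f := fun t : ℝ => (w, t)) (by fun_prop))).clm_comp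
      continuous_const
  rw [ContinuousLinearMap.intervalIntegral_apply (hcf.intervalIntegrable 0 1), rayMean]
  refine intervalIntegral.integral_congr fun t _ => ?_
  dsimp only
  have h1 : HasFDerivAt (fun v : ℝ × ℝ => f (v.2 * x, v.1, κ))
      (fderiv ℝ (fun v : ℝ × ℝ => f (v.2 * x, v.1, κ)) (w, t)) (w, t) :=
    (hg.differentiable (by simp) _).hasFDerivAt
  have h2 := h1.comp_hasDerivAt (f := fun w : ℝ => (w, t)) w
    ((hasDerivAt_id w).prodMk (hasDerivAt_const w t))
  have h3 : deriv (fun w => f (t * x, w, κ)) w = _ := h2.deriv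
  rw [h3]
  simp

end Hadamard

theorem hasDerivWithinAt_comp_triple {V : ℝ × ℝ × ℝ → ℝ} {z w k : ℝ → ℝ} {z' w' k' t : ℝ} {s : Set ℝ}
    (hV : DifferentiableAt ℝ V (z t, w t, k t)) (hz : HasDerivWithinAt z z' s t)
    (hw : HasDerivWithinAt w w' s t) (hk : HasDerivWithinAt k k' s t) :
    HasDerivWithinAt (fun t => V (z t, w t, k t))
      (deriv (fun x => V (x, w t, k t)) (z t) * z' + deriv (fun x => V (z t, x, k t)) (w t) * w' +
        deriv (fun x => V (z t, w t, x)) (k t) * k') s t := by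
  have hF := hV.hasFDerivAt
  have h := hF.comp_hasDerivWithinAt (f := fun t => (z t, w t, k t)) t (hz.prodMk (hw.prodMk hk))
  have e1 := (hF.comp_hasDerivAt (f := fun x => (x, w t, k t)) (z t)
    ((hasDerivAt_id _).prodMk (hasDerivAt_const _ _))).deriv
  have e2 := (hF.comp_hasDerivAt (f := fun x => (z t, x, k t)) (w t)
    ((hasDerivAt_const _ _).prodMk ((hasDerivAt_id _).prodMk (hasDerivAt_const _ _)))).deriv
  have e3 := (hF.comp_hasDerivAt (f := fun x => (z t, w t, x)) (k t)
    ((hasDerivAt_const _ _).prodMk ((hasDerivAt_const _ _).prodMk (hasDerivAt_id _)))).deriv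
  simp only [Function.comp_def] at h e1 e2 e3
  rw [e1, e2, e3]
  refine h.congr_deriv ?_
  have : ((z', w', k') : ℝ × ℝ × ℝ) = z' • ((1, 0, 0) : ℝ × ℝ × ℝ) + w' • ((0, 1, 0) : ℝ × ℝ × ℝ) +
      k' • ((0, 0, 1) : ℝ × ℝ × ℝ) := by simp
  rw [this, map_add, map_add, map_smul, map_smul, map_smul]
  simp only [smul_eq_mul, Prod.mk_zero_zero]
  ring

theorem hasDerivAt_comp_triple {V : ℝ × ℝ × ℝ → ℝ} (hV : ContDiff ℝ ∞ V) {z w k : ℝ → ℝ}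
    {z' w' k' t : ℝ} (hz : HasDerivAt z z' t) (hw : HasDerivAt w w' t) (hk : HasDerivAt k k' t) :
    HasDerivAt (fun t => V (z t, w t, k t))
      (deriv (fun x => V (x, w t, k t)) (z t) * z' + deriv (fun x => V (z t, x, k t)) (w t) * w' +
        deriv (fun x => V (z t, w t, x)) (k t) * k') t := by
  rw [← hasDerivWithinAt_univ] at *
  exact hasDerivWithinAt_comp_triple (hV.differentiable (by simp) _) hz hw hk

theorem mul_le_of_abs_le {c k Z : ℝ} (hc : |c| ≤ k) (hZ : 0 ≤ Z) : c * Z ≤ k * Z :=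
  mul_le_mul_of_nonneg_right ((le_abs_self c).trans hc) hZ

theorem mul_le_of_abs_le_of_abs_le {c k x u : ℝ} (hc : |c| ≤ k) (hx : |x| ≤ u) : c * x ≤ k * u :=
  (le_abs_self _).trans (by rw [abs_mul]; exact mul_le_mul hc hx (abs_nonneg _) ((abs_nonneg _).trans hc))

/-- The quadratic-form inequalities behind the Lyapunov function: here `Z = z²`, `Y = κ^L w²`,
`x = κ^M z w`, `y = κ^(D-M)`, and the other letters are the coefficients of the normal form. -/
theorem exists_lyapunov_margin {ω₀ lam γ g B Mr Lr Dr i β : ℝ} (hω₀ : 0 < ω₀) (hlam : lam < 0)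
    (hg : 0 < g) (hB : 0 ≤ B) (hM : 0 ≤ Mr) (hL : 0 ≤ Lr) (hD : 0 ≤ Dr) (hi : 0 ≤ i) :
    ∃ ε > 0, ∃ c > 0, ∃ C > 0, ∀ Z Y x y a b c' p₁ p₂ q₁ q₂ δ ka kb kc : ℝ, 0 ≤ Z → 0 ≤ Y →
      |x| ≤ ε * (Z + Y) → |y| ≤ 1 → |a - ω₀ / 2| ≤ ε → |b| ≤ B → |c' + lam / 2| ≤ ε →
      |p₁ - ω₀| ≤ ε → |p₂| ≤ B → |q₁ - lam| ≤ ε → |q₂| ≤ B → |δ - γ| ≤ ε →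
      |ka| ≤ ε → |kb| ≤ B → |kc| ≤ ε →
      c * (Z + Y) ≤ Z * a + x * b + Y * c' - γ / 2 * (y * x) ∧
      Z * a + x * b + Y * c' - γ / 2 * (y * x) ≤ C * (Z + Y) ∧
      ∀ A K : ℝ, 0 ≤ A → 0 ≤ K → K ≤ A → γ * A + (Lr * i + β) * K ≤ -g * A →
        A * ((δ - γ / 2) * (Z * p₁ + x * p₂) - γ / 2 * (Y * q₁ + x * q₂)) -
          K * i * (Z * ka + x * (Mr * b + kb) + Y * (Lr * c' + kc)) + γ / 2 * (Dr * i) * K * (y * x) +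
          (Lr * i + β) * K * (Z * a + x * b + Y * c' - γ / 2 * (y * x)) ≤ 0 := by
  obtain ⟨m, hm, hm1, hm2⟩ : ∃ m > 0, m ≤ ω₀ / 2 ∧ m ≤ -lam / 2 :=
    ⟨min (ω₀ / 2) (-lam / 2), lt_min (by linarith) (by linarith), min_le_left _ _, min_le_right _ _⟩
  have hγ := abs_nonneg γ
  obtain ⟨k₁, hk₁⟩ : ∃ k, k = 1 + B + |γ| := ⟨_, rfl⟩
  obtain ⟨kz, hkz⟩ : ∃ k, k = ω₀ + 1 + 2 * |γ| := ⟨_, rfl⟩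
  obtain ⟨kx, hkx⟩ : ∃ k, k = (|γ| / 2 + 1) * B + |γ| / 2 * B + |γ| * B + |γ| * |γ| / 2 := ⟨_, rfl⟩
  obtain ⟨kt, hkt⟩ : ∃ k, k = kz + kx + i * (1 + (Mr * B + B)) + |γ| / 2 * (Dr * i) := ⟨_, rfl⟩
  have hk₁0 : 0 < k₁ := by rw [hk₁]; positivity
  have hkz0 : 0 ≤ kz := by rw [hkz]; positivity
  have hkx0 : 0 ≤ kx := by rw [hkx]; positivity
  have hkt0 : 0 ≤ kt := by rw [hkt]; positivity
  obtain ⟨ε, hε, hε1, hεm, hεg⟩ : ∃ ε > 0, ε ≤ 1 ∧ ε * k₁ ≤ m / 2 ∧ ε * (kt + 1) ≤ g * (m / 2) := by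
    refine ⟨min 1 (min (m / 2 / k₁) (g * (m / 2) / (kt + 1))),
      lt_min one_pos (lt_min (by positivity) (by positivity)), min_le_left _ _, ?_, ?_⟩
    · rw [← le_div_iff₀ hk₁0]; exact (min_le_right _ _).trans (min_le_left _ _)
    · rw [← le_div_iff₀ (by positivity)]; exact (min_le_right _ _).trans (min_le_right _ _)
  refine ⟨ε, hε, m / 2, by positivity, ω₀ - lam + m, by linarith, ?_⟩
  intro Z Y x y a b c' p₁ p₂ q₁ q₂ δ ka kb kc hZ hY hx hy ha hb hc hp₁ hp₂ hq₁ hq₂ hδ hka hkb hkc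
  have hW : 0 ≤ Z + Y := add_nonneg hZ hY
  have hxb : |b - γ / 2 * y| ≤ B + |γ| := by
    refine (abs_sub _ _).trans ?_
    rw [abs_mul, abs_div, abs_two]
    have := mul_le_of_le_one_right (by positivity : 0 ≤ |γ| / 2) hy
    linarith
  have hxx : |(b - γ / 2 * y) * x| ≤ (B + |γ|) * (ε * (Z + Y)) := by
    rw [abs_mul]; exact mul_le_mul hxb hx (abs_nonneg _) (by positivity)
  rw [abs_le] at hxx
  have hVlow : m / 2 * (Z + Y) ≤ Z * a + x * b + Y * c' - γ / 2 * (y * x) := by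
    have h1 : (m - ε) * Z ≤ Z * a := by
      rw [mul_comm Z]; exact mul_le_mul_of_nonneg_right (by linarith [(abs_le.1 ha).1]) hZ
    have h2 : (m - ε) * Y ≤ Y * c' := by
      rw [mul_comm Y]; exact mul_le_mul_of_nonneg_right (by linarith [(abs_le.1 hc).1]) hY
    have h3 : ε * k₁ * (Z + Y) ≤ m / 2 * (Z + Y) := mul_le_mul_of_nonneg_right hεm hW
    rw [hk₁] at h3
    linear_combination h1 + h2 + hxx.1 + h3
  have hVup : Z * a + x * b + Y * c' - γ / 2 * (y * x) ≤ (ω₀ - lam + m) * (Z + Y) := by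
    have h1 : Z * a ≤ (ω₀ - lam + ε) * Z := by
      rw [mul_comm Z]; exact mul_le_mul_of_nonneg_right (by linarith [(abs_le.1 ha).2]) hZ
    have h2 : Y * c' ≤ (ω₀ - lam + ε) * Y := by
      rw [mul_comm Y]; exact mul_le_mul_of_nonneg_right (by linarith [(abs_le.1 hc).2]) hY
    have h3 : ε * k₁ * (Z + Y) ≤ m / 2 * (Z + Y) := mul_le_mul_of_nonneg_right hεm hW
    have h4 : 0 ≤ m * (Z + Y) := by positivity
    rw [hk₁] at h3
    linear_combination h1 + h2 + hxx.2 + h3 + h4 / 2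
  refine ⟨hVlow, hVup, fun A K hA hK hKA hgA => ?_⟩
  have hδ' : |δ - γ / 2| ≤ |γ| / 2 + 1 := by
    have : δ - γ / 2 = (δ - γ) + γ / 2 := by ring
    rw [this]
    refine (abs_add_le _ _).trans ?_
    rw [abs_div, abs_two]; linarith
  have hp₁' : |p₁| ≤ ω₀ + 1 := by
    rw [abs_le] at hp₁ ⊢; constructor <;> linarith [hp₁.1, hp₁.2]
  -- deviation of the decay rate from `γ V₁`
  have t1 : ((δ - γ) * p₁ + γ / 2 * (p₁ - ω₀) - γ * (a - ω₀ / 2)) * Z ≤ ε * kz * Z := by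
    refine mul_le_of_abs_le ?_ hZ
    refine (abs_sub _ _).trans ?_
    have h1 := abs_add_le ((δ - γ) * p₁) (γ / 2 * (p₁ - ω₀))
    have h2 : |(δ - γ) * p₁| ≤ ε * (ω₀ + 1) := by
      rw [abs_mul]; exact mul_le_mul hδ hp₁' (abs_nonneg _) hε.le
    have h3 : |γ / 2 * (p₁ - ω₀)| ≤ |γ| / 2 * ε := by
      rw [abs_mul, abs_div, abs_two]; exact mul_le_mul_of_nonneg_left hp₁ (by positivity)
    have h4 : |γ * (a - ω₀ / 2)| ≤ |γ| * ε := by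
      rw [abs_mul]; exact mul_le_mul_of_nonneg_left ha hγ
    rw [hkz]
    linear_combination h1 + h2 + h3 + h4 + ε / 2 * hγ
  have t2 : (-(γ / 2 * (q₁ - lam)) - γ * (c' + lam / 2)) * Y ≤ ε * kz * Y := by
    refine mul_le_of_abs_le ?_ hY
    refine (abs_sub _ _).trans ?_
    rw [abs_neg]
    have h3 : |γ / 2 * (q₁ - lam)| ≤ |γ| / 2 * ε := by
      rw [abs_mul, abs_div, abs_two]; exact mul_le_mul_of_nonneg_left hq₁ (by positivity)
    have h4 : |γ * (c' + lam / 2)| ≤ |γ| * ε := by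
      rw [abs_mul]; exact mul_le_mul_of_nonneg_left hc hγ
    rw [hkz]
    have h5 : 0 ≤ ε * (ω₀ + 1 + |γ| / 2) := by positivity
    linear_combination h3 + h4 + h5
  have t3 : ((δ - γ / 2) * p₂ - γ / 2 * q₂ - γ * b + γ * γ / 2 * y) * x ≤ kx * (ε * (Z + Y)) := by
    refine mul_le_of_abs_le_of_abs_le ?_ hx
    refine (abs_add_le _ _).trans ?_
    have h0 := abs_sub ((δ - γ / 2) * p₂ - γ / 2 * q₂) (γ * b)
    have h1 := abs_sub ((δ - γ / 2) * p₂) (γ / 2 * q₂)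
    have h2 : |(δ - γ / 2) * p₂| ≤ (|γ| / 2 + 1) * B := by
      rw [abs_mul]; exact mul_le_mul hδ' hp₂ (abs_nonneg _) (by positivity)
    have h3 : |γ / 2 * q₂| ≤ |γ| / 2 * B := by
      rw [abs_mul, abs_div, abs_two]; exact mul_le_mul_of_nonneg_left hq₂ (by positivity)
    have h4 : |γ * b| ≤ |γ| * B := by
      rw [abs_mul]; exact mul_le_mul_of_nonneg_left hb hγ
    have h5 : |γ * γ / 2 * y| ≤ |γ| * |γ| / 2 := by
      rw [abs_mul, abs_div, abs_two, abs_mul]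
      exact mul_le_of_le_one_right (by positivity) hy
    rw [hkx]
    linarith
  have t4 : -(Z * ka + x * (Mr * b + kb) + Y * kc) ≤ ε * (1 + (Mr * B + B)) * (Z + Y) := by
    have h1 : -ka * Z ≤ ε * Z := mul_le_of_abs_le (by rwa [abs_neg]) hZ
    have h2 : -kc * Y ≤ ε * Y := mul_le_of_abs_le (by rwa [abs_neg]) hY
    have h3 : -(Mr * b + kb) * x ≤ (Mr * B + B) * (ε * (Z + Y)) := by
      refine mul_le_of_abs_le_of_abs_le ?_ hx
      rw [abs_neg]
      refine (abs_add_le _ _).trans (add_le_add ?_ hkb)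
      rw [abs_mul, abs_of_nonneg hM]; exact mul_le_mul_of_nonneg_left hb hM
    linear_combination h1 + h2 + h3
  have t5 : γ / 2 * (Dr * i) * y * x ≤ |γ| / 2 * (Dr * i) * (ε * (Z + Y)) := by
    refine mul_le_of_abs_le_of_abs_le ?_ hx
    rw [abs_mul, abs_mul, abs_div, abs_two, abs_of_nonneg (mul_nonneg hD hi)]
    exact mul_le_of_le_one_right (by positivity) hy
  have t6 : 0 ≤ i * Lr * (Y * c') := by
    have : 0 ≤ c' := by
      have hk : ε ≤ ε * k₁ := le_mul_of_one_le_right hε.le (by rw [hk₁]; linarith)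
      linarith [(abs_le.1 hc).1]
    positivity
  obtain ⟨V, hV⟩ : ∃ V, V = Z * a + x * b + Y * c' - γ / 2 * (y * x) := ⟨_, rfl⟩
  rw [← hV] at hVlow ⊢
  have hV0 : 0 ≤ V := le_trans (by positivity) hVlow
  have s1 : (δ - γ / 2) * (Z * p₁ + x * p₂) - γ / 2 * (Y * q₁ + x * q₂) ≤
      γ * V + ε * (kz + kx) * (Z + Y) := by
    rw [hV]; linear_combination t1 + t2 + t3
  have s2 : -(i * (Z * ka + x * (Mr * b + kb) + Y * (Lr * c' + kc))) + γ / 2 * (Dr * i) * (y * x) ≤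
      ε * (i * (1 + (Mr * B + B)) + |γ| / 2 * (Dr * i)) * (Z + Y) := by
    linear_combination i * t4 + t5 + t6
  have s3 : ε * (kt + 1) * (Z + Y) ≤ g * V := by
    refine (mul_le_mul_of_nonneg_right hεg hW).trans ?_
    rw [mul_assoc]; exact mul_le_mul_of_nonneg_left hVlow hg.le
  have hR : 0 ≤ ε * (i * (1 + (Mr * B + B)) + |γ| / 2 * (Dr * i)) * (Z + Y) := by positivity
  have u1 := mul_le_mul_of_nonneg_left s1 hA
  have u2 := mul_le_mul_of_nonneg_left s2 hK
  have u3 := mul_le_mul_of_nonneg_right hKA hR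
  have u4 := mul_le_mul_of_nonneg_right hgA hV0
  have u5 := mul_le_mul_of_nonneg_left s3 hA
  have u6 : 0 ≤ A * (ε * (Z + Y)) := by positivity
  rw [hkt] at u5
  linear_combination u1 + u2 + u3 + u4 + u5 + u6

theorem exists_contDiff_eq_mul {f : ℝ → ℝ} (hf : ContDiff ℝ ∞ f) (h0 : f 0 = 0) :
    ∃ g : ℝ → ℝ, ContDiff ℝ ∞ g ∧ ∀ x, f x = x * g x := by
  have hF : ContDiff ℝ ∞ fun q : ℝ × ℝ => f q.1 := hf.comp contDiff_fst
  refine ⟨fun x => rayMean (fun q : ℝ × ℝ => deriv (fun s => f s) q.1) (x, 0),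
    (contDiff_rayMean (contDiff_deriv_fst hF)).comp (f := fun x : ℝ => (x, (0 : ℝ))) (by fun_prop),
    fun x => ?_⟩
  have := sub_eq_mul_rayMean_deriv hF x 0
  simpa [h0] using this

/-- Averaged equations near a stable phase, as polynomials in `κ = τ^(-1/N)`:
`R' = κ^(M+L) Lh`, `Ψ' = κ^M (Oh₀ + κ^M Oh₁)` up to a remainder, with divergence `κ^(M+D) dh`. -/
structure LockedModel where
  M : ℕ
  L : ℕ
  D : ℕ
  N : ℕ
  φ₀ : ℝ
  Lh : ℝ × ℝ × ℝ → ℝ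
  Oh₀ : ℝ × ℝ → ℝ
  Oh₁ : ℝ × ℝ × ℝ → ℝ
  dh : ℝ × ℝ × ℝ → ℝ
  one_le_M : 1 ≤ M
  M_le_D : M ≤ D
  L_le : L + M ≤ N
  L_lt : L + 1 ≤ 2 * M
  D_le : M + D ≤ N
  Lh_smooth : ContDiff ℝ ∞ Lh
  Oh₀_smooth : ContDiff ℝ ∞ Oh₀
  Oh₁_smooth : ContDiff ℝ ∞ Oh₁
  dh_smooth : ContDiff ℝ ∞ dh
  Oh₀_zero : ∀ κ, Oh₀ (0, κ) = 0
  Oh₀_pos : 0 < deriv (fun R => Oh₀ (R, 0)) 0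
  Lh_zero : Lh (0, φ₀, 0) = 0
  Lh_neg : deriv (fun Ψ => Lh (0, Ψ, 0)) φ₀ < 0
  div_eq : ∀ R Ψ κ, κ ^ L * deriv (fun R => Lh (R, Ψ, κ)) R +
    κ ^ M * deriv (fun Ψ => Oh₁ (R, Ψ, κ)) Ψ = κ ^ D * dh (R, Ψ, κ)

namespace LockedModel

variable (S : LockedModel)

def Oh (q : ℝ × ℝ × ℝ) : ℝ := S.Oh₀ (q.1, q.2.2) + q.2.2 ^ S.M * S.Oh₁ q

theorem Oh_smooth : ContDiff ℝ ∞ S.Oh := by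
  have h1 := S.Oh₀_smooth.comp (f := fun q : ℝ × ℝ × ℝ => (q.1, q.2.2)) (by fun_prop)
  have h2 := S.Oh₁_smooth
  have h3 : ContDiff ℝ ∞ fun q : ℝ × ℝ × ℝ => q.2.2 ^ S.M := by fun_prop
  exact h1.add (h3.mul h2)

theorem deriv_Oh_fst_zero (Ψ : ℝ) :
    deriv (fun R => S.Oh (R, Ψ, 0)) 0 = deriv (fun R => S.Oh₀ (R, 0)) 0 := by
  have := S.one_le_M
  simp [Oh, zero_pow (by omega : S.M ≠ 0)]

theorem deriv_Oh_snd_zero (R Ψ : ℝ) : deriv (fun Ψ => S.Oh (R, Ψ, 0)) Ψ = 0 := by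
  have := S.one_le_M
  simp [Oh, zero_pow (by omega : S.M ≠ 0)]

end LockedModel

/-- One step of the formal solution: a correction of order `κ^j` improves the residual. -/
theorem exists_residual_improved {F : ℝ × ℝ × ℝ → ℝ} (hF : ContDiff ℝ ∞ F) {X Y W g : ℝ → ℝ}
    (hX : ContDiff ℝ ∞ X) (hY : ContDiff ℝ ∞ Y) (hW : ContDiff ℝ ∞ W) (hg : ContDiff ℝ ∞ g)
    {s j : ℕ} (hs : 1 ≤ s) (hj : 1 ≤ j) {i v v₁ v₂ : ℝ}
    (hres : ∀ κ, F (X κ, Y κ, κ) + i * κ ^ s * deriv W κ = κ ^ j * g κ)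
    (h0 : g 0 + (deriv (fun R => F (R, Y 0, 0)) (X 0) * v₁ +
      deriv (fun Ψ => F (X 0, Ψ, 0)) (Y 0) * v₂) + i * j * 0 ^ (s - 1) * v = 0) :
    ∃ g' : ℝ → ℝ, ContDiff ℝ ∞ g' ∧ ∀ κ, F (X κ + κ ^ j * v₁, Y κ + κ ^ j * v₂, κ) +
      i * κ ^ s * deriv (fun κ => W κ + κ ^ j * v) κ = κ ^ (j + 1) * g' κ := by
  obtain ⟨Φ, hΦ⟩ : ∃ Φ : ℝ × ℝ → ℝ, Φ = fun q => F (X q.2 + q.1 * v₁, Y q.2 + q.1 * v₂, q.2) :=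
    ⟨_, rfl⟩
  have hΦs : ContDiff ℝ ∞ Φ := by
    rw [hΦ]
    exact hF.comp (f := fun q : ℝ × ℝ => (X q.2 + q.1 * v₁, Y q.2 + q.1 * v₂, q.2)) (by fun_prop)
  obtain ⟨G, hG⟩ : ∃ G, G = rayMean (fun q : ℝ × ℝ => deriv (fun s => Φ (s, q.2)) q.1) := ⟨_, rfl⟩
  have hGs : ContDiff ℝ ∞ G := by rw [hG]; exact contDiff_rayMean (contDiff_deriv_fst hΦs)
  have hG0 : G (0, 0) = deriv (fun R => F (R, Y 0, 0)) (X 0) * v₁ +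
      deriv (fun Ψ => F (X 0, Ψ, 0)) (Y 0) * v₂ := by
    rw [hG, rayMean_zero]
    have h := hasDerivAt_comp_triple hF (z := fun s => X 0 + s * v₁) (w := fun s => Y 0 + s * v₂)
      (k := fun _ => 0) (t := 0) (((hasDerivAt_id (0 : ℝ)).mul_const v₁).const_add (X 0))
      (((hasDerivAt_id (0 : ℝ)).mul_const v₂).const_add (Y 0)) (hasDerivAt_const _ _)
    simp only [hΦ]
    rw [h.deriv]
    simp
  obtain ⟨k, hk⟩ : ∃ k : ℝ → ℝ, k = fun κ => g κ + G (κ ^ j, κ) + i * j * κ ^ (s - 1) * v :=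
    ⟨_, rfl⟩
  have hks : ContDiff ℝ ∞ k := by
    have h1 : ContDiff ℝ ∞ fun κ : ℝ => G (κ ^ j, κ) :=
      hGs.comp (f := fun κ : ℝ => (κ ^ j, κ)) (by fun_prop)
    rw [hk]
    fun_prop
  obtain ⟨g', hg', hkg⟩ := exists_contDiff_eq_mul hks (by
    simp only [hk, zero_pow (by omega : j ≠ 0), hG0]; exact h0)
  refine ⟨g', hg', fun κ => ?_⟩
  have hd : deriv (fun κ => W κ + κ ^ j * v) κ = deriv W κ + j * κ ^ (j - 1) * v :=
    (((hW.differentiable (by simp) κ).hasDerivAt).add ((hasDerivAt_pow j κ).mul_const v)).deriv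
  have e1 : Φ (κ ^ j, κ) - Φ (0, κ) = κ ^ j * G (κ ^ j, κ) := by
    rw [hG]; exact sub_eq_mul_rayMean_deriv hΦs _ _
  simp only [hΦ, zero_mul, add_zero] at e1
  have e2 : κ ^ s * κ ^ (j - 1) = κ ^ (s - 1) * κ ^ j := by
    rw [← pow_add, ← pow_add]; congr 1; omega
  have e3 := hkg κ
  simp only [hk] at e3
  rw [hd, pow_succ]
  linear_combination e1 + hres κ + i * j * v * e2 + κ ^ j * e3

namespace LockedModel

variable (S : LockedModel)

/-- A formal solution of the averaged equations in powers of `κ` to any order. -/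
theorem exists_reference (J : ℕ) (hJ : 1 ≤ J) : ∃ Rh Ψh : ℝ → ℝ, ContDiff ℝ ∞ Rh ∧ ContDiff ℝ ∞ Ψh ∧
    Rh 0 = 0 ∧ Ψh 0 = S.φ₀ ∧ ∃ g₁ g₂ : ℝ → ℝ, ContDiff ℝ ∞ g₁ ∧ ContDiff ℝ ∞ g₂ ∧
    (∀ κ, S.Lh (Rh κ, Ψh κ, κ) + 1 / S.N * κ ^ (S.N + 1 - S.M - S.L) * deriv Rh κ = κ ^ J * g₁ κ) ∧
    ∀ κ, S.Oh (Rh κ, Ψh κ, κ) + 1 / S.N * κ ^ (S.N + 1 - S.M) * deriv Ψh κ = κ ^ J * g₂ κ := by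
  have hM := S.one_le_M
  have hLN := S.L_le
  have hMD := S.M_le_D
  have hDN := S.D_le
  induction J, hJ using Nat.le_induction with
  | base =>
    obtain ⟨g₁, hg₁, h1⟩ := exists_contDiff_eq_mul (f := fun κ => S.Lh (0, S.φ₀, κ))
      (S.Lh_smooth.comp (f := fun κ : ℝ => ((0 : ℝ), S.φ₀, κ)) (by fun_prop)) S.Lh_zero
    obtain ⟨g₂, hg₂, h2⟩ := exists_contDiff_eq_mul (f := fun κ => S.Oh (0, S.φ₀, κ))
      (S.Oh_smooth.comp (f := fun κ : ℝ => ((0 : ℝ), S.φ₀, κ)) (by fun_prop))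
      (by simp [Oh, S.Oh₀_zero, zero_pow (by omega : S.M ≠ 0)])
    refine ⟨fun _ => 0, fun _ => S.φ₀, contDiff_const, contDiff_const, rfl, rfl, g₁, g₂, hg₁, hg₂,
      fun κ => ?_, fun κ => ?_⟩
    · simpa using h1 κ
    · simpa using h2 κ
  | succ j hj ih =>
    obtain ⟨Rh, Ψh, hR, hΨ, hR0, hΨ0, g₁, g₂, hg₁, hg₂, h1, h2⟩ := ih
    have hom := S.Oh₀_pos
    have hlam := S.Lh_neg
    obtain ⟨v₁, hv₁⟩ : ∃ v₁, v₁ = -g₂ 0 / deriv (fun R => S.Oh₀ (R, 0)) 0 := ⟨_, rfl⟩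
    obtain ⟨v₂, hv₂⟩ : ∃ v₂, v₂ = -(g₁ 0 + deriv (fun R => S.Lh (R, S.φ₀, 0)) 0 * v₁ +
      1 / S.N * j * 0 ^ (S.N + 1 - S.M - S.L - 1) * v₁) / deriv (fun Ψ => S.Lh (0, Ψ, 0)) S.φ₀ :=
      ⟨_, rfl⟩
    obtain ⟨g₁', hg₁', h1'⟩ := exists_residual_improved S.Lh_smooth hR hΨ hR hg₁
      (s := S.N + 1 - S.M - S.L) (by omega) hj (v := v₁) (v₁ := v₁) (v₂ := v₂) h1 (by
        rw [hR0, hΨ0, hv₂, mul_div_cancel₀ _ hlam.ne]; ring)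
    obtain ⟨g₂', hg₂', h2'⟩ := exists_residual_improved S.Oh_smooth hR hΨ hΨ hg₂
      (s := S.N + 1 - S.M) (by omega) hj (v := v₂) (v₁ := v₁) (v₂ := v₂) h2 (by
        rw [hR0, hΨ0, S.deriv_Oh_fst_zero, S.deriv_Oh_snd_zero, hv₁,
          zero_pow (by omega : S.N + 1 - S.M - 1 ≠ 0)]; field_simp; ring)
    refine ⟨fun κ => Rh κ + κ ^ j * v₁, fun κ => Ψh κ + κ ^ j * v₂, by fun_prop, by fun_prop,
      by simp [hR0, zero_pow (by omega : j ≠ 0)], by simp [hΨ0, zero_pow (by omega : j ≠ 0)],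
      g₁', g₂', hg₁', hg₂', h1', h2'⟩

theorem exists_abs_le_of_continuous {f : ℝ → ℝ} (hf : Continuous f) (κ₀ : ℝ) :
    ∃ C > 0, ∀ κ, 0 < κ → κ ≤ κ₀ → |f κ| ≤ C := by
  obtain ⟨C, hC⟩ := isCompact_Icc.exists_bound_of_continuousOn (s := Icc 0 κ₀) hf.continuousOn
  exact ⟨max C 1, by positivity, fun κ h0 h1 => (hC κ ⟨h0.le, h1⟩).trans (le_max_left _ _)⟩

/-- The amplitude of the formal solution is of order `κ^M`. -/
theorem exists_reference_bound {J : ℕ} (hJ : S.M ≤ J) {Rh Ψh g₂ : ℝ → ℝ} (hR : ContDiff ℝ ∞ Rh)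
    (hΨ : ContDiff ℝ ∞ Ψh) (hR0 : Rh 0 = 0) (hΨ0 : Ψh 0 = S.φ₀) (hg₂ : ContDiff ℝ ∞ g₂)
    (h2 : ∀ κ, S.Oh (Rh κ, Ψh κ, κ) + 1 / S.N * κ ^ (S.N + 1 - S.M) * deriv Ψh κ = κ ^ J * g₂ κ) :
    ∃ C > 0, ∃ κ₀ > 0, ∀ κ, 0 < κ → κ ≤ κ₀ → |Rh κ| ≤ C * κ ^ S.M ∧ |Ψh κ - S.φ₀| ≤ C * κ := by
  have hMD := S.M_le_D
  have hDN := S.D_le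
  obtain ⟨G, hG⟩ : ∃ G, G = rayMean (fun q : ℝ × ℝ => deriv (fun s => S.Oh₀ (s, q.2)) q.1) :=
    ⟨_, rfl⟩
  have hGs : ContDiff ℝ ∞ G := by rw [hG]; exact contDiff_rayMean (contDiff_deriv_fst S.Oh₀_smooth)
  have hGe : ∀ x κ, S.Oh₀ (x, κ) = x * G (x, κ) := fun x κ => by
    have := sub_eq_mul_rayMean_deriv S.Oh₀_smooth x κ
    rwa [S.Oh₀_zero, sub_zero, ← hG] at this
  have hG0 : G (0, 0) = deriv (fun R => S.Oh₀ (R, 0)) 0 := by rw [hG, rayMean_zero]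
  have hom := S.Oh₀_pos
  rw [← hG0] at hom
  have hcG : Continuous fun κ => G (Rh κ, κ) :=
    hGs.continuous.comp (f := fun κ : ℝ => (Rh κ, κ)) (by fun_prop)
  have hev : ∀ᶠ κ in 𝓝 (0 : ℝ), G (0, 0) / 2 < G (Rh κ, κ) := by
    refine hcG.continuousAt.eventually (lt_mem_nhds ?_)
    dsimp only; rw [hR0]; linarith
  obtain ⟨κ₁, hκ₁, hκ⟩ := Metric.eventually_nhds_iff.1 hev
  have hdΨ : Continuous (deriv Ψh) := hΨ.continuous_deriv (by simp)
  obtain ⟨C, hC, hCb⟩ := exists_abs_le_of_continuous (f := fun κ => κ ^ (J - S.M) * g₂ κ -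
      S.Oh₁ (Rh κ, Ψh κ, κ) - 1 / S.N * κ ^ (S.N + 1 - S.M - S.M) * deriv Ψh κ) (by
    have h1 := S.Oh₁_smooth.continuous.comp (f := fun κ : ℝ => (Rh κ, Ψh κ, κ)) (by fun_prop)
    have h3 := hg₂.continuous
    simp only [Function.comp_def] at h1
    fun_prop) 1
  obtain ⟨k, hk, hke⟩ := exists_contDiff_eq_mul (f := fun κ => Ψh κ - S.φ₀) (by fun_prop)
    (by simp [hΨ0])
  obtain ⟨C', hC', hCb'⟩ := exists_abs_le_of_continuous hk.continuous 1
  refine ⟨max (C / (G (0, 0) / 2)) C', by positivity, min 1 (κ₁ / 2), by positivity,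
    fun κ k0 k1 => ⟨?_, ?_⟩⟩
  · have hgk := hκ (y := κ) (by
      rw [Real.dist_eq, sub_zero, abs_of_pos k0]
      linarith [k1.trans (min_le_right _ _)])
    have e : Rh κ * G (Rh κ, κ) = κ ^ S.M * (κ ^ (J - S.M) * g₂ κ -
        S.Oh₁ (Rh κ, Ψh κ, κ) - 1 / S.N * κ ^ (S.N + 1 - S.M - S.M) * deriv Ψh κ) := by
      have e1 := h2 κ
      rw [Oh, hGe] at e1
      have e2 : κ ^ J = κ ^ S.M * κ ^ (J - S.M) := by rw [← pow_add]; congr 1; omega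
      have e3 : κ ^ (S.N + 1 - S.M) = κ ^ S.M * κ ^ (S.N + 1 - S.M - S.M) := by
        rw [← pow_add]; congr 1; omega
      rw [e2, e3] at e1
      dsimp only at e1
      linear_combination e1
    have hb := hCb κ k0 (k1.trans (min_le_left _ _))
    have h3 : |Rh κ| * (G (0, 0) / 2) ≤ κ ^ S.M * C := by
      calc |Rh κ| * (G (0, 0) / 2) ≤ |Rh κ| * |G (Rh κ, κ)| := by
            gcongr; exact hgk.le.trans (le_abs_self _)
        _ = |κ ^ S.M * _| := by rw [← abs_mul, e]
        _ ≤ κ ^ S.M * C := by rw [abs_mul, abs_of_pos (pow_pos k0 _)]; gcongr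
    calc |Rh κ| ≤ κ ^ S.M * C / (G (0, 0) / 2) := by rwa [le_div_iff₀ (by positivity)]
      _ = C / (G (0, 0) / 2) * κ ^ S.M := by ring
      _ ≤ _ := by gcongr; exact le_max_left _ _
  · have h3 := hke κ
    rw [h3, abs_mul, abs_of_pos k0, mul_comm]
    gcongr
    exact (hCb' κ k0 (k1.trans (min_le_left _ _))).trans (le_max_right _ _)

end LockedModel

section RayMean

variable {E : Type}

/-- The first moment `∫₀¹ t f(tx, e) dt`. -/
def rayMoment (f : ℝ × E → ℝ) (q : ℝ × E) : ℝ := ∫ t in (0 : ℝ)..1, t * f (t * q.1, q.2)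

theorem contDiff_rayMoment [NormedAddCommGroup E] [NormedSpace ℝ E] [ProperSpace E] {f : ℝ × E → ℝ} (hf : ContDiff ℝ ∞ f) :
    ContDiff ℝ ∞ (rayMoment f) :=
  contDiff_intervalIntegral (f := fun v : (ℝ × E) × ℝ => v.2 * f (v.2 * v.1.1, v.1.2))
    (contDiff_snd.mul (hf.comp (f := fun v : (ℝ × E) × ℝ => (v.2 * v.1.1, v.1.2)) (by fun_prop))) 0 1

theorem rayMoment_zero (f : ℝ × E → ℝ) (e : E) : rayMoment f (0, e) = f (0, e) / 2 := by
  simp only [rayMoment, mul_zero, intervalIntegral.integral_mul_const, integral_id]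
  ring

theorem rayMean_linear [TopologicalSpace E] {f g k : ℝ × E → ℝ} (hf : Continuous f) (hg : Continuous g) {α β : ℝ} {e : E}
    (h : ∀ x, k (x, e) = α * f (x, e) + β * g (x, e)) (x : ℝ) :
    rayMean k (x, e) = α * rayMean f (x, e) + β * rayMean g (x, e) := by
  have h1 : Continuous fun t : ℝ => α * f (t * x, e) :=
    continuous_const.mul (hf.comp (f := fun t : ℝ => (t * x, e)) (by fun_prop))
  have h2 : Continuous fun t : ℝ => β * g (t * x, e) :=
    continuous_const.mul (hg.comp (f := fun t : ℝ => (t * x, e)) (by fun_prop))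
  unfold rayMean
  simp only [h]
  rw [intervalIntegral.integral_add (h1.intervalIntegrable 0 1) (h2.intervalIntegrable 0 1),
    intervalIntegral.integral_const_mul, intervalIntegral.integral_const_mul]

theorem rayMean_eq_rayMoment [TopologicalSpace E] {f p : ℝ × E → ℝ} (hp : Continuous p) {m : ℝ} {e : E}
    (h : ∀ x, f (x, e) = x * p (x, e) + m) (x : ℝ) :
    rayMean f (x, e) = x * rayMoment p (x, e) + m := by
  have h1 : Continuous fun t : ℝ => x * (t * p (t * x, e)) :=
    continuous_const.mul (continuous_id.mul (hp.comp (f := fun t : ℝ => (t * x, e)) (by fun_prop)))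
  unfold rayMean rayMoment
  simp only [h]
  have : ∀ t : ℝ, t * x * p (t * x, e) + m = x * (t * p (t * x, e)) + m := fun t => by ring
  simp only [this]
  rw [intervalIntegral.integral_add (h1.intervalIntegrable 0 1) (by simp),
    intervalIntegral.integral_const_mul]
  simp

end RayMean

namespace LockedModel

variable (S : LockedModel)

/-- The increment of `Lh` from the reference point. -/
def Qf (Rh Ψh : ℝ → ℝ) (q : ℝ × ℝ × ℝ) : ℝ :=
  S.Lh (Rh q.2.2 + q.1, Ψh q.2.2 + q.2.1, q.2.2) - S.Lh (Rh q.2.2, Ψh q.2.2, q.2.2)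

/-- The increment of `Oh` from the reference point. -/
def Pf (Rh Ψh : ℝ → ℝ) (q : ℝ × ℝ × ℝ) : ℝ :=
  S.Oh (Rh q.2.2 + q.1, Ψh q.2.2 + q.2.1, q.2.2) - S.Oh (Rh q.2.2, Ψh q.2.2, q.2.2)

/-- The averaged equations at the reference point are Hamiltonian up to terms of order `κ^D`, with
a Hamiltonian that is a definite form in `z` and `κ^(L/2) w`. -/
theorem exists_normalForm {Rh Ψh : ℝ → ℝ} (hR : ContDiff ℝ ∞ Rh) (hΨ : ContDiff ℝ ∞ Ψh)
    (hR0 : Rh 0 = 0) (hΨ0 : Ψh 0 = S.φ₀) :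
    ∃ V a b c p₁ p₂ q₁ q₂ δ : ℝ × ℝ × ℝ → ℝ, ContDiff ℝ ∞ V ∧ ContDiff ℝ ∞ a ∧ ContDiff ℝ ∞ b ∧
      ContDiff ℝ ∞ c ∧ Continuous p₁ ∧ Continuous p₂ ∧ Continuous q₁ ∧ Continuous q₂ ∧
      Continuous δ ∧ a 0 = deriv (fun R => S.Oh₀ (R, 0)) 0 / 2 ∧
      c 0 = -(deriv (fun Ψ => S.Lh (0, Ψ, 0)) S.φ₀ / 2) ∧
      p₁ 0 = deriv (fun R => S.Oh₀ (R, 0)) 0 ∧ q₁ 0 = deriv (fun Ψ => S.Lh (0, Ψ, 0)) S.φ₀ ∧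
      δ 0 = S.dh (0, S.φ₀, 0) ∧ ∀ z w κ,
        V (z, w, κ) = z ^ 2 * a (z, w, κ) + κ ^ S.M * (z * w) * b (z, w, κ) +
          κ ^ S.L * w ^ 2 * c (z, w, κ) ∧
        S.Pf Rh Ψh (z, w, κ) = z * p₁ (z, w, κ) + κ ^ S.M * (w * p₂ (z, w, κ)) ∧
        κ ^ S.L * S.Qf Rh Ψh (z, w, κ) =
          κ ^ S.L * (w * q₁ (z, w, κ)) + κ ^ S.M * (z * q₂ (z, w, κ)) ∧
        HasDerivAt (fun x => V (x, w, κ)) (S.Pf Rh Ψh (z, w, κ)) z ∧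
        HasDerivAt (fun x => V (z, x, κ))
          (κ ^ S.D * (z * δ (z, w, κ)) - κ ^ S.L * S.Qf Rh Ψh (z, w, κ)) w := by
  have hM := S.one_le_M
  have hM0 : (0 : ℝ) ^ S.M = 0 := zero_pow (by omega)
  have hMD := S.M_le_D
  have hOh := S.Oh_smooth
  have hLh := S.Lh_smooth
  have hOh₁ := S.Oh₁_smooth
  have hsh : ContDiff ℝ ∞ fun q : ℝ × ℝ × ℝ => (Rh q.2.2 + q.1, Ψh q.2.2 + q.2.1, q.2.2) := by
    fun_prop
  have hsh0 : ContDiff ℝ ∞ fun q : ℝ × ℝ × ℝ => (Rh q.2.2, Ψh q.2.2, q.2.2) := by fun_prop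
  have hQ : ContDiff ℝ ∞ (S.Qf Rh Ψh) := (hLh.comp hsh).sub (hLh.comp hsh0)
  have hP : ContDiff ℝ ∞ (S.Pf Rh Ψh) := (hOh.comp hsh).sub (hOh.comp hsh0)
  -- the functions of `w` and `κ`
  obtain ⟨Q0, hQ0⟩ : ∃ Q0 : ℝ × ℝ → ℝ, Q0 = fun v => S.Qf Rh Ψh (0, v.1, v.2) := ⟨_, rfl⟩
  have hQ0s : ContDiff ℝ ∞ Q0 := by
    rw [hQ0]; exact hQ.comp (f := fun v : ℝ × ℝ => ((0 : ℝ), v.1, v.2)) (by fun_prop)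
  obtain ⟨P0, hP0⟩ : ∃ P0 : ℝ × ℝ → ℝ, P0 = fun v => S.Oh₁ (Rh v.2, Ψh v.2 + v.1, v.2) := ⟨_, rfl⟩
  have hP0s : ContDiff ℝ ∞ P0 := by
    rw [hP0]; exact hOh₁.comp (f := fun v : ℝ × ℝ => (Rh v.2, Ψh v.2 + v.1, v.2)) (by fun_prop)
  obtain ⟨q₁, hq₁⟩ : ∃ f, f = rayMean (fun q : ℝ × ℝ => deriv (fun s => Q0 (s, q.2)) q.1) := ⟨_, rfl⟩
  have hq₁s : ContDiff ℝ ∞ q₁ := by rw [hq₁]; exact contDiff_rayMean (contDiff_deriv_fst hQ0s)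
  have hq₁e : ∀ w κ, Q0 (w, κ) = w * q₁ (w, κ) := fun w κ => by
    have := sub_eq_mul_rayMean_deriv hQ0s w κ
    rw [← hq₁] at this
    rw [← this, hQ0]
    simp [Qf]
  obtain ⟨p₂, hp₂⟩ : ∃ f, f = rayMean (fun q : ℝ × ℝ => deriv (fun s => P0 (s, q.2)) q.1) := ⟨_, rfl⟩
  have hp₂s : ContDiff ℝ ∞ p₂ := by rw [hp₂]; exact contDiff_rayMean (contDiff_deriv_fst hP0s)
  have hp₂e : ∀ w κ, S.Pf Rh Ψh (0, w, κ) = κ ^ S.M * (w * p₂ (w, κ)) := fun w κ => by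
    have := sub_eq_mul_rayMean_deriv hP0s w κ
    rw [← hp₂] at this
    rw [← this, hP0]
    simp only [Pf, Oh, add_zero]
    ring
  -- the functions of `z`, `w` and `κ`
  obtain ⟨p₁, hp₁⟩ : ∃ f, f = rayMean (fun q : ℝ × ℝ × ℝ =>
    deriv (fun s => S.Pf Rh Ψh (s, q.2)) q.1) := ⟨_, rfl⟩
  have hp₁s : ContDiff ℝ ∞ p₁ := by rw [hp₁]; exact contDiff_rayMean (contDiff_deriv_fst hP)
  have hp₁e : ∀ z w κ, S.Pf Rh Ψh (z, w, κ) = z * p₁ (z, w, κ) + κ ^ S.M * (w * p₂ (w, κ)) :=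
    fun z w κ => by
      have := sub_eq_mul_rayMean_deriv hP z (w, κ)
      rw [← hp₁, hp₂e] at this
      linarith
  obtain ⟨d, hd⟩ : ∃ f : ℝ × ℝ × ℝ → ℝ, f = fun q =>
    S.dh (Rh q.2.2 + q.1, Ψh q.2.2 + q.2.1, q.2.2) := ⟨_, rfl⟩
  have hds : ContDiff ℝ ∞ d := by rw [hd]; exact S.dh_smooth.comp hsh
  obtain ⟨pw, hpw⟩ : ∃ f : ℝ × ℝ × ℝ → ℝ, f = fun q => deriv (fun Ψ =>
    S.Oh₁ (Rh q.2.2 + q.1, Ψ, q.2.2)) (Ψh q.2.2 + q.2.1) := ⟨_, rfl⟩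
  have hpws : ContDiff ℝ ∞ pw := by rw [hpw]; exact (contDiff_deriv_two hOh₁).comp hsh
  obtain ⟨dQ, hdQ⟩ : ∃ f, f = fun q : ℝ × ℝ × ℝ => deriv (fun s => S.Qf Rh Ψh (s, q.2)) q.1 :=
    ⟨_, rfl⟩
  have hdQs : ContDiff ℝ ∞ dQ := by rw [hdQ]; exact contDiff_deriv_fst hQ
  have hdQe : ∀ z w κ, dQ (z, w, κ) =
      deriv (fun R => S.Lh (R, Ψh κ + w, κ)) (Rh κ + z) := fun z w κ => by
    rw [hdQ]
    simp only [Qf, deriv_sub_const_fun]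
    exact deriv_comp_const_add (fun R => S.Lh (R, Ψh κ + w, κ)) _ _
  have hdiv : ∀ z w κ, κ ^ S.M * pw (z, w, κ) = κ ^ S.D * d (z, w, κ) + -κ ^ S.L * dQ (z, w, κ) :=
    fun z w κ => by
      have := S.div_eq (Rh κ + z) (Ψh κ + w) κ
      rw [hdQe, hd, hpw]
      dsimp only
      linarith
  have hQz : ∀ z w κ, S.Qf Rh Ψh (z, w, κ) - Q0 (w, κ) = z * rayMean dQ (z, w, κ) :=
    fun z w κ => by
      have := sub_eq_mul_rayMean_deriv hQ z (w, κ)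
      rw [hdQ, hQ0]; exact this
  have hrdiv : ∀ z w κ, κ ^ S.M * rayMean pw (z, w, κ) =
      κ ^ S.D * rayMean d (z, w, κ) + -κ ^ S.L * rayMean dQ (z, w, κ) := fun z w κ => by
    have h1 := rayMean_linear (k := fun q => κ ^ S.M * pw q) hds.continuous hdQs.continuous
      (e := (w, κ)) (fun x => hdiv x w κ) z
    rw [← h1]
    exact (intervalIntegral.integral_const_mul _ _).symm
  -- the Hamiltonian
  obtain ⟨V, hV⟩ : ∃ V : ℝ × ℝ × ℝ → ℝ, V = fun q =>
    q.1 * rayMean (S.Pf Rh Ψh) q - q.2.2 ^ S.L * (q.2.1 * rayMean Q0 q.2) := ⟨_, rfl⟩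
  have hVs : ContDiff ℝ ∞ V := by
    have h1 := contDiff_rayMean hP
    have h2 := (contDiff_rayMean hQ0s).comp (contDiff_snd (𝕜 := ℝ) (E := ℝ) (F := ℝ × ℝ))
    have h3 : ContDiff ℝ ∞ fun q : ℝ × ℝ × ℝ => q.2.2 ^ S.L := by fun_prop
    rw [hV]
    exact (contDiff_fst.mul h1).sub (h3.mul (contDiff_snd.fst.mul h2))
  have hsnd {f : ℝ × ℝ → ℝ} (hf : ContDiff ℝ ∞ f) : ContDiff ℝ ∞ fun q : ℝ × ℝ × ℝ => f q.2 :=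
    hf.comp contDiff_snd
  refine ⟨V, rayMoment p₁, fun q => p₂ q.2, fun q => -rayMoment q₁ q.2, p₁, fun q => p₂ q.2,
    fun q => q₁ q.2, fun q => q.2.2 ^ (S.D - S.M) * rayMean d q - rayMean pw q, rayMean d, hVs,
    contDiff_rayMoment hp₁s, hsnd hp₂s, (hsnd (contDiff_rayMoment hq₁s)).neg, hp₁s.continuous,
    (hsnd hp₂s).continuous, (hsnd hq₁s).continuous, ?_, (contDiff_rayMean hds).continuous, ?_⟩
  · have h1 := (contDiff_rayMean hds).continuous
    have h2 := (contDiff_rayMean hpws).continuous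
    fun_prop
  have hp₁0 : p₁ 0 = deriv (fun R => S.Oh₀ (R, 0)) 0 := by
    rw [hp₁]
    refine (rayMean_zero _ _).trans ?_
    simp only [Pf, Prod.fst_zero, Prod.snd_zero, hR0, hΨ0, deriv_sub_const_fun, zero_add, add_zero]
    exact S.deriv_Oh_fst_zero _
  have hq₁0 : q₁ (0, 0) = deriv (fun Ψ => S.Lh (0, Ψ, 0)) S.φ₀ := by
    rw [hq₁, rayMean_zero, hQ0]
    simp only [Qf, hR0, hΨ0, deriv_sub_const_fun, add_zero]
    have := deriv_comp_const_add (fun Ψ => S.Lh (0, Ψ, 0)) S.φ₀ 0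
    rwa [add_zero] at this
  refine ⟨?_, ?_, hp₁0, hq₁0, ?_, fun z w κ => ⟨?_, hp₁e z w κ, ?_, ?_, ?_⟩⟩
  · rw [← hp₁0]; exact rayMoment_zero _ _
  · rw [← hq₁0]; exact congrArg Neg.neg (rayMoment_zero _ _)
  · refine (rayMean_zero _ _).trans ?_
    rw [hd]; simp [hR0, hΨ0]
  · rw [hV]
    dsimp only
    rw [rayMean_eq_rayMoment hp₁s.continuous (e := (w, κ)) (fun x => hp₁e x w κ),
      rayMean_eq_rayMoment hq₁s.continuous (m := 0) (fun x => by rw [hq₁e, add_zero])]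
    ring
  · have h1 := hQz z w κ
    have h2 := hrdiv z w κ
    rw [hq₁e] at h1
    have h3 : κ ^ S.D = κ ^ S.M * κ ^ (S.D - S.M) := by rw [← pow_add]; congr 1; omega
    rw [h3] at h2
    dsimp only
    linear_combination κ ^ S.L * h1 + z * h2
  · rw [hV]
    exact (hasDerivAt_mul_rayMean hP z (w, κ)).sub_const (κ ^ S.L * (w * rayMean Q0 (w, κ)))
  · have h1 := hasDerivAt_rayMean_param hP z w κ
    have h2 := hasDerivAt_mul_rayMean hQ0s w κ
    have h3 : rayMean (fun q : ℝ × ℝ × ℝ => deriv (fun w => S.Pf Rh Ψh (q.1, w, q.2.2)) q.2.1)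
        (z, w, κ) = κ ^ S.M * rayMean pw (z, w, κ) := by
      have : ∀ x, deriv (fun w => S.Pf Rh Ψh (x, w, κ)) w = κ ^ S.M * pw (x, w, κ) := fun x => by
        rw [hpw]
        simp only [Pf, Oh, deriv_sub_const_fun, deriv_const_add', deriv_const_mul_field]
        congr 1
        exact deriv_comp_const_add (fun Ψ => S.Oh₁ (Rh κ + x, Ψ, κ)) _ _
      unfold rayMean
      simp only [this]
      exact intervalIntegral.integral_const_mul _ _
    rw [h3, hrdiv] at h1
    rw [hV]
    refine HasDerivAt.congr_deriv ((h1.const_mul z).sub (h2.const_mul (κ ^ S.L))) ?_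
    linear_combination κ ^ S.L * hQz z w κ

end LockedModel

theorem exists_forall_of_eventually_nhds_zero {p : ℝ × ℝ × ℝ → Prop} (h : ∀ᶠ q in 𝓝 0, p q) :
    ∃ ρ > 0, ∀ z w κ : ℝ, |z| ≤ ρ → |w| ≤ ρ → 0 < κ → κ ≤ ρ → p (z, w, κ) := by
  obtain ⟨δ, hδ, hp⟩ := Metric.eventually_nhds_iff.1 h
  refine ⟨δ / 2, by positivity, fun z w κ hz hw h0 hκ => hp ?_⟩
  rw [Prod.dist_eq, Prod.dist_eq, max_lt_iff, max_lt_iff]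
  simp only [Prod.fst_zero, Prod.snd_zero, Real.dist_eq, sub_zero, abs_of_pos h0]
  refine ⟨?_, ?_, ?_⟩ <;> linarith

theorem eventually_abs_sub_le {f : ℝ × ℝ × ℝ → ℝ} (hf : Continuous f) {v ε : ℝ} (hv : f 0 = v)
    (hε : 0 < ε) : ∀ᶠ q in 𝓝 0, |f q - v| ≤ ε := by
  have h : ∀ᶠ q in 𝓝 (0 : ℝ × ℝ × ℝ), f q ∈ Metric.closedBall (f 0) ε :=
    hf.continuousAt.eventually (Metric.closedBall_mem_nhds _ hε)
  filter_upwards [h] with q hq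
  rwa [hv, Metric.mem_closedBall, Real.dist_eq] at hq

theorem abs_mul_mul_le_of_sq {ε k z w Y : ℝ} (hε : 0 < ε) (h : k ^ 2 * w ^ 2 ≤ ε ^ 2 * Y) :
    |k * (z * w)| ≤ ε * (z ^ 2 + Y) := by
  have hY : 0 ≤ ε ^ 2 * Y := le_trans (by positivity) h
  have hY' : 0 ≤ Y := nonneg_of_mul_nonneg_right hY (by positivity)
  rw [← mul_assoc, mul_comm k z, mul_assoc]
  apply abs_le_of_sq_le_sq _ (by positivity)
  calc (z * (k * w)) ^ 2 = z ^ 2 * (k ^ 2 * w ^ 2) := by ring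
    _ ≤ z ^ 2 * (ε ^ 2 * Y) := by gcongr
    _ ≤ (ε * (z ^ 2 + Y)) ^ 2 := by nlinarith [sq_nonneg (z ^ 2), mul_nonneg (sq_nonneg ε) (mul_nonneg (sq_nonneg z) hY'), mul_nonneg (sq_nonneg ε) (sq_nonneg (z ^ 2)), mul_nonneg (sq_nonneg ε) (sq_nonneg Y)]

namespace LockedModel

variable (S : LockedModel)

/-- The Lyapunov function near the formal solution. -/
theorem exists_lyapunov {g β κ₀ : ℝ} (hg : 0 < g) (hκ₀ : 0 < κ₀)
    (hβ : ∀ κ, 0 < κ → κ ≤ κ₀ → S.dh (0, S.φ₀, 0) * κ ^ (S.M + S.D) +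
      ((S.L : ℝ) / S.N + β) * κ ^ S.N ≤ -g * κ ^ (S.M + S.D))
    {Rh Ψh : ℝ → ℝ} (hR : ContDiff ℝ ∞ Rh) (hΨ : ContDiff ℝ ∞ Ψh) (hR0 : Rh 0 = 0)
    (hΨ0 : Ψh 0 = S.φ₀) :
    ∃ V : ℝ × ℝ × ℝ → ℝ, ContDiff ℝ ∞ V ∧ ∃ ρ > 0, ∃ c > 0, ∃ C > 0, ∀ z w κ, |z| ≤ ρ → |w| ≤ ρ →
      0 < κ → κ ≤ ρ →
      c * (z ^ 2 + κ ^ S.L * w ^ 2) ≤ V (z, w, κ) ∧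
      V (z, w, κ) ≤ C * (z ^ 2 + κ ^ S.L * w ^ 2) ∧
      ∀ e₁ e₂ η : ℝ, |e₁| ≤ η → |e₂| ≤ η →
        deriv (fun x => V (x, w, κ)) z * (κ ^ (S.M + S.L) * S.Qf Rh Ψh (z, w, κ) + e₁) +
          deriv (fun x => V (z, x, κ)) w * (κ ^ S.M * S.Pf Rh Ψh (z, w, κ) + e₂) +
          deriv (fun x => V (z, w, x)) κ * (-κ ^ (S.N + 1) / S.N) +
          ((S.L : ℝ) / S.N + β) * κ ^ S.N * V (z, w, κ) ≤ C * η := by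
  obtain ⟨V, a, b, c', p₁, p₂, q₁, q₂, δ, hV, ha, hb, hc', hp₁, hp₂, hq₁, hq₂, hδ, ha0, hc0, hp₁0,
    hq₁0, hδ0, hnf⟩ := S.exists_normalForm hR hΨ hR0 hΨ0
  have hM := S.one_le_M
  have hMD := S.M_le_D
  have hLM := S.L_lt
  have hDN := S.D_le
  obtain ⟨γ, hγ⟩ : ∃ γ, γ = S.dh (0, S.φ₀, 0) := ⟨_, rfl⟩
  rw [← hγ] at hβ hδ0
  have hω := S.Oh₀_pos
  have hlam := S.Lh_neg
  obtain ⟨B, hB, hBb, hBp, hBq⟩ : ∃ B ≥ (1 : ℝ), |b 0| + 1 ≤ B ∧ |p₂ 0| + 1 ≤ B ∧ |q₂ 0| + 1 ≤ B :=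
    ⟨|b 0| + |p₂ 0| + |q₂ 0| + 1, by
      have h1 := abs_nonneg (b 0); have h2 := abs_nonneg (p₂ 0); have h3 := abs_nonneg (q₂ 0)
      linarith, by
      have h2 := abs_nonneg (p₂ 0); have h3 := abs_nonneg (q₂ 0)
      linarith, by
      have h1 := abs_nonneg (b 0); have h3 := abs_nonneg (q₂ 0)
      linarith, by
      have h1 := abs_nonneg (b 0); have h2 := abs_nonneg (p₂ 0)
      linarith⟩
  obtain ⟨ε, hε, c, hc, C, hC, hmargin⟩ := exists_lyapunov_margin (γ := γ) (β := β) (Mr := S.M)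
    (Lr := S.L) (Dr := S.D) (i := 1 / S.N) hω hlam hg (zero_le_one.trans hB) (by positivity)
    (by positivity) (by positivity) (by positivity)
  -- the derivatives with respect to `κ`
  have hdκ {f : ℝ × ℝ × ℝ → ℝ} (hf : ContDiff ℝ ∞ f) :
      ContDiff ℝ ∞ fun q : ℝ × ℝ × ℝ => deriv (fun x => f (q.1, q.2.1, x)) q.2.2 := by
    have h1 : ContDiff ℝ ∞ fun v : ℝ × ℝ × ℝ => f (v.2.1, v.2.2, v.1) :=
      hf.comp (f := fun v : ℝ × ℝ × ℝ => (v.2.1, v.2.2, v.1)) (by fun_prop)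
    exact (contDiff_deriv_fst h1).comp (f := fun q : ℝ × ℝ × ℝ => (q.2.2, q.1, q.2.1)) (by fun_prop)
  have hdκc {f : ℝ × ℝ × ℝ → ℝ} (hf : ContDiff ℝ ∞ f) :
      Continuous fun q : ℝ × ℝ × ℝ => q.2.2 * deriv (fun x => f (q.1, q.2.1, x)) q.2.2 :=
    (continuous_snd.snd).mul (hdκ hf).continuous
  have hdV1 : Continuous fun q : ℝ × ℝ × ℝ => deriv (fun x => V (x, q.2)) q.1 :=
    (contDiff_deriv_fst hV).continuous
  have hdV2 : Continuous fun q : ℝ × ℝ × ℝ => deriv (fun x => V (q.1, x, q.2.2)) q.2.1 :=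
    (contDiff_deriv_two hV).continuous
  have hone := zero_lt_one' ℝ
  obtain ⟨ρ, hρ, hρall⟩ := exists_forall_of_eventually_nhds_zero
    ((eventually_abs_sub_le ha.continuous ha0 hε).and <|
    (eventually_abs_sub_le hb.continuous rfl hone).and <|
    (eventually_abs_sub_le hc'.continuous hc0 hε).and <|
    (eventually_abs_sub_le hp₁ hp₁0 hε).and <|
    (eventually_abs_sub_le hp₂ rfl hone).and <|
    (eventually_abs_sub_le hq₁ hq₁0 hε).and <|
    (eventually_abs_sub_le hq₂ rfl hone).and <|
    (eventually_abs_sub_le hδ hδ0 hε).and <|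
    (eventually_abs_sub_le (hdκc ha) (v := 0) (by simp) hε).and <|
    (eventually_abs_sub_le (hdκc hb) (v := 0) (by simp) hone).and <|
    (eventually_abs_sub_le (hdκc hc') (v := 0) (by simp) hε).and <|
    (eventually_abs_sub_le hdV1 rfl hone).and
    (eventually_abs_sub_le hdV2 rfl hone))
  obtain ⟨B₁, hB₁⟩ : ∃ B₁, B₁ = |deriv (fun x => V (x, (0 : ℝ × ℝ × ℝ).2)) (0 : ℝ × ℝ × ℝ).1| +
      |deriv (fun x => V ((0 : ℝ × ℝ × ℝ).1, x, (0 : ℝ × ℝ × ℝ).2.2)) (0 : ℝ × ℝ × ℝ).2.1| + 1 :=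
    ⟨_, rfl⟩
  have hB₁0 : 1 ≤ B₁ := by
    rw [hB₁]
    have h1 := abs_nonneg (deriv (fun x => V (x, (0 : ℝ × ℝ × ℝ).2)) (0 : ℝ × ℝ × ℝ).1)
    have h2 := abs_nonneg
      (deriv (fun x => V ((0 : ℝ × ℝ × ℝ).1, x, (0 : ℝ × ℝ × ℝ).2.2)) (0 : ℝ × ℝ × ℝ).2.1)
    linarith
  refine ⟨fun q => V q - γ / 2 * (q.2.2 ^ S.D * (q.1 * q.2.1)), by fun_prop,
    min ρ (min κ₀ (min 1 (ε ^ 2))), by positivity, c, hc, max C (2 * (B₁ + |γ|)), by positivity, ?_⟩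
  intro z w κ hz hw h0 hκ
  have hz' := hz.trans (min_le_left _ _)
  have hw' := hw.trans (min_le_left _ _)
  have hκρ := hκ.trans (min_le_left _ _)
  have hκ₀' := (hκ.trans (min_le_right _ _)).trans (min_le_left _ _)
  have hκ1 : κ ≤ 1 := ((hκ.trans (min_le_right _ _)).trans (min_le_right _ _)).trans (min_le_left _ _)
  have hκε : κ ≤ ε ^ 2 :=
    ((hκ.trans (min_le_right _ _)).trans (min_le_right _ _)).trans (min_le_right _ _)
  have hz1 : |z| ≤ 1 :=
    ((hz.trans (min_le_right _ _)).trans (min_le_right _ _)).trans (min_le_left _ _)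
  have hw1 : |w| ≤ 1 :=
    ((hw.trans (min_le_right _ _)).trans (min_le_right _ _)).trans (min_le_left _ _)
  obtain ⟨ea, eb, ec, ep₁, ep₂, eq₁, eq₂, eδ, eka, ekb, ekc, eV1, eV2⟩ := hρall z w κ hz' hw' h0 hκρ
  obtain ⟨n1, n2, n3, n4, n5⟩ := hnf z w κ
  have hbd {u v : ℝ} (h : |u - v| ≤ 1) : |u| ≤ |v| + 1 := by
    have := abs_sub_abs_le_abs_sub u v; linarith
  rw [sub_zero] at eka ekb ekc
  have hpowD : κ ^ S.D = κ ^ S.M * κ ^ (S.D - S.M) := by rw [← pow_add]; congr 1; omega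
  have hx : |κ ^ S.M * (z * w)| ≤ ε * (z ^ 2 + κ ^ S.L * w ^ 2) := by
    apply abs_mul_mul_le_of_sq hε
    have h2M : (κ ^ S.M) ^ 2 ≤ ε ^ 2 * κ ^ S.L := by
      calc (κ ^ S.M) ^ 2 = κ ^ (2 * S.M) := by rw [← pow_mul]; congr 1; ring
        _ ≤ κ ^ (S.L + 1) := pow_le_pow_of_le_one h0.le hκ1 hLM
        _ = κ * κ ^ S.L := by ring
        _ ≤ _ := by gcongr
    calc (κ ^ S.M) ^ 2 * w ^ 2 ≤ ε ^ 2 * κ ^ S.L * w ^ 2 := by gcongr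
      _ = _ := by ring
  have hy : |κ ^ (S.D - S.M)| ≤ 1 := by
    rw [abs_of_pos (by positivity)]; exact pow_le_one₀ h0.le hκ1
  obtain ⟨m1, m2, m3⟩ := hmargin (z ^ 2) (κ ^ S.L * w ^ 2) (κ ^ S.M * (z * w)) (κ ^ (S.D - S.M))
    (a (z, w, κ)) (b (z, w, κ)) (c' (z, w, κ)) (p₁ (z, w, κ)) (p₂ (z, w, κ)) (q₁ (z, w, κ))
    (q₂ (z, w, κ)) (δ (z, w, κ)) _ _ _ (by positivity) (by positivity) hx hy ea
    ((hbd eb).trans hBb) (by simpa using ec) ep₁ ((hbd ep₂).trans hBp) eq₁ ((hbd eq₂).trans hBq) eδ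
    eka (ekb.trans hB) ekc
  have hVe : V (z, w, κ) - γ / 2 * (κ ^ S.D * (z * w)) = z ^ 2 * a (z, w, κ) +
      κ ^ S.M * (z * w) * b (z, w, κ) + κ ^ S.L * w ^ 2 * c' (z, w, κ) -
        γ / 2 * (κ ^ (S.D - S.M) * (κ ^ S.M * (z * w))) := by
    rw [n1, hpowD]; ring
  have hW : 0 ≤ z ^ 2 + κ ^ S.L * w ^ 2 := by positivity
  dsimp only
  refine ⟨by rw [hVe]; exact m1, by rw [hVe]; exact m2.trans (by gcongr; exact le_max_left _ _),
    fun e₁ e₂ η he₁ he₂ => ?_⟩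
  have d1 : deriv (fun x => V (x, w, κ) - γ / 2 * (κ ^ S.D * (x * w))) z =
      S.Pf Rh Ψh (z, w, κ) - γ / 2 * (κ ^ S.D * w) := by
    have := (n4.fun_sub ((((hasDerivAt_id z).mul_const w).const_mul (κ ^ S.D)).const_mul (γ / 2))).deriv
    simpa using this
  have d2 : deriv (fun x => V (z, x, κ) - γ / 2 * (κ ^ S.D * (z * x))) w =
      κ ^ S.D * (z * δ (z, w, κ)) - κ ^ S.L * S.Qf Rh Ψh (z, w, κ) - γ / 2 * (κ ^ S.D * z) := by
    have := (n5.fun_sub ((((hasDerivAt_id w).const_mul z).const_mul (κ ^ S.D)).const_mul (γ / 2))).deriv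
    simpa using this
  have hdκf {f : ℝ × ℝ × ℝ → ℝ} (hf : ContDiff ℝ ∞ f) :
      HasDerivAt (fun x => f (z, w, x)) (deriv (fun x => f (z, w, x)) κ) κ := by
    have : ContDiff ℝ ∞ fun x => f (z, w, x) := hf.comp (f := fun x : ℝ => (z, w, x)) (by fun_prop)
    exact (this.differentiable (by simp) κ).hasDerivAt
  have hpk (k : ℕ) : κ * (k * κ ^ (k - 1)) = k * κ ^ k := by
    rcases k with _ | k
    · simp
    · rw [Nat.add_sub_cancel, pow_succ]; ring
  have d3 : κ * deriv (fun x => V (z, w, x) - γ / 2 * (x ^ S.D * (z * w))) κ =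
      z ^ 2 * (κ * deriv (fun x => a (z, w, x)) κ) + κ ^ S.M * (z * w) * (S.M * b (z, w, κ) +
        κ * deriv (fun x => b (z, w, x)) κ) + κ ^ S.L * w ^ 2 * (S.L * c' (z, w, κ) +
        κ * deriv (fun x => c' (z, w, x)) κ) - γ / 2 * S.D * (κ ^ (S.D - S.M) * (κ ^ S.M * (z * w))) := by
    have h1 : (fun x => V (z, w, x) - γ / 2 * (x ^ S.D * (z * w))) = fun x =>
        z ^ 2 * a (z, w, x) + x ^ S.M * (z * w) * b (z, w, x) + x ^ S.L * w ^ 2 * c' (z, w, x) -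
          γ / 2 * (x ^ S.D * (z * w)) := by
      ext x; rw [(hnf z w x).1]
    have h2 := ((((hdκf ha).const_mul (z ^ 2)).add ((((hasDerivAt_pow S.M κ).mul_const (z * w))).mul
      (hdκf hb))).add ((((hasDerivAt_pow S.L κ).mul_const (w ^ 2))).mul (hdκf hc'))).sub
      (((hasDerivAt_pow S.D κ).mul_const (z * w)).const_mul (γ / 2))
    rw [h1]
    refine (congrArg (κ * ·) h2.deriv).trans ?_
    have e1 := hpk S.M
    have e2 := hpk S.L
    have e3 := hpk S.D
    rw [hpowD] at e3
    linear_combination (z * w) * b (z, w, κ) * e1 + w ^ 2 * c' (z, w, κ) * e2 -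
      γ / 2 * (z * w) * e3
  have hm := m3 (κ ^ (S.M + S.D)) (κ ^ S.N) (by positivity) (by positivity)
    (pow_le_pow_of_le_one h0.le hκ1 hDN) (by
      have := hβ κ h0 hκ₀'
      rw [mul_one_div]; exact this)
  have hη : 0 ≤ η := (abs_nonneg _).trans he₁
  have herr : (deriv (fun x => V (x, w, κ)) z - γ / 2 * (κ ^ S.D * w)) * e₁ +
      (deriv (fun x => V (z, x, κ)) w - γ / 2 * (κ ^ S.D * z)) * e₂ ≤ 2 * (B₁ + |γ|) * η := by
    have hD1 : κ ^ S.D ≤ 1 := pow_le_one₀ h0.le hκ1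
    have hγb {u : ℝ} (hu : |u| ≤ 1) : |γ / 2 * (κ ^ S.D * u)| ≤ |γ| := by
      rw [abs_mul, abs_mul, abs_div, abs_two, abs_of_pos (pow_pos h0 S.D)]
      calc |γ| / 2 * (κ ^ S.D * |u|) ≤ |γ| / 2 * (1 * 1) := by gcongr
        _ ≤ |γ| := by linarith [abs_nonneg γ]
    have h1 : |deriv (fun x => V (x, w, κ)) z - γ / 2 * (κ ^ S.D * w)| ≤ B₁ + |γ| := by
      refine (abs_sub _ _).trans (add_le_add ((hbd eV1).trans ?_) (hγb hw1))
      rw [hB₁]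
      linarith [abs_nonneg
        (deriv (fun x => V ((0 : ℝ × ℝ × ℝ).1, x, (0 : ℝ × ℝ × ℝ).2.2)) (0 : ℝ × ℝ × ℝ).2.1)]
    have h2 : |deriv (fun x => V (z, x, κ)) w - γ / 2 * (κ ^ S.D * z)| ≤ B₁ + |γ| := by
      refine (abs_sub _ _).trans (add_le_add ((hbd eV2).trans ?_) (hγb hz1))
      rw [hB₁]
      linarith [abs_nonneg (deriv (fun x => V (x, (0 : ℝ × ℝ × ℝ).2)) (0 : ℝ × ℝ × ℝ).1)]
    linarith [mul_le_of_abs_le_of_abs_le h1 he₁, mul_le_of_abs_le_of_abs_le h2 he₂]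
  rw [n4.deriv, n5.deriv] at herr
  have hCη : 2 * (B₁ + |γ|) * η ≤ max C (2 * (B₁ + |γ|)) * η := by
    gcongr; exact le_max_right _ _
  refine le_trans ?_ hCη
  rw [d1, d2, hVe]
  have e4 : deriv (fun x => V (z, w, x) - γ / 2 * (x ^ S.D * (z * w))) κ * (-κ ^ (S.N + 1) / S.N) =
      -(κ ^ S.N / S.N) * (κ * deriv (fun x => V (z, w, x) - γ / 2 * (x ^ S.D * (z * w))) κ) := by
    ring
  rw [e4, d3, pow_add κ S.M S.L]
  have hn2 : z * p₁ (z, w, κ) * z = z * S.Pf Rh Ψh (z, w, κ) - κ ^ S.M * (z * w) * p₂ (z, w, κ) := by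
    rw [n2]; ring
  have hn3 : κ ^ S.L * w ^ 2 * q₁ (z, w, κ) = w * (κ ^ S.L * S.Qf Rh Ψh (z, w, κ)) -
      κ ^ S.M * (z * w) * q₂ (z, w, κ) := by
    rw [n3]; ring
  rw [pow_add κ S.M S.D] at hm
  rw [hpowD] at hm herr ⊢
  linear_combination hm + herr + κ ^ S.M * (κ ^ S.M * κ ^ (S.D - S.M)) * (-(δ (z, w, κ) - γ / 2) * hn2 +
    γ / 2 * hn3)

end LockedModel

section Scale

variable {N : ℕ}

theorem rpow_neg_one_div_pow {τ : ℝ} (hτ : 0 < τ) (k : ℕ) :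
    (τ ^ (-(1 : ℝ) / N)) ^ k = τ ^ (-(k : ℝ) / N) := by
  rw [← rpow_natCast, ← rpow_mul hτ.le]
  congr 1; ring

theorem rpow_neg_one_div_pow_self (hN : 1 ≤ N) {τ : ℝ} (hτ : 0 < τ) :
    (τ ^ (-(1 : ℝ) / N)) ^ N = τ⁻¹ := by
  have : (N : ℝ) ≠ 0 := by positivity
  rw [rpow_neg_one_div_pow hτ, neg_div, div_self this, Real.rpow_neg_one]

theorem hasDerivAt_rpow_neg_one_div (hN : 1 ≤ N) {τ : ℝ} (hτ : 0 < τ) :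
    HasDerivAt (fun τ : ℝ => τ ^ (-(1 : ℝ) / N)) (-(τ ^ (-(1 : ℝ) / N)) ^ (N + 1) / N) τ := by
  refine (Real.hasDerivAt_rpow_const (p := -(1 : ℝ) / N) (Or.inl hτ.ne')).congr_deriv ?_
  rw [pow_succ, rpow_neg_one_div_pow_self hN hτ, Real.rpow_sub_one hτ.ne']
  ring

end Scale

namespace LockedModel

variable (S : LockedModel)

theorem one_le_N : 1 ≤ S.N := by
  have h1 := S.one_le_M
  have h2 := S.L_le
  omega

/-- The small parameter `κ = τ^(-1/N)`. -/
def κ (τ : ℝ) : ℝ := τ ^ (-(1 : ℝ) / S.N)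

theorem κ_pos {τ : ℝ} (hτ : 0 < τ) : 0 < S.κ τ := rpow_pos_of_pos hτ _

theorem κ_anti {τ τ' : ℝ} (hτ : 0 < τ) (h : τ ≤ τ') : S.κ τ' ≤ S.κ τ := by
  apply Real.rpow_le_rpow_of_nonpos hτ h
  rw [neg_div]
  have : (0 : ℝ) ≤ 1 / S.N := by positivity
  linarith

theorem one_le_of_κ_le_one {τ : ℝ} (hτ : 0 < τ) (h : S.κ τ ≤ 1) : 1 ≤ τ := by
  have h1 := rpow_neg_one_div_pow_self S.one_le_N hτ
  have h2 : S.κ τ ^ S.N ≤ 1 := pow_le_one₀ (S.κ_pos hτ).le h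
  unfold κ at h2
  rw [h1] at h2
  exact (one_le_inv₀ (inv_pos.2 hτ)).2 h2 |>.trans_eq (inv_inv τ)

/-- The decay of the Lyapunov function along a trajectory. -/
theorem lyapunov_decay {V : ℝ × ℝ × ℝ → ℝ} (hV : ContDiff ℝ ∞ V) {β β' C η τs T : ℝ}
    (hτs : 1 ≤ τs) (hT : τs ≤ T) (hβ' : β' ≤ β) (hβ'2 : β' ≤ 2 * S.M / S.N) (hC : 0 ≤ C) (hη : 0 ≤ η)
    {Rh Ψh z w z' w' : ℝ → ℝ} (hz : ContinuousOn z (Icc τs T))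
    (hw : ContinuousOn w (Icc τs T))
    (hz' : ∀ τ ∈ Ioo τs T, HasDerivAt z (z' τ) τ) (hw' : ∀ τ ∈ Ioo τs T, HasDerivAt w (w' τ) τ)
    (hV0 : ∀ τ ∈ Ioo τs T, 0 ≤ V (z τ, w τ, S.κ τ))
    (he₁ : ∀ τ ∈ Ioo τs T, |z' τ - S.κ τ ^ (S.M + S.L) * S.Qf Rh Ψh (z τ, w τ, S.κ τ)| ≤
      η * S.κ τ ^ (S.N + 2 * S.M + 1 + S.L))
    (he₂ : ∀ τ ∈ Ioo τs T, |w' τ - S.κ τ ^ S.M * S.Pf Rh Ψh (z τ, w τ, S.κ τ)| ≤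
      η * S.κ τ ^ (S.N + 2 * S.M + 1 + S.L))
    (hVd : ∀ τ ∈ Ioo τs T, ∀ e₁ e₂ η : ℝ, |e₁| ≤ η → |e₂| ≤ η →
      deriv (fun x => V (x, w τ, S.κ τ)) (z τ) *
          (S.κ τ ^ (S.M + S.L) * S.Qf Rh Ψh (z τ, w τ, S.κ τ) + e₁) +
        deriv (fun x => V (z τ, x, S.κ τ)) (w τ) * (S.κ τ ^ S.M * S.Pf Rh Ψh (z τ, w τ, S.κ τ) + e₂) +
        deriv (fun x => V (z τ, w τ, x)) (S.κ τ) * (-S.κ τ ^ (S.N + 1) / S.N) +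
        ((S.L : ℝ) / S.N + β) * S.κ τ ^ S.N * V (z τ, w τ, S.κ τ) ≤ C * η) :
    T ^ (β' + S.L / S.N) * V (z T, w T, S.κ T) ≤
      τs ^ (β' + S.L / S.N) * V (z τs, w τs, S.κ τs) + S.N * (C * η) * S.κ τs := by
  have hN := S.one_le_N
  have hN0 : (0 : ℝ) < S.N := by exact_mod_cast hN
  have hpos : ∀ τ, τs ≤ τ → 0 < τ := fun τ h => by linarith
  obtain ⟨p, hp⟩ : ∃ p, p = β' + (S.L : ℝ) / S.N := ⟨_, rfl⟩
  rw [← hp]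
  have hκc : ContinuousOn S.κ (Icc τs T) := fun τ hτ =>
    (hasDerivAt_rpow_neg_one_div hN (hpos τ hτ.1)).continuousAt.continuousWithinAt
  have hanti : AntitoneOn (fun τ => τ ^ p * V (z τ, w τ, S.κ τ) + S.N * (C * η) * S.κ τ)
      (Icc τs T) := by
    have hder : ∀ τ ∈ Ioo τs T, HasDerivAt
        (fun τ => τ ^ p * V (z τ, w τ, S.κ τ) + S.N * (C * η) * S.κ τ)
        (p * τ ^ (p - 1) * V (z τ, w τ, S.κ τ) + τ ^ p *
          (deriv (fun x => V (x, w τ, S.κ τ)) (z τ) * z' τ +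
          deriv (fun x => V (z τ, x, S.κ τ)) (w τ) * w' τ +
          deriv (fun x => V (z τ, w τ, x)) (S.κ τ) * (-S.κ τ ^ (S.N + 1) / S.N)) +
          S.N * (C * η) * (-S.κ τ ^ (S.N + 1) / S.N)) τ := fun τ hτ => by
      have h0 := hpos τ hτ.1.le
      have hk := hasDerivAt_rpow_neg_one_div (N := S.N) hN h0
      exact ((Real.hasDerivAt_rpow_const (p := p) (Or.inl h0.ne')).mul
        (hasDerivAt_comp_triple hV (hz' τ hτ) (hw' τ hτ) hk)).add (hk.const_mul _)
    refine antitoneOn_of_deriv_nonpos (convex_Icc _ _) ?_ ?_ ?_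
    · have h1 : ContinuousOn (fun τ : ℝ => τ ^ p) (Icc τs T) := fun τ hτ =>
        (Real.continuousAt_rpow_const _ _ (Or.inl (hpos τ hτ.1).ne')).continuousWithinAt
      have h2 : ContinuousOn (fun τ => V (z τ, w τ, S.κ τ)) (Icc τs T) :=
        hV.continuous.comp_continuousOn (hz.prodMk (hw.prodMk hκc))
      exact (h1.mul h2).add (continuousOn_const.mul hκc)
    · rw [interior_Icc]
      exact fun τ hτ => (hder τ hτ).differentiableAt.differentiableWithinAt
    · rw [interior_Icc]
      intro τ hτ
      rw [(hder τ hτ).deriv]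
      have h0 := hpos τ hτ.1.le
      have h1 : (1 : ℝ) ≤ τ := hτs.trans hτ.1.le
      have hk0 := S.κ_pos h0
      have hb := hVd τ hτ _ _ _ (he₁ τ hτ) (he₂ τ hτ)
      rw [add_sub_cancel, add_sub_cancel] at hb
      have hkN : S.κ τ ^ S.N = τ⁻¹ := rpow_neg_one_div_pow_self hN h0
      have hp1 : τ ^ (p - 1) = τ ^ p * S.κ τ ^ S.N := by
        rw [hkN, Real.rpow_sub_one h0.ne', div_eq_mul_inv]
      have hpβ : p * (S.κ τ ^ S.N * V (z τ, w τ, S.κ τ)) ≤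
          ((S.L : ℝ) / S.N + β) * (S.κ τ ^ S.N * V (z τ, w τ, S.κ τ)) := by
        apply mul_le_mul_of_nonneg_right (by rw [hp]; linarith)
        exact mul_nonneg (by positivity) (hV0 τ hτ)
      have hexp : τ ^ p * S.κ τ ^ (S.N + 2 * S.M + 1 + S.L) ≤ S.κ τ ^ (S.N + 1) := by
        unfold κ
        rw [rpow_neg_one_div_pow h0, rpow_neg_one_div_pow h0, ← rpow_add h0]
        apply Real.rpow_le_rpow_of_exponent_le h1
        rw [hp]
        have : (2 * S.M : ℝ) / S.N + (S.L : ℝ) / S.N + -((S.N + 2 * S.M + 1 + S.L : ℕ) : ℝ) / S.N =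
            -((S.N + 1 : ℕ) : ℝ) / S.N := by
          push_cast; ring
        linarith
      have hb' := mul_le_mul_of_nonneg_left hb (rpow_nonneg h0.le p)
      have hpβ' := mul_le_mul_of_nonneg_left hpβ (rpow_nonneg h0.le p)
      have hexp' := mul_le_mul_of_nonneg_left hexp (mul_nonneg hC hη)
      have hcancel : S.N * (C * η) * (-S.κ τ ^ (S.N + 1) / S.N) = -(C * η * S.κ τ ^ (S.N + 1)) := by
        field_simp
      rw [hp1, hcancel]
      linear_combination hb' + hpβ' + hexp'
  have h := hanti (Set.left_mem_Icc.2 hT) (Set.right_mem_Icc.2 hT) hT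
  have hT0 : 0 ≤ S.N * (C * η) * S.κ T :=
    mul_nonneg (by positivity) (S.κ_pos (hpos T hT)).le
  dsimp only at h
  linarith

end LockedModel

namespace LockedModel

variable (S : LockedModel)

theorem abs_residual_le {R' d κ F₁ F₀ g C₀ C₁ N : ℝ} {s t J E : ℕ} (hκ : 0 < κ) (hκ1 : κ ≤ 1)
    (hJ : E ≤ s + J) (h1 : |R' - κ ^ s * F₁| ≤ C₀ * κ ^ E) (hg : |g| ≤ C₁)
    (hres : F₀ + 1 / N * κ ^ t * d = κ ^ J * g) {N' : ℕ} (ht : s + t = N' + 1) :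
    |R' - d * (-κ ^ (N' + 1) / N) - κ ^ s * (F₁ - F₀)| ≤ (C₀ + C₁) * κ ^ E := by
  have e : R' - d * (-κ ^ (N' + 1) / N) - κ ^ s * (F₁ - F₀) =
      (R' - κ ^ s * F₁) + κ ^ (s + J) * g := by
    rw [← ht, pow_add, pow_add]
    linear_combination κ ^ s * hres
  rw [e]
  refine (abs_add_le _ _).trans ?_
  rw [add_mul]
  refine add_le_add h1 ?_
  rw [abs_mul, abs_of_pos (pow_pos hκ _), mul_comm]
  have := pow_le_pow_of_le_one hκ.le hκ1 hJ
  have := (abs_nonneg g).trans hg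
  gcongr

theorem abs_le_of_closure {f : ℝ → ℝ} {a b c ρ : ℝ} (hab : a < b) (hf : ContinuousOn f (Icc a b))
    (h : ∀ t ∈ Ioo a b, |f t - c| ≤ ρ) : ∀ t ∈ Icc a b, |f t - c| ≤ ρ := by
  have h1 : Set.MapsTo f (Ioo a b) (Metric.closedBall c ρ) := fun t ht => by
    rw [Metric.mem_closedBall, Real.dist_eq]; exact h t ht
  have h2 := h1.closure_of_continuousOn (by rwa [closure_Ioo hab.ne])
  rw [closure_Ioo hab.ne, Metric.isClosed_closedBall.closure_eq] at h2
  intro t ht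
  have := h2 ht
  rwa [Metric.mem_closedBall, Real.dist_eq] at this

set_option maxHeartbeats 1000000 in
/-- Stability of the locked phase, with a rate of convergence, for the averaged equations with a
remainder of sufficiently high order. -/
theorem exists_stability {g β β' κ₀ : ℝ} (hg : 0 < g) (hκ₀ : 0 < κ₀)
    (hβ : ∀ κ, 0 < κ → κ ≤ κ₀ → S.dh (0, S.φ₀, 0) * κ ^ (S.M + S.D) +
      ((S.L : ℝ) / S.N + β) * κ ^ S.N ≤ -g * κ ^ (S.M + S.D))
    (hβ'0 : 0 ≤ β') (hβ' : β' ≤ β) (hβ'2 : β' ≤ 2 * S.M / S.N) :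
    ∃ ρ > 0, ∀ ρ' > 0, ∀ C₀ > 0, ∃ κ₁ > 0, ∃ C > 0, ∀ τs T : ℝ, 0 < τs → S.κ τs ≤ κ₁ → τs ≤ T →
      ∀ R Ψ R' Ψ' : ℝ → ℝ, ContinuousOn R (Icc τs T) → ContinuousOn Ψ (Icc τs T) →
      |R τs| ≤ C₀ * S.κ τs ^ S.M → |Ψ τs - S.φ₀| ≤ C₀ * S.κ τs →
      (∀ τ ∈ Ioo τs T, |R τ| ≤ ρ ∧ |Ψ τ - S.φ₀| ≤ ρ ∧ HasDerivAt R (R' τ) τ ∧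
        HasDerivAt Ψ (Ψ' τ) τ ∧
        |R' τ - S.κ τ ^ (S.M + S.L) * S.Lh (R τ, Ψ τ, S.κ τ)| ≤
          C₀ * S.κ τ ^ (S.N + 2 * S.M + 1 + S.L) ∧
        |Ψ' τ - S.κ τ ^ S.M * S.Oh (R τ, Ψ τ, S.κ τ)| ≤
          C₀ * S.κ τ ^ (S.N + 2 * S.M + 1 + S.L)) →
      |R T| < ρ' ∧ |Ψ T - S.φ₀| < ρ' ∧
        |R T| ≤ C * (τs ^ (β' / 2) * T ^ (-(β' / 2)) + S.κ T ^ S.M) ∧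
        |Ψ T - S.φ₀| ≤ C * (τs ^ (β' / 2) * T ^ (-(β' / 2)) + S.κ T) := by
  have hM := S.one_le_M
  have hMD := S.M_le_D
  have hLM := S.L_lt
  have hLN := S.L_le
  have hDN := S.D_le
  obtain ⟨E, hE⟩ : ∃ E, E = S.N + 2 * S.M + 1 + S.L := ⟨_, rfl⟩
  obtain ⟨Rh, Ψh, hR, hΨ, hR0, hΨ0, g₁, g₂, hg₁, hg₂, h1, h2⟩ := S.exists_reference E (by omega)
  obtain ⟨Cr, hCr, κr, hκr, href⟩ := S.exists_reference_bound (by omega) hR hΨ hR0 hΨ0 hg₂ h2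
  obtain ⟨V, hV, ρV, hρV, c, hc, CV, hCV, hlyap⟩ := S.exists_lyapunov hg hκ₀ hβ hR hΨ hR0 hΨ0
  obtain ⟨G₁, hG₁, hg₁b⟩ := exists_abs_le_of_continuous hg₁.continuous 1
  obtain ⟨G₂, hG₂, hg₂b⟩ := exists_abs_le_of_continuous hg₂.continuous 1
  refine ⟨ρV / 2, by positivity, fun ρ' hρ' C₀ hC₀ => ?_⟩
  obtain ⟨η, hη⟩ : ∃ η, η = C₀ + (G₁ + G₂) := ⟨_, rfl⟩
  have hη0 : 0 < η := by rw [hη]; positivity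
  obtain ⟨C₆, hC₆⟩ : ∃ C₆, C₆ = C₀ + Cr := ⟨_, rfl⟩
  have hC₆0 : 0 < C₆ := by rw [hC₆]; positivity
  obtain ⟨C₇, hC₇⟩ : ∃ C₇, C₇ = 2 * CV * C₆ ^ 2 + S.N * (CV * η) := ⟨_, rfl⟩
  have hC₇0 : 0 < C₇ := by rw [hC₇]; positivity
  obtain ⟨C₈, hC₈⟩ : ∃ C₈, C₈ = 1 + C₇ / c := ⟨_, rfl⟩
  have hC₈0 : 0 < C₈ := by rw [hC₈]; positivity
  -- the smallness of the initial time
  have hsmall : ∃ κ₁ > 0, κ₁ ≤ 1 ∧ κ₁ ≤ κr ∧ κ₁ ≤ ρV ∧ C₆ * κ₁ ≤ ρV / 2 ∧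
      C₈ * κ₁ ^ (1 / 2 : ℝ) + Cr * κ₁ < ρ' := by
    have hcont : Continuous fun κ : ℝ => C₈ * κ ^ (1 / 2 : ℝ) + Cr * κ :=
      (continuous_const.mul (Real.continuous_rpow_const (by norm_num))).add (by fun_prop)
    have hev : ∀ᶠ κ in 𝓝[>] (0 : ℝ), C₈ * κ ^ (1 / 2 : ℝ) + Cr * κ < ρ' :=
      nhdsWithin_le_nhds (hcont.continuousAt.eventually (gt_mem_nhds (by
        simp [Real.zero_rpow]; exact hρ')))
    have hle : ∀ {v : ℝ}, 0 < v → ∀ᶠ κ in 𝓝[>] (0 : ℝ), κ ≤ v := fun hv =>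
      nhdsWithin_le_nhds (ge_mem_nhds hv)
    obtain ⟨κ₁, hk0, hk1, hk2, hk3, hk4, hk5⟩ := ((eventually_mem_nhdsWithin).and <|
      (hle one_pos).and <| (hle hκr).and <| (hle hρV).and <|
      (hle (show 0 < ρV / 2 / C₆ by positivity)).and hev).exists
    exact ⟨κ₁, hk0, hk1, hk2, hk3, by rw [le_div_iff₀ hC₆0] at hk4; linarith, hk5⟩
  obtain ⟨κ₁, hκ₁, hκ1, hκr', hκV, hκ6, hκρ'⟩ := hsmall
  refine ⟨κ₁, hκ₁, C₈ + Cr, by positivity, ?_⟩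
  intro τs T hτs hκs hT R Ψ R' Ψ' hRc hΨc hRs hΨs hall
  rw [← hE] at hall
  have hτs1 : 1 ≤ τs := S.one_le_of_κ_le_one hτs (hκs.trans hκ1)
  have hpos : ∀ τ, τs ≤ τ → 0 < τ := fun τ h => hτs.trans_le h
  have hκle : ∀ τ, τs ≤ τ → S.κ τ ≤ κ₁ := fun τ h => (S.κ_anti hτs h).trans hκs
  have href' : ∀ τ, τs ≤ τ → |Rh (S.κ τ)| ≤ Cr * S.κ τ ^ S.M ∧ |Ψh (S.κ τ) - S.φ₀| ≤ Cr * S.κ τ :=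
    fun τ h => href _ (S.κ_pos (hpos τ h)) ((hκle τ h).trans hκr')
  have hpowM : ∀ τ, τs ≤ τ → S.κ τ ^ S.M ≤ S.κ τ := fun τ h => by
    calc S.κ τ ^ S.M ≤ S.κ τ ^ 1 :=
          pow_le_pow_of_le_one (S.κ_pos (hpos τ h)).le ((hκle τ h).trans hκ1) hM
      _ = _ := pow_one _
  have hCr1 : ∀ τ, τs ≤ τ → Cr * S.κ τ ≤ ρV / 2 := fun τ h => by
    calc Cr * S.κ τ ≤ C₆ * κ₁ := by
          have := (S.κ_pos (hpos τ h)).le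
          apply mul_le_mul (by rw [hC₆]; linarith) (hκle τ h) this hC₆0.le
      _ ≤ _ := hκ6
  obtain ⟨z, hz⟩ : ∃ z : ℝ → ℝ, z = fun τ => R τ - Rh (S.κ τ) := ⟨_, rfl⟩
  obtain ⟨w, hw⟩ : ∃ w : ℝ → ℝ, w = fun τ => Ψ τ - Ψh (S.κ τ) := ⟨_, rfl⟩
  have hκd : ∀ τ, τs ≤ τ → HasDerivAt S.κ (-S.κ τ ^ (S.N + 1) / S.N) τ := fun τ h =>
    hasDerivAt_rpow_neg_one_div S.one_le_N (hpos τ h)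
  have hκc : ContinuousOn S.κ (Icc τs T) := fun τ hτ =>
    (hκd τ hτ.1).continuousAt.continuousWithinAt
  have hzc : ContinuousOn z (Icc τs T) := by
    rw [hz]; exact hRc.sub (hR.continuous.comp_continuousOn hκc)
  have hwc : ContinuousOn w (Icc τs T) := by
    rw [hw]; exact hΨc.sub (hΨ.continuous.comp_continuousOn hκc)
  have hzs : |z τs| ≤ C₆ * S.κ τs ^ S.M := by
    rw [hz, hC₆, add_mul]
    exact (abs_sub _ _).trans (add_le_add hRs (href' τs le_rfl).1)
  have hws : |w τs| ≤ C₆ * S.κ τs := by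
    rw [hw, hC₆, add_mul]
    have e : Ψ τs - Ψh (S.κ τs) = (Ψ τs - S.φ₀) - (Ψh (S.κ τs) - S.φ₀) := by ring
    dsimp only
    rw [e]
    exact (abs_sub _ _).trans (add_le_add hΨs (href' τs le_rfl).2)
  have hzwV : ∀ τ ∈ Icc τs T, |z τ| ≤ ρV ∧ |w τ| ≤ ρV := by
    have hκ6' : C₆ * S.κ τs ≤ ρV / 2 :=
      (mul_le_mul_of_nonneg_left (hκle τs le_rfl) hC₆0.le).trans hκ6
    rcases hT.eq_or_lt with rfl | hlt
    · rw [Set.Icc_self]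
      rintro τ rfl
      have := mul_le_mul_of_nonneg_left (hpowM τ le_rfl) hC₆0.le
      exact ⟨by linarith, by linarith⟩
    · have k1 := abs_le_of_closure (c := 0) hlt hRc fun t ht => by
        rw [sub_zero]; exact (hall t ht).1
      have k2 := abs_le_of_closure hlt hΨc fun t ht => (hall t ht).2.1
      intro τ hτ
      have l1 := k1 τ hτ
      rw [sub_zero] at l1
      have l2 := k2 τ hτ
      have l3 := hCr1 τ hτ.1
      have l4 := mul_le_mul_of_nonneg_left (hpowM τ hτ.1) hCr.le
      rw [hz, hw]
      refine ⟨(abs_sub _ _).trans ?_, ?_⟩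
      · linarith [(href' τ hτ.1).1]
      · have e : Ψ τ - Ψh (S.κ τ) = (Ψ τ - S.φ₀) - (Ψh (S.κ τ) - S.φ₀) := by ring
        dsimp only
        rw [e]
        refine (abs_sub _ _).trans ?_
        linarith [(href' τ hτ.1).2]
  have hly : ∀ τ ∈ Icc τs T, _ := fun τ hτ =>
    hlyap (z τ) (w τ) (S.κ τ) (hzwV τ hτ).1 (hzwV τ hτ).2 (S.κ_pos (hpos τ hτ.1))
      ((hκle τ hτ.1).trans hκV)
  have hWnn : ∀ τ, τs ≤ τ → 0 ≤ z τ ^ 2 + S.κ τ ^ S.L * w τ ^ 2 := fun τ h => by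
    have := S.κ_pos (hpos τ h)
    positivity
  have hdecay := S.lyapunov_decay hV (Rh := Rh) (Ψh := Ψh)
    (z' := fun τ => R' τ - deriv Rh (S.κ τ) * (-S.κ τ ^ (S.N + 1) / S.N))
    (w' := fun τ => Ψ' τ - deriv Ψh (S.κ τ) * (-S.κ τ ^ (S.N + 1) / S.N)) (C := CV) (η := η)
    hτs1 hT hβ' hβ'2 hCV.le hη0.le hzc hwc
    (fun τ hτ => by
      rw [hz]
      exact (hall τ hτ).2.2.1.sub ((hR.differentiable (by simp) _).hasDerivAt.comp τ (hκd τ hτ.1.le)))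
    (fun τ hτ => by
      rw [hw]
      exact (hall τ hτ).2.2.2.1.sub
        ((hΨ.differentiable (by simp) _).hasDerivAt.comp τ (hκd τ hτ.1.le)))
    (fun τ hτ => by
      have hτ' := Set.Ioo_subset_Icc_self hτ
      exact le_trans (mul_nonneg hc.le (hWnn τ hτ'.1)) (hly τ hτ').1)
    (fun τ hτ => by
      have h0 := S.κ_pos (hpos τ hτ.1.le)
      have hk1 := (hκle τ hτ.1.le).trans hκ1
      have := abs_residual_le (s := S.M + S.L) (t := S.N + 1 - S.M - S.L) (J := E) (E := E) h0 hk1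
        (by omega) (hall τ hτ).2.2.2.2.1 (hg₁b _ h0 hk1) (h1 (S.κ τ)) (N' := S.N) (by omega)
      rw [← hE, Qf, hz, hw]
      simp only [add_sub_cancel]
      refine this.trans ?_
      have := pow_pos h0 E
      gcongr
      linarith)
    (fun τ hτ => by
      have h0 := S.κ_pos (hpos τ hτ.1.le)
      have hk1 := (hκle τ hτ.1.le).trans hκ1
      have := abs_residual_le (s := S.M) (t := S.N + 1 - S.M) (J := E) (E := E) h0 hk1
        (by omega) (hall τ hτ).2.2.2.2.2 (hg₂b _ h0 hk1) (h2 (S.κ τ)) (N' := S.N) (by omega)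
      rw [← hE, Pf, hz, hw]
      simp only [add_sub_cancel]
      refine this.trans ?_
      have := pow_pos h0 E
      gcongr
      linarith)
    (fun τ hτ => (hly τ (Set.Ioo_subset_Icc_self hτ)).2.2)
  have hks0 := S.κ_pos hτs
  have hT0 := hpos T hT
  have hkT0 := S.κ_pos hT0
  have hks1 : S.κ τs ≤ 1 := hκs.trans hκ1
  -- the initial value of the Lyapunov function
  have hVs : V (z τs, w τs, S.κ τs) ≤ 2 * CV * C₆ ^ 2 * (S.κ τs ^ S.L * S.κ τs) := by
    refine (hly τs (Set.left_mem_Icc.2 hT)).2.1.trans ?_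
    have e1 : z τs ^ 2 ≤ C₆ ^ 2 * (S.κ τs ^ S.L * S.κ τs) := by
      calc z τs ^ 2 = |z τs| ^ 2 := (sq_abs _).symm
        _ ≤ (C₆ * S.κ τs ^ S.M) ^ 2 := by gcongr
        _ = C₆ ^ 2 * S.κ τs ^ (2 * S.M) := by rw [mul_pow, ← pow_mul]; congr 2; ring
        _ ≤ C₆ ^ 2 * S.κ τs ^ (S.L + 1) := by
          exact mul_le_mul_of_nonneg_left (pow_le_pow_of_le_one hks0.le hks1 hLM) (sq_nonneg _)
        _ = _ := by rw [pow_succ (S.κ τs) S.L]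
    have e2 : w τs ^ 2 ≤ C₆ ^ 2 * S.κ τs := by
      calc w τs ^ 2 = |w τs| ^ 2 := (sq_abs _).symm
        _ ≤ (C₆ * S.κ τs) ^ 2 := by gcongr
        _ = C₆ ^ 2 * (S.κ τs * S.κ τs) := by ring
        _ ≤ C₆ ^ 2 * (S.κ τs * 1) := by gcongr
        _ = _ := by ring
    calc CV * (z τs ^ 2 + S.κ τs ^ S.L * w τs ^ 2) ≤
        CV * (C₆ ^ 2 * (S.κ τs ^ S.L * S.κ τs) + S.κ τs ^ S.L * (C₆ ^ 2 * S.κ τs)) := by gcongr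
      _ = _ := by ring
  have hκL : ∀ {τ : ℝ}, 0 < τ → τ ^ ((S.L : ℝ) / S.N) * S.κ τ ^ S.L = 1 := fun {τ} h => by
    unfold κ
    rw [rpow_neg_one_div_pow h, ← rpow_add h, neg_div, add_neg_cancel, Real.rpow_zero]
  have hu : T ^ (β' + S.L / S.N) * V (z T, w T, S.κ T) ≤ C₇ * (τs ^ β' * S.κ τs) := by
    refine hdecay.trans ?_
    have i1 := mul_le_mul_of_nonneg_left hVs (rpow_nonneg hτs.le (β' + S.L / S.N))
    have i2 : τs ^ (β' + S.L / S.N) * (2 * CV * C₆ ^ 2 * (S.κ τs ^ S.L * S.κ τs)) =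
        2 * CV * C₆ ^ 2 * (τs ^ β' * S.κ τs) := by
      rw [rpow_add hτs]
      linear_combination 2 * CV * C₆ ^ 2 * τs ^ β' * S.κ τs * hκL hτs
    have i3 : (1 : ℝ) ≤ τs ^ β' := Real.one_le_rpow hτs1 hβ'0
    have i4 : S.N * (CV * η) * S.κ τs ≤ S.N * (CV * η) * (τs ^ β' * S.κ τs) := by
      gcongr; exact le_mul_of_one_le_left hks0.le i3
    rw [hC₇]
    linarith
  -- the resulting bound for the deviations
  obtain ⟨q, hq⟩ : ∃ q, q = τs ^ (β' / 2) * T ^ (-(β' / 2)) := ⟨_, rfl⟩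
  have hq0 : 0 < q := by rw [hq]; positivity
  have hq2 : q ^ 2 = τs ^ β' * T ^ (-β') := by
    rw [hq, mul_pow, ← rpow_natCast, ← rpow_natCast, ← rpow_mul hτs.le,
      ← rpow_mul hT0.le]
    norm_num
  have hq1 : q ≤ 1 := by
    rw [hq, rpow_neg hT0.le, ← div_eq_mul_inv]
    exact div_le_one_of_le₀ (Real.rpow_le_rpow hτs.le hT (by linarith)) (by positivity)
  have hVT : V (z T, w T, S.κ T) ≤ C₇ * (q ^ 2 * S.κ τs) * S.κ T ^ S.L := by
    have hTβ : T ^ β' * T ^ (-β') = 1 := by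
      rw [← rpow_add hT0, add_neg_cancel, Real.rpow_zero]
    have i1 := mul_le_mul_of_nonneg_left hu
      (mul_nonneg (rpow_nonneg hT0.le (-β')) (pow_nonneg hkT0.le S.L))
    rw [rpow_add hT0] at i1
    rw [hq2]
    have i2 := hκL hT0
    have i3 : T ^ (-β') * S.κ T ^ S.L * (T ^ β' * T ^ ((S.L : ℝ) / S.N) * V (z T, w T, S.κ T)) =
        V (z T, w T, S.κ T) := by
      linear_combination (T ^ ((S.L : ℝ) / S.N) * S.κ T ^ S.L * V (z T, w T, S.κ T)) * hTβ +
        V (z T, w T, S.κ T) * i2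
    rw [i3] at i1
    linear_combination i1
  have hlow := (hly T (Set.right_mem_Icc.2 hT)).1
  have hkTL : 0 < S.κ T ^ S.L := pow_pos hkT0 _
  have hkTL1 : S.κ T ^ S.L ≤ 1 := pow_le_one₀ hkT0.le ((hκle T hT).trans hκ1)
  have hsq {x : ℝ} (hx : c * x ^ 2 ≤ C₇ * (q ^ 2 * S.κ τs)) :
      |x| ≤ C₈ * (q * S.κ τs ^ (1 / 2 : ℝ)) := by
    refine abs_le_of_sq_le_sq ?_ (by positivity)
    have e1 : (S.κ τs ^ (1 / 2 : ℝ)) ^ 2 = S.κ τs := by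
      rw [← rpow_natCast, ← rpow_mul hks0.le]; norm_num
    rw [mul_pow, mul_pow, e1]
    have e2 : x ^ 2 ≤ C₇ / c * (q ^ 2 * S.κ τs) := by
      rw [div_mul_eq_mul_div, le_div_iff₀ hc]; linarith
    refine e2.trans ?_
    have e3 : C₇ / c ≤ C₈ ^ 2 := by
      have : 0 < C₇ / c := by positivity
      rw [hC₈]; nlinarith
    gcongr
  have hzT : |z T| ≤ C₈ * (q * S.κ τs ^ (1 / 2 : ℝ)) := by
    apply hsq
    have : 0 ≤ c * (S.κ T ^ S.L * w T ^ 2) := by positivity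
    have h3 : C₇ * (q ^ 2 * S.κ τs) * S.κ T ^ S.L ≤ C₇ * (q ^ 2 * S.κ τs) :=
      mul_le_of_le_one_right (by positivity) hkTL1
    linarith
  have hwT : |w T| ≤ C₈ * (q * S.κ τs ^ (1 / 2 : ℝ)) := by
    apply hsq
    have h3 : 0 ≤ c * z T ^ 2 := by positivity
    have h4 : (c * w T ^ 2) * S.κ T ^ S.L ≤ C₇ * (q ^ 2 * S.κ τs) * S.κ T ^ S.L := by linarith
    exact le_of_mul_le_mul_right h4 hkTL
  have hsq1 : S.κ τs ^ (1 / 2 : ℝ) ≤ κ₁ ^ (1 / 2 : ℝ) := Real.rpow_le_rpow hks0.le hκs (by norm_num)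
  have hsq2 : S.κ τs ^ (1 / 2 : ℝ) ≤ 1 := Real.rpow_le_one hks0.le hks1 (by norm_num)
  have hsq0 : 0 < S.κ τs ^ (1 / 2 : ℝ) := by positivity
  have b1 : C₈ * (q * S.κ τs ^ (1 / 2 : ℝ)) ≤ C₈ * κ₁ ^ (1 / 2 : ℝ) := by
    gcongr
    calc q * S.κ τs ^ (1 / 2 : ℝ) ≤ 1 * κ₁ ^ (1 / 2 : ℝ) := by gcongr
      _ = _ := one_mul _
  have b2 : C₈ * (q * S.κ τs ^ (1 / 2 : ℝ)) ≤ C₈ * q := by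
    gcongr; exact mul_le_of_le_one_right hq0.le hsq2
  have hRT : |R T| ≤ |z T| + Cr * S.κ T ^ S.M := by
    have e : R T = z T + Rh (S.κ T) := by rw [hz]; ring
    rw [e]; exact (abs_add_le _ _).trans (add_le_add le_rfl (href' T hT).1)
  have hΨT : |Ψ T - S.φ₀| ≤ |w T| + Cr * S.κ T := by
    have e : Ψ T - S.φ₀ = w T + (Ψh (S.κ T) - S.φ₀) := by rw [hw]; ring
    rw [e]; exact (abs_add_le _ _).trans (add_le_add le_rfl (href' T hT).2)
  have hCrT : Cr * S.κ T ≤ Cr * κ₁ := mul_le_mul_of_nonneg_left (hκle T hT) hCr.le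
  have hCrM : Cr * S.κ T ^ S.M ≤ Cr * S.κ T := mul_le_mul_of_nonneg_left (hpowM T hT) hCr.le
  rw [← hq]
  refine ⟨by linarith, by linarith, ?_, ?_⟩
  · have h3 : 0 ≤ C₈ * S.κ T ^ S.M + Cr * q := by positivity
    linarith
  · have h3 : 0 ≤ C₈ * S.κ T + Cr * q := by positivity
    linarith

end LockedModel

theorem sum_pow_mul_eq_pow_mul_sum {κ : ℝ} {f : ℕ → ℝ} {k m : ℕ} (hk : k ≤ m)
    (hf : ∀ K < k, f K = 0) : ∑ K ∈ range m, κ ^ K * f K =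
      κ ^ k * ∑ K ∈ range (m - k), κ ^ K * f (k + K) := by
  obtain ⟨j, rfl⟩ := Nat.exists_eq_add_of_le hk
  rw [Finset.sum_range_add, Finset.sum_eq_zero fun K hK => by rw [hf K (mem_range.1 hK), mul_zero],
    zero_add, Nat.add_sub_cancel_left, mul_sum]
  exact sum_congr rfl fun K _ => by rw [pow_add, mul_assoc]

theorem sum_zero_pow_mul {f : ℕ → ℝ} {m : ℕ} (hm : 0 < m) :
    ∑ K ∈ range m, (0 : ℝ) ^ K * f K = f 0 := by
  rw [Finset.sum_eq_single_of_mem 0 (mem_range.2 hm) fun K _ hK => by simp [zero_pow hK]]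
  simp

namespace ChirpedSystem

variable {P : ChirpedSystem}

theorem contDiff_Λ (hrc : -1 ≤ P.σ ∧ P.σ < (P.b : ℝ) / P.q) (K : ℕ) :
    ContDiff ℝ ∞ fun v : ℝ × ℝ => P.Λ K v.1 v.2 := (regular_avg hrc K).Λ_smooth

theorem contDiff_Ω (hrc : -1 ≤ P.σ ∧ P.σ < (P.b : ℝ) / P.q) (K : ℕ) :
    ContDiff ℝ ∞ fun v : ℝ × ℝ => P.Ω K v.1 v.2 := (regular_avg hrc K).Ω_smooth

theorem hasDerivAt_Λ (hrc : -1 ≤ P.σ ∧ P.σ < (P.b : ℝ) / P.q) (K : ℕ) (R Ψ : ℝ) :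
    HasDerivAt (fun R => P.Λ K R Ψ) (deriv (fun R => P.Λ K R Ψ) R) R :=
  hasDerivAt_fst_of_contDiff (contDiff_Λ hrc K) R Ψ

theorem hasDerivAt_Ω (hrc : -1 ≤ P.σ ∧ P.σ < (P.b : ℝ) / P.q) (K : ℕ) (R Ψ : ℝ) :
    HasDerivAt (fun Ψ => P.Ω K R Ψ) (deriv (fun Ψ => P.Ω K R Ψ) Ψ) Ψ :=
  hasDerivAt_fst_of_contDiff (f := fun v : ℝ × ℝ => P.Ω K v.2 v.1)
    ((contDiff_Ω hrc K).comp (f := fun v : ℝ × ℝ => (v.2, v.1)) (by fun_prop)) Ψ R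

theorem contDiff_divergence (hrc : -1 ≤ P.σ ∧ P.σ < (P.b : ℝ) / P.q) (K : ℕ) :
    ContDiff ℝ ∞ fun v : ℝ × ℝ => P.divergence K v.1 v.2 := by
  have h1 := contDiff_deriv_fst (contDiff_Λ hrc K)
  have h2 := (contDiff_deriv_fst (f := fun v : ℝ × ℝ => P.Ω K v.2 v.1)
    ((contDiff_Ω hrc K).comp (f := fun v : ℝ × ℝ => (v.2, v.1)) (by fun_prop))).comp
      (f := fun v : ℝ × ℝ => (v.2, v.1)) (by fun_prop)
  exact h1.add h2

/-- The sum of the terms `K < m` of the averaged equations. -/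
def averagedModel (hrc : -1 ≤ P.σ ∧ P.σ < (P.b : ℝ) / P.q) (L D m : ℕ) (φ₀ : ℝ)
    (hL : L + P.M ≤ P.N ∧ L + 1 ≤ 2 * P.M)
    (hzero : ∀ K, K < L → ∀ R Ψ, P.Λ K R Ψ = 0) (hφ₀ : P.Λ L 0 φ₀ = 0)
    (hlam : deriv (fun Ψ => P.Λ L 0 Ψ) φ₀ < 0) (hD : P.M ≤ D)
    (hdiv : ∀ K, K < D → ∀ R Ψ, P.divergence K R Ψ = 0)
    (hMD : P.M + D ≤ P.N) (hm : L + D < m) : LockedModel where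
  M := P.M
  L := L
  D := D
  N := P.N
  φ₀ := φ₀
  Lh q := ∑ K ∈ range (m - L), q.2.2 ^ K * P.Λ (L + K) q.1 q.2.1
  Oh₀ q := ∑ K ∈ range P.M, q.2 ^ K * P.Ω K q.1 0
  Oh₁ q := ∑ K ∈ range (m - P.M), q.2.2 ^ K * P.Ω (P.M + K) q.1 q.2.1
  dh q := ∑ K ∈ range (m - D), q.2.2 ^ K * P.divergence (D + K) q.1 q.2.1
  one_le_M := (P.M_cast hrc.2).2
  M_le_D := hD
  L_le := hL.1
  L_lt := hL.2
  D_le := hMD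
  Lh_smooth := ContDiff.sum fun K _ => ContDiff.mul (by fun_prop)
    ((contDiff_Λ hrc _).comp (f := fun q : ℝ × ℝ × ℝ => (q.1, q.2.1)) (by fun_prop))
  Oh₀_smooth := ContDiff.sum fun K _ => ContDiff.mul (by fun_prop)
    ((contDiff_Ω hrc _).comp (f := fun q : ℝ × ℝ => (q.1, (0 : ℝ))) (by fun_prop))
  Oh₁_smooth := ContDiff.sum fun K _ => ContDiff.mul (by fun_prop)
    ((contDiff_Ω hrc _).comp (f := fun q : ℝ × ℝ × ℝ => (q.1, q.2.1)) (by fun_prop))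
  dh_smooth := ContDiff.sum fun K _ => ContDiff.mul (by fun_prop)
    ((contDiff_divergence hrc _).comp (f := fun q : ℝ × ℝ × ℝ => (q.1, q.2.1)) (by fun_prop))
  Oh₀_zero κ := Finset.sum_eq_zero fun K hK => by
    have hK' := mem_range.1 hK
    dsimp only
    rw [Ω_eq_of_lt hrc hK', coeffΘ_zero_of_lt hrc hK', mul_zero]
  Oh₀_pos := by
    have hM := (P.M_cast hrc.2).2
    have h1 : (fun R => ∑ K ∈ range P.M, (0 : ℝ) ^ K * P.Ω K R 0) =
        fun R => P.resRatio * ((P.h : ℝ) - 1) * P.ampConst * R := by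
      ext R
      rw [sum_zero_pow_mul (f := fun K => P.Ω K R 0) hM, Ω_eq_of_lt hrc hM, coeffΘ_zero hrc]
    have h2 := P.resRatio_pos
    have h3 := P.h_sub_one_pos
    have h4 := P.ampConst_pos
    simp only [h1]
    rw [((hasDerivAt_id' (0 : ℝ)).const_mul _).deriv]
    positivity
  Lh_zero := by
    rw [sum_zero_pow_mul (f := fun K => P.Λ (L + K) 0 φ₀) (by omega)]; exact hφ₀
  Lh_neg := by
    have h1 : (fun Ψ => ∑ K ∈ range (m - L), (0 : ℝ) ^ K * P.Λ (L + K) 0 Ψ) =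
        fun Ψ => P.Λ L 0 Ψ := by
      ext Ψ; rw [sum_zero_pow_mul (f := fun K => P.Λ (L + K) 0 Ψ) (by omega), add_zero]
    simp only [h1]
    exact hlam
  div_eq R Ψ κ := by
    have hMD' : P.M ≤ m := by omega
    have e1 := HasDerivAt.fun_sum (u := range (m - L)) fun K _ =>
      (hasDerivAt_Λ hrc (L + K) R Ψ).const_mul (κ ^ K)
    have e2 := HasDerivAt.fun_sum (u := range (m - P.M)) fun K _ =>
      (hasDerivAt_Ω hrc (P.M + K) R Ψ).const_mul (κ ^ K)
    dsimp only
    rw [e1.deriv, e2.deriv,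
      ← sum_pow_mul_eq_pow_mul_sum (f := fun K => deriv (fun R => P.Λ K R Ψ) R) (by omega)
        fun K hK => by simp only [hzero K hK, deriv_const],
      ← sum_pow_mul_eq_pow_mul_sum (f := fun K => deriv (fun Ψ => P.Ω K R Ψ) Ψ) hMD'
        fun K hK => by simp only [Ω_eq_of_lt hrc hK, deriv_const],
      ← sum_pow_mul_eq_pow_mul_sum (f := fun K => P.divergence K R Ψ) (by omega)
        fun K hK => hdiv K hK R Ψ, ← Finset.sum_add_distrib]
    exact sum_congr rfl fun K _ => by rw [divergence]; ring

section

variable (hrc : -1 ≤ P.σ ∧ P.σ < (P.b : ℝ) / P.q) (L D m : ℕ) (φ₀ : ℝ)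
    (hL : L + P.M ≤ P.N ∧ L + 1 ≤ 2 * P.M)
    (hzero : ∀ K, K < L → ∀ R Ψ, P.Λ K R Ψ = 0) (hφ₀ : P.Λ L 0 φ₀ = 0)
    (hlam : deriv (fun Ψ => P.Λ L 0 Ψ) φ₀ < 0) (hD : P.M ≤ D)
    (hdiv : ∀ K, K < D → ∀ R Ψ, P.divergence K R Ψ = 0)
    (hMD : P.M + D ≤ P.N) (hm : L + D < m)

theorem pow_mul_averagedModel_Lh (R Ψ κ : ℝ) :
    κ ^ L * (averagedModel hrc L D m φ₀ hL hzero hφ₀ hlam hD hdiv hMD hm).Lh (R, Ψ, κ) =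
      ∑ K ∈ range m, κ ^ K * P.Λ K R Ψ :=
  (sum_pow_mul_eq_pow_mul_sum (f := fun K => P.Λ K R Ψ) (by omega) fun K hK => hzero K hK R Ψ).symm

theorem averagedModel_Oh (R Ψ κ : ℝ) :
    (averagedModel hrc L D m φ₀ hL hzero hφ₀ hlam hD hdiv hMD hm).Oh (R, Ψ, κ) =
      ∑ K ∈ range m, κ ^ K * P.Ω K R Ψ := by
  obtain ⟨j, rfl⟩ := Nat.exists_eq_add_of_le (show P.M ≤ m by omega)
  rw [Finset.sum_range_add, LockedModel.Oh]
  simp only [averagedModel, Nat.add_sub_cancel_left]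
  rw [mul_sum]
  refine congrArg₂ (· + ·) (sum_congr rfl fun K hK => ?_)
    (sum_congr rfl fun K _ => by rw [pow_add, mul_assoc])
  have hK' := mem_range.1 hK
  rw [Ω_eq_of_lt hrc hK', Ω_eq_of_lt hrc hK']

end

end ChirpedSystem

/-- A smooth function that is periodic in its last two variables is bounded and Lipschitz where the
first variable is bounded. -/
theorem exists_strip_bound_of_periodic {w : ℝ × ℝ × ℝ → ℝ} (hw : ContDiff ℝ ∞ w) {T₁ T₂ : ℝ}
    (hT₁ : 0 < T₁) (hT₂ : 0 < T₂) (h1 : ∀ r θ ζ, w (r, θ + T₁, ζ) = w (r, θ, ζ))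
    (h2 : ∀ r θ ζ, w (r, θ, ζ + T₂) = w (r, θ, ζ)) (r₁ : ℝ) :
    ∃ C > 0, (∀ r θ ζ, |r| ≤ r₁ → |w (r, θ, ζ)| ≤ C) ∧ ∀ x y : ℝ × ℝ, ∀ ζ, |x.1| ≤ r₁ → |y.1| ≤ r₁ →
      |w (x.1, x.2, ζ) - w (y.1, y.2, ζ)| ≤ C * ‖x - y‖ := by
  have hS : IsCompact (Icc (-r₁) r₁ ×ˢ Icc 0 T₁ ×ˢ Icc 0 T₂) :=
    isCompact_Icc.prod (isCompact_Icc.prod isCompact_Icc)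
  have key : ∀ g : ℝ × ℝ × ℝ → ℝ, Continuous g → (∀ r θ ζ, g (r, θ + T₁, ζ) = g (r, θ, ζ)) →
      (∀ r θ ζ, g (r, θ, ζ + T₂) = g (r, θ, ζ)) → ∃ C, ∀ r θ ζ, |r| ≤ r₁ → |g (r, θ, ζ)| ≤ C := by
    intro g hg g1 g2
    obtain ⟨C, hC⟩ := hS.exists_bound_of_continuousOn hg.continuousOn
    refine ⟨C, fun r θ ζ hr => ?_⟩
    obtain ⟨θ', hθ', e1⟩ := exists_mem_Icc_of_periodic hT₁ (f := fun θ => g (r, θ, ζ))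
      (fun x => g1 r x ζ) θ
    obtain ⟨ζ', hζ', e2⟩ := exists_mem_Icc_of_periodic hT₂ (f := fun ζ => g (r, θ', ζ))
      (fun x => g2 r θ' x) ζ
    rw [e1, e2]
    exact hC _ ⟨abs_le.1 hr, hθ', hζ'⟩
  obtain ⟨C₁, hC₁⟩ := key w hw.continuous h1 h2
  have hd : ∀ (v : ℝ × ℝ × ℝ), (∀ p, w (p + v) = w p) → ∀ p, fderiv ℝ w (p + v) = fderiv ℝ w p :=
    fun v hv p => by
      rw [← fderiv_comp_add_right v]
      simp only [hv]
  obtain ⟨C₂, hC₂⟩ := key (fun p => ‖fderiv ℝ w p‖) (hw.continuous_fderiv (by simp)).norm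
    (fun r θ ζ => by
      have := hd (0, T₁, 0) (fun p => by
        have := h1 p.1 p.2.1 p.2.2
        simpa [Prod.ext_iff, Prod.add_def] using this) (r, θ, ζ)
      simp only [Prod.mk_add_mk, add_zero] at this
      rw [this])
    (fun r θ ζ => by
      have := hd (0, 0, T₂) (fun p => by
        have := h2 p.1 p.2.1 p.2.2
        simpa [Prod.ext_iff, Prod.add_def] using this) (r, θ, ζ)
      simp only [Prod.mk_add_mk, add_zero] at this
      rw [this])
  refine ⟨max (max C₁ C₂) 1, by positivity, fun r θ ζ hr =>
    (hC₁ r θ ζ hr).trans ((le_max_left _ _).trans (le_max_left _ _)), fun x y ζ hx hy => ?_⟩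
  have hconv : Convex ℝ {p : ℝ × ℝ × ℝ | |p.1| ≤ r₁} := by
    have : {p : ℝ × ℝ × ℝ | |p.1| ≤ r₁} = (Icc (-r₁) r₁) ×ˢ univ := by
      ext p; simp [abs_le]
    rw [this]
    exact (convex_Icc _ _).prod convex_univ
  have := hconv.norm_image_sub_le_of_norm_fderiv_le (f := w) (C := C₂)
    (fun p _ => hw.differentiable (by simp) p)
    (fun p hp => (le_abs_self _).trans (hC₂ p.1 p.2.1 p.2.2 hp))
    (x := (y.1, y.2, ζ)) (y := (x.1, x.2, ζ)) hy hx
  rw [norm_eq_abs] at this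
  refine this.trans ?_
  have hn : ‖((x.1, x.2, ζ) : ℝ × ℝ × ℝ) - (y.1, y.2, ζ)‖ = ‖x - y‖ := by
    simp [Prod.norm_def]
  rw [hn]
  gcongr
  exact (le_max_right _ _).trans (le_max_left _ _)

/-- A near-identity map on a strip covers every smaller strip. -/
theorem exists_eq_of_nearIdentity {F : ℝ × ℝ → ℝ × ℝ} {r₀ ε : ℝ}
    (hb : ∀ x : ℝ × ℝ, |x.1| ≤ r₀ → ‖F x - x‖ ≤ ε)
    (hl : ∀ x y : ℝ × ℝ, |x.1| ≤ r₀ → |y.1| ≤ r₀ → ‖F x - x - (F y - y)‖ ≤ 1 / 2 * ‖x - y‖)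
    (hr₀ : 0 ≤ r₀) {X : ℝ × ℝ} (hX : |X.1| + ε ≤ r₀) : ∃ x : ℝ × ℝ, |x.1| ≤ r₀ ∧ F x = X := by
  obtain ⟨π, hπ⟩ : ∃ π : ℝ × ℝ → ℝ × ℝ, π = fun x => (max (-r₀) (min r₀ x.1), x.2) := ⟨_, rfl⟩
  have hπK : ∀ x, |(π x).1| ≤ r₀ := fun x => by
    rw [hπ, abs_le]
    exact ⟨le_max_left _ _, max_le (by linarith) (min_le_left _ _)⟩
  have hπl : ∀ x y, ‖π x - π y‖ ≤ ‖x - y‖ := fun x y => by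
    rw [hπ, Prod.norm_def, Prod.norm_def]
    refine max_le_max ?_ le_rfl
    simp only [Prod.fst_sub, norm_eq_abs]
    refine (abs_max_sub_max_le_max _ _ _ _).trans (max_le (by simp) ?_)
    exact (abs_min_sub_min_le_max _ _ _ _).trans (max_le (by simp) le_rfl)
  have hc : ContractingWith (1 / 2) fun x => X - (F (π x) - π x) := by
    refine ⟨by rw [← NNReal.coe_lt_coe]; norm_num, LipschitzWith.of_dist_le_mul fun x y => ?_⟩
    rw [dist_eq_norm, dist_eq_norm]
    have e : X - (F (π x) - π x) - (X - (F (π y) - π y)) =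
        -(F (π x) - π x - (F (π y) - π y)) := by abel
    rw [e, norm_neg]
    refine (hl _ _ (hπK x) (hπK y)).trans ?_
    push_cast
    exact mul_le_mul_of_nonneg_left (hπl x y) (by norm_num)
  have hfix := hc.fixedPoint_isFixedPt
  obtain ⟨x, hx⟩ : ∃ x, x = ContractingWith.fixedPoint _ hc := ⟨_, rfl⟩
  rw [← hx, Function.IsFixedPt] at hfix
  have hxr : |x.1| ≤ r₀ := by
    have h1 : x.1 = X.1 - (F (π x) - π x).1 := by rw [← Prod.fst_sub, hfix]
    rw [h1]
    refine (abs_sub _ _).trans (le_trans (add_le_add le_rfl ?_) hX)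
    exact (norm_fst_le _).trans (hb _ (hπK x))
  have hπx : π x = x := by
    rw [hπ]
    have := abs_le.1 hxr
    ext
    · simp [this.1, this.2]
    · rfl
  refine ⟨x, hxr, ?_⟩
  rw [hπx] at hfix
  have : F x = X - (X - (F x - x)) + x := by abel
  rw [this, hfix]
  abel

theorem le_two_mul_of_nearIdentity {F : ℝ × ℝ → ℝ × ℝ} {x y : ℝ × ℝ}
    (hl : ‖F x - x - (F y - y)‖ ≤ 1 / 2 * ‖x - y‖) : ‖x - y‖ ≤ 2 * ‖F x - F y‖ := by
  have e : x - y = (F x - F y) - (F x - x - (F y - y)) := by abel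
  have h := norm_sub_le (F x - F y) (F x - x - (F y - y))
  rw [← e] at h
  linarith

namespace ChirpedSystem

/-- The small parameter `κ = τ^(-1/N)`. -/
def κ (P : ChirpedSystem) (τ : ℝ) : ℝ := τ ^ (-(1 : ℝ) / P.N)

/-- The near-identity transformation `(r,θ) ↦ (R_n,Ψ_n)`. -/
def averagedVars (P : ChirpedSystem) (n : ℕ) (τ : ℝ) (x : ℝ × ℝ) : ℝ × ℝ :=
  (P.Rn n x.1 x.2 τ, P.Ψn n x.1 x.2 τ)

variable {P : ChirpedSystem}

theorem κ_pos {τ : ℝ} (hτ : 0 < τ) : 0 < P.κ τ := rpow_pos_of_pos hτ _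

theorem κ_pow {τ : ℝ} (hτ : 0 < τ) (k : ℕ) : P.κ τ ^ k = τ ^ (-(k : ℝ) / P.N) :=
  rpow_neg_one_div_pow hτ k

theorem κ_rpow_neg {τ : ℝ} (hτ : 0 < τ) : P.κ τ ^ (-(P.N : ℝ)) = τ := by
  have : (P.N : ℝ) ≠ 0 := by have := P.N_cast.2; positivity
  rw [κ, ← rpow_mul hτ.le, neg_div, neg_mul_neg, one_div, inv_mul_cancel₀ this, Real.rpow_one]

theorem exists_sum_bound (n : ℕ) (r₁ : ℝ)
    {χ : AvgCoeff → ℝ → ℝ → ℝ → ℝ}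
    (hs : ∀ K, ContDiff ℝ ∞ fun p : ℝ × ℝ × ℝ => χ (P.avg K) p.1 p.2.1 p.2.2)
    (h1 : ∀ K r θ ζ, χ (P.avg K) r (θ + 2 * Real.pi) ζ = χ (P.avg K) r θ ζ)
    (h2 : ∀ K r θ ζ, χ (P.avg K) r θ (ζ + 2 * Real.pi * P.kap) = χ (P.avg K) r θ ζ) :
    ∃ C > 0, ∀ τ, 0 < τ → P.κ τ ≤ 1 → ∀ ζ,
      (∀ x : ℝ × ℝ, |x.1| ≤ r₁ → |∑ K ∈ range n, τ ^ (-((P.M : ℝ) + K) / P.N) *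
        χ (P.avg K) x.1 x.2 ζ| ≤ C * P.κ τ ^ P.M) ∧
      ∀ x y : ℝ × ℝ, |x.1| ≤ r₁ → |y.1| ≤ r₁ →
        |∑ K ∈ range n, τ ^ (-((P.M : ℝ) + K) / P.N) * χ (P.avg K) x.1 x.2 ζ -
          ∑ K ∈ range n, τ ^ (-((P.M : ℝ) + K) / P.N) * χ (P.avg K) y.1 y.2 ζ| ≤
          C * P.κ τ ^ P.M * ‖x - y‖ := by
  choose C hC hCb hCl using fun K => exists_strip_bound_of_periodic (hs K)
    (by positivity : 0 < 2 * Real.pi) P.phase_period_pos (h1 K) (h2 K) r₁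
  have hsum : 0 ≤ ∑ K ∈ range n, C K := Finset.sum_nonneg fun K _ => (hC K).le
  have hpow : ∀ τ, 0 < τ → P.κ τ ≤ 1 → ∀ K : ℕ, |τ ^ (-((P.M : ℝ) + K) / P.N)| ≤ P.κ τ ^ P.M :=
    fun τ hτ hκ K => by
      have e : τ ^ (-((P.M : ℝ) + K) / P.N) = P.κ τ ^ (P.M + K) := by rw [κ_pow hτ]; push_cast; rfl
      rw [e, abs_of_pos (pow_pos (κ_pos hτ) _)]
      exact pow_le_pow_of_le_one (κ_pos hτ).le hκ (by omega)
  refine ⟨∑ K ∈ range n, C K + 1, by positivity, fun τ hτ hκ ζ => ⟨fun x hx => ?_,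
    fun x y hx hy => ?_⟩⟩
  · have hk := pow_pos (κ_pos (P := P) hτ) P.M
    calc _ ≤ ∑ K ∈ range n, P.κ τ ^ P.M * C K := by
          refine (Finset.abs_sum_le_sum_abs _ _).trans (Finset.sum_le_sum fun K _ => ?_)
          rw [abs_mul]
          exact mul_le_mul (hpow τ hτ hκ K) (hCb K _ _ _ hx) (abs_nonneg _) hk.le
      _ = (∑ K ∈ range n, C K) * P.κ τ ^ P.M := by rw [← mul_sum, mul_comm]
      _ ≤ _ := by gcongr; linarith
  · have hk := pow_pos (κ_pos (P := P) hτ) P.M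
    rw [← Finset.sum_sub_distrib]
    calc _ ≤ ∑ K ∈ range n, P.κ τ ^ P.M * (C K * ‖x - y‖) := by
          refine (Finset.abs_sum_le_sum_abs _ _).trans (Finset.sum_le_sum fun K _ => ?_)
          rw [← mul_sub, abs_mul]
          exact mul_le_mul (hpow τ hτ hκ K) (hCl K x y ζ hx hy) (abs_nonneg _) hk.le
      _ = (∑ K ∈ range n, C K) * P.κ τ ^ P.M * ‖x - y‖ := by
          rw [← mul_sum, ← Finset.sum_mul]; ring
      _ ≤ _ := by gcongr; linarith

theorem exists_averagedVars_bound (hrc : -1 ≤ P.σ ∧ P.σ < (P.b : ℝ) / P.q) (n : ℕ) (r₁ : ℝ) :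
    ∃ C > 0, ∀ τ, 0 < τ → P.κ τ ≤ 1 →
      (∀ x : ℝ × ℝ, |x.1| ≤ r₁ → ‖P.averagedVars n τ x - x‖ ≤ C * P.κ τ ^ P.M) ∧
      ∀ x y : ℝ × ℝ, |x.1| ≤ r₁ → |y.1| ≤ r₁ →
        ‖P.averagedVars n τ x - x - (P.averagedVars n τ y - y)‖ ≤ C * P.κ τ ^ P.M * ‖x - y‖ := by
  obtain ⟨C₁, hC₁, b1⟩ := exists_sum_bound (n + 1) r₁ (χ := AvgCoeff.ρ)
    (fun K => (regular_avg hrc K).ρ_smooth) (fun K => (regular_avg hrc K).ρ_periodic)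
    fun K => (regular_avg hrc K).ρ_phase
  obtain ⟨C₂, hC₂, b2⟩ := exists_sum_bound (n + 1) r₁ (χ := AvgCoeff.ψ)
    (fun K => (regular_avg hrc K).ψ_smooth) (fun K => (regular_avg hrc K).ψ_periodic)
    fun K => (regular_avg hrc K).ψ_phase
  have hdiff : ∀ τ x, P.averagedVars n τ x - x =
      (∑ K ∈ range (n + 1), τ ^ (-((P.M : ℝ) + K) / P.N) * (P.avg K).ρ x.1 x.2 (P.ζ τ),
        ∑ K ∈ range (n + 1), τ ^ (-((P.M : ℝ) + K) / P.N) * (P.avg K).ψ x.1 x.2 (P.ζ τ)) :=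
    fun τ x => by ext <;> simp [averagedVars, Rn, Ψn]
  refine ⟨max C₁ C₂, by positivity, fun τ hτ hκ => ⟨fun x hx => ?_, fun x y hx hy => ?_⟩⟩
  · have hk := pow_pos (κ_pos (P := P) hτ) P.M
    rw [hdiff, Prod.norm_def]
    refine max_le (((b1 τ hτ hκ _).1 x hx).trans ?_) (((b2 τ hτ hκ _).1 x hx).trans ?_)
    · gcongr; exact le_max_left _ _
    · gcongr; exact le_max_right _ _
  · have hk := pow_pos (κ_pos (P := P) hτ) P.M
    rw [hdiff, hdiff, Prod.norm_def]
    refine max_le (((b1 τ hτ hκ _).2 x y hx hy).trans ?_) (((b2 τ hτ hκ _).2 x y hx hy).trans ?_)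
    · gcongr; exact le_max_left _ _
    · gcongr; exact le_max_right _ _

theorem backward_averagedVars {r₀ τ : ℝ} {n : ℕ}
    (hl : ∀ x y : ℝ × ℝ, |x.1| ≤ r₀ → |y.1| ≤ r₀ →
      ‖P.averagedVars n τ x - x - (P.averagedVars n τ y - y)‖ ≤ 1 / 2 * ‖x - y‖)
    {x : ℝ × ℝ} (hx : |x.1| ≤ r₀) :
    P.backward r₀ n τ (P.Rn n x.1 x.2 τ) (P.Ψn n x.1 x.2 τ) = x := by
  have hinj : Set.InjOn (P.averagedVars n τ) {v : ℝ × ℝ | |v.1| ≤ r₀} := fun u hu v hv huv => by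
    have := le_two_mul_of_nearIdentity (hl u v hu hv)
    rw [huv, sub_self, norm_zero, mul_zero] at this
    exact sub_eq_zero.1 (norm_le_zero_iff.1 this)
  exact hinj.leftInvOn_invFunOn hx

end ChirpedSystem

theorem contDiffOn_deriv_mid {G : ℝ × ℝ × ℝ → ℝ} {O : Set (ℝ × ℝ × ℝ)} (hO : IsOpen O)
    (hG : ContDiffOn ℝ ∞ G O) :
    ContDiffOn ℝ ∞ (fun q : ℝ × ℝ × ℝ => deriv (fun r => G (q.1, r, q.2.2)) q.2.1) O := by
  have hs : ContDiff ℝ ∞ fun v : ℝ × ℝ × ℝ => ((v.2.1, v.1, v.2.2) : ℝ × ℝ × ℝ) := by fun_prop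
  have h1 := hG.comp hs.contDiffOn (Set.mapsTo_preimage _ O)
  have h2 := contDiffOn_deriv_fst (hO.preimage hs.continuous) h1
  exact h2.comp hs.contDiffOn fun q hq => by simpa using hq

theorem contDiffOn_deriv_last {G : ℝ × ℝ × ℝ → ℝ} {O : Set (ℝ × ℝ × ℝ)} (hO : IsOpen O)
    (hG : ContDiffOn ℝ ∞ G O) :
    ContDiffOn ℝ ∞ (fun q : ℝ × ℝ × ℝ => deriv (fun r => G (q.1, q.2.1, r)) q.2.2) O := by
  have hs : ContDiff ℝ ∞ fun v : ℝ × ℝ × ℝ => ((v.2.2, v.2.1, v.1) : ℝ × ℝ × ℝ) := by fun_prop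
  have h1 := hG.comp hs.contDiffOn (Set.mapsTo_preimage _ O)
  have h2 := contDiffOn_deriv_fst (hO.preimage hs.continuous) h1
  exact h2.comp hs.contDiffOn fun q hq => by simpa using hq

open scoped NNReal in
theorem exists_lipschitzOnWith_of_contDiffOn {E F : Type} [NormedAddCommGroup E] [NormedSpace ℝ E]
    [NormedAddCommGroup F] [NormedSpace ℝ F] {v : E → F} {O s : Set E} (hO : IsOpen O)
    (hv : ContDiffOn ℝ ∞ v O) (hs : IsCompact s) (hsO : s ⊆ O) : ∃ K : ℝ≥0, LipschitzOnWith K v s :=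
  LocallyLipschitzOn.exists_lipschitzOnWith_of_compact hs fun x hx => by
    obtain ⟨K, t, ht, hK⟩ := (((hv x (hsO hx)).contDiffAt (hO.mem_nhds (hsO hx))).of_le
      (by simp : (1 : WithTop ℕ∞) ≤ ∞)).exists_lipschitzOnWith
    exact ⟨K, t, mem_nhdsWithin_of_mem_nhds ht, hK⟩

namespace ChirpedSystem

variable {P : ChirpedSystem}

/-- The vector field of the equations for `(r,θ)`. -/
def field (P : ChirpedSystem) (τ : ℝ) (x : ℝ × ℝ) : ℝ × ℝ :=
  (τ ^ (-(P.M : ℝ) / P.N) * P.fieldR x.1 x.2 (P.ζ τ) τ,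
    τ ^ (-(P.M : ℝ) / P.N) * P.fieldΘ x.1 x.2 (P.ζ τ) τ)

/-- The vector field of the averaged equations in the old variables. -/
def averagedField (P : ChirpedSystem) (n : ℕ) (τ : ℝ) (x : ℝ × ℝ) : ℝ × ℝ :=
  (P.totalDeriv (P.Rn n) x.1 x.2 τ, P.totalDeriv (P.Ψn n) x.1 x.2 τ)

theorem contDiffOn_rpow_fst (p : ℝ) {O : Set (ℝ × ℝ × ℝ)} (hO : ∀ q ∈ O, 0 < q.1) :
    ContDiffOn ℝ ∞ (fun q : ℝ × ℝ × ℝ => q.1 ^ p) O := fun q hq =>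
  ((Real.contDiffAt_rpow_const_of_ne (hO q hq).ne').comp q contDiffAt_fst).contDiffWithinAt

theorem exists_field_smooth (hrc : -1 ≤ P.σ ∧ P.σ < (P.b : ℝ) / P.q) (r₁ : ℝ) :
    ∃ κ₀ > 0, ∃ O : Set (ℝ × ℝ × ℝ), IsOpen O ∧ (∀ q ∈ O, 0 < q.1) ∧
      (∀ τ, 0 < τ → P.κ τ < κ₀ → ∀ x : ℝ × ℝ, |x.1| ≤ r₁ → (τ, x) ∈ O) ∧
      ContDiffOn ℝ ∞ (fun q : ℝ × ℝ × ℝ => P.field q.1 q.2) O := by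
  obtain ⟨κ₀, hκ₀, -, O, hO, hmem, hR, hΘ⟩ := exists_field_regular hrc r₁
  obtain ⟨O₁, hO₁⟩ : ∃ O₁ : Set (ℝ × ℝ × ℝ), O₁ = {q | 0 < q.1} ∩
      {q | (P.κ q.1, q.2.1, q.2.2, P.vartheta * q.1) ∈ O} := ⟨_, rfl⟩
  have hpos : ∀ q ∈ O₁, 0 < q.1 := fun q hq => by rw [hO₁] at hq; exact hq.1
  have hsm : ContDiffOn ℝ ∞ (fun q : ℝ × ℝ × ℝ => ((P.κ q.1, q.2.1, q.2.2, P.vartheta * q.1) : Pt))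
      {q | 0 < q.1} := by
    have h1 : ContDiffOn ℝ ∞ (fun q : ℝ × ℝ × ℝ => P.κ q.1) {q | 0 < q.1} :=
      contDiffOn_rpow_fst _ fun q hq => hq
    exact h1.prodMk (by fun_prop)
  refine ⟨κ₀, hκ₀, O₁, ?_, hpos, fun τ hτ hκ x hx => ?_, ?_⟩
  · rw [hO₁]
    exact hsm.continuousOn.isOpen_inter_preimage (isOpen_lt continuous_const continuous_fst) hO
  · rw [hO₁]
    exact ⟨hτ, hmem _ (κ_pos hτ) hκ _ hx _ _⟩
  · have hmaps : Set.MapsTo (fun q : ℝ × ℝ × ℝ => ((P.κ q.1, q.2.1, q.2.2, P.vartheta * q.1) : Pt))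
        O₁ O := fun q hq => by rw [hO₁] at hq; exact hq.2
    have hsub : O₁ ⊆ {q | 0 < q.1} := hpos
    have g1 := hR.comp (hsm.mono hsub) hmaps
    have g2 := hΘ.comp (hsm.mono hsub) hmaps
    refine ContDiffOn.prodMk ?_ ?_
    · refine ((contDiffOn_rpow_fst (-(P.M : ℝ) / P.N) hpos).mul g1).congr fun q hq => ?_
      simp only [Function.comp_def, κ_rpow_neg (hpos q hq), ζ_eq (hpos q hq)]
    · refine ((contDiffOn_rpow_fst (-(P.M : ℝ) / P.N) hpos).mul g2).congr fun q hq => ?_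
      simp only [Function.comp_def, κ_rpow_neg (hpos q hq), ζ_eq (hpos q hq)]

theorem contDiffOn_sum (n : ℕ) {χ : AvgCoeff → ℝ → ℝ → ℝ → ℝ}
    (hs : ∀ K, ContDiff ℝ ∞ fun p : ℝ × ℝ × ℝ => χ (P.avg K) p.1 p.2.1 p.2.2) :
    ContDiffOn ℝ ∞ (fun q : ℝ × ℝ × ℝ => ∑ K ∈ range n, q.1 ^ (-((P.M : ℝ) + K) / P.N) *
      χ (P.avg K) q.2.1 q.2.2 (P.ζ q.1)) {q | 0 < q.1} := by
  refine ContDiffOn.sum fun K _ => (contDiffOn_rpow_fst _ fun q hq => hq).mul ?_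
  have h1 : ContDiff ℝ ∞ fun q : ℝ × ℝ × ℝ => χ (P.avg K) q.2.1 q.2.2 (P.vartheta * q.1) :=
    (hs K).comp (f := fun q : ℝ × ℝ × ℝ => (q.2.1, q.2.2, P.vartheta * q.1)) (by fun_prop)
  exact h1.contDiffOn.congr fun q hq => by simp only [ζ_eq (show 0 < q.1 from hq)]

theorem contDiffOn_Rn (hrc : -1 ≤ P.σ ∧ P.σ < (P.b : ℝ) / P.q) (n : ℕ) :
    ContDiffOn ℝ ∞ (fun q : ℝ × ℝ × ℝ => P.Rn n q.2.1 q.2.2 q.1) {q | 0 < q.1} := by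
  have h1 : ContDiff ℝ ∞ fun q : ℝ × ℝ × ℝ => q.2.1 := by fun_prop
  exact h1.contDiffOn.add (contDiffOn_sum (n + 1) fun K => (regular_avg hrc K).ρ_smooth)

theorem contDiffOn_Ψn (hrc : -1 ≤ P.σ ∧ P.σ < (P.b : ℝ) / P.q) (n : ℕ) :
    ContDiffOn ℝ ∞ (fun q : ℝ × ℝ × ℝ => P.Ψn n q.2.1 q.2.2 q.1) {q | 0 < q.1} := by
  have h1 : ContDiff ℝ ∞ fun q : ℝ × ℝ × ℝ => q.2.2 := by fun_prop
  exact h1.contDiffOn.add (contDiffOn_sum (n + 1) fun K => (regular_avg hrc K).ψ_smooth)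

theorem contDiffOn_totalDeriv {Q : ℝ → ℝ → ℝ → ℝ} {O : Set (ℝ × ℝ × ℝ)}
    (hpos : ∀ q ∈ O, 0 < q.1)
    (hQ : ContDiffOn ℝ ∞ (fun q : ℝ × ℝ × ℝ => Q q.2.1 q.2.2 q.1) {q | 0 < q.1})
    (hf : ContDiffOn ℝ ∞ (fun q : ℝ × ℝ × ℝ => P.field q.1 q.2) O) :
    ContDiffOn ℝ ∞ (fun q : ℝ × ℝ × ℝ => P.totalDeriv Q q.2.1 q.2.2 q.1) O := by
  have hO₀ : IsOpen {q : ℝ × ℝ × ℝ | 0 < q.1} := isOpen_lt continuous_const continuous_fst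
  have hsub : O ⊆ {q | 0 < q.1} := hpos
  have dτ : ContDiffOn ℝ ∞ (fun q : ℝ × ℝ × ℝ => deriv (fun τ => Q q.2.1 q.2.2 τ) q.1)
      {q | 0 < q.1} := contDiffOn_deriv_fst hO₀ hQ
  have dr := contDiffOn_deriv_mid hO₀ hQ
  have dθ := contDiffOn_deriv_last hO₀ hQ
  refine (((hf.fst.mul (dr.mono hsub)).add (hf.snd.mul (dθ.mono hsub))).add (dτ.mono hsub)).congr
    fun q _ => ?_
  simp only [totalDeriv, field]
  ring

theorem hasDerivWithinAt_totalDeriv {Q : ℝ → ℝ → ℝ → ℝ}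
    (hQ : ContDiffOn ℝ ∞ (fun q : ℝ × ℝ × ℝ => Q q.2.1 q.2.2 q.1) {q | 0 < q.1}) {x : ℝ → ℝ × ℝ}
    {s : Set ℝ} {τ : ℝ} (hτ : 0 < τ) (hx : HasDerivWithinAt x (P.field τ (x τ)) s τ) :
    HasDerivWithinAt (fun τ => Q (x τ).1 (x τ).2 τ) (P.totalDeriv Q (x τ).1 (x τ).2 τ) s τ := by
  have hO₀ : IsOpen {q : ℝ × ℝ × ℝ | 0 < q.1} := isOpen_lt continuous_const continuous_fst
  have hd : DifferentiableAt ℝ (fun q : ℝ × ℝ × ℝ => Q q.2.1 q.2.2 q.1) (τ, (x τ).1, (x τ).2) :=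
    (hQ.contDiffAt (hO₀.mem_nhds hτ)).differentiableAt (by simp)
  refine (hasDerivWithinAt_comp_triple (z := fun τ => τ) (w := fun τ => (x τ).1)
    (k := fun τ => (x τ).2) hd (hasDerivWithinAt_id τ s) hx.fst hx.snd).congr_deriv ?_
  simp only [totalDeriv, field]
  ring

/-- In the averaged variables the equations hold with a small remainder. -/
theorem exists_averagedField_bound (hrc : -1 ≤ P.σ ∧ P.σ < (P.b : ℝ) / P.q) (n : ℕ) (r₁ : ℝ) :
    ∃ C > 0, ∃ κ₀ > 0, ∀ τ, 0 < τ → P.κ τ < κ₀ → ∀ x : ℝ × ℝ, |x.1| ≤ r₁ →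
      |(P.averagedField n τ x).1 - P.κ τ ^ P.M * ∑ K ∈ range (n + 1), P.κ τ ^ K *
        P.Λ K (P.averagedVars n τ x).1 (P.averagedVars n τ x).2| ≤ C * P.κ τ ^ (P.M + n + 1) ∧
      |(P.averagedField n τ x).2 - P.κ τ ^ P.M * ∑ K ∈ range (n + 1), P.κ τ ^ K *
        P.Ω K (P.averagedVars n τ x).1 (P.averagedVars n τ x).2| ≤ C * P.κ τ ^ (P.M + n + 1) := by
  obtain ⟨C, hC, κ₀, hκ₀, h⟩ := exists_totalDeriv_bound hrc n r₁
  refine ⟨C, hC, κ₀, hκ₀, fun τ hτ hκ x hx => ?_⟩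
  have := h (P.κ τ) (κ_pos hτ) hκ x.1 hx x.2
  rwa [κ_rpow_neg hτ] at this

end ChirpedSystem

namespace ChirpedSystem

variable {P : ChirpedSystem}

/-- A solution of the averaged system, as one vector equation. -/
theorem IsAveragedSolution.hasDerivWithinAt {r₀ : ℝ} {n : ℕ} {a : ℝ} {R Ψ : ℝ → ℝ}
    (h : P.IsAveragedSolution r₀ n a R Ψ) {τ : ℝ} (hτ : a ≤ τ) :
    HasDerivWithinAt (fun τ => (R τ, Ψ τ))
      (P.averagedField n τ (P.backward r₀ n τ (R τ) (Ψ τ))) (Ici a) τ := by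
  obtain ⟨h1, h2⟩ := h τ hτ
  rw [remΛ, add_sub_cancel] at h1
  rw [remΩ, add_sub_cancel] at h2
  exact h1.prodMk h2

/-- The averaged equations are Lipschitz on compact sets inside the strip. -/
theorem exists_lipschitzOnWith_averaged {r₀ : ℝ} (hr₀ : 0 < r₀) {n : ℕ} {a T B : ℝ}
    {O : Set (ℝ × ℝ × ℝ)} (hO : IsOpen O)
    (hmem : ∀ τ, a ≤ τ → ∀ x : ℝ × ℝ, |x.1| ≤ r₀ → (τ, x) ∈ O)
    (hf : ContDiffOn ℝ ∞ (fun q : ℝ × ℝ × ℝ => P.averagedField n q.1 q.2) O)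
    (hb : ∀ τ, a ≤ τ → ∀ x : ℝ × ℝ, |x.1| ≤ r₀ → ‖P.averagedVars n τ x - x‖ ≤ r₀ / 2)
    (hl : ∀ τ, a ≤ τ → ∀ x y : ℝ × ℝ, |x.1| ≤ r₀ → |y.1| ≤ r₀ →
      ‖P.averagedVars n τ x - x - (P.averagedVars n τ y - y)‖ ≤ 1 / 2 * ‖x - y‖) :
    ∃ K : NNReal, ∀ t ∈ Set.Ico a T, LipschitzOnWith K
      (fun X : ℝ × ℝ => P.averagedField n t (P.backward r₀ n t X.1 X.2))
      {X | |X.1| ≤ r₀ / 2 ∧ |X.2| ≤ B} := by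
  have hc : IsCompact (Icc a T ×ˢ Icc (-r₀) r₀ ×ˢ Icc (-(B + r₀)) (B + r₀)) :=
    isCompact_Icc.prod (isCompact_Icc.prod isCompact_Icc)
  obtain ⟨K, hK⟩ := exists_lipschitzOnWith_of_contDiffOn hO hf hc fun q hq =>
    hmem q.1 hq.1.1 q.2 (abs_le.2 hq.2.1)
  refine ⟨K * 2, fun t ht => LipschitzOnWith.of_dist_le_mul fun X hX Y hY => ?_⟩
  have key : ∀ X : ℝ × ℝ, |X.1| ≤ r₀ / 2 → |X.2| ≤ B → ∃ x : ℝ × ℝ, |x.1| ≤ r₀ ∧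
      P.averagedVars n t x = X ∧ P.backward r₀ n t X.1 X.2 = x ∧
      (t, x) ∈ Icc a T ×ˢ Icc (-r₀) r₀ ×ˢ Icc (-(B + r₀)) (B + r₀) := by
    intro X h1 h2
    obtain ⟨x, hx, hxX⟩ := exists_eq_of_nearIdentity (hb t ht.1) (hl t ht.1) hr₀.le
      (X := X) (by linarith)
    refine ⟨x, hx, hxX, ?_, Set.Ico_subset_Icc_self ht, abs_le.1 hx, abs_le.1 ?_⟩
    · rw [← hxX]; exact backward_averagedVars (hl t ht.1) hx
    · have h3 := (norm_snd_le _).trans (hb t ht.1 x hx)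
      rw [hxX, Prod.snd_sub, norm_eq_abs] at h3
      have h4 := abs_sub_abs_le_abs_sub x.2 X.2
      rw [abs_sub_comm] at h4
      linarith
  obtain ⟨x, hx, hxX, hbx, hxm⟩ := key X hX.1 hX.2
  obtain ⟨y, hy, hyY, hby, hym⟩ := key Y hY.1 hY.2
  simp only [hbx, hby]
  have h1 := hK.dist_le_mul _ hxm _ hym
  have h2 := le_two_mul_of_nearIdentity (hl t ht.1 x y hx hy)
  rw [hxX, hyY] at h2
  have h3 : dist (t, x) (t, y) = ‖x - y‖ := by rw [Prod.dist_eq, dist_self, dist_eq_norm]; simp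
  rw [h3] at h1
  refine h1.trans ?_
  rw [dist_eq_norm, NNReal.coe_mul, mul_assoc]
  exact mul_le_mul_of_nonneg_left h2 K.2

/-- The solutions of the averaged system that start near a small solution of the equations for
`(r,θ)` are the images of the latter. -/
theorem exists_forall_averagedSolution_eq (hrc : -1 ≤ P.σ ∧ P.σ < (P.b : ℝ) / P.q) (n : ℕ) {r₀ : ℝ}
    (hr₀ : 0 < r₀) : ∃ κ₀ > 0, ∀ a, 0 < a → P.κ a < κ₀ → ∀ α : ℝ → ℝ × ℝ,
      (∀ τ, a ≤ τ → |(α τ).1| ≤ r₀ / 8 ∧ HasDerivWithinAt α (P.field τ (α τ)) (Ici a) τ) →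
      P.IsAveragedSolution r₀ n a (fun τ => P.Rn n (α τ).1 (α τ).2 τ)
        (fun τ => P.Ψn n (α τ).1 (α τ).2 τ) ∧
      ∀ R Ψ : ℝ → ℝ, P.IsAveragedSolution r₀ n a R Ψ → R a = P.Rn n (α a).1 (α a).2 a →
        Ψ a = P.Ψn n (α a).1 (α a).2 a → ∀ τ, a ≤ τ → R τ = P.Rn n (α τ).1 (α τ).2 τ ∧
          Ψ τ = P.Ψn n (α τ).1 (α τ).2 τ := by
  obtain ⟨κf, hκf, O, hO, hpos, hmem, hfield⟩ := exists_field_smooth hrc r₀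
  obtain ⟨C, hC, hnear⟩ := exists_averagedVars_bound hrc n r₀
  have hM := (P.M_cast hrc.2).2
  refine ⟨min κf (min 1 (min (1 / (2 * C)) (r₀ / 8 / C))), by positivity, fun a ha hκa α hα => ?_⟩
  have hτ0 : ∀ τ, a ≤ τ → 0 < τ := fun τ h => ha.trans_le h
  have hκle : ∀ τ, a ≤ τ → P.κ τ < min κf (min 1 (min (1 / (2 * C)) (r₀ / 8 / C))) := fun τ h => by
    refine lt_of_le_of_lt (Real.rpow_le_rpow_of_nonpos ha h ?_) hκa
    rw [neg_div]
    have : (0 : ℝ) ≤ 1 / P.N := by positivity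
    linarith
  have hκ1 : ∀ τ, a ≤ τ → P.κ τ ≤ 1 := fun τ h =>
    (hκle τ h).le.trans ((min_le_right _ _).trans (min_le_left _ _))
  have hCκ : ∀ τ, a ≤ τ → C * P.κ τ ^ P.M ≤ 1 / 2 ∧ C * P.κ τ ^ P.M ≤ r₀ / 8 := fun τ h => by
    have h0 := κ_pos (P := P) (hτ0 τ h)
    have h1 : P.κ τ ^ P.M ≤ P.κ τ := by
      simpa using pow_le_pow_of_le_one h0.le (hκ1 τ h) hM
    have h2 := (hκle τ h).le.trans ((min_le_right _ _).trans ((min_le_right _ _).trans (min_le_left _ _)))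
    have h3 := (hκle τ h).le.trans ((min_le_right _ _).trans ((min_le_right _ _).trans (min_le_right _ _)))
    rw [le_div_iff₀ (by positivity)] at h2 h3
    have h4 := mul_le_mul_of_nonneg_left h1 hC.le
    constructor <;> linarith
  have hb : ∀ τ, a ≤ τ → ∀ x : ℝ × ℝ, |x.1| ≤ r₀ → ‖P.averagedVars n τ x - x‖ ≤ r₀ / 8 :=
    fun τ h x hx => ((hnear τ (hτ0 τ h) (hκ1 τ h)).1 x hx).trans (hCκ τ h).2
  have hl : ∀ τ, a ≤ τ → ∀ x y : ℝ × ℝ, |x.1| ≤ r₀ → |y.1| ≤ r₀ →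
      ‖P.averagedVars n τ x - x - (P.averagedVars n τ y - y)‖ ≤ 1 / 2 * ‖x - y‖ :=
    fun τ h x y hx hy => ((hnear τ (hτ0 τ h) (hκ1 τ h)).2 x y hx hy).trans
      (mul_le_mul_of_nonneg_right (hCκ τ h).1 (norm_nonneg _))
  have hα1 : ∀ τ, a ≤ τ → |(α τ).1| ≤ r₀ := fun τ h => (hα τ h).1.trans (by linarith)
  have hdR := fun τ (h : a ≤ τ) =>
    hasDerivWithinAt_totalDeriv (contDiffOn_Rn hrc n) (hτ0 τ h) (hα τ h).2
  have hdΨ := fun τ (h : a ≤ τ) =>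
    hasDerivWithinAt_totalDeriv (contDiffOn_Ψn hrc n) (hτ0 τ h) (hα τ h).2
  have hsol : P.IsAveragedSolution r₀ n a (fun τ => P.Rn n (α τ).1 (α τ).2 τ)
      (fun τ => P.Ψn n (α τ).1 (α τ).2 τ) := fun τ h => by
    rw [remΛ, remΩ, add_sub_cancel, add_sub_cancel, backward_averagedVars (hl τ h) (hα1 τ h)]
    exact ⟨hdR τ h, hdΨ τ h⟩
  refine ⟨hsol, fun R Ψ hRΨ hRa hΨa => ?_⟩
  obtain ⟨X₁, hX₁⟩ : ∃ X₁ : ℝ → ℝ × ℝ, X₁ = fun τ => P.averagedVars n τ (α τ) := ⟨_, rfl⟩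
  obtain ⟨X₂, hX₂⟩ : ∃ X₂ : ℝ → ℝ × ℝ, X₂ = fun τ => (R τ, Ψ τ) := ⟨_, rfl⟩
  have hd₁ : ∀ τ, a ≤ τ → HasDerivWithinAt X₁
      (P.averagedField n τ (P.backward r₀ n τ (X₁ τ).1 (X₁ τ).2)) (Ici a) τ := fun τ h => by
    rw [hX₁]; exact hsol.hasDerivWithinAt h
  have hd₂ : ∀ τ, a ≤ τ → HasDerivWithinAt X₂
      (P.averagedField n τ (P.backward r₀ n τ (X₂ τ).1 (X₂ τ).2)) (Ici a) τ := fun τ h => by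
    rw [hX₂]; exact hRΨ.hasDerivWithinAt h
  have hc₁ : ContinuousOn X₁ (Ici a) := fun τ h => (hd₁ τ h).continuousWithinAt
  have hc₂ : ContinuousOn X₂ (Ici a) := fun τ h => (hd₂ τ h).continuousWithinAt
  have hinit : X₂ a = X₁ a := by rw [hX₁, hX₂]; exact Prod.ext hRa hΨa
  have hX₁b : ∀ τ, a ≤ τ → |(X₁ τ).1| ≤ r₀ / 4 := fun τ h => by
    have h1 := (norm_fst_le _).trans (hb τ h (α τ) (hα1 τ h))
    rw [Prod.fst_sub, norm_eq_abs] at h1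
    have h2 := abs_sub_abs_le_abs_sub (P.averagedVars n τ (α τ)).1 (α τ).1
    rw [hX₁]
    linarith [(hα τ h).1]
  have hfs : ContDiffOn ℝ ∞ (fun q : ℝ × ℝ × ℝ => P.averagedField n q.1 q.2) O :=
    (contDiffOn_totalDeriv hpos (contDiffOn_Rn hrc n) hfield).prodMk
      (contDiffOn_totalDeriv hpos (contDiffOn_Ψn hrc n) hfield)
  have key : ∀ T, a ≤ T → (∀ t, a ≤ t → t < T → ‖X₂ t - X₁ t‖ ≤ r₀ / 8) → X₂ T = X₁ T := by
    intro T hT hclose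
    obtain ⟨B, hB⟩ := isCompact_Icc.exists_bound_of_continuousOn
      (hc₁.mono (Set.Icc_subset_Ici_self : Icc a T ⊆ Ici a))
    obtain ⟨K, hK⟩ := exists_lipschitzOnWith_averaged (P := P) (n := n) (a := a) (T := T)
      (B := B + r₀ / 8) hr₀ hO
      (fun τ h x hx => hmem τ (hτ0 τ h) ((hκle τ h).trans_le (min_le_left _ _)) x hx) hfs
      (fun τ h x hx => (hb τ h x hx).trans (by linarith)) hl
    have hmono : ∀ t, a ≤ t → Ici t ⊆ Ici a := fun t ht => Set.Ici_subset_Ici.2 ht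
    have h := ODE_solution_unique_of_mem_Icc_right
      (v := fun t X => P.averagedField n t (P.backward r₀ n t X.1 X.2))
      (s := fun _ => {X | |X.1| ≤ r₀ / 2 ∧ |X.2| ≤ B + r₀ / 8}) hK
      (hc₂.mono Set.Icc_subset_Ici_self) (fun t ht => (hd₂ t ht.1).mono (hmono t ht.1))
      (fun t ht => by
        have h1 := hclose t ht.1 ht.2
        have h2 := (norm_fst_le _).trans h1
        have h3 := (norm_snd_le _).trans h1
        rw [Prod.fst_sub, norm_eq_abs] at h2
        rw [Prod.snd_sub, norm_eq_abs] at h3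
        have h4 := abs_sub_abs_le_abs_sub (X₂ t).1 (X₁ t).1
        have h5 := abs_sub_abs_le_abs_sub (X₂ t).2 (X₁ t).2
        have h6 := (norm_snd_le _).trans (hB t (Set.Ico_subset_Icc_self ht))
        rw [norm_eq_abs] at h6
        exact ⟨by linarith [hX₁b t ht.1], by linarith⟩)
      (hc₁.mono Set.Icc_subset_Ici_self) (fun t ht => (hd₁ t ht.1).mono (hmono t ht.1))
      (fun t ht => by
        have h6 := (norm_snd_le _).trans (hB t (Set.Ico_subset_Icc_self ht))
        rw [norm_eq_abs] at h6
        exact ⟨by linarith [hX₁b t ht.1], by linarith⟩) hinit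
    exact h (Set.right_mem_Icc.2 hT)
  have hall := forall_mem_of_bootstrap (α := fun τ => X₂ τ - X₁ τ) (a := a)
    (K := Metric.closedBall 0 (r₀ / 8))
    (fun t ht => ((hc₂ t ht).sub (hc₁ t ht)).mono (Set.Ici_subset_Ici.2 ht))
    (fun T hT hTK => by
      have := key T hT fun t h1 h2 => by simpa using hTK t h1 h2
      rw [this, sub_self]
      exact Metric.ball_subset_interior_closedBall (Metric.mem_ball_self (by positivity)))
  intro τ hτ
  have := key τ hτ fun t h1 _ => by simpa using hall t h1
  rw [hX₁, hX₂] at this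
  exact Prod.ext_iff.1 this

end ChirpedSystem

namespace ChirpedSystem

variable {P : ChirpedSystem}

/-- The field is Lipschitz on compact sets inside the strip, and continuous. -/
theorem field_lipschitz {r : ℝ} {a : ℝ} {K : Set (ℝ × ℝ)} (hK : IsCompact K)
    (hKr : ∀ x ∈ K, |x.1| ≤ r) {O : Set (ℝ × ℝ × ℝ)} (hO : IsOpen O)
    (hmem : ∀ τ, a ≤ τ → ∀ x : ℝ × ℝ, |x.1| ≤ r → (τ, x) ∈ O)
    (hf : ContDiffOn ℝ ∞ (fun q : ℝ × ℝ × ℝ => P.field q.1 q.2) O) :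
    (∀ T, a ≤ T → ∃ C : NNReal, ∀ t ∈ Icc a T, LipschitzOnWith C (P.field t) K) ∧
      ContinuousOn (fun q : ℝ × ℝ × ℝ => P.field q.1 q.2) (Ici a ×ˢ K) := by
  refine ⟨fun T _ => ?_, hf.continuousOn.mono fun q hq => hmem q.1 hq.1 q.2 (hKr _ hq.2)⟩
  obtain ⟨C, hC⟩ := exists_lipschitzOnWith_of_contDiffOn hO hf (isCompact_Icc.prod hK)
    fun q (hq : q ∈ Icc a T ×ˢ K) => hmem q.1 hq.1.1 q.2 (hKr _ hq.2)
  refine ⟨C, fun t ht => LipschitzOnWith.of_dist_le_mul fun x hx y hy => ?_⟩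
  have h := hC.dist_le_mul (t, x) ⟨ht, hx⟩ (t, y) ⟨ht, hy⟩
  have e : dist (t, x) (t, y) = dist x y := by
    rw [Prod.dist_eq, dist_self, max_eq_right dist_nonneg]
  rwa [e] at h

/-- Clamping to a box. -/
def clampBox (r c : ℝ) (x : ℝ × ℝ) : ℝ × ℝ :=
  (max (-r) (min r x.1), max (c - r) (min (c + r) x.2))

theorem lipschitzWith_clampBox (r c : ℝ) : LipschitzWith 1 (clampBox r c) :=
  LipschitzWith.of_dist_le_mul fun x y => by
    rw [NNReal.coe_one, one_mul, Prod.dist_eq, Prod.dist_eq]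
    have h : ∀ b d u v : ℝ, dist (max b (min d u)) (max b (min d v)) ≤ dist u v := fun b d u v => by
      rw [Real.dist_eq, Real.dist_eq]
      refine (abs_max_sub_max_le_max _ _ _ _).trans (max_le (by simp) ?_)
      exact (abs_min_sub_min_le_max _ _ _ _).trans (max_le (by simp) le_rfl)
    exact max_le_max (h _ _ _ _) (h _ _ _ _)

theorem clampBox_mem {r : ℝ} (hr : 0 ≤ r) (c : ℝ) (x : ℝ × ℝ) :
    clampBox r c x ∈ Icc (-r) r ×ˢ Icc (c - r) (c + r) :=
  ⟨⟨le_max_left _ _, max_le (by linarith) (min_le_left _ _)⟩,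
    ⟨le_max_left _ _, max_le (by linarith) (min_le_left _ _)⟩⟩

theorem clampBox_eq {r c : ℝ} {x : ℝ × ℝ} (hx : x ∈ Icc (-r) r ×ˢ Icc (c - r) (c + r)) :
    clampBox r c x = x := by
  obtain ⟨⟨h1, h2⟩, h3, h4⟩ := hx
  simp [clampBox, h1, h2, h3, h4]

/-- The solutions of the equations for `(r,θ)` that start close to the locked phase at a late time
stay close to it and approach it at a definite rate. -/
theorem exists_locked_solutions (hrc : -1 ≤ P.σ ∧ P.σ < (P.b : ℝ) / P.q) {S : LockedModel} {m : ℕ}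
    (hSM : S.M = P.M) (hSN : S.N = P.N)
    (hLh : ∀ R Ψ κ, κ ^ S.L * S.Lh (R, Ψ, κ) = ∑ K ∈ range (m + 1), κ ^ K * P.Λ K R Ψ)
    (hOh : ∀ R Ψ κ, S.Oh (R, Ψ, κ) = ∑ K ∈ range (m + 1), κ ^ K * P.Ω K R Ψ)
    (hm : S.N + S.M + S.L ≤ m) {g β β' κ₀ : ℝ} (hg : 0 < g) (hκ₀ : 0 < κ₀)
    (hβ : ∀ κ, 0 < κ → κ ≤ κ₀ → S.dh (0, S.φ₀, 0) * κ ^ (S.M + S.D) +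
      ((S.L : ℝ) / S.N + β) * κ ^ S.N ≤ -g * κ ^ (S.M + S.D))
    (hβ'0 : 0 ≤ β') (hβ' : β' ≤ β) (hβ'2 : β' ≤ 2 * S.M / S.N) {r₀ : ℝ} (hr₀ : 0 < r₀)
    {C₀ : ℝ} (hC₀ : 0 < C₀) :
    ∃ κ₁ > 0, ∃ C > 0, ∀ a, 0 < a → P.κ a ≤ κ₁ → ∀ p : ℝ × ℝ, |p.1| ≤ C₀ * P.κ a ^ P.M →
      |p.2 - S.φ₀| ≤ C₀ * P.κ a → ∃ α : ℝ → ℝ × ℝ, α a = p ∧ ∀ τ, a ≤ τ →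
        (|(α τ).1| ≤ r₀ ∧ HasDerivWithinAt α (P.field τ (α τ)) (Ici a) τ) ∧
        |(α τ).1| ≤ C * (a ^ (β' / 2) * τ ^ (-(β' / 2)) + P.κ τ ^ P.M) ∧
        |(α τ).2 - S.φ₀| ≤ C * (a ^ (β' / 2) * τ ^ (-(β' / 2)) + P.κ τ) := by
  have hM := (P.M_cast hrc.2).2
  have hSκ : ∀ τ, S.κ τ = P.κ τ := fun τ => by rw [LockedModel.κ, κ, hSN]
  obtain ⟨ρ, hρ, hstab⟩ := S.exists_stability hg hκ₀ hβ hβ'0 hβ' hβ'2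
  obtain ⟨r, hr⟩ : ∃ r, r = min (ρ / 2) r₀ := ⟨_, rfl⟩
  have hr0 : 0 < r := by rw [hr]; positivity
  have hrρ : r ≤ ρ / 2 := by rw [hr]; exact min_le_left _ _
  have hrr₀ : r ≤ r₀ := by rw [hr]; exact min_le_right _ _
  obtain ⟨Cm, hCm, hnear⟩ := exists_averagedVars_bound hrc m r
  obtain ⟨Cf, hCf, κf, hκf, hfield⟩ := exists_averagedField_bound hrc m r
  obtain ⟨κO, hκO, O, hO, hpos, hmem, hsm⟩ := exists_field_smooth hrc r
  obtain ⟨C₀', hC₀'⟩ : ∃ C₀', C₀' = max (C₀ + Cm) Cf := ⟨_, rfl⟩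
  have hC₀'1 : C₀ + Cm ≤ C₀' := by rw [hC₀']; exact le_max_left _ _
  have hC₀'2 : Cf ≤ C₀' := by rw [hC₀']; exact le_max_right _ _
  obtain ⟨κs, hκs, C, hC, hst⟩ := hstab (r / 2) (by positivity) C₀' (by linarith)
  refine ⟨min κs (min (κf / 2) (min (κO / 2) (min 1 (r / 4 / (C₀ + Cm))))), by positivity,
    C + Cm, by positivity, fun a ha hκa p hp1 hp2 => ?_⟩
  obtain ⟨k1, k2⟩ := le_min_iff.1 hκa
  obtain ⟨k2, k3⟩ := le_min_iff.1 k2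
  obtain ⟨k3, k4⟩ := le_min_iff.1 k3
  obtain ⟨k4, k5⟩ := le_min_iff.1 k4
  rw [le_div_iff₀ (by positivity)] at k5
  have hτ0 : ∀ τ, a ≤ τ → 0 < τ := fun τ h => ha.trans_le h
  have hanti : ∀ τ, a ≤ τ → P.κ τ ≤ P.κ a := fun τ h => by
    refine Real.rpow_le_rpow_of_nonpos ha h ?_
    rw [neg_div]
    have : (0 : ℝ) ≤ 1 / P.N := by positivity
    linarith
  have hκ0 : ∀ τ, a ≤ τ → 0 < P.κ τ := fun τ h => κ_pos (hτ0 τ h)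
  have hκ1 : ∀ τ, a ≤ τ → P.κ τ ≤ 1 := fun τ h => (hanti τ h).trans k4
  have hpow : ∀ τ, a ≤ τ → P.κ τ ^ P.M ≤ P.κ τ := fun τ h => by
    simpa using pow_le_pow_of_le_one (hκ0 τ h).le (hκ1 τ h) hM
  have hsmall : ∀ τ, a ≤ τ → Cm * P.κ τ ^ P.M ≤ r / 4 := fun τ h => by
    have h1 := mul_le_mul_of_nonneg_left ((hpow τ h).trans (hanti τ h)) hCm.le
    have h2 := mul_pos hC₀ (hκ0 a le_rfl)
    linarith
  have hdiff : ∀ τ, a ≤ τ → ∀ x : ℝ × ℝ, |x.1| ≤ r →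
      |(P.averagedVars m τ x).1 - x.1| ≤ Cm * P.κ τ ^ P.M ∧
      |(P.averagedVars m τ x).2 - x.2| ≤ Cm * P.κ τ ^ P.M := fun τ h x hx => by
    have h1 := (hnear τ (hτ0 τ h) (hκ1 τ h)).1 x hx
    exact ⟨(norm_fst_le _).trans h1, (norm_snd_le _).trans h1⟩
  obtain ⟨K, hK⟩ : ∃ K : Set (ℝ × ℝ), K = Icc (-r) r ×ˢ Icc (S.φ₀ - r) (S.φ₀ + r) := ⟨_, rfl⟩
  have hKc : IsCompact K := by rw [hK]; exact isCompact_Icc.prod isCompact_Icc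
  have hKm : ∀ x : ℝ × ℝ, x ∈ K ↔ |x.1| ≤ r ∧ |x.2 - S.φ₀| ≤ r := fun x => by
    rw [hK, Set.mem_prod, Set.mem_Icc, Set.mem_Icc, abs_le, abs_le]
    constructor
    · rintro ⟨⟨h1, h2⟩, h3, h4⟩; exact ⟨⟨h1, h2⟩, by linarith, by linarith⟩
    · rintro ⟨⟨h1, h2⟩, h3, h4⟩; exact ⟨⟨h1, h2⟩, by linarith, by linarith⟩
  have hpr : |p.1| ≤ r ∧ |p.2 - S.φ₀| ≤ r := by
    have h1 := mul_le_mul_of_nonneg_left (hpow a le_rfl) hC₀.le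
    have h2 := mul_pos hCm (hκ0 a le_rfl)
    constructor <;> linarith
  -- the estimates for a solution that has not left the box
  have main : ∀ α : ℝ → ℝ × ℝ, α a = p → ∀ T, a ≤ T → ContinuousOn α (Icc a T) →
      (∀ t, a ≤ t → t < T → α t ∈ K ∧ HasDerivWithinAt α (P.field t (α t)) (Ici a) t) →
      |(α T).1| < r ∧ |(α T).2 - S.φ₀| < r ∧
        |(α T).1| ≤ (C + Cm) * (a ^ (β' / 2) * T ^ (-(β' / 2)) + P.κ T ^ P.M) ∧
        |(α T).2 - S.φ₀| ≤ (C + Cm) * (a ^ (β' / 2) * T ^ (-(β' / 2)) + P.κ T) := by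
    intro α hαa T hT hαc hα
    have hαT : |(α T).1| ≤ r := by
      rcases hT.eq_or_lt with rfl | hlt
      · rw [hαa]; exact hpr.1
      · have := LockedModel.abs_le_of_closure (c := 0) hlt hαc.fst (fun t ht => by
          rw [sub_zero]; exact ((hKm _).1 (hα t ht.1.le ht.2).1).1) T (Set.right_mem_Icc.2 hT)
        rwa [sub_zero] at this
    have hgc : ContinuousOn (fun τ => ((τ, α τ) : ℝ × ℝ × ℝ)) (Icc a T) :=
      continuousOn_id.prodMk hαc
    have hmaps : Set.MapsTo (fun τ => ((τ, α τ) : ℝ × ℝ × ℝ)) (Icc a T) {q | 0 < q.1} :=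
      fun τ hτ => hτ0 τ hτ.1
    have hst' := hst a T ha (by rw [hSκ]; exact k1) hT
      (fun τ => (P.averagedVars m τ (α τ)).1) (fun τ => (P.averagedVars m τ (α τ)).2)
      (fun τ => (P.averagedField m τ (α τ)).1) (fun τ => (P.averagedField m τ (α τ)).2)
      ((contDiffOn_Rn hrc m).continuousOn.comp hgc hmaps)
      ((contDiffOn_Ψn hrc m).continuousOn.comp hgc hmaps)
      (by
        have h1 := (hdiff a le_rfl (α a) (by rw [hαa]; exact hpr.1)).1
        rw [hαa] at h1 ⊢
        have h2 := abs_sub_abs_le_abs_sub (P.averagedVars m a p).1 p.1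
        have h3 := mul_le_mul_of_nonneg_right hC₀'1 (pow_pos (hκ0 a le_rfl) P.M).le
        rw [hSκ, hSM]
        linarith)
      (by
        have h1 := (hdiff a le_rfl (α a) (by rw [hαa]; exact hpr.1)).2
        rw [hαa] at h1 ⊢
        have h2 := abs_sub_le (P.averagedVars m a p).2 p.2 S.φ₀
        have h3 := mul_le_mul_of_nonneg_right hC₀'1 (hκ0 a le_rfl).le
        have h4 := mul_le_mul_of_nonneg_left (hpow a le_rfl) hCm.le
        rw [hSκ]
        linarith)
      (fun τ hτ => by
        obtain ⟨hαK, hαd⟩ := hα τ hτ.1.le hτ.2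
        obtain ⟨b1, b2⟩ := (hKm _).1 hαK
        obtain ⟨d1, d2⟩ := hdiff τ hτ.1.le _ b1
        have hs := hsmall τ hτ.1.le
        have hn : Ici a ∈ 𝓝 τ := Ici_mem_nhds hτ.1
        obtain ⟨f1, f2⟩ := hfield τ (hτ0 τ hτ.1.le) (by linarith [hanti τ hτ.1.le]) _ b1
        have hpw : P.κ τ ^ (P.M + m + 1) ≤ P.κ τ ^ (P.N + 2 * P.M + 1 + S.L) :=
          pow_le_pow_of_le_one (hκ0 τ hτ.1.le).le (hκ1 τ hτ.1.le) (by omega)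
        have hpw' : Cf * P.κ τ ^ (P.M + m + 1) ≤ C₀' * P.κ τ ^ (P.N + 2 * P.M + 1 + S.L) :=
          mul_le_mul hC₀'2 hpw (pow_pos (hκ0 τ hτ.1.le) _).le (by linarith)
        have g1 := abs_sub_abs_le_abs_sub (P.averagedVars m τ (α τ)).1 (α τ).1
        have g2 := abs_sub_le (P.averagedVars m τ (α τ)).2 (α τ).2 S.φ₀
        refine ⟨by linarith, by linarith,
          (hasDerivWithinAt_totalDeriv (contDiffOn_Rn hrc m) (hτ0 τ hτ.1.le) hαd).hasDerivAt hn,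
          (hasDerivWithinAt_totalDeriv (contDiffOn_Ψn hrc m) (hτ0 τ hτ.1.le) hαd).hasDerivAt hn, ?_, ?_⟩
        · rw [hSκ, pow_add, mul_assoc, hLh, hSM, hSN]
          exact f1.trans hpw'
        · rw [hSκ, hOh, hSM, hSN]
          exact f2.trans hpw')
    rw [hSκ, hSM] at hst'
    obtain ⟨s1, s2, s3, s4⟩ := hst'
    obtain ⟨d1, d2⟩ := hdiff T hT _ hαT
    have hs := hsmall T hT
    have g1 := abs_sub_abs_le_abs_sub (α T).1 (P.averagedVars m T (α T)).1
    rw [abs_sub_comm] at g1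
    have g2 := abs_sub_le (α T).2 (P.averagedVars m T (α T)).2 S.φ₀
    rw [abs_sub_comm (α T).2 (P.averagedVars m T (α T)).2] at g2
    have hq : 0 ≤ a ^ (β' / 2) * T ^ (-(β' / 2)) :=
      mul_nonneg (rpow_nonneg ha.le _) (rpow_nonneg (hτ0 T hT).le _)
    have hq' := mul_nonneg hCm.le hq
    have hp' := mul_le_mul_of_nonneg_left (hpow T hT) hCm.le
    refine ⟨by linarith, by linarith, ?_, ?_⟩
    · linarith
    · linarith
  obtain ⟨hlip, hcont⟩ := field_lipschitz (P := P) (a := a) hKc (fun x hx => ((hKm x).1 hx).1) hO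
    (fun τ h x hx => hmem τ (hτ0 τ h) (by linarith [hanti τ h]) x hx) hsm
  obtain ⟨α, hαa, hα⟩ := exists_global_solution_of_apriori (v := P.field) (p := p) hKc
    (lipschitzWith_clampBox r S.φ₀) (fun x => by rw [hK]; exact clampBox_mem hr0.le _ x)
    (fun x hx => clampBox_eq (by rwa [hK] at hx)) hlip hcont
    (fun α hαa T hT hαc hα => by
      obtain ⟨h1, h2, -, -⟩ := main α hαa T hT hαc hα
      rw [hK, interior_prod_eq, interior_Icc, interior_Icc]
      rw [abs_lt] at h1 h2
      exact ⟨h1, by linarith, by linarith⟩)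
  refine ⟨α, hαa, fun τ hτ => ?_⟩
  have hc : ContinuousOn α (Ici a) := fun t ht => (hα t ht).2.continuousWithinAt
  obtain ⟨-, -, h3, h4⟩ := main α hαa τ hτ (hc.mono Set.Icc_subset_Ici_self) fun t ht _ => hα t ht
  exact ⟨⟨(((hKm _).1 (hα τ hτ).1).1).trans hrr₀, (hα τ hτ).2⟩, h3, h4⟩

end ChirpedSystem

namespace ChirpedSystem

variable {P : ChirpedSystem}

theorem γHat_margin {L D : ℕ} {φ₀ ς : ℝ} (hγHat : P.γHat L D φ₀ < 0) (hMD : P.M + D ≤ P.N)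
    (hς : 0 < ς ∧ ς < 1) :
    ∃ β ≥ 0, (P.M + D = P.N → β = ς * |P.γHat L D φ₀|) ∧
      (P.M + D ≠ P.N → β = 2 * P.M / P.N) ∧ ∃ g > 0, ∃ κ₀ > 0, ∀ κ : ℝ, 0 < κ → κ ≤ κ₀ →
        P.divergence D 0 φ₀ * κ ^ (P.M + D) + ((L : ℝ) / P.N + β) * κ ^ P.N ≤ -g * κ ^ (P.M + D) := by
  by_cases h : P.M + D = P.N
  · have e : P.γHat L D φ₀ = P.divergence D 0 φ₀ + (L : ℝ) / P.N := by rw [γHat, if_pos h]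
    have hL : (0 : ℝ) ≤ (L : ℝ) / P.N := by positivity
    refine ⟨ς * |P.γHat L D φ₀|, mul_nonneg hς.1.le (abs_nonneg _), fun _ => rfl,
      fun h' => absurd h h', (1 - ς) * |P.γHat L D φ₀|,
      mul_pos (by linarith [hς.2]) (abs_pos.2 hγHat.ne), 1, one_pos, fun κ _ _ => le_of_eq ?_⟩
    rw [h, abs_of_neg hγHat, e]
    ring
  · have e : P.γHat L D φ₀ = P.divergence D 0 φ₀ := by rw [γHat, if_neg h, add_zero]
    rw [e] at hγHat
    obtain ⟨c, hc⟩ : ∃ c, c = (L : ℝ) / P.N + 2 * P.M / P.N + 1 := ⟨_, rfl⟩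
    have hc0 : 0 < c := by rw [hc]; positivity
    refine ⟨2 * P.M / P.N, by positivity, fun h' => absurd h' h, fun _ => rfl,
      -P.divergence D 0 φ₀ / 2, by linarith, min 1 (-P.divergence D 0 φ₀ / 2 / c),
      lt_min one_pos (div_pos (by linarith) hc0), fun κ k0 k1 => ?_⟩
    have k2 := k1.trans (min_le_right _ _)
    rw [le_div_iff₀ hc0] at k2
    have hpow : κ ^ P.N ≤ κ * κ ^ (P.M + D) := by
      rw [← pow_succ']
      exact pow_le_pow_of_le_one k0.le (k1.trans (min_le_left _ _)) (by omega)
    have hk := pow_pos k0 (P.M + D)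
    have h1 := mul_le_mul_of_nonneg_left hpow hc0.le
    have h2 := mul_le_mul_of_nonneg_right k2 hk.le
    have h3 := pow_pos k0 P.N
    rw [hc] at h1 h2
    linarith

theorem tendsto_κ : Tendsto P.κ atTop (𝓝 0) := by
  have h := tendsto_rpow_neg_atTop (y := 1 / (P.N : ℝ)) (by have := P.N_cast.2; positivity)
  unfold κ
  simpa only [neg_div] using h

/-- The consequences of phase locking that are used: the orders of `ϱ` and of `φ - φ₀`. -/
theorem IsPhaseLocked.exists_bound {φ₀ : ℝ} {ϱ φ : ℝ → ℝ} (h : P.IsPhaseLocked φ₀ ϱ φ) :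
    ∃ C > 0, ∀ᶠ τ in atTop, |ϱ τ| ≤ C * P.κ τ ^ P.M ∧ |φ τ - φ₀| ≤ C * P.κ τ := by
  obtain ⟨c, d, hcd⟩ := h
  obtain ⟨h1, h2⟩ := hcd 0
  obtain ⟨C₁, hC₁, b1⟩ := h1.exists_pos
  obtain ⟨C₂, hC₂, b2⟩ := h2.exists_pos
  refine ⟨max C₁ C₂, by positivity, ?_⟩
  filter_upwards [b1.bound, b2.bound, eventually_gt_atTop 0] with τ e1 e2 hτ
  have hk := κ_pos (P := P) hτ
  have f1 : τ ^ (-((P.M : ℝ) + (0 : ℕ)) / P.N) = P.κ τ ^ P.M := by rw [κ_pow hτ]; simp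
  have f2 : τ ^ (-(((0 : ℕ) : ℝ) + 1) / P.N) = P.κ τ := by rw [κ]; simp
  rw [f1, norm_eq_abs, norm_eq_abs, abs_of_pos (pow_pos hk _)] at e1
  rw [f2, norm_eq_abs, norm_eq_abs, abs_of_pos hk] at e2
  simp only [Finset.range_zero, Finset.sum_empty, sub_zero] at e1
  simp only [zero_lt_one, Finset.Icc_eq_empty_of_lt, Finset.sum_empty, sub_zero] at e2
  refine ⟨e1.trans ?_, e2.trans ?_⟩
  · gcongr; exact le_max_left _ _
  · gcongr; exact le_max_right _ _

end ChirpedSystem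

theorem mainTheorem5 (P : ChirpedSystem)
    (hrc : -1 ≤ P.σ ∧ P.σ < (P.b : ℝ) / P.q)
    (L D n : ℕ) (φ₀ : ℝ)
    (hL : L + P.M ≤ P.N ∧ L + 1 ≤ 2 * P.M)
    (hzero : ∀ K, K < L → ∀ R Ψ, P.Λ K R Ψ = 0)
    (hne : ∃ R Ψ, P.Λ L R Ψ ≠ 0)
    (hφ₀ : P.Λ L 0 φ₀ = 0)
    (hlam : deriv (fun Ψ => P.Λ L 0 Ψ) φ₀ < 0)
    (hD : P.M ≤ D)
    (hdiv : ∀ K, K < D → ∀ R Ψ, P.divergence K R Ψ = 0)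
    (hγ : P.divergence D 0 φ₀ ≠ 0)
    (hn : L + D ≤ n)
    (hγHat : P.γHat L D φ₀ < 0)
    (hMD : P.M + D ≤ P.N)
    (r₀ : ℝ) (hr₀ : 0 < r₀)
    (τ₀ : ℝ) (hτ₀ : 0 < τ₀) (ϱ φ : ℝ → ℝ)
    (hsol : P.IsTruncatedSolution L n τ₀ ϱ φ)
    (hlock : P.IsPhaseLocked φ₀ ϱ φ)
    (ς : ℝ) (hς : 0 < ς ∧ ς < 1) :
    ∃ Δs : ℝ, 0 < Δs ∧ ∃ τs : ℝ, τ₀ < τs ∧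
      ∀ Rs Ψs : ℝ, |Rs - ϱ τs| < Δs → |Ψs - φ τs| < Δs →
        (∃ R Ψ : ℝ → ℝ, P.IsAveragedSolution r₀ n τs R Ψ ∧ R τs = Rs ∧ Ψ τs = Ψs) ∧
        ∀ R Ψ : ℝ → ℝ, P.IsAveragedSolution r₀ n τs R Ψ → R τs = Rs → Ψ τs = Ψs →
          (R =O[atTop] fun τ : ℝ =>
            (if P.M + D = P.N then τ ^ (-(ς / 2 * |P.γHat L D φ₀|)) else 0) +
              τ ^ (-(P.M : ℝ) / P.N)) ∧
          ((fun τ => Ψ τ - φ₀) =O[atTop] fun τ : ℝ =>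
            (if P.M + D = P.N then τ ^ (-(ς / 2 * |P.γHat L D φ₀|)) else 0) +
              τ ^ (-(1 : ℝ) / P.N)) := by
  have hM := (P.M_cast hrc.2).2
  obtain ⟨β, hβ0, hβ1, hβ2, g, hg, κ₀, hκ₀, hmargin⟩ :=
    ChirpedSystem.γHat_margin hγHat hMD hς
  obtain ⟨β', hβ'⟩ : ∃ β', β' = min β (2 * P.M / P.N) := ⟨_, rfl⟩
  have hβ'0 : 0 ≤ β' := by rw [hβ']; exact le_min hβ0 (by positivity)
  have hm : L + D < P.N + P.M + L + D + 1 := by omega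
  obtain ⟨κu, hκu, huniq⟩ := ChirpedSystem.exists_forall_averagedSolution_eq hrc n hr₀
  obtain ⟨Cn, hCn, hnear⟩ := ChirpedSystem.exists_averagedVars_bound hrc n r₀
  obtain ⟨Cl, hCl, hlocked⟩ := hlock.exists_bound
  obtain ⟨κ₁, hκ₁, C, hC, hex⟩ := ChirpedSystem.exists_locked_solutions hrc
    (S := ChirpedSystem.averagedModel hrc L D (P.N + P.M + L + D + 1) φ₀ hL hzero hφ₀ hlam hD hdiv
      hMD hm) (m := P.N + P.M + L + D) rfl rfl
    (ChirpedSystem.pow_mul_averagedModel_Lh hrc L D _ φ₀ hL hzero hφ₀ hlam hD hdiv hMD hm)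
    (ChirpedSystem.averagedModel_Oh hrc L D _ φ₀ hL hzero hφ₀ hlam hD hdiv hMD hm)
    (Nat.le_add_right _ _) (β := β) (β' := β') hg hκ₀ (fun κ k0 k1 => by
      refine le_trans (le_of_eq ?_) (hmargin κ k0 k1)
      simp only [ChirpedSystem.averagedModel]
      rw [sum_zero_pow_mul (f := fun K => P.divergence (D + K) 0 φ₀) (by omega), add_zero])
    hβ'0 (by rw [hβ']; exact min_le_left _ _) (by rw [hβ']; exact min_le_right _ _)
    (r₀ := r₀ / 8) (by positivity) (C₀ := Cl + 1 + Cn) (by positivity)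
  have hle : ∀ {v : ℝ}, 0 < v → ∀ᶠ τ in atTop, P.κ τ < v := fun hv =>
    ChirpedSystem.tendsto_κ.eventually (gt_mem_nhds hv)
  obtain ⟨τs, hτs, ⟨hϱ, hφ⟩, k1, k2, k3, k4, k5⟩ := ((eventually_gt_atTop τ₀).and <| hlocked.and <|
    (hle hκ₁).and <| (hle hκu).and <| (hle one_pos).and <|
    (hle (show 0 < 1 / (2 * Cn) by positivity)).and
    (hle (show 0 < r₀ / (Cl + 1 + Cn) by positivity))).exists
  have hτs0 : 0 < τs := hτ₀.trans hτs
  have hκs0 := ChirpedSystem.κ_pos (P := P) hτs0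
  have hκsM := pow_pos hκs0 P.M
  have hpow : P.κ τs ^ P.M ≤ P.κ τs := by
    simpa using pow_le_pow_of_le_one hκs0.le k3.le hM
  rw [lt_div_iff₀ (by positivity)] at k4 k5
  refine ⟨P.κ τs ^ P.M, hκsM, τs, hτs, fun Rs Ψs hRs hΨs => ?_⟩
  have hRs' : |Rs| ≤ (Cl + 1) * P.κ τs ^ P.M := by
    have := abs_sub_abs_le_abs_sub Rs (ϱ τs); linarith
  obtain ⟨hb, hl⟩ := hnear τs hτs0 k3.le
  have hCnκ := mul_le_mul_of_nonneg_left hpow hCn.le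
  obtain ⟨x, hx, hxF⟩ := exists_eq_of_nearIdentity hb
    (fun x y hx hy => (hl x y hx hy).trans
      (mul_le_mul_of_nonneg_right (by linarith) (norm_nonneg _))) hr₀.le (X := (Rs, Ψs)) (by
        have := mul_le_mul_of_nonneg_left hpow (show 0 ≤ Cl + 1 by positivity)
        dsimp only
        linarith)
  have hxd := hb x hx
  rw [hxF] at hxd
  have hx1 : |x.1| ≤ (Cl + 1 + Cn) * P.κ τs ^ P.M := by
    have h1 := (norm_fst_le _).trans hxd
    rw [Prod.fst_sub, norm_eq_abs, abs_sub_comm] at h1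
    have h2 := abs_sub_abs_le_abs_sub x.1 Rs
    dsimp only at h1
    linarith
  have hx2 : |x.2 - φ₀| ≤ (Cl + 1 + Cn) * P.κ τs := by
    have h1 := (norm_snd_le _).trans hxd
    rw [Prod.snd_sub, norm_eq_abs, abs_sub_comm] at h1
    have h2 := abs_sub_le x.2 Ψs φ₀
    have h3 := abs_sub_le Ψs (φ τs) φ₀
    dsimp only at h1
    linarith
  obtain ⟨α, hαs, hα⟩ := hex τs hτs0 k1.le x hx1 hx2
  obtain ⟨hsolα, hall⟩ := huniq τs hτs0 k2 α fun τ hτ => (hα τ hτ).1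
  have hRα : P.Rn n (α τs).1 (α τs).2 τs = Rs := by rw [hαs]; exact congrArg Prod.fst hxF
  have hΨα : P.Ψn n (α τs).1 (α τs).2 τs = Ψs := by rw [hαs]; exact congrArg Prod.snd hxF
  refine ⟨⟨_, _, hsolα, hRα, hΨα⟩, fun R Ψ hRΨ hR hΨ => ?_⟩
  have heq := hall R Ψ hRΨ (by rw [hR, hRα]) (by rw [hΨ, hΨα])
  obtain ⟨E, hE⟩ : ∃ E : ℝ → ℝ, E = fun τ =>
      if P.M + D = P.N then τ ^ (-(ς / 2 * |P.γHat L D φ₀|)) else 0 := ⟨_, rfl⟩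
  have hE0 : ∀ τ, 0 < τ → 0 ≤ E τ := fun τ hτ => by
    rw [hE]; dsimp only; split_ifs <;> positivity
  have hrate : ∀ τ, 0 < τ → τ ^ (-(β' / 2)) ≤ E τ + P.κ τ ^ P.M := fun τ hτ => by
    have e1 : τ ^ (-(2 * (P.M : ℝ) / P.N / 2)) = P.κ τ ^ P.M := by
      rw [ChirpedSystem.κ_pow hτ]; congr 1; ring
    have hk := pow_pos (ChirpedSystem.κ_pos (P := P) hτ) P.M
    rcases min_choice β (2 * (P.M : ℝ) / P.N) with h | h
    · rw [hβ', h]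
      by_cases hN : P.M + D = P.N
      · have e2 : E τ = τ ^ (-(β / 2)) := by
          rw [hE, hβ1 hN]; dsimp only; rw [if_pos hN]; congr 1; ring
        rw [e2]; linarith
      · rw [hβ2 hN, e1]; linarith [hE0 τ hτ]
    · rw [hβ', h, e1]; linarith [hE0 τ hτ]
  have hconst : 0 ≤ C * τs ^ (β' / 2) := mul_nonneg hC.le (rpow_nonneg hτs0.le _)
  have hbound : ∀ᶠ τ in atTop,
      |R τ| ≤ (C * τs ^ (β' / 2) + C + Cn) * (E τ + P.κ τ ^ P.M) ∧
      |Ψ τ - φ₀| ≤ (C * τs ^ (β' / 2) + C + Cn) * (E τ + P.κ τ) := by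
    filter_upwards [eventually_ge_atTop τs, hle one_pos] with τ hτ hκ
    have hτ0 := hτs0.trans_le hτ
    have hk0 := ChirpedSystem.κ_pos (P := P) hτ0
    have hkM : P.κ τ ^ P.M ≤ P.κ τ := by simpa using pow_le_pow_of_le_one hk0.le hκ.le hM
    obtain ⟨⟨a1, -⟩, a2, a3⟩ := hα τ hτ
    obtain ⟨b1, b2⟩ := heq τ hτ
    have c1 := (hnear τ hτ0 hκ.le).1 (α τ) (by linarith)
    have c2 := (norm_fst_le _).trans c1
    have c3 := (norm_snd_le _).trans c1
    rw [Prod.fst_sub, norm_eq_abs] at c2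
    rw [Prod.snd_sub, norm_eq_abs] at c3
    simp only [ChirpedSystem.averagedVars] at c2 c3
    rw [← b1] at c2
    rw [← b2] at c3
    have d1 := abs_sub_abs_le_abs_sub (R τ) (α τ).1
    have d2 := abs_sub_le (Ψ τ) (α τ).2 φ₀
    have r1 := mul_le_mul_of_nonneg_left (hrate τ hτ0) hconst
    have e0 := hE0 τ hτ0
    have e1 := mul_nonneg hC.le e0
    have e2 := mul_nonneg hCn.le e0
    have e3 := mul_le_mul_of_nonneg_left hkM hconst
    have e4 := mul_le_mul_of_nonneg_left hkM hCn.le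
    have a3' : |(α τ).2 - φ₀| ≤ C * (τs ^ (β' / 2) * τ ^ (-(β' / 2)) + P.κ τ) := a3
    constructor
    · linarith
    · linarith
  have hκM : ∀ {τ : ℝ}, 0 < τ → τ ^ (-(P.M : ℝ) / P.N) = P.κ τ ^ P.M := fun {τ} hτ =>
    (ChirpedSystem.κ_pow hτ P.M).symm
  refine ⟨IsBigO.of_bound (C * τs ^ (β' / 2) + C + Cn) ?_,
    IsBigO.of_bound (C * τs ^ (β' / 2) + C + Cn) ?_⟩
  · filter_upwards [hbound, eventually_gt_atTop 0] with τ h hτ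
    have h0 : 0 ≤ E τ + P.κ τ ^ P.M :=
      add_nonneg (hE0 τ hτ) (pow_pos (ChirpedSystem.κ_pos hτ) _).le
    have h1 := h.1
    rw [hE] at h0 h1
    rw [hκM hτ, norm_eq_abs, norm_eq_abs, abs_of_nonneg h0]
    exact h1
  · filter_upwards [hbound, eventually_gt_atTop 0] with τ h hτ
    have h0 : 0 ≤ E τ + P.κ τ := add_nonneg (hE0 τ hτ) (ChirpedSystem.κ_pos hτ).le
    have h1 := h.2
    rw [hE] at h0 h1
    rw [norm_eq_abs, norm_eq_abs]
    exact h1.trans_eq (congrArg _ (abs_of_nonneg h0).symm)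

end
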